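/- Let $F$ be a compact (Hausdorff) smooth manifold of dimension $2n\ge 2$ with non-empty boundary $K=\partial F$, and let $\lambda$ be a smooth $1$-form on $F$ such that $d\lambda$ is non-degenerate (hence symplectic) at every point of $F-K$ (it may degenerate along $K$), and such that the form $\alpha$ induced by $\lambda$ on $K$ is a positive contact form: $\alpha\wedge(d\alpha)^{n-1}$ vanishes nowhere and orients $K$ as the boundary of $F$, where $F$ is oriented by $(d\lambda)^n$ on $F-K$. Let $X$ be the Liouville vector field on $F-K$, defined by $X\lrcorner d\lambda=\lambda$. Then the singular foliation spanned by $X$ on $F-K$ extends to a foliation of $F$ transverse to $K$: there is a smooth vector field $\nu$ on $F$, transverse to $K$, with $\nu=vX$ on $F-K$ for a smooth function $v>0$ on $F-K$. For any such $\nu$, let $U\subset F$ be the union of all orbits of $\nu$ which exit through $K$. Then $U$ is open in $F$. Let $SK=\{s\alpha_x : s>0,\ x\in K\}\subset T^*K$ be the symplectization of $(K,\ker\alpha)$, let $SK_{<\alpha}$ and $SK_{\le\alpha}$ be its subsets $\{s<1\}$ and $\{s\le1\}$, let $K_\alpha\subset SK$ be the graph of $\alpha$, and let $\lambda^\xi$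 be the restriction to $SK$ of the canonical $1$-form of $T^*K$. There is a unique smooth homeomorphism $h:U\to SK_{\le\alpha}$ such that - $h$ is the identity on $K\cong K_\alpha$, i.e. $h(x)=\alpha_x$ for $x\in K$, and $h$ induces a diffeomorphism between $U-K$ and $SK_{<\alpha}$; - $\lambda|_U=h^*\lambda^\xi$. Furthermore, the singularities of $h$ (the points of $U$ where its differential is not injective) are exactly the points of $K$ where $d\lambda$ is degenerate, and the fold points of $h$ are exactly the points of $K$ where the $2n$-form $(d\lambda)^n$ vanishes transversely (i.e. its density in a chart of $F$ vanishes at the point and has non-zero differential there). Here $p$ is a fold point of $h$ if $\ker dh_p$ is a line and the second intrinsic derivative of $h$ at $p$ is non-zero on it: for $0\ne k\in\ker dh_p$ the second derivative of $h$ at $p$ along $k$, computed in charts, does not lie in the image of $dh_p$. -/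

import Mathlib

open Set Filter Topology Bundle
open scoped Manifold ContDiff

noncomputable section

/-! ### Multilinear algebra -/

section Algebra

variable {V : Type*}

/-- The value on `v₀, …, v_{2n-1}` of the `n`-th exterior power `Ω ∧ ⋯ ∧ Ω` of a 2-form `Ω`
(determinant convention, so that the first power is `Ω` itself). -/
def wedgePow (Ω : V → V → ℝ) (n : ℕ) (v : Fin (2 * n) → V) : ℝ :=
  (1 / 2 ^ n : ℝ) * ∑ σ : Equiv.Perm (Fin (2 * n)), ((Equiv.Perm.sign σ : ℤ) : ℝ) *
    ∏ i : Fin n, Ω (v (σ ⟨2 * i, by omega⟩)) (v (σ ⟨2 * i + 1, by omega⟩))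

/-- The value on `v₀, …, v_{2m}` of the exterior product `a ∧ Ω ∧ ⋯ ∧ Ω` of a 1-form `a` with
the `m`-th exterior power of a 2-form `Ω` (determinant convention). -/
def wedgeOnePow (a : V → ℝ) (Ω : V → V → ℝ) (m : ℕ) (v : Fin (2 * m + 1) → V) : ℝ :=
  (1 / 2 ^ m : ℝ) * ∑ σ : Equiv.Perm (Fin (2 * m + 1)), ((Equiv.Perm.sign σ : ℤ) : ℝ) *
    (a (v (σ 0)) *
      ∏ i : Fin m, Ω (v (σ ⟨2 * i + 1, by omega⟩)) (v (σ ⟨2 * i + 2, by omega⟩)))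

end Algebra

/-! ### Differential forms on manifolds -/

section Forms

variable {E H : Type*} [NormedAddCommGroup E] [NormedSpace ℝ E] [TopologicalSpace H]
  (I : ModelWithCorners ℝ E H) {M : Type*} [TopologicalSpace M] [ChartedSpace H M]

/-- A (not necessarily smooth) differential 1-form on `M`. -/
abbrev OneForm (M : Type*) [TopologicalSpace M] [ChartedSpace H M] : Type _ :=
  ∀ p : M, TangentSpace I p →L[ℝ] ℝ

/-- The total space of the cotangent bundle `T*M`, with Mathlib's topology and smooth structure. -/
abbrev Cotangent (M : Type*) [TopologicalSpace M] [ChartedSpace H M] [IsManifold I 1 M] :=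
  TotalSpace (E →L[ℝ] ℝ) (fun p : M => TangentSpace I p →L[ℝ] Bundle.Trivial M ℝ p)

/-- The model with corners of the total space of the cotangent bundle. -/
abbrev cotangentModel : ModelWithCorners ℝ (E × (E →L[ℝ] ℝ)) (ModelProd H (E →L[ℝ] ℝ)) :=
  I.prod 𝓘(ℝ, E →L[ℝ] ℝ)

/-- The 1-form `θ` is smooth, i.e. a smooth section of the cotangent bundle. -/
def OneForm.IsSmooth [IsManifold I 1 M] (θ : OneForm I M) : Prop :=
  ContMDiff I (cotangentModel I) ∞ (fun p => (⟨p, θ p⟩ : Cotangent I M))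

/-- The 1-form `θ` read in the preferred chart at `p`. -/
def OneForm.inChart (θ : OneForm I M) (p : M) (y : E) : E →L[ℝ] ℝ :=
  (θ ((extChartAt I p).symm y)).comp (mfderivWithin 𝓘(ℝ, E) I (extChartAt I p).symm (range I) y)

/-- The exterior derivative `dθ` of a 1-form, a 2-form on `M`: in the preferred chart at `p`,
`dθ (u, v) = D θ(u) (v) - D θ(v) (u)`. The tangent space at `p` is `E` through this very chart. -/
def OneForm.d (θ : OneForm I M) (p : M) (u v : TangentSpace I p) : ℝ :=
  (fderivWithin ℝ (OneForm.inChart I θ p) (range I) (extChartAt I p p) : E →L[ℝ] E →L[ℝ] ℝ) u v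
  - (fderivWithin ℝ (OneForm.inChart I θ p) (range I) (extChartAt I p p) : E →L[ℝ] E →L[ℝ] ℝ) v u

/-- The 2-form `dθ` is non-degenerate at `p`. -/
def OneForm.DNondegenerateAt (θ : OneForm I M) (p : M) : Prop :=
  ∀ u : TangentSpace I p, (∀ v : TangentSpace I p, OneForm.d I θ p u v = 0) → u = 0

/-- The Liouville vector field `X` of `θ`, given by `dθ (X, ·) = θ` (where `dθ` is non-degenerate
this determines `X`; the value is `0` where there is no solution). -/
def OneForm.liouvilleField (θ : OneForm I M) (p : M) : TangentSpace I p :=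
  open Classical in
  if h : ∃ X : TangentSpace I p, ∀ w : TangentSpace I p, OneForm.d I θ p X w = θ p w
  then h.choose else 0

/-- The vector field near `p` which is constant, equal to `v`, in the preferred chart at `p`
(through which `E` is the tangent space at `p`). -/
def coordField (p : M) [IsManifold I 1 M] (v : E) (q : M) : TangentSpace I q :=
  (trivializationAt E (TangentSpace I : M → Type _) p).symm q v

/-- The tautological (canonical) 1-form of the cotangent bundle: at a covector `β`, it sends a
tangent vector `w` of `T*M` to `β (dπ w)`, where `π` is the bundle projection. -/
def canonicalForm [IsManifold I 1 M] :
    OneForm (cotangentModel I) (Cotangent I M) := fun β =>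
  (show TangentSpace I β.proj →L[ℝ] ℝ from β.2).comp
    (mfderiv (cotangentModel I) I (fun b : Cotangent I M => b.proj) β)

/-- The graph `M_α ⊆ T*M` of a 1-form `α`, as a map `M → T*M`. -/
def OneForm.toCotangent [IsManifold I 1 M] (α : OneForm I M) (x : M) : Cotangent I M := ⟨x, α x⟩

/-- For a contact form `α` with cooriented kernel `ξ`, the part `SM_{<α}` of the symplectization
`SM = {s α_x | s > 0, x ∈ M}` of `(M, ξ)` given by the condition `s < 1`. -/
def SLt [IsManifold I 1 M] (α : OneForm I M) : Set (Cotangent I M) :=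
  {β | ∃ s : ℝ, 0 < s ∧ s < 1 ∧ β = ⟨β.proj, s • α β.proj⟩}

/-- For a contact form `α` with cooriented kernel `ξ`, the part `SM_{≤α}` of the symplectization
`SM = {s α_x | s > 0, x ∈ M}` of `(M, ξ)` given by the condition `s ≤ 1`. -/
def SLe [IsManifold I 1 M] (α : OneForm I M) : Set (Cotangent I M) :=
  {β | ∃ s : ℝ, 0 < s ∧ s ≤ 1 ∧ β = ⟨β.proj, s • α β.proj⟩}

end Forms

/-! ### Singular points and folds of maps -/

section Singularities

variable {E H E' H' : Type*}
  [NormedAddCommGroup E] [NormedSpace ℝ E] [TopologicalSpace H] (I : ModelWithCorners ℝ E H)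
  [NormedAddCommGroup E'] [NormedSpace ℝ E'] [TopologicalSpace H'] (J : ModelWithCorners ℝ E' H')
  {M N : Type*} [TopologicalSpace M] [ChartedSpace H M] [TopologicalSpace N] [ChartedSpace H' N]

/-- `p` is a singular point of the map `h`: the differential of `h` at `p` is not injective.
(If `h` takes its values in a submanifold whose dimension is that of `M`, these are the points
where `h`, as a map to this submanifold, does not have an invertible differential.) -/
def IsSingularPoint (h : M → N) (p : M) : Prop :=
  ¬ Function.Injective (mfderiv I J h p)

/-- `p` is a fold point of the map `h`: the kernel of the differential `dh` at `p` is a line and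
the second intrinsic derivative of `h` at `p`, restricted to this line, is non-zero, i.e. the
second derivative `D²h (k, k)` in charts, along a non-zero `k` in the kernel, is not in the range
of `dh` (this does not depend on the charts, as `dh (k) = 0`). If `h` takes its values in a
submanifold, it does not matter whether `h` is regarded as a map to this submanifold or to `N`. -/
def IsFoldPoint (h : M → N) (p : M) : Prop :=
  Module.finrank ℝ (mfderiv I J h p).ker = 1 ∧
  ∀ k : TangentSpace I p, mfderiv I J h p k = 0 → k ≠ 0 →
    ¬ ∃ w : TangentSpace I p, mfderiv I J h p w =
      iteratedFDerivWithin ℝ 2 (writtenInExtChartAt I J p h) (range I) (extChartAt I p p)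
        (fun _ => (k : E))

end Singularities

/-! ### Domains of dimension `2m + 2` and their boundaries -/

section Domain

variable {m : ℕ}
  {F : Type*} [TopologicalSpace F] [ChartedSpace (EuclideanHalfSpace (2 * m + 2)) F]
  [IsManifold (𝓡∂ (2 * m + 2)) ∞ F]
  {K : Type*} [TopologicalSpace K] [ChartedSpace (EuclideanSpace ℝ (Fin (2 * m + 1))) K]
  [IsManifold (𝓡 (2 * m + 1)) ∞ K]

/-- `ι` identifies the manifold `K` with the boundary of `F`: it is a smooth embedding whose image
is the boundary of `F`. -/
structure IsBoundaryInclusion (m : ℕ)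
    {F : Type*} [TopologicalSpace F] [ChartedSpace (EuclideanHalfSpace (2 * m + 2)) F]
    {K : Type*} [TopologicalSpace K] [ChartedSpace (EuclideanSpace ℝ (Fin (2 * m + 1))) K]
    (ι : K → F) : Prop where
  embedding : Manifold.IsSmoothEmbedding (𝓡 (2 * m + 1)) (𝓡∂ (2 * m + 2)) ∞ ι
  range_eq : range ι = (𝓡∂ (2 * m + 2)).boundary F

/-- The form `α` induced on `K` by a 1-form `lam` on `F`, i.e. its pullback by `ι`. -/
def boundaryForm (ι : K → F) (lam : OneForm (𝓡∂ (2 * m + 2)) F) : OneForm (𝓡 (2 * m + 1)) K :=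
  fun x => (lam (ι x)).comp (mfderiv (𝓡 (2 * m + 1)) (𝓡∂ (2 * m + 2)) ι x)

/-- `α` is a contact form on the `(2m+1)`-dimensional manifold `K`: the form `α ∧ (dα)^m` does not
vanish anywhere. -/
def IsContactForm (α : OneForm (𝓡 (2 * m + 1)) K) : Prop :=
  ∀ (x : K) (w : Fin (2 * m + 1) → TangentSpace (𝓡 (2 * m + 1)) x), LinearIndependent ℝ w →
    wedgeOnePow (α x) (OneForm.d (𝓡 (2 * m + 1)) α x) m w ≠ 0

/-- At a boundary point `p`, the half-space is `{y₀ ≥ 0}` in the preferred chart at `p`, so that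
the outward pointing tangent vectors at `p` are those whose coordinate `0` is negative. -/
def IsOutward (m : ℕ) {F : Type*} [TopologicalSpace F]
    [ChartedSpace (EuclideanHalfSpace (2 * m + 2)) F] (p : F) (N : TangentSpace (𝓡∂ (2 * m + 2)) p) : Prop :=
  (show EuclideanSpace ℝ (Fin (2 * m + 2)) from N) 0 < 0

/-- The form `α` induced on `K` by `lam` is positive for the boundary orientation: the orientation
of `K` given by `α ∧ (dα)^m` is the orientation of `K` as the boundary of `F`, where `F` is oriented
by the volume form `(d lam)^(m+1)` of its interior. Explicitly: if the basis `w` of the tangent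
space of `K` at `x` is positive for `α ∧ (dα)^m` and `N` is an outward pointing vector, then the
basis `(N, w)` is positive for `(d lam)^(m+1)`. As this form may vanish at the boundary point, its
sign is read at nearby interior points, where `(N, w)` is extended by constants in a chart. -/
def IsPositiveOnBoundary (ι : K → F) (lam : OneForm (𝓡∂ (2 * m + 2)) F) : Prop :=
  ∀ (x : K) (w : Fin (2 * m + 1) → TangentSpace (𝓡 (2 * m + 1)) x)
    (N : TangentSpace (𝓡∂ (2 * m + 2)) (ι x)), IsOutward m (ι x) N →
    0 < wedgeOnePow (boundaryForm ι lam x) (OneForm.d (𝓡 (2 * m + 1)) (boundaryForm ι lam) x) m w →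
    ∀ᶠ q in 𝓝[(𝓡∂ (2 * m + 2)).interior F] (ι x),
      0 < wedgePow (OneForm.d (𝓡∂ (2 * m + 2)) lam q) (m + 1)
        (fun i => coordField (𝓡∂ (2 * m + 2)) (ι x)
          ((Fin.cons N (fun j => mfderiv (𝓡 (2 * m + 1)) (𝓡∂ (2 * m + 2)) ι x (w j)) :
            Fin (2 * m + 1 + 1) → TangentSpace (𝓡∂ (2 * m + 2)) (ι x)) i) q)

/-- The top degree form `(d lam)^(m+1)` vanishes transversely at `p`: its density in a chart
(the value on the coordinate frame) vanishes at `p` and has a non-zero differential at `p`. -/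
def TopPowerVanishesTransverselyAt (lam : OneForm (𝓡∂ (2 * m + 2)) F) (p : F) : Prop :=
  let density : F → ℝ := fun q =>
    wedgePow (OneForm.d (𝓡∂ (2 * m + 2)) lam q) (m + 1)
      (fun i => coordField (𝓡∂ (2 * m + 2)) p
        (EuclideanSpace.single i (1 : ℝ) : EuclideanSpace ℝ (Fin (2 * m + 2))) q)
  density p = 0 ∧ mfderiv (𝓡∂ (2 * m + 2)) 𝓘(ℝ, ℝ) density p ≠ 0

/-- The vector field `ν` generates a foliation of `F` which extends the (oriented, singular)
foliation spanned by the Liouville field of `lam` in the interior of `F`, and which is transverse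
to the boundary `ι (K)`. -/
structure IsTransverseExtension (ι : K → F) (lam : OneForm (𝓡∂ (2 * m + 2)) F)
    (ν : ∀ p : F, TangentSpace (𝓡∂ (2 * m + 2)) p) : Prop where
  smooth : ContMDiff (𝓡∂ (2 * m + 2)) (𝓡∂ (2 * m + 2)).tangent ∞
    (fun p => (⟨p, ν p⟩ : TangentBundle (𝓡∂ (2 * m + 2)) F))
  extends_liouville : ∃ v : F → ℝ,
    ContMDiffOn (𝓡∂ (2 * m + 2)) 𝓘(ℝ, ℝ) ∞ v ((𝓡∂ (2 * m + 2)).interior F) ∧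
    ∀ p ∈ (𝓡∂ (2 * m + 2)).interior F,
      0 < v p ∧ ν p = v p • OneForm.liouvilleField (𝓡∂ (2 * m + 2)) lam p
  transverse : ∀ x : K,
    ν (ι x) ∉ range (mfderiv (𝓡 (2 * m + 1)) (𝓡∂ (2 * m + 2)) ι x)

/-- The union of all the orbits of `ν` which exit through the boundary of `F`. -/
def exitCollar (ν : ∀ p : F, TangentSpace (𝓡∂ (2 * m + 2)) p) : Set F :=
  {p | ∃ (T : ℝ) (γ : ℝ → F), 0 ≤ T ∧ IsMIntegralCurveOn γ ν (Icc 0 T) ∧ γ 0 = p ∧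
    γ T ∈ (𝓡∂ (2 * m + 2)).boundary F}

/-- `h` is a smooth homeomorphism from `U` onto `SK_{≤α}`, where `α` is the form induced by `lam` on
the boundary `K`, such that `h` is the identity on `K ≅ K_α`, induces a diffeomorphism between
`U - K` and `SK_{<α}`, and pulls back the canonical 1-form to `lam`. -/
structure IsLiouvilleCollarMap (ι : K → F) (lam : OneForm (𝓡∂ (2 * m + 2)) F) (U : Set F)
    (h : F → Cotangent (𝓡 (2 * m + 1)) K) : Prop where
  smooth : ContMDiffOn (𝓡∂ (2 * m + 2))
    (cotangentModel (𝓡 (2 * m + 1))) ∞ h U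
  homeo_and_diffeo : ∃ g : Cotangent (𝓡 (2 * m + 1)) K → F,
    MapsTo h U (SLe (𝓡 (2 * m + 1)) (boundaryForm ι lam)) ∧
    MapsTo g (SLe (𝓡 (2 * m + 1)) (boundaryForm ι lam)) U ∧
    InvOn g h U (SLe (𝓡 (2 * m + 1)) (boundaryForm ι lam)) ∧
    ContinuousOn g (SLe (𝓡 (2 * m + 1)) (boundaryForm ι lam)) ∧
    MapsTo h (U \ range ι) (SLt (𝓡 (2 * m + 1)) (boundaryForm ι lam)) ∧
    MapsTo g (SLt (𝓡 (2 * m + 1)) (boundaryForm ι lam)) (U \ range ι) ∧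
    ContMDiffOn (cotangentModel (𝓡 (2 * m + 1)))
      (𝓡∂ (2 * m + 2)) ∞ g (SLt (𝓡 (2 * m + 1)) (boundaryForm ι lam))
  boundary : ∀ x : K, h (ι x) = OneForm.toCotangent (𝓡 (2 * m + 1)) (boundaryForm ι lam) x
  pullback : ∀ p ∈ U, lam p = (canonicalForm (𝓡 (2 * m + 1)) (h p)).comp
    (mfderiv (𝓡∂ (2 * m + 2))
      (cotangentModel (𝓡 (2 * m + 1))) h p)

end Domain

end

/-!
The proof works with a pair `(ν, g)` such that `dλ (ν, ·) = g λ` on all of `F`, with `g` smooth,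
non-negative, and positive in the interior, and with `ν` pointing outwards along `K`
(`IsLiouvilleData`). In the interior this means `ν = g X` for the Liouville field `X`.

*The foliation.* Near a boundary point, the conditions that `N` have transverse component `-1` in a
chart, that `λ (N) = 0`, and that `dλ (N, ·) = g λ` on the coordinate hyperplane parallel to `K` form
a square linear system for `(N, g)`. The contact condition makes it regular at `K`, so that it has a
smooth solution even where `dλ` degenerates (`IsBoundaryInclusion.exists_local_field`). Contracting
`(dλ)^n` with `N` gives `n g λ ∧ (dλ)^(n-1)` (`wedgePow_cons`), hence the positivity of the
contact form says that, near `K`, `g > 0` in the interior if and only if `N` points outwards (`IsBoundaryInclusion.eventually_sign`). The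
conditions on `N` are convex, and the local solutions are glued by a partition of unity
(`IsBoundaryInclusion.exists_isTransverseExtension`). Conversely every transverse extension comes
with such a factor `g` (`IsBoundaryInclusion.exists_isLiouvilleData`).

*The collar.* The orbits of `-ν` which start on `K` exist for all positive times, because `F` is
compact and `-ν` points inwards; they never return to `K`. Smooth flows across the boundary are
obtained by extending the field beyond the half-space by reflections
(`exists_contDiff_extension_of_nhdsWithin`) and by solving the integral equation of the flow with the
implicit function theorem (`exists_contDiffOn_localFlow`). The orbits sweep out an open set `U`, on
which the projection `pr` to `K` along the orbits is smooth (`IsOrbitFamily.exists_projection`). The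
Lie derivatives along `ν` of `λ` and `pr^*α` are `g λ` and `0`, and both forms agree along `K`. Thus
`λ = s pr^*α`, where `s = exp (-∫ g)` along each orbit, by uniqueness for linear differential
equations (`eq_smul_along_integralCurve`, `IsLiouvilleData.exists_isLiouvilleCollar`).

*The map.* It follows that `h p = s(p) α_{pr(p)}` pulls the canonical form back to `λ`. Along every
orbit `s` decreases strictly from `1` to `0`: the limit is `0` because the orbit stays in a compact
subset of the interior after a unit of time, where `g` is bounded below
(`IsLiouvilleData.exists_le_factor`). Therefore `h` is a bijection from `U` to `SK_{≤α}`. Its inverse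
is smooth over the interior by the inverse function theorem, since `dλ` is non-degenerate there, and
continuous up to `K` (`IsLiouvilleCollar.isLiouvilleCollarMap`). For uniqueness, any other map `h'`
gives `λ = s' pr'^*α`; the contact condition forces `dpr' (ν) = 0`, so that `pr'` is constant on the
orbits, `pr' = pr` and `s' = s` (`IsLiouvilleCollar.eqOn_toCotangent`).

*Singularities.* The kernel of `dh` is the common kernel of `dpr` and `ds`. It is contained in the
kernel of `dλ`, which is trivial in the interior, and at a boundary point the kernel of `dpr` is
spanned by `ν`, with `ds (ν) = g s`. So `h` is singular exactly where `g` vanishes, which is where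
`dλ` degenerates (`IsLiouvilleCollar.isSingularPoint_iff`). Along `ν` the derivative of `h` is `g s`
times the fibre direction `α`; where `g = 0`, the second derivative along `ν` is `dg (ν) s` times this
direction modulo the range of `dh`, and the point is a fold if and only if `dg (ν) ≠ 0`
(`IsLiouvilleCollar.isFoldPoint_iff`). Near `K` the density of `(dλ)^n` is the product of `g` and a
function without zeros, and `dg` vanishes on the tangent space of `K` because `g ≥ 0`; hence
`dg (ν) ≠ 0` expresses that the density vanishes transversely
(`IsLiouvilleData.topPowerVanishesTransverselyAt_iff`).
-/


noncomputable section

/-! ### Exterior powers of a 2-form -/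

section WedgeAlgebra

variable {V : Type*} [AddCommGroup V] [Module ℝ V]

/-- The multilinear form `v ↦ ∏ Ω (v₂ᵢ, v₂ᵢ₊₁)`, whose antisymmetrization is `wedgePow Ω n`. -/
def pairingProd (B : V →ₗ[ℝ] V →ₗ[ℝ] ℝ) (n : ℕ) :
    MultilinearMap ℝ (fun _ : Fin (2 * n) => V) ℝ where
  toFun v := ∏ i : Fin n, B (v ⟨2 * i, by omega⟩) (v ⟨2 * i + 1, by omega⟩)
  map_update_add' v k x y := by
    have hk : (k : ℕ) / 2 < n := by omega
    rw [Fintype.prod_eq_mul_prod_compl ⟨k / 2, hk⟩, Fintype.prod_eq_mul_prod_compl ⟨k / 2, hk⟩,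
      Fintype.prod_eq_mul_prod_compl ⟨k / 2, hk⟩]
    have hz : ∀ z : V, ∏ i ∈ {(⟨k / 2, hk⟩ : Fin n)}ᶜ,
        B (Function.update v k z ⟨2 * i, by omega⟩) (Function.update v k z ⟨2 * i + 1, by omega⟩) =
        ∏ i ∈ {(⟨k / 2, hk⟩ : Fin n)}ᶜ, B (v ⟨2 * i, by omega⟩) (v ⟨2 * i + 1, by omega⟩) := by
      intro z
      refine Finset.prod_congr rfl fun i hi => ?_
      have hi' : (i : ℕ) ≠ k / 2 := by
        simpa [Fin.ext_iff] using hi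
      rw [Function.update_of_ne (by rw [Ne, Fin.ext_iff]; simp only; omega),
        Function.update_of_ne (by rw [Ne, Fin.ext_iff]; simp only; omega)]
    rw [hz, hz, hz, ← add_mul]
    congr 1
    rcases Nat.even_or_odd' (k : ℕ) with ⟨c, hc | hc⟩
    · have h1 : (⟨2 * (k / 2 : ℕ), by omega⟩ : Fin (2 * n)) = k := by ext; simp only; omega
      have h2 : (⟨2 * (k / 2 : ℕ) + 1, by omega⟩ : Fin (2 * n)) ≠ k := by
        rw [Ne, Fin.ext_iff]; simp only; omega
      simp only [h1, Function.update_self, Function.update_of_ne h2, map_add, LinearMap.add_apply]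
    · have h1 : (⟨2 * (k / 2 : ℕ), by omega⟩ : Fin (2 * n)) ≠ k := by
        rw [Ne, Fin.ext_iff]; simp only; omega
      have h2 : (⟨2 * (k / 2 : ℕ) + 1, by omega⟩ : Fin (2 * n)) = k := by ext; simp only; omega
      simp only [h2, Function.update_self, Function.update_of_ne h1, map_add]
  map_update_smul' v k r x := by
    have hk : (k : ℕ) / 2 < n := by omega
    rw [Fintype.prod_eq_mul_prod_compl ⟨k / 2, hk⟩, Fintype.prod_eq_mul_prod_compl ⟨k / 2, hk⟩]
    have hz : ∀ z : V, ∏ i ∈ {(⟨k / 2, hk⟩ : Fin n)}ᶜ,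
        B (Function.update v k z ⟨2 * i, by omega⟩) (Function.update v k z ⟨2 * i + 1, by omega⟩) =
        ∏ i ∈ {(⟨k / 2, hk⟩ : Fin n)}ᶜ, B (v ⟨2 * i, by omega⟩) (v ⟨2 * i + 1, by omega⟩) := by
      intro z
      refine Finset.prod_congr rfl fun i hi => ?_
      have hi' : (i : ℕ) ≠ k / 2 := by
        simpa [Fin.ext_iff] using hi
      rw [Function.update_of_ne (by rw [Ne, Fin.ext_iff]; simp only; omega),
        Function.update_of_ne (by rw [Ne, Fin.ext_iff]; simp only; omega)]
    rw [hz, hz, smul_eq_mul, ← mul_assoc]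
    congr 1
    rcases Nat.even_or_odd' (k : ℕ) with ⟨c, hc | hc⟩
    · have h1 : (⟨2 * (k / 2 : ℕ), by omega⟩ : Fin (2 * n)) = k := by ext; simp only; omega
      have h2 : (⟨2 * (k / 2 : ℕ) + 1, by omega⟩ : Fin (2 * n)) ≠ k := by
        rw [Ne, Fin.ext_iff]; simp only; omega
      simp only [h1, Function.update_self, Function.update_of_ne h2, map_smul,
        LinearMap.smul_apply, smul_eq_mul]
    · have h1 : (⟨2 * (k / 2 : ℕ), by omega⟩ : Fin (2 * n)) ≠ k := by
        rw [Ne, Fin.ext_iff]; simp only; omega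
      have h2 : (⟨2 * (k / 2 : ℕ) + 1, by omega⟩ : Fin (2 * n)) = k := by ext; simp only; omega
      simp only [h2, Function.update_self, Function.update_of_ne h1, map_smul, smul_eq_mul]

/-- `wedgePow Ω n` as an alternating form. -/
def wedgePowAlt (B : V →ₗ[ℝ] V →ₗ[ℝ] ℝ) (n : ℕ) : V [⋀^Fin (2 * n)]→ₗ[ℝ] ℝ :=
  (1 / 2 ^ n : ℝ) • MultilinearMap.alternatization (pairingProd B n)

theorem wedgePowAlt_apply (B : V →ₗ[ℝ] V →ₗ[ℝ] ℝ) (n : ℕ) (v : Fin (2 * n) → V) :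
    wedgePowAlt B n v = wedgePow (fun x y => B x y) n v := by
  rw [wedgePowAlt, AlternatingMap.smul_apply, MultilinearMap.alternatization_apply, smul_eq_mul,
    wedgePow]
  congr 1
  refine Finset.sum_congr rfl fun σ _ => ?_
  rw [Units.smul_def, zsmul_eq_mul]
  rfl

theorem wedgeOnePow_neg (a : V →ₗ[ℝ] ℝ) (B : V →ₗ[ℝ] V →ₗ[ℝ] ℝ) (m : ℕ)
    (w : Fin (2 * m + 1) → V) :
    wedgeOnePow a (fun x y => B x y) m (fun i => - w i) =
      - wedgeOnePow a (fun x y => B x y) m w := by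
  simp [wedgeOnePow]

/-- If `a` vanishes on all the vectors but the first, and one of these is `Ω`-orthogonal to all the
others, then every term of `a ∧ Ω^m` vanishes. -/
theorem wedgeOnePow_eq_zero (a : V →ₗ[ℝ] ℝ) (B : V →ₗ[ℝ] V →ₗ[ℝ] ℝ) (m : ℕ)
    (hB : ∀ x y, B x y = - B y x)
    (w : Fin (2 * m + 1) → V) (ha : ∀ j, j ≠ 0 → a (w j) = 0) (k : Fin (2 * m + 1)) (hk : k ≠ 0)
    (hkj : ∀ j, j ≠ 0 → B (w k) (w j) = 0) :
    wedgeOnePow a (fun x y => B x y) m w = 0 := by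
  rw [wedgeOnePow]
  refine mul_eq_zero_of_right _ (Finset.sum_eq_zero fun σ _ => mul_eq_zero_of_right _ ?_)
  by_cases h0 : σ 0 = 0
  · refine mul_eq_zero_of_right _ ?_
    have hne : σ.symm k ≠ 0 := by
      intro h
      apply hk
      rw [← h0, ← h, Equiv.apply_symm_apply]
    have hpos : 0 < (σ.symm k : ℕ) := Nat.pos_of_ne_zero fun h => hne (Fin.ext h)
    have hlt := (σ.symm k).isLt
    have h0' : ∀ j, j ≠ 0 → σ j ≠ 0 := fun j hj h => hj (σ.injective (h.trans h0.symm))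
    refine Finset.prod_eq_zero (i := ⟨((σ.symm k : ℕ) - 1) / 2, by omega⟩) (Finset.mem_univ _) ?_
    rcases Nat.even_or_odd' (σ.symm k : ℕ) with ⟨c, hc | hc⟩
    · have h2 : (⟨2 * (((σ.symm k : ℕ) - 1) / 2) + 2, by omega⟩ : Fin (2 * m + 1)) = σ.symm k := by
        ext; simp only; omega
      simp only [h2, Equiv.apply_symm_apply]
      rw [hB, hkj _ (h0' _ (by rw [Ne, Fin.ext_iff]; simp)), neg_zero]
    · have h2 : (⟨2 * (((σ.symm k : ℕ) - 1) / 2) + 1, by omega⟩ : Fin (2 * m + 1)) = σ.symm k := by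
        ext; simp only; omega
      simp only [h2, Equiv.apply_symm_apply]
      exact hkj _ (h0' _ (by rw [Ne, Fin.ext_iff]; simp))
  · exact mul_eq_zero_of_left (ha _ h0) _

/-- One signed term of the sum which defines `wedgePow`. -/
def wedgeTerm (B : V →ₗ[ℝ] V →ₗ[ℝ] ℝ) (n : ℕ) (v : Fin (2 * n) → V)
    (σ : Equiv.Perm (Fin (2 * n))) : ℝ :=
  ((Equiv.Perm.sign σ : ℤ) : ℝ) *
    ∏ i : Fin n, B (v (σ ⟨2 * i, by omega⟩)) (v (σ ⟨2 * i + 1, by omega⟩))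

/-- Exchanging the two arguments of one factor changes both the sign of the permutation and the
sign of this factor. -/
theorem wedgeTerm_flip (B : V →ₗ[ℝ] V →ₗ[ℝ] ℝ) (hB : ∀ x y, B x y = - B y x) (n : ℕ)
    (v : Fin (2 * n) → V) (i : Fin n) (σ : Equiv.Perm (Fin (2 * n))) :
    wedgeTerm B n v (σ * Equiv.swap ⟨2 * i, by omega⟩ ⟨2 * i + 1, by omega⟩) =
      wedgeTerm B n v σ := by
  have hne : (⟨2 * i, by omega⟩ : Fin (2 * n)) ≠ ⟨2 * i + 1, by omega⟩ := by
    rw [Ne, Fin.ext_iff]; simp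
  rw [wedgeTerm, wedgeTerm, Equiv.Perm.sign_mul, Equiv.Perm.sign_swap hne,
    Fintype.prod_eq_mul_prod_compl i, Fintype.prod_eq_mul_prod_compl i]
  have hz : ∏ j ∈ {i}ᶜ, B (v ((σ * Equiv.swap (⟨2 * i, by omega⟩ : Fin (2 * n)) ⟨2 * i + 1, by omega⟩)
        ⟨2 * j, by omega⟩)) (v ((σ * Equiv.swap (⟨2 * i, by omega⟩ : Fin (2 * n)) ⟨2 * i + 1, by omega⟩)
        ⟨2 * j + 1, by omega⟩)) =
      ∏ j ∈ {i}ᶜ, B (v (σ ⟨2 * j, by omega⟩)) (v (σ ⟨2 * j + 1, by omega⟩)) := by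
    refine Finset.prod_congr rfl fun j hj => ?_
    have hj' : (j : ℕ) ≠ i := by simpa [Fin.ext_iff] using hj
    rw [Equiv.Perm.mul_apply, Equiv.Perm.mul_apply, Equiv.swap_apply_of_ne_of_ne,
      Equiv.swap_apply_of_ne_of_ne] <;> rw [Ne, Fin.ext_iff] <;> simp only <;> omega
  rw [hz, Equiv.Perm.mul_apply, Equiv.Perm.mul_apply, Equiv.swap_apply_left,
    Equiv.swap_apply_right, hB]
  push_cast
  ring

/-- Exchanging two factors is an even permutation, and permutes the factors of the product. -/
theorem wedgeTerm_blockSwap (B : V →ₗ[ℝ] V →ₗ[ℝ] ℝ) (n : ℕ)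
    (v : Fin (2 * n) → V) (i j : Fin n) (hij : i ≠ j) (σ : Equiv.Perm (Fin (2 * n))) :
    wedgeTerm B n v (σ * (Equiv.swap ⟨2 * i, by omega⟩ ⟨2 * j, by omega⟩ *
      Equiv.swap ⟨2 * i + 1, by omega⟩ ⟨2 * j + 1, by omega⟩)) = wedgeTerm B n v σ := by
  have hij' : (i : ℕ) ≠ j := fun h => hij (Fin.ext h)
  have hne : (⟨2 * i, by omega⟩ : Fin (2 * n)) ≠ ⟨2 * j, by omega⟩ := by
    rw [Ne, Fin.ext_iff]; simp only; omega
  have hne' : (⟨2 * i + 1, by omega⟩ : Fin (2 * n)) ≠ ⟨2 * j + 1, by omega⟩ := by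
    rw [Ne, Fin.ext_iff]; simp only; omega
  rw [wedgeTerm, wedgeTerm, Equiv.Perm.sign_mul, Equiv.Perm.sign_mul, Equiv.Perm.sign_swap hne,
    Equiv.Perm.sign_swap hne']
  congr 1
  · simp
  · rw [← Equiv.prod_comp (Equiv.swap i j)
      (fun l : Fin n => B (v (σ ⟨2 * l, by omega⟩)) (v (σ ⟨2 * l + 1, by omega⟩)))]
    refine Finset.prod_congr rfl fun l _ => ?_
    have key : ∀ l : Fin n, (Equiv.swap (⟨2 * i, by omega⟩ : Fin (2 * n)) ⟨2 * j, by omega⟩ *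
          Equiv.swap (⟨2 * i + 1, by omega⟩ : Fin (2 * n)) ⟨2 * j + 1, by omega⟩) ⟨2 * l, by omega⟩ =
          ⟨2 * (Equiv.swap i j l), by omega⟩ ∧
        (Equiv.swap (⟨2 * i, by omega⟩ : Fin (2 * n)) ⟨2 * j, by omega⟩ *
          Equiv.swap (⟨2 * i + 1, by omega⟩ : Fin (2 * n)) ⟨2 * j + 1, by omega⟩) ⟨2 * l + 1, by omega⟩ =
          ⟨2 * (Equiv.swap i j l) + 1, by omega⟩ := by
      intro l
      simp only [Equiv.Perm.mul_apply, Equiv.swap_apply_def, Fin.ext_iff]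
      constructor <;> split_ifs <;> simp_all <;> omega
    change B (v (σ ((_ * _ : Equiv.Perm (Fin (2 * n))) _)))
      (v (σ ((_ * _ : Equiv.Perm (Fin (2 * n))) _))) = _
    rw [(key l).1, (key l).2]

/-- Contraction of the top power: `N ⌟ Ω^(m+1) = (m+1) (N ⌟ Ω) ∧ Ω^m`. The sum over the permutations
`σ` is grouped by the place `j` with `σ j = 0`, at which `N` is inserted; all `2m+2` groups
contribute equally. -/
theorem wedgePow_cons (B : V →ₗ[ℝ] V →ₗ[ℝ] ℝ) (hB : ∀ x y, B x y = - B y x) (m : ℕ)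
    (N : V) (w : Fin (2 * m + 1) → V) :
    wedgePow (fun x y => B x y) (m + 1) (Fin.cons N w : Fin (2 * m + 1 + 1) → V) =
      (m + 1) * wedgeOnePow (B N) (fun x y => B x y) m w := by
  classical
  set u : Fin (2 * (m + 1)) → V := (Fin.cons N w : Fin (2 * m + 1 + 1) → V) with hu
  -- the contribution of the permutations which send `j` to `0` does not depend on `j`
  let Q : Fin (2 * (m + 1)) → ℝ := fun j =>
    ∑ σ : Equiv.Perm (Fin (2 * (m + 1))), if σ j = 0 then wedgeTerm B (m + 1) u σ else 0
  have hQmul : ∀ (κ : Equiv.Perm (Fin (2 * (m + 1)))) (j : Fin (2 * (m + 1))),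
      (∀ σ, wedgeTerm B (m + 1) u (σ * κ) = wedgeTerm B (m + 1) u σ) → Q j = Q (κ j) := by
    intro κ j hκ
    simp only [Q]
    rw [← Equiv.sum_comp (Equiv.mulRight κ)
      (fun σ => if σ j = 0 then wedgeTerm B (m + 1) u σ else 0)]
    refine Finset.sum_congr rfl fun σ _ => ?_
    simp only [Equiv.coe_mulRight, Equiv.Perm.mul_apply, hκ]
  have hQ : ∀ j, Q j = Q 0 := by
    intro j
    -- an even place is moved to `0` by exchanging two factors
    have heven : ∀ i : Fin (m + 1), Q ⟨2 * i, by omega⟩ = Q 0 := by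
      intro i
      by_cases hi : i = 0
      · subst hi; rfl
      · rw [hQmul _ ⟨2 * i, by omega⟩ (wedgeTerm_blockSwap B (m + 1) u i 0 hi)]
        congr 1
        rw [Equiv.Perm.mul_apply, Equiv.swap_apply_of_ne_of_ne
          (a := (⟨2 * i + 1, by omega⟩ : Fin (2 * (m + 1)))), Equiv.swap_apply_left]
        · rfl
        · rw [Ne, Fin.ext_iff]; simp
        · rw [Ne, Fin.ext_iff]; simp only; omega
    rcases Nat.even_or_odd' (j : ℕ) with ⟨c, hc | hc⟩
    · have hj : j = ⟨2 * (⟨c, by omega⟩ : Fin (m + 1)), by simp only; omega⟩ := Fin.ext hc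
      rw [hj]; exact heven _
    · have hj : j = ⟨2 * (⟨c, by omega⟩ : Fin (m + 1)) + 1, by simp only; omega⟩ := Fin.ext hc
      -- an odd place is moved to the even place before it by flipping a factor
      rw [hj, hQmul _ _ (wedgeTerm_flip B hB (m + 1) u ⟨c, by omega⟩), Equiv.swap_apply_right]
      exact heven _
  have hsum : ∑ σ : Equiv.Perm (Fin (2 * (m + 1))), wedgeTerm B (m + 1) u σ =
      (2 * (m + 1)) * Q 0 := by
    have h1 : ∀ σ : Equiv.Perm (Fin (2 * (m + 1))), wedgeTerm B (m + 1) u σ =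
        ∑ j, if σ j = 0 then wedgeTerm B (m + 1) u σ else 0 := by
      intro σ
      rw [Finset.sum_eq_single (σ.symm 0)]
      · simp
      · intro b _ hb
        rw [if_neg]
        intro h
        exact hb (by rw [← h, Equiv.symm_apply_apply])
      · simp
    rw [Finset.sum_congr rfl fun σ _ => h1 σ, Finset.sum_comm]
    change ∑ j, Q j = _
    rw [Finset.sum_congr rfl fun j _ => hQ j]
    simp
  -- the permutations which fix `0` are the permutations of the remaining places
  have hQ0 : Q 0 = ∑ τ : Equiv.Perm (Fin (2 * m + 1)), ((Equiv.Perm.sign τ : ℤ) : ℝ) *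
      (B N (w (τ 0)) * ∏ i : Fin m, B (w (τ ⟨2 * i + 1, by omega⟩)) (w (τ ⟨2 * i + 2, by omega⟩))) := by
    have h1 : Q 0 = ∑ σ : Equiv.Perm (Fin (2 * m + 1 + 1)),
        if σ 0 = 0 then wedgeTerm B (m + 1) u σ else 0 := rfl
    rw [h1, ← Equiv.sum_comp Equiv.Perm.decomposeFin.symm, Fintype.sum_prod_type,
      Finset.sum_eq_single 0]
    · refine Finset.sum_congr rfl fun τ _ => ?_
      rw [if_pos (Equiv.Perm.decomposeFin_symm_apply_zero _ _), wedgeTerm]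
      have hs : Equiv.Perm.sign (Equiv.Perm.decomposeFin.symm ((0 : Fin (2 * m + 1 + 1)), τ)) =
          Equiv.Perm.sign τ := by
        rw [Equiv.Perm.decomposeFin.symm_sign, if_pos rfl, one_mul]
      congr 1
      · rw [← hs]
      · rw [Fin.prod_univ_succ]
        congr 1
    · intro b _ hb
      refine Finset.sum_eq_zero fun τ _ => ?_
      rw [if_neg]
      rw [Equiv.Perm.decomposeFin_symm_apply_zero]
      exact hb
    · simp
  have hdef : wedgePow (fun x y => B x y) (m + 1) u =
      (1 / 2 ^ (m + 1) : ℝ) * ∑ σ : Equiv.Perm (Fin (2 * (m + 1))), wedgeTerm B (m + 1) u σ := rfl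
  rw [hdef, hsum, hQ0, wedgeOnePow]
  rw [pow_succ]
  field_simp

end WedgeAlgebra

/-! ### Extension of functions across a hyperplane by reflections -/

section Reflection

universe u

variable {E : Type u} [NormedAddCommGroup E] [NormedSpace ℝ E]

/-- The extension of a function `f` on the half-space `{0 ≤ ℓ}` by a linear combination of its
composites with the dilations of ratios `c k < 0` along the line spanned by `e`. -/
def reflectExt {κ G : Type*} [Fintype κ] [NormedAddCommGroup G] [NormedSpace ℝ G]
    (ℓ : E →L[ℝ] ℝ) (e : E) (a c : κ → ℝ) (f : E → G) (y : E) : G :=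
  if 0 ≤ ℓ y then f y else ∑ k, a k • f (y + ((c k - 1) * ℓ y) • e)

variable {κ : Type*} [Fintype κ] {ℓ : E →L[ℝ] ℝ} {e : E} {c : κ → ℝ}

theorem reflectExt_of_nonpos {G : Type*} [NormedAddCommGroup G] [NormedSpace ℝ G] {a : κ → ℝ}
    (ha : ∑ k, a k = 1) (f : E → G) {y : E} (hy : ℓ y ≤ 0) :
    reflectExt ℓ e a c f y = ∑ k, a k • f (y + ((c k - 1) * ℓ y) • e) := by
  rw [reflectExt]
  split_ifs with h
  · have h0 : ℓ y = 0 := le_antisymm hy h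
    simp only [h0, mul_zero, zero_smul, add_zero, ← Finset.sum_smul, ha, one_smul]
  · rfl

theorem reflectExt_of_nonneg {G : Type*} [NormedAddCommGroup G] [NormedSpace ℝ G] (a : κ → ℝ)
    (f : E → G) {y : E} (hy : 0 ≤ ℓ y) : reflectExt ℓ e a c f y = f y := if_pos hy

/-- The reflection extension of a `C^n` function is `C^n`, if the moments of order `≤ n` of the
coefficients `a k` at the points `c k` are equal to `1`: by induction, because the derivative of the
extension is again a sum of two reflection extensions. -/
theorem contDiff_reflectExt (he : ℓ e = 1) (hc : ∀ k, c k < 0) (n : ℕ) :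
    ∀ {G : Type u} [NormedAddCommGroup G] [NormedSpace ℝ G] (a : κ → ℝ)
      (_ : ∀ j ≤ n, ∑ k, a k * c k ^ j = 1) (f : E → G) (_ : ContDiffOn ℝ n f {y | 0 ≤ ℓ y}),
      ContDiff ℝ n (reflectExt ℓ e a c f) := by
  have hmap : ∀ k, MapsTo (fun y => y + ((c k - 1) * ℓ y) • e) {y | ℓ y ≤ 0} {y | 0 ≤ ℓ y} := by
    intro k y hy
    simp only [mem_ofPred_eq, map_add, map_smul, he, smul_eq_mul, mul_one] at hy ⊢
    nlinarith [hc k]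
  have hHc : IsClosed {y | 0 ≤ ℓ y} := isClosed_le continuous_const ℓ.continuous
  have hHc' : IsClosed {y | ℓ y ≤ 0} := isClosed_le ℓ.continuous continuous_const
  have hcover : {y | 0 ≤ ℓ y} ∪ {y | ℓ y ≤ 0} = univ :=
    eq_univ_of_forall fun y => le_total 0 (ℓ y)
  have huniq : UniqueDiffOn ℝ {y | 0 ≤ ℓ y} := by
    refine uniqueDiffOn_convex ?_ ⟨e, ?_⟩
    · exact (convex_Ici (0 : ℝ)).linear_preimage (ℓ : E →ₗ[ℝ] ℝ)
    · have : IsOpen {y | 0 < ℓ y} := isOpen_lt continuous_const ℓ.continuous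
      exact interior_maximal (s := {y | 0 ≤ ℓ y}) (t := {y | 0 < ℓ y})
        (ofPred_subset_ofPred.2 fun y hy => hy.le) this (by simp [he])
  induction n with
  | zero =>
    intro G _ _ a ha f hf
    have ha0 : ∑ k, a k = 1 := by simpa using ha 0 le_rfl
    rw [Nat.cast_zero, contDiffOn_zero] at hf
    rw [Nat.cast_zero, contDiff_zero, ← continuousOn_univ, ← hcover]
    refine ContinuousOn.union_of_isClosed ?_ ?_ hHc hHc'
    · exact hf.congr fun y hy => reflectExt_of_nonneg a f hy
    · refine ContinuousOn.congr ?_ fun y hy => reflectExt_of_nonpos ha0 f hy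
      refine continuousOn_finsetSum _ fun k _ => ContinuousOn.const_smul ?_ _
      exact hf.comp (by fun_prop) (hmap k)
  | succ n ih =>
    intro G _ _ a ha f hf
    have ha0 : ∑ k, a k = 1 := by simpa using ha 0 (Nat.zero_le _)
    have ha1 : ∑ k, a k * c k = 1 := by simpa using ha 1 (by omega)
    -- the derivative splits into its parts along the hyperplane and along `e`; on the latter
    -- the reflections act by the coefficients `a k * c k`
    let P : E →L[ℝ] E := ℓ.smulRight e
    let Q : E →L[ℝ] E := ContinuousLinearMap.id ℝ E - P
    let D := fderivWithin ℝ f {y | 0 ≤ ℓ y}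
    have hD : ContDiffOn ℝ n D {y | 0 ≤ ℓ y} :=
      hf.fderivWithin huniq (by norm_cast)
    have hdiff : ∀ x, 0 ≤ ℓ x → HasFDerivWithinAt f (D x) {y | 0 ≤ ℓ y} x := fun x hx =>
      ((hf.differentiableOn (by norm_num)) x hx).hasFDerivWithinAt
    rw [Nat.cast_succ, contDiff_succ_iff_hasFDerivAt]
    refine ⟨fun x => reflectExt ℓ e a c (fun y => (D y).comp Q) x +
      reflectExt ℓ e (fun k => a k * c k) c (fun y => (D y).comp P) x, ?_, ?_⟩
    · refine ContDiff.add ?_ ?_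
      · exact ih a (fun j hj => ha j (by omega)) _ (hD.clm_comp contDiffOn_const)
      · refine ih _ (fun j hj => ?_) _ (hD.clm_comp contDiffOn_const)
        rw [← ha (j + 1) (by omega)]
        exact Finset.sum_congr rfl fun k _ => by ring
    · have hA : ∀ x, 0 ≤ ℓ x → HasFDerivWithinAt (reflectExt ℓ e a c f)
          (reflectExt ℓ e a c (fun y => (D y).comp Q) x +
            reflectExt ℓ e (fun k => a k * c k) c (fun y => (D y).comp P) x)
          {y | 0 ≤ ℓ y} x := by
        intro x hx
        rw [reflectExt_of_nonneg _ _ hx, reflectExt_of_nonneg _ _ hx,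
          ← ContinuousLinearMap.comp_add]
        have : Q + P = ContinuousLinearMap.id ℝ E := sub_add_cancel _ _
        rw [this, ContinuousLinearMap.comp_id]
        exact (hdiff x hx).congr (fun y hy => reflectExt_of_nonneg a f hy)
          (reflectExt_of_nonneg a f hx)
      have hB : ∀ x, ℓ x ≤ 0 → HasFDerivWithinAt (reflectExt ℓ e a c f)
          (reflectExt ℓ e a c (fun y => (D y).comp Q) x +
            reflectExt ℓ e (fun k => a k * c k) c (fun y => (D y).comp P) x)
          {y | ℓ y ≤ 0} x := by
        intro x hx
        rw [reflectExt_of_nonpos ha0 _ hx, reflectExt_of_nonpos ha1 _ hx,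
          ← Finset.sum_add_distrib]
        refine HasFDerivWithinAt.congr ?_ (fun y hy => reflectExt_of_nonpos ha0 f hy)
          (reflectExt_of_nonpos ha0 f hx)
        refine HasFDerivWithinAt.fun_sum fun k _ => ?_
        have hR : HasFDerivWithinAt (fun y => y + ((c k - 1) * ℓ y) • e) (Q + c k • P)
            {y | ℓ y ≤ 0} x := by
          have h1 : HasFDerivAt (fun y => y + ((c k - 1) * ℓ y) • e)
              (ContinuousLinearMap.id ℝ E + ((c k - 1) • ℓ).smulRight e) x :=
            (hasFDerivAt_id x).add ((ℓ.hasFDerivAt.const_mul (c k - 1)).smul_const e)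
          convert h1.hasFDerivWithinAt using 1
          ext v
          simp only [Q, P, add_apply, sub_apply, smul_apply, ContinuousLinearMap.smulRight_apply,
            ContinuousLinearMap.id_apply, smul_eq_mul]
          module
        have h2 := ((hdiff _ (hmap k hx)).comp x hR (hmap k)).const_smul (a k)
        refine h2.congr_fderiv ?_
        rw [ContinuousLinearMap.comp_add, ContinuousLinearMap.comp_smul, smul_add, smul_smul]
      intro x
      rcases lt_trichotomy (ℓ x) 0 with h | h | h
      · exact (hB x h.le).hasFDerivAt
          (mem_of_superset ((isOpen_lt ℓ.continuous continuous_const).mem_nhds h)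
            fun y (hy : ℓ y < 0) => hy.le)
      · rw [← hasFDerivWithinAt_univ, ← hcover]
        exact (hA x h.ge).union (hB x h.le)
      · exact (hA x h.le).hasFDerivAt
          (mem_of_superset ((isOpen_lt continuous_const ℓ.continuous).mem_nhds h)
            fun y (hy : 0 < ℓ y) => hy.le)

/-- Coefficients with prescribed moments, by Lagrange interpolation at `1` of the monomials. -/
theorem exists_reflection_coefficients (n : ℕ) :
    ∃ a c : Fin (n + 1) → ℝ, (∀ k, c k < 0) ∧ ∀ j ≤ n, ∑ k, a k * c k ^ j = 1 := by
  let c : Fin (n + 1) → ℝ := fun k => -((k : ℝ) + 1)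
  have hinj : Set.InjOn c (Finset.univ : Finset (Fin (n + 1))) := by
    intro i _ j _ h
    simp only [c, neg_inj, add_left_inj, Nat.cast_inj] at h
    exact Fin.ext h
  refine ⟨fun k => (Lagrange.basis Finset.univ c k).eval 1, c, fun k => ?_, fun j hj => ?_⟩
  · simp only [c]; have : (0 : ℝ) ≤ (k : ℕ) := Nat.cast_nonneg _; linarith
  · have h := Lagrange.eq_interpolate (f := (Polynomial.X ^ j : Polynomial ℝ)) hinj (by
      rw [Polynomial.degree_X_pow, Finset.card_univ, Fintype.card_fin]
      exact_mod_cast Nat.lt_succ_of_le hj)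
    have h2 := congrArg (Polynomial.eval (1 : ℝ)) h
    rw [Lagrange.interpolate_apply, Polynomial.eval_finsetSum] at h2
    simp only [Polynomial.eval_pow, Polynomial.eval_X, one_pow, Polynomial.eval_mul,
      Polynomial.eval_C] at h2
    exact (Finset.sum_congr rfl fun k _ => mul_comm _ _).trans h2.symm

/-- A function which is `C^n` on a half-space extends to a `C^n` function on the whole space. -/
theorem exists_contDiff_extension_of_halfSpace {G : Type u} [NormedAddCommGroup G]
    [NormedSpace ℝ G] (he : ℓ e = 1) (n : ℕ) {f : E → G} (hf : ContDiffOn ℝ n f {y | 0 ≤ ℓ y}) :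
    ∃ f' : E → G, ContDiff ℝ n f' ∧ ∀ y, 0 ≤ ℓ y → f' y = f y := by
  obtain ⟨a, c, hc, ha⟩ := exists_reflection_coefficients n
  exact ⟨reflectExt ℓ e a c f, contDiff_reflectExt he hc n a ha f hf,
    fun y hy => reflectExt_of_nonneg a f hy⟩

/-- Local version of `exists_contDiff_extension_of_halfSpace`. -/
theorem exists_contDiff_extension_of_nhdsWithin {G : Type u} [NormedAddCommGroup G]
    [NormedSpace ℝ G] [FiniteDimensional ℝ E] (he : ℓ e = 1) (n : ℕ) {f : E → G} {x : E}
    {s : Set E} (hs : s ∈ 𝓝[{y | 0 ≤ ℓ y}] x) (hf : ContDiffOn ℝ n f s) :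
    ∃ f' : E → G, ContDiff ℝ n f' ∧ ∀ᶠ y in 𝓝[{y | 0 ≤ ℓ y}] x, y ∈ s ∧ f' y = f y := by
  obtain ⟨u, hu, hus⟩ := mem_nhdsWithin_iff_exists_mem_nhds_inter.1 hs
  obtain ⟨r, hr, hru⟩ := Metric.mem_nhds_iff.1 hu
  -- after multiplication by a bump function, `f` is `C^n` on the whole half-space
  let χ : ContDiffBump x := ⟨r / 4, r / 2, by positivity, by linarith⟩
  have hχ : ContDiffOn ℝ n (fun y => χ y • f y) {y | 0 ≤ ℓ y} := by
    intro y hy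
    by_cases hyr : y ∈ Metric.ball x r
    · have hys : y ∈ s := hus ⟨hru hyr, hy⟩
      have hsy : s ∈ 𝓝[{y | 0 ≤ ℓ y}] y :=
        mem_nhdsWithin_iff_exists_mem_nhds_inter.2 ⟨Metric.ball x r,
          Metric.isOpen_ball.mem_nhds hyr, fun z hz => hus ⟨hru hz.1, hz.2⟩⟩
      have : ContDiffWithinAt ℝ n (fun y => χ y • f y) s y :=
        (χ.contDiff.contDiffWithinAt).smul (hf y hys)
      exact this.mono_of_mem_nhdsWithin hsy
    · have hev : (fun y => χ y • f y) =ᶠ[𝓝 y] fun _ => 0 := by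
        have ho : IsOpen (Metric.closedBall x (r / 2))ᶜ := Metric.isClosed_closedBall.isOpen_compl
        have hy' : y ∈ (Metric.closedBall x (r / 2))ᶜ := by
          simp only [Metric.mem_ball, not_lt, mem_compl_iff, Metric.mem_closedBall, not_le] at hyr ⊢
          linarith
        filter_upwards [ho.mem_nhds hy'] with z hz
        have : χ z = 0 := χ.zero_of_le_dist (by
          simp only [mem_compl_iff, Metric.mem_closedBall, not_le] at hz
          exact hz.le)
        rw [this, zero_smul]
      exact (contDiffAt_const.congr_of_eventuallyEq hev).contDiffWithinAt
  obtain ⟨f', hf', heq⟩ := exists_contDiff_extension_of_halfSpace he n hχ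
  refine ⟨f', hf', ?_⟩
  have h1 : Metric.closedBall x (r / 4) ∈ 𝓝 x := Metric.closedBall_mem_nhds x (by positivity)
  filter_upwards [hs, self_mem_nhdsWithin, mem_nhdsWithin_of_mem_nhds h1] with y hy hyH hyr
  refine ⟨hy, ?_⟩
  rw [heq y hyH, χ.one_of_mem_closedBall hyr, one_smul]

end Reflection

/-! ### Superposition operators and smooth local flows -/

section Superposition

universe u

variable {X : Type*} [TopologicalSpace X] [CompactSpace X]
  {E : Type u} [NormedAddCommGroup E] [NormedSpace ℝ E]
  {G W : Type*} [NormedAddCommGroup G] [NormedSpace ℝ G] [NormedAddCommGroup W] [NormedSpace ℝ W]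

/-- Pointwise application of a bilinear map `b` to continuous functions. -/
def pointwiseBilin (X : Type*) [TopologicalSpace X] [CompactSpace X] (b : W →L[ℝ] E →L[ℝ] G) :
    C(X, W) →L[ℝ] C(X, E) →L[ℝ] C(X, G) :=
  LinearMap.mkContinuous₂
    (LinearMap.mk₂ ℝ (fun (A : C(X, W)) (γ : C(X, E)) =>
        (⟨fun t => b (A t) (γ t), by fun_prop⟩ : C(X, G)))
      (fun A B γ => by ext t; simp) (fun c A γ => by ext t; simp)
      (fun A γ η => by ext t; simp) (fun c A γ => by ext t; simp)) ‖b‖ (fun A γ => by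
        rw [ContinuousMap.norm_le _ (by positivity)]
        intro t
        exact b.le_of_opNorm₂_le_of_le le_rfl (A.norm_coe_le_norm t) (γ.norm_coe_le_norm t))

/-- The superposition operator is differentiable. The mean value inequality on the segments from
`γ t` to `η t` is uniform in `t`, because `f' ∘ η` is uniformly close to `f' ∘ γ`. -/
theorem hasFDerivAt_postcomp (f : C(E, G)) (f' : C(E, W)) (b : W →L[ℝ] E →L[ℝ] G)
    (hf : ∀ x, HasFDerivAt f (b (f' x)) x) (γ : C(X, E)) :
    HasFDerivAt (fun η : C(X, E) => f.comp η) (pointwiseBilin X b (f'.comp γ)) γ := by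
  rw [hasFDerivAt_iff_isLittleO, Asymptotics.isLittleO_iff]
  intro ε hε
  have hcont : Continuous fun η : C(X, E) => f'.comp η := ContinuousMap.continuous_postcomp f'
  have hb : 0 < ‖b‖ + 1 := by positivity
  obtain ⟨δ, hδ, hball⟩ := Metric.continuousAt_iff.1 (hcont.continuousAt (x := γ))
    (ε / (‖b‖ + 1)) (by positivity)
  filter_upwards [Metric.ball_mem_nhds γ hδ] with η hη
  rw [ContinuousMap.norm_le _ (by positivity)]
  intro t
  have hseg : ∀ y ∈ segment ℝ (γ t) (η t), ‖b (f' y) - b (f' (γ t))‖ ≤ ε := by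
    intro y hy
    rw [segment_eq_image'] at hy
    obtain ⟨θ, ⟨h0, h1⟩, rfl⟩ := hy
    have hd : dist (γ + θ • (η - γ)) γ < δ := by
      rw [dist_eq_norm, add_sub_cancel_left, norm_smul, Real.norm_of_nonneg h0]
      calc θ * ‖η - γ‖ ≤ 1 * ‖η - γ‖ := by gcongr
        _ < δ := by rw [one_mul, ← dist_eq_norm]; exact hη
    have h2 := (hball hd).le
    have h3 : ‖f' (γ t + θ • (η t - γ t)) - f' (γ t)‖ ≤ ε / (‖b‖ + 1) := by
      rw [← dist_eq_norm]
      exact (ContinuousMap.dist_apply_le_dist (f := f'.comp (γ + θ • (η - γ)))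
        (g := f'.comp γ) t).trans h2
    rw [← map_sub]
    calc ‖b (f' (γ t + θ • (η t - γ t)) - f' (γ t))‖
        ≤ ‖b‖ * (ε / (‖b‖ + 1)) := b.le_of_opNorm_le_of_le le_rfl h3
      _ ≤ (‖b‖ + 1) * (ε / (‖b‖ + 1)) := by gcongr; linarith
      _ = ε := by field_simp
  have h3 := (convex_segment (γ t) (η t)).norm_image_sub_le_of_norm_hasFDerivWithin_le'
    (f := f) (f' := fun y => b (f' y)) (φ := b (f' (γ t))) (fun y _ => (hf y).hasFDerivWithinAt)
    hseg (left_mem_segment ℝ _ _) (right_mem_segment ℝ _ _)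
  calc ‖(f.comp η - f.comp γ - pointwiseBilin X b (f'.comp γ) (η - γ)) t‖
      = ‖f (η t) - f (γ t) - b (f' (γ t)) (η t - γ t)‖ := rfl
    _ ≤ ε * ‖η t - γ t‖ := h3
    _ ≤ ε * ‖η - γ‖ := by
      gcongr
      exact ContinuousMap.norm_coe_le_norm (η - γ) t

theorem contDiff_postcomp_succ {n : ℕ} (f : C(E, G)) (f' : C(E, W)) (b : W →L[ℝ] E →L[ℝ] G)
    (hf : ∀ x, HasFDerivAt f (b (f' x)) x)
    (h : ContDiff ℝ n (fun η : C(X, E) => f'.comp η)) :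
    ContDiff ℝ (n + 1) (fun η : C(X, E) => f.comp η) := by
  rw [contDiff_succ_iff_hasFDerivAt]
  exact ⟨fun γ => pointwiseBilin X b (f'.comp γ), (pointwiseBilin X b).contDiff.comp h,
    fun γ => hasFDerivAt_postcomp f f' b hf γ⟩

/-- The superposition operator `γ ↦ f ∘ γ` is as smooth as `f`. -/
theorem contDiff_postcomp (n : ℕ) : ∀ {G : Type u} [NormedAddCommGroup G] [NormedSpace ℝ G]
    (f : C(E, G)) (_ : ContDiff ℝ n f), ContDiff ℝ n (fun η : C(X, E) => f.comp η) := by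
  induction n with
  | zero =>
    intro G _ _ f _
    rw [Nat.cast_zero, contDiff_zero]
    exact ContinuousMap.continuous_postcomp f
  | succ n ih =>
    intro G _ _ f hf
    rw [Nat.cast_succ, contDiff_succ_iff_hasFDerivAt] at hf
    obtain ⟨f', hf', hd⟩ := hf
    rw [Nat.cast_succ]
    exact contDiff_postcomp_succ (W := E →L[ℝ] G) f ⟨f', hf'.continuous⟩
      (ContinuousLinearMap.id ℝ (E →L[ℝ] G)) hd (ih (G := E →L[ℝ] G) ⟨f', hf'.continuous⟩ hf')

end Superposition

section LocalFlow

universe u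

variable {E : Type u} [NormedAddCommGroup E] [NormedSpace ℝ E] [CompleteSpace E]

/-- The Volterra operator `γ ↦ ∫₀ᵘ γ` on the continuous functions on `[-1, 1]`. -/
def volterra (E : Type*) [NormedAddCommGroup E] [NormedSpace ℝ E] [CompleteSpace E] :
    C(Icc (-1 : ℝ) 1, E) →L[ℝ] C(Icc (-1 : ℝ) 1, E) :=
  LinearMap.mkContinuous
    { toFun := fun γ => ⟨fun u => ∫ s in (0 : ℝ)..u, IccExtend (by norm_num) γ s, by
        have h : Continuous (IccExtend (by norm_num : (-1 : ℝ) ≤ 1) γ) := γ.continuous.Icc_extend'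
        exact (intervalIntegral.continuous_primitive (fun a b => h.intervalIntegrable a b) 0).comp
          continuous_subtype_val⟩
      map_add' := fun γ η => by
        have h : ∀ γ : C(Icc (-1 : ℝ) 1, E),
          Continuous (IccExtend (by norm_num : (-1 : ℝ) ≤ 1) γ) := fun γ => γ.continuous.Icc_extend'
        ext u
        exact intervalIntegral.integral_add ((h γ).intervalIntegrable _ _)
          ((h η).intervalIntegrable _ _)
      map_smul' := fun c γ => by
        ext u
        exact intervalIntegral.integral_smul c _ } 1 (fun γ => by
      rw [one_mul, ContinuousMap.norm_le _ (norm_nonneg _)]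
      intro u
      refine (intervalIntegral.norm_integral_le_of_norm_le_const (C := ‖γ‖)
        fun s _ => γ.norm_coe_le_norm _).trans ?_
      have : |(u : ℝ) - 0| ≤ 1 := by rw [sub_zero, abs_le]; exact u.2
      calc ‖γ‖ * |(u : ℝ) - 0| ≤ ‖γ‖ * 1 := by gcongr
        _ = ‖γ‖ := mul_one _)

/-- A `C^n` vector field `f` has, near each point `x₀`, a local flow which is `C^n` in the time
and the initial point together. The flow is found by the implicit function theorem, applied to
the integral equation `γ = x + T ∫ f ∘ γ` for curves `γ` on `[-1, 1]`: its solution with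
parameters `(T, x)` is `γ u = φ (u T, x)`. -/
theorem exists_contDiffOn_localFlow {n : ℕ} (hn : 1 ≤ n) {f : E → E} (hf : ContDiff ℝ n f)
    (x₀ : E) {ρ : ℝ} (hρ : 0 < ρ) :
    ∃ (φ : ℝ × E → E) (r : ℝ), 0 < r ∧
      (∀ p ∈ Metric.ball ((0 : ℝ), x₀) r, ContDiffAt ℝ n φ p) ∧
      (∀ x ∈ Metric.ball x₀ r, φ (0, x) = x) ∧
      (∀ x ∈ Metric.ball x₀ r, ∀ t, |t| < r → φ (t, x) ∈ Metric.ball x₀ ρ) ∧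
      (∀ x ∈ Metric.ball x₀ r, ∀ t, |t| < r →
        HasDerivAt (fun s => φ (s, x)) (f (φ (t, x))) t) := by
  let fc : C(E, E) := ⟨f, hf.continuous⟩
  let X := C(Icc (-1 : ℝ) 1, E)
  let cst : E →L[ℝ] X := ContinuousLinearMap.const ℝ (Icc (-1 : ℝ) 1)
  let Φ : (ℝ × E) × X → X := fun p => p.2 - cst p.1.2 - p.1.1 • volterra E (fc.comp p.2)
  have hΦ : ContDiff ℝ n Φ := by
    have h1 : ContDiff ℝ n fun p : (ℝ × E) × X => fc.comp p.2 :=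
      (contDiff_postcomp n fc hf).comp contDiff_snd
    have h2 : ContDiff ℝ n fun p : (ℝ × E) × X => volterra E (fc.comp p.2) :=
      (volterra E).contDiff.comp h1
    have h3 : ContDiff ℝ n fun p : (ℝ × E) × X => cst p.1.2 :=
      cst.contDiff.comp (contDiff_snd.comp contDiff_fst)
    have h4 : ContDiff ℝ n fun p : (ℝ × E) × X => p.1.1 := contDiff_fst.comp contDiff_fst
    exact (contDiff_snd.sub h3).sub (h4.smul h2)
  have hn0 : (n : ℕ∞ω) ≠ 0 := by
    have : n ≠ 0 := by omega
    exact_mod_cast this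
  set u₀ : (ℝ × E) × X := ((0, x₀), cst x₀) with hu₀
  -- at `T = 0` the partial derivative of the equation in the curve is the identity
  have hinr : fderiv ℝ Φ u₀ ∘L .inr ℝ (ℝ × E) X = ContinuousLinearMap.id ℝ X := by
    have h1 : HasFDerivAt Φ (fderiv ℝ Φ u₀) u₀ :=
      (hΦ.differentiable hn0 u₀).hasFDerivAt
    have h2 : HasFDerivAt (fun γ : X => Φ ((0, x₀), γ)) (fderiv ℝ Φ u₀ ∘L .inr ℝ (ℝ × E) X)
        (cst x₀) := h1.comp (cst x₀) (hasFDerivAt_prodMk_right (0, x₀) (cst x₀))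
    have h3 : HasFDerivAt (fun γ : X => Φ ((0, x₀), γ)) (ContinuousLinearMap.id ℝ X)
        (cst x₀) := by
      have : (fun γ : X => Φ ((0, x₀), γ)) = fun γ => γ - cst x₀ := by
        funext γ; simp [Φ]
      rw [this]
      exact (hasFDerivAt_id _).sub_const _
    exact h2.unique h3
  have hinv : (fderiv ℝ Φ u₀ ∘L .inr ℝ (ℝ × E) X).IsInvertible := by
    rw [hinr]; exact ⟨ContinuousLinearEquiv.refl ℝ X, rfl⟩
  have hcd : ContDiffAt ℝ n Φ u₀ := hΦ.contDiffAt
  let ψ := hcd.implicitFunction hn0 hinv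
  have hψ : ContDiffAt ℝ n ψ (0, x₀) := hcd.contDiffAt_implicitFunction hn0 hinv
  have hψ0 : ψ (0, x₀) = cst x₀ := hcd.implicitFunction_apply_self hn0 hinv
  have hΦ0 : Φ u₀ = 0 := by simp [Φ, hu₀]
  have hiff : ∀ᶠ v in 𝓝 u₀, Φ v = 0 ↔ ψ v.1 = v.2 := by
    have := hcd.eventually_apply_eq_iff_implicitFunction hn0 hinv
    rwa [hΦ0] at this
  obtain ⟨r₁, hr₁, hball⟩ := Metric.eventually_nhds_iff_ball.1 hiff
  have hev1 : ∀ᶠ p in 𝓝 ((0 : ℝ), x₀), ContDiffAt ℝ n ψ p := hψ.eventually (by simp)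
  have hev2 : ∀ᶠ p in 𝓝 ((0 : ℝ), x₀), ψ p ∈ Metric.ball (cst x₀) (min r₁ ρ) := by
    refine hψ.continuousAt.eventually_mem ?_
    rw [hψ0]
    exact Metric.ball_mem_nhds _ (lt_min hr₁ hρ)
  obtain ⟨r₂, hr₂, hball2⟩ := Metric.eventually_nhds_iff_ball.1 (hev1.and hev2)
  have hmem : ∀ t : ℝ, ∀ x : E, |t| < min r₁ r₂ → x ∈ Metric.ball x₀ (min r₁ r₂) →
      (t, x) ∈ Metric.ball ((0 : ℝ), x₀) (min r₁ r₂) := by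
    intro t x ht hx
    rw [← ball_prod_same]
    exact ⟨by simpa using ht, hx⟩
  have hmin : Metric.ball ((0 : ℝ), x₀) (min r₁ r₂) ⊆ Metric.ball ((0 : ℝ), x₀) r₂ :=
    Metric.ball_subset_ball (min_le_right _ _)
  have hmin1 : Metric.ball ((0 : ℝ), x₀) (min r₁ r₂) ⊆ Metric.ball ((0 : ℝ), x₀) r₁ :=
    Metric.ball_subset_ball (min_le_left _ _)
  have hint : ∀ p ∈ Metric.ball ((0 : ℝ), x₀) (min r₁ r₂), Φ (p, ψ p) = 0 := by
    intro p hp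
    have h1 := (hball2 p (hmin hp)).2
    refine (hball (p, ψ p) ?_).2 rfl
    rw [hu₀, ← ball_prod_same]
    exact ⟨hmin1 hp, Metric.ball_subset_ball (min_le_left _ _) h1⟩
  have hval : ∀ p ∈ Metric.ball ((0 : ℝ), x₀) (min r₁ r₂), ∀ u : Icc (-1 : ℝ) 1,
      ψ p u = p.2 + p.1 • ∫ s in (0 : ℝ)..u, f (IccExtend (by norm_num) (ψ p) s) := by
    intro p hp u
    have h1 := DFunLike.congr_fun (hint p hp) u
    have h2 : ψ p u - p.2 - p.1 • (∫ s in (0 : ℝ)..u, f (IccExtend (by norm_num) (ψ p) s)) = 0 := h1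
    rw [sub_sub, sub_eq_zero] at h2
    exact h2
  have hone : (1 : ℝ) ∈ Icc (-1 : ℝ) 1 := by constructor <;> norm_num
  -- the solutions with smaller time parameter are restrictions, by local uniqueness
  have hscale : ∀ t : ℝ, ∀ x : E, |t| < min r₁ r₂ → x ∈ Metric.ball x₀ (min r₁ r₂) →
      ∀ u : Icc (-1 : ℝ) 1, ψ (u * t, x) ⟨1, hone⟩ = ψ (t, x) u := by
    intro t x ht hx u
    have hu1 : |(u : ℝ)| ≤ 1 := abs_le.2 u.2
    have hut : |(u : ℝ) * t| < min r₁ r₂ := by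
      rw [abs_mul]
      exact lt_of_le_of_lt (mul_le_of_le_one_left (abs_nonneg _) hu1) ht
    have hus : ∀ s : Icc (-1 : ℝ) 1, (u : ℝ) * s ∈ Icc (-1 : ℝ) 1 := fun s => by
      rw [mem_Icc, ← abs_le, abs_mul]
      exact mul_le_one₀ hu1 (abs_nonneg _) (abs_le.2 s.2)
    let γ : X := ⟨fun s => ψ (t, x) ⟨u * s, hus s⟩, by fun_prop⟩
    have hγball : γ ∈ Metric.ball (cst x₀) r₁ := by
      have h1 := (hball2 _ (hmin (hmem t x ht hx))).2
      have h1' : dist (ψ (t, x)) (cst x₀) < r₁ := (Metric.mem_ball.1 h1).trans_le (min_le_left _ _)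
      rw [Metric.mem_ball]
      refine lt_of_le_of_lt ?_ h1'
      rw [ContinuousMap.dist_le dist_nonneg]
      intro s
      exact ContinuousMap.dist_apply_le_dist (f := ψ (t, x)) (g := cst x₀) ⟨u * s, hus s⟩
    have hγ : Φ ((u * t, x), γ) = 0 := by
      ext s
      change γ s - x - ((u : ℝ) * t) •
        (∫ s' in (0 : ℝ)..s, f (IccExtend (by norm_num) γ s')) = 0
      have h1 : γ s = x + t • ∫ s' in (0 : ℝ)..(u * s),
          f (IccExtend (by norm_num) (ψ (t, x)) s') :=
        hval _ (hmem t x ht hx) ⟨u * s, hus s⟩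
      have h2 : (∫ s' in (0 : ℝ)..s, f (IccExtend (by norm_num) γ s')) =
          ∫ s' in (0 : ℝ)..s, f (IccExtend (by norm_num : (-1 : ℝ) ≤ 1) (ψ (t, x)) (u * s')) := by
        refine intervalIntegral.integral_congr fun s' hs' => ?_
        have hs'1 : s' ∈ Icc (-1 : ℝ) 1 := by
          have := (convex_Icc (-1 : ℝ) 1).ordConnected.uIcc_subset
            (show (0 : ℝ) ∈ Icc (-1 : ℝ) 1 by constructor <;> norm_num) s.2
          exact this hs'
        rw [IccExtend_of_mem _ _ hs'1, IccExtend_of_mem _ _ (hus ⟨s', hs'1⟩)]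
        rfl
      have h3 := intervalIntegral.smul_integral_comp_mul_left (a := 0) (b := (s : ℝ))
        (fun s' => f (IccExtend (by norm_num : (-1 : ℝ) ≤ 1) (ψ (t, x)) s')) (u : ℝ)
      rw [mul_zero] at h3
      rw [h1, h2, ← h3, mul_comm (u : ℝ) t, mul_smul, add_sub_cancel_left, sub_self]
    have h2 := (hball ((u * t, x), γ) (by
      rw [hu₀, ← ball_prod_same]
      exact ⟨hmin1 (hmem _ x hut hx), hγball⟩)).1 hγ
    change ψ (u * t, x) = γ at h2
    rw [h2]
    change ψ (t, x) ⟨u * 1, _⟩ = _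
    congr 1
    exact Subtype.ext (mul_one _)
  refine ⟨fun p => ψ p ⟨1, hone⟩, min r₁ r₂, lt_min hr₁ hr₂, ?_, ?_, ?_, ?_⟩
  · intro p hp
    exact (ContinuousMap.evalCLM ℝ (⟨1, hone⟩ : Icc (-1 : ℝ) 1) : X →L[ℝ] E).contDiff.contDiffAt.comp
      p (hball2 p (hmin hp)).1
  · intro x hx
    have := hval (0, x) (hmem 0 x (by simpa using lt_min hr₁ hr₂) hx) ⟨1, hone⟩
    simpa using this
  · intro x hx t ht
    have h1 := (hball2 _ (hmin (hmem t x ht hx))).2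
    exact lt_of_le_of_lt (ContinuousMap.dist_apply_le_dist (f := ψ (t, x)) (g := cst x₀) ⟨1, hone⟩)
      ((Metric.mem_ball.1 h1).trans_le (min_le_right _ _))
  · intro x hx t ht
    -- for `|s| < T`, the curve `s ↦ φ (s, x)` is the solution with time parameter `T`, rescaled
    obtain ⟨T, htT, hTr⟩ := exists_between ht
    have hT : 0 < T := lt_of_le_of_lt (abs_nonneg _) htT
    have hTr' : |T| < min r₁ r₂ := by rwa [abs_of_pos hT]
    have hform : ∀ t', |t'| < T → ψ (t', x) ⟨1, hone⟩ =
        x + T • ∫ s in (0 : ℝ)..(t' / T), f (IccExtend (by norm_num) (ψ (T, x)) s) := by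
      intro t' ht'
      have hmem' : t' / T ∈ Icc (-1 : ℝ) 1 := by
        rw [mem_Icc, ← abs_le, abs_div, abs_of_pos hT]
        exact (div_le_one hT).2 ht'.le
      have h1 := hscale T x hTr' hx ⟨t' / T, hmem'⟩
      simp only [div_mul_cancel₀ _ hT.ne'] at h1
      rw [h1]
      exact hval _ (hmem T x hTr' hx) ⟨t' / T, hmem'⟩
    have hcont : Continuous fun s => f (IccExtend (by norm_num : (-1 : ℝ) ≤ 1) (ψ (T, x)) s) :=
      hf.continuous.comp (ψ (T, x)).continuous.Icc_extend'
    have hval' : f (IccExtend (by norm_num : (-1 : ℝ) ≤ 1) (ψ (T, x)) (t / T)) =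
        f (ψ (t, x) ⟨1, hone⟩) := by
      have hmem' : t / T ∈ Icc (-1 : ℝ) 1 := by
        rw [mem_Icc, ← abs_le, abs_div, abs_of_pos hT]
        exact (div_le_one hT).2 htT.le
      have h1 := hscale T x hTr' hx ⟨t / T, hmem'⟩
      simp only [div_mul_cancel₀ _ hT.ne'] at h1
      rw [h1, IccExtend_of_mem _ _ hmem']
    have hder : HasDerivAt (fun t' => x + T • ∫ s in (0 : ℝ)..(t' / T),
        f (IccExtend (by norm_num : (-1 : ℝ) ≤ 1) (ψ (T, x)) s)) (f (ψ (t, x) ⟨1, hone⟩)) t := by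
      have h1 := intervalIntegral.integral_hasDerivAt_right (hcont.intervalIntegrable 0 (t / T))
        (hcont.stronglyMeasurableAtFilter _ _) hcont.continuousAt
      have h2 := (h1.scomp t ((hasDerivAt_id t).div_const T)).const_smul T
      rw [smul_smul, mul_one_div_cancel hT.ne', one_smul, hval'] at h2
      exact h2.const_add x
    refine hder.congr_of_eventuallyEq ?_
    have ho : IsOpen {t' : ℝ | |t'| < T} := isOpen_lt continuous_abs continuous_const
    filter_upwards [ho.mem_nhds htT] with t' ht'
    exact hform t' ht'

end LocalFlow

/-! ### Differential forms and vector fields read in charts -/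

section Curl

variable {E E' : Type*} [NormedAddCommGroup E] [NormedSpace ℝ E]
  [NormedAddCommGroup E'] [NormedSpace ℝ E']

/-- The exterior derivative of a 1-form on a subset of a vector space, as a bilinear form. -/
def curl (θ : E → E →L[ℝ] ℝ) (S : Set E) (y : E) : E →L[ℝ] E →L[ℝ] ℝ :=
  fderivWithin ℝ θ S y - (fderivWithin ℝ θ S y).flip

theorem curl_apply (θ : E → E →L[ℝ] ℝ) (S : Set E) (y u v : E) :
    curl θ S y u v = fderivWithin ℝ θ S y u v - fderivWithin ℝ θ S y v u := by
  simp [curl]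

theorem curl_antisymm (θ : E → E →L[ℝ] ℝ) (S : Set E) (y u v : E) :
    curl θ S y u v = - curl θ S y v u := by
  simp [curl]

theorem curl_congr {θ θ' : E → E →L[ℝ] ℝ} {S : Set E} {y : E} (h : θ =ᶠ[𝓝[S] y] θ')
    (hy : y ∈ S) : curl θ S y = curl θ' S y := by
  rw [curl, curl, h.fderivWithin_eq (h.self_of_nhdsWithin hy)]

/-- The exterior derivative commutes with pullbacks. -/
theorem curl_pullback {θ : E' → E' →L[ℝ] ℝ} {τ : E → E'} {S : Set E} {S' : Set E'} {y : E}
    (hS : UniqueDiffOn ℝ S) (hyS : y ∈ S) (hy : y ∈ closure (interior S))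
    (hτ : ContDiffWithinAt ℝ 2 τ S y) (hmaps : ∀ᶠ z in 𝓝[S] y, τ z ∈ S')
    (hθ : DifferentiableWithinAt ℝ θ S' (τ y)) (u v : E) :
    curl (fun z => (θ (τ z)).comp (fderivWithin ℝ τ S z)) S y u v =
      curl θ S' (τ y) (fderivWithin ℝ τ S y u) (fderivWithin ℝ τ S y v) := by
  have hτ1 : HasFDerivWithinAt τ (fderivWithin ℝ τ S y) S y :=
    (hτ.differentiableWithinAt two_ne_zero).hasFDerivWithinAt
  have hten : Tendsto τ (𝓝[S] y) (𝓝[S'] (τ y)) :=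
    tendsto_nhdsWithin_iff.2 ⟨hτ.continuousWithinAt, hmaps⟩
  have h1 : HasFDerivWithinAt (fun z => θ (τ z))
      ((fderivWithin ℝ θ S' (τ y)).comp (fderivWithin ℝ τ S y)) S y :=
    hθ.hasFDerivWithinAt.comp_of_tendsto y hτ1 hten
  have h2 : HasFDerivWithinAt (fderivWithin ℝ τ S)
      (fderivWithin ℝ (fderivWithin ℝ τ S) S y) S y :=
    ((hτ.fderivWithin_right (m := 1) hS (by norm_num) hyS).differentiableWithinAt
      one_ne_zero).hasFDerivWithinAt
  have h3 := (h1.clm_comp h2).fderivWithin (hS y hyS)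
  have hsym := hτ.isSymmSndFDerivWithinAt (by simp) hS hy hyS
  rw [curl_apply, curl_apply, h3]
  have := hsym u v
  simp only [ContinuousLinearMap.comp_apply, add_apply,
    ContinuousLinearMap.compL_apply, ContinuousLinearMap.flip_apply]
  rw [this]
  ring

end Curl

section Charts

variable {E H : Type*} [NormedAddCommGroup E] [NormedSpace ℝ E] [TopologicalSpace H]
  (I : ModelWithCorners ℝ E H) {M : Type*} [TopologicalSpace M] [ChartedSpace H M]

/-- The differential at `q` of a function with values in a normed space. -/
def fnD {G : Type*} [NormedAddCommGroup G] [NormedSpace ℝ G] (f : M → G) (q : M) :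
    TangentSpace I q →L[ℝ] G :=
  mfderiv I 𝓘(ℝ, G) f q

/-- The differential at `q` of the preferred chart at `p`. -/
def chartD (p q : M) : TangentSpace I q →L[ℝ] E :=
  mfderiv I 𝓘(ℝ, E) (extChartAt I p) q

/-- The differential of the inverse of the preferred chart at `p`, at the image of `q`. -/
def chartDInv (p q : M) : E →L[ℝ] TangentSpace I q :=
  (mfderivWithin 𝓘(ℝ, E) I (extChartAt I p).symm (range I) (extChartAt I p q) :)

/-- A vector field read in the preferred chart at `p`. -/
def chartField (V : ∀ p : M, TangentSpace I p) (p : M) (y : E) : E :=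
  chartD I p ((extChartAt I p).symm y) (V ((extChartAt I p).symm y))

variable {I}

section
variable [IsManifold I 1 M]

theorem chartD_chartDInv {p q : M} (hq : q ∈ (chartAt H p).source) (v : E) :
    chartD I p q (chartDInv I p q v) = v := by
  have h := mfderiv_extChartAt_comp_mfderivWithin_extChartAt_symm' (I := I) (x := p) (y := q)
    (by simpa using hq)
  exact DFunLike.congr_fun h v

theorem chartDInv_chartD {p q : M} (hq : q ∈ (chartAt H p).source) (v : TangentSpace I q) :
    chartDInv I p q (chartD I p q v) = v := by
  have h := mfderivWithin_extChartAt_symm_comp_mfderiv_extChartAt' (I := I) (x := p) (y := q)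
    (by simpa using hq)
  exact DFunLike.congr_fun h v

theorem chartD_self (p : M) (v : TangentSpace I p) : chartD I p p v = (v : E) := by
  have h := mfderiv_extChartAt_self (I := I) (x := p)
  exact DFunLike.congr_fun h v

omit [IsManifold I 1 M] in
theorem inChart_extChartAt (θ : OneForm I M) {p q : M} (hq : q ∈ (chartAt H p).source) :
    OneForm.inChart I θ p (extChartAt I p q) = (θ q).comp (chartDInv I p q) := by
  have h : (extChartAt I p).symm (extChartAt I p q) = q := (extChartAt I p).left_inv (by simpa using hq)
  unfold OneForm.inChart chartDInv
  rw [h]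

theorem OneForm.apply_eq_inChart (θ : OneForm I M) {p q : M} (hq : q ∈ (chartAt H p).source)
    (u : TangentSpace I q) :
    θ q u = OneForm.inChart I θ p (extChartAt I p q) (chartD I p q u) := by
  rw [inChart_extChartAt θ hq, ContinuousLinearMap.comp_apply, chartDInv_chartD hq]

theorem coordField_eq {p q : M} (hq : q ∈ (chartAt H p).source) (v : E) :
    coordField I p v q = chartDInv I p q v := by
  have h := TangentBundle.symmL_trivializationAt (I := I) (x₀ := p) (x := q) hq
  have h2 := DFunLike.congr_fun h v
  rwa [Trivialization.symmL_apply _ (by simpa using hq)] at h2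

omit [IsManifold I 1 M] in
theorem chartField_extChartAt (V : ∀ p : M, TangentSpace I p) {p q : M}
    (hq : q ∈ (chartAt H p).source) :
    chartField I V p (extChartAt I p q) = chartD I p q (V q) := by
  have h : (extChartAt I p).symm (extChartAt I p q) = q := (extChartAt I p).left_inv (by simpa using hq)
  unfold chartField
  rw [h]

end

variable [IsManifold I ∞ M]

/-- Smoothness near `q` can be tested in the preferred chart at any `p` whose domain
contains `q`. -/
theorem contMDiffAt_iff_comp_symm {G : Type*} [NormedAddCommGroup G] [NormedSpace ℝ G] {n : ℕ∞}
    {f : M → G} {p q : M} (hq : q ∈ (chartAt H p).source) :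
    ContMDiffAt I 𝓘(ℝ, G) n f q ↔
      ContDiffWithinAt ℝ n (fun y => f ((extChartAt I p).symm y)) (range I) (extChartAt I p q) := by
  have : IsManifold I n M := .of_le (n := ∞) (by exact_mod_cast le_top)
  rw [contMDiffAt_iff_source_of_mem_source (x := p) hq, contMDiffWithinAt_iff_contDiffWithinAt]
  rfl

theorem ContMDiffAt.contDiffWithinAt_comp_symm {G : Type*} [NormedAddCommGroup G]
    [NormedSpace ℝ G] {n : ℕ∞} {f : M → G} {p q : M} (hf : ContMDiffAt I 𝓘(ℝ, G) n f q)
    (hq : q ∈ (chartAt H p).source) :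
    ContDiffWithinAt ℝ n (fun y => f ((extChartAt I p).symm y)) (range I) (extChartAt I p q) :=
  (contMDiffAt_iff_comp_symm hq).1 hf

omit [IsManifold I ∞ M] in
theorem eventually_nhdsWithin_range_extChartAt {p q : M} (hq : q ∈ (chartAt H p).source)
    {P : M → Prop} (h : ∀ᶠ z in 𝓝 q, P z) :
    ∀ᶠ y in 𝓝[range I] (extChartAt I p q),
      y ∈ (extChartAt I p).target ∧ (extChartAt I p).symm y ∈ (chartAt H p).source ∧
        P ((extChartAt I p).symm y) := by
  have hq' : q ∈ (extChartAt I p).source := by simpa using hq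
  have h1 : (extChartAt I p).target ∈ 𝓝[range I] (extChartAt I p q) :=
    extChartAt_target_mem_nhdsWithin' hq'
  have hc : Tendsto (extChartAt I p).symm (𝓝[range I] (extChartAt I p q)) (𝓝 q) := by
    have := (continuousAt_extChartAt_symm' (I := I) hq').tendsto
    rw [(extChartAt I p).left_inv hq'] at this
    exact this.mono_left nhdsWithin_le_nhds
  filter_upwards [h1, hc.eventually h] with y hy hP
  refine ⟨hy, ?_, hP⟩
  have := (extChartAt I p).map_target hy
  simpa using this

omit [IsManifold I ∞ M] in
theorem eventually_nhds_of_nhdsWithin_range {p q : M} (hq : q ∈ (chartAt H p).source)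
    {P : E → Prop} (h : ∀ᶠ y in 𝓝[range I] (extChartAt I p q), P y) :
    ∀ᶠ z in 𝓝 q, z ∈ (chartAt H p).source ∧ P (extChartAt I p z) := by
  have hq' : q ∈ (extChartAt I p).source := by simpa using hq
  have hc : Tendsto (extChartAt I p) (𝓝 q) (𝓝[range I] (extChartAt I p q)) :=
    tendsto_nhdsWithin_iff.2 ⟨(continuousAt_extChartAt' hq').tendsto,
      Eventually.of_forall fun z => by simp [extChartAt]⟩
  filter_upwards [hc.eventually h, (chartAt H p).open_source.mem_nhds hq] with z hz hz'
  exact ⟨hz', hz⟩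

end Charts

section Pullback

variable {E H : Type*} [NormedAddCommGroup E] [NormedSpace ℝ E] [TopologicalSpace H]
  {I : ModelWithCorners ℝ E H} {M : Type*} [TopologicalSpace M] [ChartedSpace H M]
  [IsManifold I ∞ M]
  {E' H' : Type*} [NormedAddCommGroup E'] [NormedSpace ℝ E'] [TopologicalSpace H']
  {J : ModelWithCorners ℝ E' H'} {N : Type*} [TopologicalSpace N] [ChartedSpace H' N]
  [IsManifold J ∞ N]

/-- A map between manifolds read in the preferred charts at `p` and `p'`. -/
def chartMap (I : ModelWithCorners ℝ E H) (J : ModelWithCorners ℝ E' H') (f : M → N) (p : M)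
    (p' : N) (y : E) : E' :=
  extChartAt J p' (f ((extChartAt I p).symm y))

theorem contDiffWithinAt_chartMap {n : ℕ∞} {f : M → N} {p q : M} {p' : N}
    (hf : ContMDiffAt I J n f q) (hq : q ∈ (chartAt H p).source)
    (hfq : f q ∈ (chartAt H' p').source) :
    ContDiffWithinAt ℝ n (chartMap I J f p p') (range I) (extChartAt I p q) := by
  have : IsManifold J n N := .of_le (n := ∞) (by exact_mod_cast le_top)
  have h : ContMDiffAt I 𝓘(ℝ, E') n (fun z => extChartAt J p' (f z)) q :=
    (contMDiffAt_extChartAt' hfq).comp q hf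
  exact h.contDiffWithinAt_comp_symm hq

theorem fderivWithin_chartMap {f : M → N} {p q : M} {p' : N}
    (hf : MDifferentiableAt I J f q) (hq : q ∈ (chartAt H p).source)
    (hfq : f q ∈ (chartAt H' p').source) (u : E) :
    fderivWithin ℝ (chartMap I J f p p') (range I) (extChartAt I p q) u =
      chartD J p' (f q) (mfderiv I J f q (chartDInv I p q u)) := by
  have hq' : q ∈ (extChartAt I p).source := by simpa using hq
  have hinv : (extChartAt I p).symm (extChartAt I p q) = q := (extChartAt I p).left_inv hq'
  have hg : MDifferentiableAt I 𝓘(ℝ, E') (fun z => extChartAt J p' (f z)) q :=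
    (mdifferentiableAt_extChartAt hfq).comp q hf
  have h1 : mfderiv I 𝓘(ℝ, E') (fun z => extChartAt J p' (f z)) q =
      (mfderiv J 𝓘(ℝ, E') (extChartAt J p') (f q)).comp (mfderiv I J f q) :=
    mfderiv_comp q (mdifferentiableAt_extChartAt hfq) hf
  have hs : MDifferentiableWithinAt 𝓘(ℝ, E) I (extChartAt I p).symm (range I)
      (extChartAt I p q) :=
    mdifferentiableWithinAt_extChartAt_symm ((extChartAt I p).map_source hq')
  have hu : UniqueMDiffWithinAt 𝓘(ℝ, E) (range I) (extChartAt I p q) :=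
    (I.uniqueDiffOn _ (by simp [extChartAt])).uniqueMDiffWithinAt
  have h2 := mfderiv_comp_mfderivWithin_of_eq (x := extChartAt I p q) hg hs hu hinv
  rw [mfderivWithin_eq_fderivWithin] at h2
  have h3 : ((fun z => extChartAt J p' (f z)) ∘ (extChartAt I p).symm) = chartMap I J f p p' := rfl
  rw [h3, h1] at h2
  exact DFunLike.congr_fun h2 u


/-- A 1-form which, near `q`, has `C^n` coefficients in the preferred chart at `q`. -/
def OneForm.SmoothAt (I : ModelWithCorners ℝ E H) (θ : OneForm I M) (n : ℕ∞) (q : M) : Prop :=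
  ContDiffWithinAt ℝ n (OneForm.inChart I θ q) (range I) (extChartAt I q q)

theorem ContMDiffAt.eventually_natCast {f : M → N} {q : M} {n : ℕ}
    (hf : ContMDiffAt I J n f q) : ∀ᶠ z in 𝓝 q, ContMDiffAt I J n f z := by
  have : IsManifold I (n : ℕ∞ω) M := .of_le (n := ∞) (by exact_mod_cast le_top)
  have : IsManifold J (n : ℕ∞ω) N := .of_le (n := ∞) (by exact_mod_cast le_top)
  exact (contMDiffAt_iff_contMDiffAt_nhds (by simp)).1 hf

/-- In charts, the pullback of a 1-form by `f` is its pullback by `f` read in these charts. -/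
theorem inChart_pullback {f : M → N} {p q : M} {p' : N} {θ : OneForm J N} {η : OneForm I M}
    (hf : ContMDiffAt I J 1 f q) (hq : q ∈ (chartAt H p).source)
    (hfq : f q ∈ (chartAt H' p').source)
    (hη : ∀ᶠ z in 𝓝 q, η z = (θ (f z)).comp (mfderiv I J f z)) :
    OneForm.inChart I η p =ᶠ[𝓝[range I] (extChartAt I p q)] fun y =>
      (OneForm.inChart J θ p' (chartMap I J f p p' y)).comp
        (fderivWithin ℝ (chartMap I J f p p') (range I) y) := by
  have h1 := eventually_nhdsWithin_range_extChartAt (I := I) hq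
    ((hη.and (ContMDiffAt.eventually_natCast (I := I) (J := J) (f := f) (n := 1)
      (by exact_mod_cast hf))).and
      (hf.continuousAt.eventually ((chartAt H' p').open_source.mem_nhds hfq)))
  filter_upwards [h1] with y hy
  obtain ⟨hyt, hys, ⟨hy1, hy2⟩, hy3⟩ := hy
  have hy4 : MDifferentiableAt I J f ((extChartAt I p).symm y) :=
    hy2.mdifferentiableAt (by simp)
  obtain ⟨z, rfl⟩ : ∃ z, z = (extChartAt I p).symm y := ⟨_, rfl⟩
  have hyz : extChartAt I p ((extChartAt I p).symm y) = y := (extChartAt I p).right_inv hyt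
  ext u
  have h2 := fderivWithin_chartMap hy4 hys hy3 u
  have h3 := inChart_extChartAt η hys
  rw [hyz] at h2 h3
  rw [h3, ContinuousLinearMap.comp_apply, ContinuousLinearMap.comp_apply, h2, hy1,
    ContinuousLinearMap.comp_apply]
  exact OneForm.apply_eq_inChart θ hy3 _

theorem contDiffWithinAt_inChart_pullback {f : M → N} {p q : M} {p' : N} {θ : OneForm J N}
    {η : OneForm I M} {n : ℕ∞} (hf : ContMDiffAt I J (n + 1) f q) (hq : q ∈ (chartAt H p).source)
    (hfq : f q ∈ (chartAt H' p').source)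
    (hη : ∀ᶠ z in 𝓝 q, η z = (θ (f z)).comp (mfderiv I J f z))
    (hθ : ContDiffWithinAt ℝ n (OneForm.inChart J θ p') (range J) (extChartAt J p' (f q))) :
    ContDiffWithinAt ℝ n (OneForm.inChart I η p) (range I) (extChartAt I p q) := by
  have hmem : extChartAt I p q ∈ range I := by simp [extChartAt]
  refine ContDiffWithinAt.congr_of_eventuallyEq_of_mem ?_
    (inChart_pullback (hf.of_le (by simp)) hq hfq hη) hmem
  have h0 : ContDiffWithinAt ℝ ((n + 1 : ℕ∞) : ℕ∞ω) (chartMap I J f p p') (range I)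
      (extChartAt I p q) := contDiffWithinAt_chartMap (by exact_mod_cast hf) hq hfq
  have hval : chartMap I J f p p' (extChartAt I p q) = extChartAt J p' (f q) := by
    unfold chartMap
    rw [(extChartAt I p).left_inv (by simpa using hq)]
  refine ContDiffWithinAt.clm_comp ?_ (h0.fderivWithin_right I.uniqueDiffOn (by simp) hmem)
  refine ContDiffWithinAt.comp (t := range J) _ (by rwa [hval]) (h0.of_le (by simp)) ?_
  intro y _
  simp [chartMap, extChartAt]

/-- Smoothness of a 1-form near `q` can be tested in any chart. -/
theorem OneForm.SmoothAt.contDiffWithinAt {θ : OneForm I M} {n : ℕ∞} {p q : M}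
    (h : OneForm.SmoothAt I θ n q) (hq : q ∈ (chartAt H p).source) :
    ContDiffWithinAt ℝ n (OneForm.inChart I θ p) (range I) (extChartAt I p q) :=
  contDiffWithinAt_inChart_pullback (f := id) (p' := q)
    (contMDiffAt_id.of_le (m := (n + 1 : ℕ∞ω)) le_top) hq (mem_chart_source H q)
    (Eventually.of_forall fun z => by
      ext u
      rw [mfderiv_id]
      rfl) h

theorem OneForm.smoothAt_pullback {f : M → N} {q : M} {θ : OneForm J N}
    {η : OneForm I M} {n : ℕ∞} (hf : ContMDiffAt I J (n + 1) f q)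
    (hη : ∀ᶠ z in 𝓝 q, η z = (θ (f z)).comp (mfderiv I J f z))
    (hθ : OneForm.SmoothAt J θ n (f q)) : OneForm.SmoothAt I η n q :=
  contDiffWithinAt_inChart_pullback hf (mem_chart_source H q) (mem_chart_source H' _) hη hθ

theorem OneForm.d_eq_curl_self (θ : OneForm I M) (q : M) (u v : TangentSpace I q) :
    OneForm.d I θ q u v = curl (OneForm.inChart I θ q) (range I) (extChartAt I q q)
      (chartD I q q u) (chartD I q q v) := by
  rw [chartD_self, chartD_self]
  exact (curl_apply (OneForm.inChart I θ q) (range I) (extChartAt I q q) u v).symm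

theorem curl_inChart_pullback {f : M → N} {p q : M} {p' : N} {θ : OneForm J N} {η : OneForm I M}
    (hf : ContMDiffAt I J 2 f q) (hq : q ∈ (chartAt H p).source)
    (hfq : f q ∈ (chartAt H' p').source)
    (hη : ∀ᶠ z in 𝓝 q, η z = (θ (f z)).comp (mfderiv I J f z))
    (hθ : ContDiffWithinAt ℝ 1 (OneForm.inChart J θ p') (range J) (extChartAt J p' (f q)))
    (u v : E) :
    curl (OneForm.inChart I η p) (range I) (extChartAt I p q) u v =
      curl (OneForm.inChart J θ p') (range J) (extChartAt J p' (f q))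
        (chartD J p' (f q) (mfderiv I J f q (chartDInv I p q u)))
        (chartD J p' (f q) (mfderiv I J f q (chartDInv I p q v))) := by
  have hmem : extChartAt I p q ∈ range I := by simp [extChartAt]
  have hval : chartMap I J f p p' (extChartAt I p q) = extChartAt J p' (f q) := by
    unfold chartMap
    rw [(extChartAt I p).left_inv (by simpa using hq)]
  have hd : MDifferentiableAt I J f q := hf.mdifferentiableAt (by simp)
  have h0 : ContDiffWithinAt ℝ 2 (chartMap I J f p p') (range I)
      (extChartAt I p q) := contDiffWithinAt_chartMap (n := 2) hf hq hfq
  rw [curl_congr (inChart_pullback (hf.of_le (by norm_num)) hq hfq hη) hmem,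
    curl_pullback (S' := range J) I.uniqueDiffOn hmem (I.range_subset_closure_interior hmem) h0
      (Eventually.of_forall fun y => by simp [chartMap, extChartAt])
      (by rw [hval]; exact hθ.differentiableWithinAt one_ne_zero), hval,
    fderivWithin_chartMap hd hq hfq, fderivWithin_chartMap hd hq hfq]

/-- The exterior derivative can be computed in any chart. -/
theorem OneForm.d_eq_curl {θ : OneForm I M} {p q : M} (h : OneForm.SmoothAt I θ 1 q)
    (hq : q ∈ (chartAt H p).source) (u v : TangentSpace I q) :
    OneForm.d I θ q u v = curl (OneForm.inChart I θ p) (range I) (extChartAt I p q)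
      (chartD I p q u) (chartD I p q v) := by
  have h1 := curl_inChart_pullback (I := I) (J := I) (f := id) (p := p) (q := q) (p' := q) (θ := θ)
    (η := θ) contMDiffAt_id hq (mem_chart_source H q)
    (Eventually.of_forall fun z => by
      ext u
      rw [mfderiv_id]
      rfl) h (chartD I p q u) (chartD I p q v)
  rw [h1, chartDInv_chartD hq, chartDInv_chartD hq, OneForm.d_eq_curl_self, mfderiv_id]
  simp only [id]
  rw [ContinuousLinearMap.id_apply, ContinuousLinearMap.id_apply]

/-- The exterior derivative commutes with pullbacks. -/
theorem OneForm.d_pullback {f : M → N} {q : M} {θ : OneForm J N} {η : OneForm I M}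
    (hf : ContMDiffAt I J 2 f q)
    (hη : ∀ᶠ z in 𝓝 q, η z = (θ (f z)).comp (mfderiv I J f z))
    (hθ : OneForm.SmoothAt J θ 1 (f q)) (u v : TangentSpace I q) :
    OneForm.d I η q u v = OneForm.d J θ (f q) (mfderiv I J f q u) (mfderiv I J f q v) := by
  have hη1 : OneForm.SmoothAt I η 1 q :=
    OneForm.smoothAt_pullback (n := 1) (by exact_mod_cast hf) hη hθ
  rw [OneForm.d_eq_curl hη1 (mem_chart_source H q),
    curl_inChart_pullback hf (mem_chart_source H q) (mem_chart_source H' (f q)) hη hθ,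
    chartDInv_chartD (mem_chart_source H q), chartDInv_chartD (mem_chart_source H q),
    OneForm.d_eq_curl hθ (mem_chart_source H' _)]

theorem OneForm.IsSmooth.smoothAt {θ : OneForm I M} (h : OneForm.IsSmooth I θ) (q : M) :
    OneForm.SmoothAt I θ ⊤ q := by
  have h1 := (contMDiffAt_hom_bundle _).1 (h q)
  have h2 := (h1.2).contDiffWithinAt_comp_symm (n := ⊤) (mem_chart_source H q)
  have hmem : extChartAt I q q ∈ range I := by simp [extChartAt]
  refine ContDiffWithinAt.congr_of_eventuallyEq_of_mem h2 ?_ hmem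
  filter_upwards [eventually_nhdsWithin_range_extChartAt (mem_chart_source H q)
    (Eventually.of_forall (fun _ => trivial))] with y hy
  obtain ⟨hyt, hys, -⟩ := hy
  have hyz : extChartAt I q ((extChartAt I q).symm y) = y := (extChartAt I q).right_inv hyt
  have h3 := inChart_extChartAt θ hys
  rw [hyz] at h3
  rw [h3]
  ext v
  have h4 := TangentBundle.symmL_trivializationAt (I := I) hys
  have h5 := DFunLike.congr_fun h4 v
  simp only [ContinuousLinearMap.inCoordinates, ContinuousLinearMap.comp_apply, h4]
  simp [chartDInv]
  rfl

theorem contDiffWithinAt_chartField {V : ∀ p : M, TangentSpace I p} {n : ℕ∞} {p q : M}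
    (hV : ContMDiffAt I I.tangent n (fun p => (⟨p, V p⟩ : TangentBundle I M)) q)
    (hq : q ∈ (chartAt H p).source) :
    ContDiffWithinAt ℝ n (chartField I V p) (range I) (extChartAt I p q) := by
  have h1 := ((trivializationAt E (TangentSpace I : M → Type _) p).contMDiffAt_iff
    (IM := I) (IB := I) (n := n) (f := fun p => (⟨p, V p⟩ : TangentBundle I M)) (x₀ := q)
    (by simpa [Trivialization.mem_source] using hq)).1 hV
  have h2 := (h1.2).contDiffWithinAt_comp_symm hq
  have hmem : extChartAt I p q ∈ range I := by simp [extChartAt]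
  refine ContDiffWithinAt.congr_of_eventuallyEq_of_mem h2 ?_ hmem
  filter_upwards [eventually_nhdsWithin_range_extChartAt hq
    (Eventually.of_forall (fun _ => trivial))] with y hy
  obtain ⟨hyt, hys, -⟩ := hy
  have h4 := TangentBundle.continuousLinearMapAt_trivializationAt (I := I) hys
  have h5 := DFunLike.congr_fun h4 (V ((extChartAt I p).symm y))
  rw [Trivialization.continuousLinearMapAt_apply, Trivialization.linearMapAt_apply,
    if_pos (by simpa using hys)] at h5
  exact h5.symm

end Pullback

section FormsAlongCurves

variable {E H : Type*} [NormedAddCommGroup E] [NormedSpace ℝ E] [TopologicalSpace H]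
  {I : ModelWithCorners ℝ E H} {M : Type*} [TopologicalSpace M] [ChartedSpace H M]
  [IsManifold I ∞ M]

omit [IsManifold I ∞ M] in
theorem extChartAt_mem_range (p q : M) : extChartAt I p q ∈ range I := by
  simp [extChartAt]

theorem fderivWithin_comp_symm {G : Type*} [NormedAddCommGroup G] [NormedSpace ℝ G] {f : M → G}
    {p q : M} (hf : MDifferentiableAt I 𝓘(ℝ, G) f q) (hq : q ∈ (chartAt H p).source) (u : E) :
    fderivWithin ℝ (fun y => f ((extChartAt I p).symm y)) (range I) (extChartAt I p q) u =
      fnD I f q (chartDInv I p q u) := by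
  have hq' : q ∈ (extChartAt I p).source := by simpa using hq
  have hinv : (extChartAt I p).symm (extChartAt I p q) = q := (extChartAt I p).left_inv hq'
  have hs : MDifferentiableWithinAt 𝓘(ℝ, E) I (extChartAt I p).symm (range I)
      (extChartAt I p q) :=
    mdifferentiableWithinAt_extChartAt_symm ((extChartAt I p).map_source hq')
  have hu : UniqueMDiffWithinAt 𝓘(ℝ, E) (range I) (extChartAt I p q) :=
    (I.uniqueDiffOn _ (by simp [extChartAt])).uniqueMDiffWithinAt
  have h2 := mfderiv_comp_mfderivWithin_of_eq (x := extChartAt I p q) hf hs hu hinv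
  rw [mfderivWithin_eq_fderivWithin] at h2
  exact DFunLike.congr_fun h2 u

theorem chartDInv_self (p : M) (v : E) : (chartDInv I p p v : E) = v :=
  (chartD_self p (chartDInv I p p v)).symm.trans (chartD_chartDInv (mem_chart_source H p) v)

omit [IsManifold I ∞ M] in
theorem inChart_smul {s : M → ℝ} {η lam : OneForm I M} {p q : M}
    (hq : q ∈ (chartAt H p).source) (h : ∀ᶠ z in 𝓝 q, lam z = s z • η z) :
    OneForm.inChart I lam p =ᶠ[𝓝[range I] (extChartAt I p q)]
      fun y => s ((extChartAt I p).symm y) • OneForm.inChart I η p y := by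
  filter_upwards [eventually_nhdsWithin_range_extChartAt hq h] with y hy
  rw [OneForm.inChart, hy.2.2, OneForm.inChart]
  rfl

/-- The Leibniz rule `d(s η) = ds ∧ η + s dη`. -/
theorem OneForm.d_smul {s : M → ℝ} {η lam : OneForm I M} {p : M}
    (hs : MDifferentiableAt I 𝓘(ℝ, ℝ) s p) (hη : OneForm.SmoothAt I η 1 p)
    (h : ∀ᶠ z in 𝓝 p, lam z = s z • η z) (u v : TangentSpace I p) :
    OneForm.d I lam p u v =
      fnD I s p u * η p v - fnD I s p v * η p u
        + s p * OneForm.d I η p u v := by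
  have hmem := extChartAt_mem_range (I := I) p p
  have hinv : (extChartAt I p).symm (extChartAt I p p) = p := extChartAt_to_inv p
  rw [OneForm.d_eq_curl_self, OneForm.d_eq_curl_self, curl_congr
    (inChart_smul (mem_chart_source H p) h) hmem]
  have h1 : DifferentiableWithinAt ℝ (fun y => s ((extChartAt I p).symm y)) (range I)
      (extChartAt I p p) := by
    exact ((mdifferentiableAt_iff s p).1 hs).2
  have h2 : DifferentiableWithinAt ℝ (OneForm.inChart I η p) (range I) (extChartAt I p p) :=
    hη.differentiableWithinAt one_ne_zero
  have h3 := (h1.hasFDerivWithinAt.fun_smul h2.hasFDerivWithinAt).fderivWithin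
    (I.uniqueDiffOn _ hmem)
  have h4 : ∀ u : TangentSpace I p, fderivWithin ℝ (fun y => s ((extChartAt I p).symm y)) (range I)
      (extChartAt I p p) (chartD I p p u) = fnD I s p u := fun u => by
    have := fderivWithin_comp_symm hs (mem_chart_source H p) (chartD I p p u)
    rwa [chartDInv_chartD (mem_chart_source H p)] at this
  have key : ∀ u v : E, curl (fun y => s ((extChartAt I p).symm y) • OneForm.inChart I η p y)
      (range I) (extChartAt I p p) u v =
      fderivWithin ℝ (fun y => s ((extChartAt I p).symm y)) (range I) (extChartAt I p p) u *
          OneForm.inChart I η p (extChartAt I p p) v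
        - fderivWithin ℝ (fun y => s ((extChartAt I p).symm y)) (range I) (extChartAt I p p) v *
          OneForm.inChart I η p (extChartAt I p p) u
        + s p * curl (OneForm.inChart I η p) (range I) (extChartAt I p p) u v := by
    intro u v
    rw [curl_apply, curl_apply, h3, hinv]
    simp only [add_apply, smul_apply, ContinuousLinearMap.smulRight_apply, smul_eq_mul]
    ring
  rw [key, h4, h4, OneForm.apply_eq_inChart η (mem_chart_source H p),
    OneForm.apply_eq_inChart η (mem_chart_source H p)]

/-- Cartan's formula in a chart: if `θ(V) = 0` and `dθ (V, ·) = f θ`, then the Lie derivative of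
`θ` along `V` is `f θ`. -/
theorem fderivWithin_inChart_chartField {θ : OneForm I M} {V : ∀ p : M, TangentSpace I p} {f : ℝ}
    {p q : M} (hq : q ∈ (chartAt H p).source) (hθ : OneForm.SmoothAt I θ 1 q)
    (hV : ContMDiffAt I I.tangent 1 (fun p => (⟨p, V p⟩ : TangentBundle I M)) q)
    (h0 : ∀ᶠ z in 𝓝 q, θ z (V z) = 0)
    (hd : ∀ w : TangentSpace I q, OneForm.d I θ q (V q) w = f * θ q w) :
    fderivWithin ℝ (OneForm.inChart I θ p) (range I) (extChartAt I p q)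
        (chartField I V p (extChartAt I p q)) =
      f • OneForm.inChart I θ p (extChartAt I p q) -
        (OneForm.inChart I θ p (extChartAt I p q)).comp
          (fderivWithin ℝ (chartField I V p) (range I) (extChartAt I p q)) := by
  have hmem := extChartAt_mem_range (I := I) p q
  have h1 : HasFDerivWithinAt (OneForm.inChart I θ p) _ (range I) (extChartAt I p q) :=
    ((hθ.contDiffWithinAt hq).differentiableWithinAt one_ne_zero).hasFDerivWithinAt
  have h2 : HasFDerivWithinAt (chartField I V p) _ (range I) (extChartAt I p q) :=
    ((contDiffWithinAt_chartField (n := 1) hV hq).differentiableWithinAt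
      one_ne_zero).hasFDerivWithinAt
  have h3 : (fun y => OneForm.inChart I θ p y (chartField I V p y))
      =ᶠ[𝓝[range I] (extChartAt I p q)] fun _ => (0 : ℝ) := by
    filter_upwards [eventually_nhdsWithin_range_extChartAt (I := I) hq h0] with y hy
    obtain ⟨hyt, hys, hy0⟩ := hy
    have hyz : extChartAt I p ((extChartAt I p).symm y) = y := (extChartAt I p).right_inv hyt
    rw [OneForm.apply_eq_inChart θ hys, ← chartField_extChartAt V hys, hyz] at hy0
    exact hy0
  have h4 := (h1.clm_apply h2).fderivWithin (I.uniqueDiffOn _ hmem)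
  rw [h3.fderivWithin_eq (h3.self_of_nhdsWithin hmem), fderivWithin_const_apply] at h4
  ext w
  have h5 := DFunLike.congr_fun h4 w
  have h6 := hd (chartDInv I p q w)
  rw [OneForm.d_eq_curl hθ hq, chartD_chartDInv hq, ← chartField_extChartAt V hq, curl_apply,
    OneForm.apply_eq_inChart θ hq, chartD_chartDInv hq] at h6
  simp only [zero_apply, add_apply, ContinuousLinearMap.comp_apply,
    ContinuousLinearMap.flip_apply, sub_apply, smul_apply, smul_eq_mul] at h5 ⊢
  linarith

theorem IsMIntegralCurveOn.hasDerivWithinAt_extChartAt {γ : ℝ → M}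
    {V : ∀ p : M, TangentSpace I p} {s : Set ℝ} (hγ : IsMIntegralCurveOn (I := I) γ V s) {t : ℝ} (ht : t ∈ s)
    {p : M} (hp : γ t ∈ (chartAt H p).source) :
    HasDerivWithinAt (fun t => extChartAt I p (γ t)) (chartField I V p (extChartAt I p (γ t))) s t := by
  have h1 := (mdifferentiableAt_extChartAt (I := I) hp).hasMFDerivAt.comp_hasMFDerivWithinAt t
    (hγ t ht)
  have h2 : HasFDerivWithinAt (fun t => extChartAt I p (γ t))
      ((chartD I p (γ t)).comp ((1 : ℝ →L[ℝ] ℝ).smulRight (V (γ t))) : ℝ →L[ℝ] E) s t :=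
    hasMFDerivWithinAt_iff_hasFDerivWithinAt.1 h1
  refine h2.hasDerivWithinAt.congr_deriv ?_
  rw [chartField_extChartAt V hp]
  change chartD I p (γ t) ((1 : ℝ) • V (γ t)) = _
  rw [one_smul]

theorem isMIntegralCurveOn_extChartAt_symm {σ : ℝ → E}
    {V : ∀ p : M, TangentSpace I p} {s : Set ℝ} {p : M}
    (hσ : ∀ t ∈ s, σ t ∈ (extChartAt I p).target)
    (h : ∀ t ∈ s, HasDerivWithinAt σ (chartField I V p (σ t)) s t) :
    IsMIntegralCurveOn (I := I) (fun t => (extChartAt I p).symm (σ t)) V s := by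
  intro t ht
  have h1 : HasMFDerivWithinAt 𝓘(ℝ, ℝ) 𝓘(ℝ, E) σ s t _ :=
    (h t ht).hasFDerivWithinAt.hasMFDerivWithinAt
  have h2 := (mdifferentiableWithinAt_extChartAt_symm (I := I) (hσ t ht)).hasMFDerivWithinAt
  have h3 := h2.comp t h1 (fun r hr => extChartAt_target_subset_range p (hσ r hr))
  refine h3.congr_mfderiv ?_
  have hs : (extChartAt I p).symm (σ t) ∈ (chartAt H p).source := by
    simpa using (extChartAt I p).map_target (hσ t ht)
  have h4 := chartDInv_chartD (I := I) hs (V ((extChartAt I p).symm (σ t)))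
  have h5 : chartDInv I p ((extChartAt I p).symm (σ t)) =
      (mfderivWithin 𝓘(ℝ, E) I (extChartAt I p).symm (range I) (σ t) :) := by
    unfold chartDInv
    rw [(extChartAt I p).right_inv (hσ t ht)]
  ext
  rw [h5] at h4
  change mfderivWithin 𝓘(ℝ, E) I (extChartAt I p).symm (range I) (σ t)
    ((1 : ℝ) • chartField I V p (σ t)) = (1 : ℝ) • V ((extChartAt I p).symm (σ t))
  rw [one_smul, one_smul]
  exact h4

theorem hasDerivWithinAt_inChart_comp {θ : OneForm I M} {γ : ℝ → M}
    {V : ∀ p : M, TangentSpace I p} {s : Set ℝ} (hγ : IsMIntegralCurveOn (I := I) γ V s) {t : ℝ} (ht : t ∈ s)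
    {p : M} (hp : γ t ∈ (chartAt H p).source) (hθ : OneForm.SmoothAt I θ 1 (γ t)) :
    HasDerivWithinAt (fun t => OneForm.inChart I θ p (extChartAt I p (γ t)))
      (fderivWithin ℝ (OneForm.inChart I θ p) (range I) (extChartAt I p (γ t))
        (chartField I V p (extChartAt I p (γ t)))) s t := by
  have h1 := ((hθ.contDiffWithinAt hp).differentiableWithinAt one_ne_zero).hasFDerivWithinAt
  exact h1.comp_hasDerivWithinAt t (hγ.hasDerivWithinAt_extChartAt ht hp)
    (fun r _ => extChartAt_mem_range p (γ r))

end FormsAlongCurves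

/-! ### Integral curves on manifolds with boundary -/

section Gronwall

variable {W : Type*} [NormedAddCommGroup W] [NormedSpace ℝ W]

theorem eq_zero_of_norm_hasDerivWithinAt_le_aux {s : Set ℝ} (hs : s.OrdConnected) {ζ ζ' : ℝ → W}
    {C : ℝ} (h : ∀ t ∈ s, HasDerivWithinAt ζ (ζ' t) s t) (hC : ∀ t ∈ s, ‖ζ' t‖ ≤ C * ‖ζ t‖)
    {a b : ℝ} (ha : a ∈ s) (hb : b ∈ s) (hab : a ≤ b) (h0 : ζ a = 0) : ζ b = 0 := by
  have hsub : Icc a b ⊆ s := hs.out ha hb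
  have h1 := norm_le_gronwallBound_of_norm_deriv_right_le (f := ζ) (f' := ζ') (δ := 0) (K := C)
    (ε := 0) (a := a) (b := b)
    (fun t ht => ((h t (hsub ht)).continuousWithinAt).mono hsub)
    (fun t ht => (h t (hsub (Ico_subset_Icc_self ht))).mono_of_mem_nhdsWithin
      (mem_of_superset (Icc_mem_nhdsGE ht.2) ((Icc_subset_Icc_left ht.1).trans hsub)))
    (by simp [h0]) (fun t ht => by simpa using hC t (hsub (Ico_subset_Icc_self ht))) b ⟨hab, le_rfl⟩
  simpa [gronwallBound_ε0_δ0] using h1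

/-- A solution of a linear differential inequality `‖ζ'‖ ≤ C ‖ζ‖` on an interval which vanishes
at one point vanishes everywhere. -/
theorem eq_zero_of_norm_hasDerivWithinAt_le {s : Set ℝ} (hs : s.OrdConnected) {ζ ζ' : ℝ → W}
    {C : ℝ} (h : ∀ t ∈ s, HasDerivWithinAt ζ (ζ' t) s t) (hC : ∀ t ∈ s, ‖ζ' t‖ ≤ C * ‖ζ t‖)
    {a b : ℝ} (ha : a ∈ s) (hb : b ∈ s) (h0 : ζ a = 0) : ζ b = 0 := by
  rcases le_total a b with hab | hab
  · exact eq_zero_of_norm_hasDerivWithinAt_le_aux hs h hC ha hb hab h0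
  · have hs' : (Neg.neg ⁻¹' s : Set ℝ).OrdConnected :=
      ⟨fun x hx y hy z hz => hs.out hy hx ⟨neg_le_neg hz.2, neg_le_neg hz.1⟩⟩
    have := eq_zero_of_norm_hasDerivWithinAt_le_aux (ζ := fun t => ζ (-t)) (ζ' := fun t => -ζ' (-t))
      (C := C) hs' (fun t ht => by
        have h1 := (h (-t) ht).scomp t ((hasDerivAt_neg t).hasDerivWithinAt (s := Neg.neg ⁻¹' s))
          (fun x hx => hx)
        simpa [Function.comp_def] using h1)
      (fun t ht => by simpa using hC (-t) ht) (a := -a) (b := -b) (by simpa) (by simpa)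
      (neg_le_neg hab) (by simpa)
    simpa using this

end Gronwall

section IntegralCurves

variable {E H : Type*} [NormedAddCommGroup E] [NormedSpace ℝ E] [TopologicalSpace H]
  {I : ModelWithCorners ℝ E H} {M : Type*} [TopologicalSpace M] [ChartedSpace H M]
  [IsManifold I ∞ M]

omit [IsManifold I ∞ M] in
theorem IsMIntegralCurveOn.tendsto_extChartAt {γ : ℝ → M} {V : ∀ p : M, TangentSpace I p}
    {s : Set ℝ} (hγ : IsMIntegralCurveOn (I := I) γ V s) {t : ℝ} (ht : t ∈ s) {p : M}
    (hp : γ t ∈ (chartAt H p).source) :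
    Tendsto (fun r => extChartAt I p (γ r)) (𝓝[s] t) (𝓝[range I] (extChartAt I p (γ t))) :=
  tendsto_nhdsWithin_iff.2 ⟨(continuousAt_extChartAt' (I := I) (by simpa using hp)).tendsto.comp
    (hγ.continuousWithinAt ht).tendsto, Eventually.of_forall fun r => extChartAt_mem_range p (γ r)⟩

omit [IsManifold I ∞ M] in
theorem IsMIntegralCurveOn.eventually_mem_source {γ : ℝ → M} {V : ∀ p : M, TangentSpace I p}
    {s : Set ℝ} (hγ : IsMIntegralCurveOn (I := I) γ V s) {t : ℝ} (ht : t ∈ s) :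
    ∀ᶠ r in 𝓝[s] t, γ r ∈ (chartAt H (γ t)).source :=
  (hγ.continuousWithinAt ht).eventually
    ((chartAt H (γ t)).open_source.mem_nhds (mem_chart_source H (γ t)))

/-- Integral curves defined on an interval, possibly through boundary points, are determined by
their value at one point. -/
theorem IsMIntegralCurveOn.eq_of_eq [T2Space M] {γ γ' : ℝ → M} {V : ∀ p : M, TangentSpace I p}
    (hV : ContMDiff I I.tangent 1 (fun p => (⟨p, V p⟩ : TangentBundle I M)))
    {s : Set ℝ} (hs : s.OrdConnected) (hγ : IsMIntegralCurveOn (I := I) γ V s)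
    (hγ' : IsMIntegralCurveOn (I := I) γ' V s) {a b : ℝ} (ha : a ∈ s) (hb : b ∈ s)
    (h : γ a = γ' a) : γ b = γ' b := by
  -- it suffices to see that the truth value of `γ t = γ' t` is locally constant; where it is true,
  -- the difference of the curves in a chart satisfies a Grönwall inequality
  refine (hs.isPreconnected.induction₂ (fun a b => γ a = γ' a ↔ γ b = γ' b) ?_
    (fun _ _ _ _ _ _ => Iff.trans) (fun _ _ _ _ => Iff.symm) ha hb).1 h
  intro t₀ ht₀
  by_cases heq : γ t₀ = γ' t₀
  swap
  · have := ((hγ.continuousWithinAt ht₀).tendsto.prodMk_nhds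
      (hγ'.continuousWithinAt ht₀).tendsto).eventually (isClosed_diagonal.isOpen_compl.mem_nhds
        (show (γ t₀, γ' t₀) ∈ (diagonal M)ᶜ from heq))
    filter_upwards [this] with t ht
    exact iff_of_false heq ht
  set p := γ t₀ with hp
  obtain ⟨L, u, hu, hL⟩ := (contDiffWithinAt_chartField (n := 1) (hV p)
    (mem_chart_source H p)).exists_lipschitzOnWith I.convex_range
  have e1 := (hγ.tendsto_extChartAt ht₀ (mem_chart_source H (γ t₀))).eventually hu
  have e2 : ∀ᶠ r in 𝓝[s] t₀, extChartAt I p (γ' r) ∈ u := by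
    have := (hγ'.tendsto_extChartAt ht₀ (mem_chart_source H (γ' t₀)))
    rw [← heq] at this
    exact this.eventually hu
  have e3 := hγ.eventually_mem_source ht₀
  have e4 := hγ'.eventually_mem_source ht₀
  rw [← heq] at e4
  obtain ⟨ε, hε, hsub⟩ := Metric.mem_nhdsWithin_iff.1 (e1.and (e2.and (e3.and e4)))
  have hJ : (Metric.ball t₀ ε ∩ s).OrdConnected := by
    rw [Real.ball_eq_Ioo]
    exact ordConnected_Ioo.inter hs
  have hmem : Metric.ball t₀ ε ∩ s ∈ 𝓝[s] t₀ :=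
    inter_mem (mem_nhdsWithin_of_mem_nhds (Metric.ball_mem_nhds _ hε)) self_mem_nhdsWithin
  filter_upwards [hmem] with t ht
  refine iff_of_true heq ?_
  have hz := eq_zero_of_norm_hasDerivWithinAt_le hJ
    (ζ := fun t => extChartAt I p (γ t) - extChartAt I p (γ' t))
    (ζ' := fun t => chartField I V p (extChartAt I p (γ t)) -
      chartField I V p (extChartAt I p (γ' t))) (C := L)
    (fun r hr => ((hγ.mono inter_subset_right).hasDerivWithinAt_extChartAt hr (hsub hr).2.2.1).sub
      ((hγ'.mono inter_subset_right).hasDerivWithinAt_extChartAt hr (hsub hr).2.2.2))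
    (fun r hr => hL.norm_sub_le (hsub hr).1 (hsub hr).2.1)
    (a := t₀) (b := t) ⟨Metric.mem_ball_self hε, ht₀⟩ ht (by simp [← hp, heq])
  exact (extChartAt I p).injOn (by simpa using (hsub ht).2.2.1) (by simpa using (hsub ht).2.2.2)
    (sub_eq_zero.1 hz)

/-- If the Lie derivatives of `θ` and `η` along `V` are `f θ` and `f' η`, then an equality
`θ = S η` propagates along the integral curves of `V`, when `S` satisfies `S' = (f - f') S`. -/
theorem eq_smul_along_integralCurve {θ η : OneForm I M} {V : ∀ p : M, TangentSpace I p}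
    (hV : ContMDiff I I.tangent 1 (fun p => (⟨p, V p⟩ : TangentBundle I M)))
    {f f' : M → ℝ} (hf : Continuous f) {γ : ℝ → M} {s : Set ℝ} (hs : s.OrdConnected)
    (hγ : IsMIntegralCurveOn (I := I) γ V s)
    (hθ : ∀ t ∈ s, OneForm.SmoothAt I θ 1 (γ t)) (hη : ∀ t ∈ s, OneForm.SmoothAt I η 1 (γ t))
    (hθ0 : ∀ t ∈ s, ∀ᶠ z in 𝓝 (γ t), θ z (V z) = 0)
    (hη0 : ∀ t ∈ s, ∀ᶠ z in 𝓝 (γ t), η z (V z) = 0)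
    (hdθ : ∀ t ∈ s, ∀ w, OneForm.d I θ (γ t) (V (γ t)) w = f (γ t) * θ (γ t) w)
    (hdη : ∀ t ∈ s, ∀ w, OneForm.d I η (γ t) (V (γ t)) w = f' (γ t) * η (γ t) w)
    {S : ℝ → ℝ} (hS : ∀ t ∈ s, HasDerivWithinAt S ((f (γ t) - f' (γ t)) * S t) s t)
    {a b : ℝ} (ha : a ∈ s) (hb : b ∈ s) (h : θ (γ a) = S a • η (γ a)) :
    θ (γ b) = S b • η (γ b) := by
  refine (hs.isPreconnected.induction₂
    (fun a b => θ (γ a) = S a • η (γ a) ↔ θ (γ b) = S b • η (γ b)) ?_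
    (fun _ _ _ _ _ _ => Iff.trans) (fun _ _ _ _ => Iff.symm) ha hb).1 h
  intro t₀ ht₀
  set p := γ t₀ with hp
  have hmemr := extChartAt_mem_range (I := I) p p
  have hcV : ContinuousWithinAt (fun y => fderivWithin ℝ (chartField I V p) (range I) y) (range I)
      (extChartAt I p p) :=
    ((contDiffWithinAt_chartField (n := 1) (hV p) (mem_chart_source H p)).fderivWithin_right
      (m := 0) I.uniqueDiffOn (by simp) hmemr).continuousWithinAt
  have e1 : ∀ᶠ y in 𝓝[range I] (extChartAt I p p),
      ‖fderivWithin ℝ (chartField I V p) (range I) y‖ <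
        ‖fderivWithin ℝ (chartField I V p) (range I) (extChartAt I p p)‖ + 1 :=
    hcV.norm.eventually (gt_mem_nhds (lt_add_one _))
  have e1' := (hγ.tendsto_extChartAt ht₀ (mem_chart_source H (γ t₀))).eventually e1
  have e2 : ∀ᶠ r in 𝓝[s] t₀, ‖f (γ r)‖ < ‖f p‖ + 1 :=
    (hf.continuousAt.comp_continuousWithinAt (hγ.continuousWithinAt ht₀)).norm.eventually
      (gt_mem_nhds (lt_add_one _))
  have e3 := hγ.eventually_mem_source ht₀
  obtain ⟨ε, hε, hsub⟩ := Metric.mem_nhdsWithin_iff.1 (e1'.and (e2.and e3))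
  set C := ‖fderivWithin ℝ (chartField I V p) (range I) (extChartAt I p p)‖ + 1
  have hJ : (Metric.ball t₀ ε ∩ s).OrdConnected := by
    rw [Real.ball_eq_Ioo]
    exact ordConnected_Ioo.inter hs
  have hmem : Metric.ball t₀ ε ∩ s ∈ 𝓝[s] t₀ :=
    inter_mem (mem_nhdsWithin_of_mem_nhds (Metric.ball_mem_nhds _ hε)) self_mem_nhdsWithin
  -- the difference of both sides in the chart, which satisfies a linear differential equation
  set ζ : ℝ → E →L[ℝ] ℝ := fun r => OneForm.inChart I θ p (extChartAt I p (γ r)) -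
    S r • OneForm.inChart I η p (extChartAt I p (γ r)) with hζ
  have hiff : ∀ r ∈ Metric.ball t₀ ε ∩ s, (θ (γ r) = S r • η (γ r) ↔ ζ r = 0) := by
    intro r hr
    have hsrc := (hsub hr).2.2
    rw [hζ, sub_eq_zero]
    constructor
    · intro h1
      rw [inChart_extChartAt θ hsrc, inChart_extChartAt η hsrc, h1]
      rfl
    · intro h1
      ext u
      rw [OneForm.apply_eq_inChart θ hsrc, h1]
      exact congrArg (S r * ·) (OneForm.apply_eq_inChart η hsrc u).symm
  set D : ℝ → E →L[ℝ] E := fun r =>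
    fderivWithin ℝ (chartField I V p) (range I) (extChartAt I p (γ r))
  have hder : ∀ r ∈ Metric.ball t₀ ε ∩ s,
      HasDerivWithinAt ζ (f (γ r) • ζ r - (ζ r).comp (D r)) (Metric.ball t₀ ε ∩ s) r := by
    intro r hr
    have hsrc := (hsub hr).2.2
    have hγ' := hγ.mono (inter_subset_right (s := Metric.ball t₀ ε))
    have d1 := hasDerivWithinAt_inChart_comp hγ' hr hsrc (hθ r hr.2)
    have d2 := hasDerivWithinAt_inChart_comp hγ' hr hsrc (hη r hr.2)
    rw [fderivWithin_inChart_chartField hsrc (hθ r hr.2) (hV _) (hθ0 r hr.2) (hdθ r hr.2)] at d1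
    rw [fderivWithin_inChart_chartField hsrc (hη r hr.2) (hV _) (hη0 r hr.2) (hdη r hr.2)] at d2
    refine (d1.sub (((hS r hr.2).mono inter_subset_right).fun_smul d2)).congr_deriv ?_
    ext w
    simp only [hζ, D, sub_apply, add_apply, smul_apply, ContinuousLinearMap.comp_apply,
      smul_eq_mul]
    ring
  have hbound : ∀ r ∈ Metric.ball t₀ ε ∩ s,
      ‖f (γ r) • ζ r - (ζ r).comp (D r)‖ ≤ (‖f p‖ + 1 + C) * ‖ζ r‖ := by
    intro r hr
    have b1 : ‖f (γ r) • ζ r‖ ≤ (‖f p‖ + 1) * ‖ζ r‖ := by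
      rw [norm_smul]
      exact mul_le_mul_of_nonneg_right (hsub hr).2.1.le (norm_nonneg _)
    have b2 : ‖(ζ r).comp (D r)‖ ≤ ‖ζ r‖ * C :=
      (ContinuousLinearMap.opNorm_comp_le _ _).trans
        (mul_le_mul_of_nonneg_left (hsub hr).1.le (norm_nonneg _))
    calc _ ≤ _ := norm_sub_le _ _
      _ ≤ (‖f p‖ + 1) * ‖ζ r‖ + ‖ζ r‖ * C := add_le_add b1 b2
      _ = _ := by ring
  filter_upwards [hmem] with t ht
  have ht₀' : t₀ ∈ Metric.ball t₀ ε ∩ s := ⟨Metric.mem_ball_self hε, ht₀⟩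
  rw [show p = γ t₀ from rfl, hiff t₀ ht₀', hiff t ht]
  exact ⟨eq_zero_of_norm_hasDerivWithinAt_le hJ hder hbound ht₀' ht,
    eq_zero_of_norm_hasDerivWithinAt_le hJ hder hbound ht ht₀'⟩

omit [IsManifold I ∞ M] in
/-- The concatenation of two integral curves is an integral curve. -/
theorem IsMIntegralCurveOn.concat {γ γ' : ℝ → M} {V : ∀ p : M, TangentSpace I p} {T ε : ℝ}
    (hT : 0 ≤ T) (hε : 0 ≤ ε)
    (hγ : IsMIntegralCurveOn (I := I) γ V (Icc 0 T)) (hγ' : IsMIntegralCurveOn (I := I) γ' V (Icc 0 ε))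
    (h : γ' 0 = γ T) :
    IsMIntegralCurveOn (I := I) (fun t => if t ≤ T then γ t else γ' (t - T)) V (Icc 0 (T + ε)) := by
  have hs : IsMIntegralCurveOn (I := I) (fun t => γ' (t - T)) V (Icc T (T + ε)) := by
    have := hγ'.comp_add (-T)
    refine (this.mono ?_)
    intro t ht
    simp only [Set.mem_ofPred_eq, mem_Icc] at ht ⊢
    constructor <;> linarith [ht.1, ht.2]
  set δ := fun t => if t ≤ T then γ t else γ' (t - T) with hδ
  have hδ1 : ∀ t ∈ Icc 0 T, δ t = γ t := fun t ht => if_pos ht.2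
  have hδ2 : ∀ t ∈ Icc T (T + ε), δ t = γ' (t - T) := by
    intro t ht
    rcases ht.1.eq_or_lt with rfl | hlt
    · simp [hδ, h]
    · simp [hδ, not_le.2 hlt]
  have h1 : ∀ t ∈ Icc 0 T, HasMFDerivWithinAt 𝓘(ℝ, ℝ) I δ (Icc 0 T) t
      ((1 : ℝ →L[ℝ] ℝ).smulRight (V (δ t))) := by
    intro t ht
    have := hγ t ht
    rw [← hδ1 t ht] at this
    exact this.congr_of_eventuallyEq (eventually_of_mem self_mem_nhdsWithin hδ1) (hδ1 t ht)
  have h2 : ∀ t ∈ Icc T (T + ε), HasMFDerivWithinAt 𝓘(ℝ, ℝ) I δ (Icc T (T + ε)) t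
      ((1 : ℝ →L[ℝ] ℝ).smulRight (V (δ t))) := by
    intro t ht
    have : HasMFDerivWithinAt 𝓘(ℝ, ℝ) I (fun t => γ' (t - T)) (Icc T (T + ε)) t
      ((1 : ℝ →L[ℝ] ℝ).smulRight (V (γ' (t - T)))) := hs t ht
    rw [← hδ2 t ht] at this
    exact this.congr_of_eventuallyEq (eventually_of_mem self_mem_nhdsWithin hδ2) (hδ2 t ht)
  intro t ht
  rcases lt_trichotomy t T with hlt | rfl | hlt
  · refine (h1 t ⟨ht.1, hlt.le⟩).mono_of_mem_nhdsWithin ?_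
    filter_upwards [self_mem_nhdsWithin, mem_nhdsWithin_of_mem_nhds (Iio_mem_nhds hlt)] with r hr hr'
    exact ⟨hr.1, hr'.le⟩
  · have := (h1 t ⟨ht.1, le_rfl⟩).union (h2 t ⟨le_rfl, ht.2⟩)
    rwa [Icc_union_Icc_eq_Icc hT (by linarith)] at this
  · refine (h2 t ⟨hlt.le, ht.2⟩).mono_of_mem_nhdsWithin ?_
    filter_upwards [self_mem_nhdsWithin, mem_nhdsWithin_of_mem_nhds (Ioi_mem_nhds hlt)] with r hr hr'
    exact ⟨hr'.le, hr.2⟩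

omit [IsManifold I ∞ M] in
/-- If all integral curves exist for a uniform time, they exist for all positive times. -/
theorem exists_isMIntegralCurveOn_Icc {V : ∀ p : M, TangentSpace I p} {ε : ℝ} (hε : 0 < ε)
    (h : ∀ p : M, ∃ γ : ℝ → M, γ 0 = p ∧ IsMIntegralCurveOn (I := I) γ V (Icc 0 ε)) (p : M) (T : ℝ) :
    ∃ γ : ℝ → M, γ 0 = p ∧ IsMIntegralCurveOn (I := I) γ V (Icc 0 T) := by
  have key : ∀ n : ℕ, ∃ γ : ℝ → M, γ 0 = p ∧ IsMIntegralCurveOn (I := I) γ V (Icc 0 (n * ε)) := by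
    intro n
    induction n with
    | zero =>
      obtain ⟨γ, h0, hγ⟩ := h p
      exact ⟨γ, h0, hγ.mono (Icc_subset_Icc_right (by simp [hε.le]))⟩
    | succ n ih =>
      obtain ⟨γ, h0, hγ⟩ := ih
      obtain ⟨γ', h0', hγ'⟩ := h (γ (n * ε))
      have hn : 0 ≤ n * ε := by positivity
      refine ⟨_, ?_, (hγ.concat hn hε.le hγ' h0').mono
        (Icc_subset_Icc_right (by push_cast; linarith))⟩
      simp [hn, h0]
  obtain ⟨n, hn⟩ := exists_nat_ge (T / ε)
  obtain ⟨γ, h0, hγ⟩ := key n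
  exact ⟨γ, h0, hγ.mono (Icc_subset_Icc_right ((div_le_iff₀ hε).1 hn))⟩

/-- If all integral curves exist for all positive times, they can be taken to be defined on
`[0, ∞)`. -/
theorem exists_isMIntegralCurveOn_Ici [T2Space M] {V : ∀ p : M, TangentSpace I p}
    (hV : ContMDiff I I.tangent 1 (fun p => (⟨p, V p⟩ : TangentBundle I M)))
    {ε : ℝ} (hε : 0 < ε)
    (h : ∀ p : M, ∃ γ : ℝ → M, γ 0 = p ∧ IsMIntegralCurveOn (I := I) γ V (Icc 0 ε)) (p : M) :
    ∃ γ : ℝ → M, γ 0 = p ∧ IsMIntegralCurveOn (I := I) γ V (Ici 0) := by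
  choose c hc0 hc using fun T => exists_isMIntegralCurveOn_Icc hε h p T
  have heq : ∀ T t, 0 ≤ t → t ≤ T → c t t = c T t := fun T t h0 ht =>
    IsMIntegralCurveOn.eq_of_eq hV ordConnected_Icc (hc t) ((hc T).mono (Icc_subset_Icc_right ht))
      (a := 0) ⟨le_rfl, h0⟩ ⟨h0, le_rfl⟩ (by rw [hc0, hc0])
  refine ⟨fun t => c t t, hc0 0, fun t (ht : 0 ≤ t) => ?_⟩
  have h1 : HasMFDerivWithinAt 𝓘(ℝ, ℝ) I (c (t + 1)) (Ici 0) t _ :=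
    (hc (t + 1) t ⟨ht, by linarith⟩).mono_of_mem_nhdsWithin (by
      filter_upwards [self_mem_nhdsWithin,
        mem_nhdsWithin_of_mem_nhds (Iio_mem_nhds (lt_add_one t))] with r hr hr'
      exact ⟨hr, hr'.le⟩)
  rw [← heq (t + 1) t ht (by linarith)] at h1
  refine h1.congr_of_eventuallyEq ?_ (heq (t + 1) t ht (by linarith))
  filter_upwards [self_mem_nhdsWithin,
    mem_nhdsWithin_of_mem_nhds (Iio_mem_nhds (lt_add_one t))] with r hr hr'
  exact heq (t + 1) r hr hr'.le

omit [IsManifold I ∞ M] in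
/-- Reversing time turns integral curves of `V` into integral curves of `-V`. -/
theorem IsMIntegralCurveOn.reverse {γ : ℝ → M} {V : ∀ p : M, TangentSpace I p} {T : ℝ}
    (hγ : IsMIntegralCurveOn (I := I) γ V (Icc 0 T)) :
    IsMIntegralCurveOn (I := I) (fun t => γ (T - t)) (fun p => -V p) (Icc 0 T) := by
  have h1 := (hγ.comp_add T).comp_mul (-1)
  have h2 : ((-1 : ℝ) • V) = fun p => -V p := by
    funext p
    simp
  rw [h2] at h1
  have h3 := h1.mono (show Icc 0 T ⊆ _ from fun t ht => by
    simp only [Set.mem_ofPred_eq, mem_Icc] at ht ⊢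
    constructor <;> linarith [ht.1, ht.2])
  convert! h3 using 1
  funext t
  simp only [Function.comp_apply]
  congr 1
  ring

end IntegralCurves

/-! ### Local flows on a manifold with boundary -/

section HalfSpace

variable {E H : Type*} [NormedAddCommGroup E] [NormedSpace ℝ E]
  [TopologicalSpace H] {I : ModelWithCorners ℝ E H} {ℓ : E →L[ℝ] ℝ} {e : E}

theorem interior_nonneg_clm (he : ℓ e = 1) : interior {y : E | 0 ≤ ℓ y} = {y | 0 < ℓ y} := by
  refine Subset.antisymm (fun y hy => ?_) ?_
  · obtain ⟨r, hr, hsub⟩ := Metric.isOpen_iff.1 isOpen_interior y hy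
    have hcont : Continuous fun t : ℝ => y - t • e := by fun_prop
    have h1 : ∀ᶠ t : ℝ in 𝓝[>] 0, y - t • e ∈ interior {y : E | 0 ≤ ℓ y} :=
      (hcont.tendsto' 0 y (by simp)).mono_left nhdsWithin_le_nhds |>.eventually
        (isOpen_interior.mem_nhds hy)
    obtain ⟨t, ht, ht0⟩ := (h1.and self_mem_nhdsWithin).exists
    have h2 : y - t • e ∈ {y : E | 0 ≤ ℓ y} := interior_subset ht
    simp only [Set.mem_ofPred_eq, map_sub, map_smul, he, smul_eq_mul, mul_one] at h2
    have : 0 < t := ht0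
    change 0 < ℓ y
    linarith
  · refine interior_maximal (fun y (hy : 0 < ℓ y) => hy.le) ?_
    exact isOpen_lt continuous_const ℓ.continuous

variable {M : Type*} [TopologicalSpace M] [ChartedSpace H M] [IsManifold I ∞ M]

/-- In a chart with values in a half-space, the interior points are those of positive height. -/
theorem mem_interior_iff_of_mem_source (he : ℓ e = 1) (hI : range I = {y | 0 ≤ ℓ y}) {p q : M}
    (hq : q ∈ (chartAt H p).source) :
    q ∈ I.interior M ↔ 0 < ℓ (extChartAt I p q) := by
  have h1 := I.isInteriorPoint_iff_of_mem_atlas (M := M) (n := ∞) (by simp) (chart_mem_atlas H p) hq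
  change I.IsInteriorPoint q ↔ _
  rw [h1]
  have hq' : q ∈ (extChartAt I p).source := by simpa using hq
  change extChartAt I p q ∈ interior (extChartAt I p).target ↔ extChartAt I p q ∈ {y | 0 < ℓ y}
  rw [← interior_nonneg_clm he, ← hI]
  constructor
  · exact fun h => interior_mono (extChartAt_target_subset_range p) h
  · intro h
    rw [mem_interior_iff_mem_nhds] at h ⊢
    have := extChartAt_target_mem_nhdsWithin' hq'
    rwa [nhdsWithin_eq_nhds.2 h] at this

theorem mem_boundary_iff_of_mem_source (he : ℓ e = 1) (hI : range I = {y | 0 ≤ ℓ y}) {p q : M}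
    (hq : q ∈ (chartAt H p).source) :
    q ∈ I.boundary M ↔ ℓ (extChartAt I p q) = 0 := by
  rw [← I.compl_interior, mem_compl_iff, mem_interior_iff_of_mem_source he hI hq, not_lt]
  have : extChartAt I p q ∈ {y | 0 ≤ ℓ y} := hI ▸ extChartAt_mem_range p q
  exact ⟨fun h => le_antisymm h this, fun h => h.le⟩

variable [FiniteDimensional ℝ E]

/-- Local flows of a smooth vector field on a manifold with boundary, in a chart: they are
restrictions of smooth maps defined on open sets, and describe integral curves as long as they stay
in the half-space. -/
theorem exists_localFlow (he : ℓ e = 1) (hI : range I = {y | 0 ≤ ℓ y})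
    {V : ∀ p : M, TangentSpace I p}
    (hV : ContMDiff I I.tangent ∞ (fun p => (⟨p, V p⟩ : TangentBundle I M))) (p : M) {n : ℕ}
    (hn : 1 ≤ n) :
    ∃ (φ : ℝ × E → E) (r : ℝ), 0 < r ∧
      (∀ z ∈ Metric.ball ((0 : ℝ), extChartAt I p p) r, ContDiffAt ℝ n φ z) ∧
      (∀ y ∈ Metric.ball (extChartAt I p p) r, φ (0, y) = y) ∧
      (∀ y ∈ Metric.ball (extChartAt I p p) r, ∀ t, |t| < r → φ (t, y) ∈ range I →
        φ (t, y) ∈ (extChartAt I p).target) ∧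
      HasDerivAt (fun t => φ (t, extChartAt I p p)) (V p : E) 0 ∧
      (∀ y ∈ Metric.ball (extChartAt I p p) r, IsMIntegralCurveOn (I := I)
        (fun t => (extChartAt I p).symm (φ (t, y))) V {t | |t| < r ∧ φ (t, y) ∈ range I}) ∧
      (p ∈ I.interior M → ∀ y ∈ Metric.ball (extChartAt I p p) r, ∀ t, |t| < r →
        0 < ℓ (φ (t, y))) ∧
      (0 < ℓ (V p) → ∀ y ∈ Metric.ball (extChartAt I p p) r,
        StrictMonoOn (fun t => ℓ (φ (t, y))) (Ioo (-r) r)) := by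
  have hps := mem_chart_source H p
  have hcd : ContDiffWithinAt ℝ n (chartField I V p) (range I) (extChartAt I p p) :=
    contDiffWithinAt_chartField (n := n) ((hV p).of_le (by exact_mod_cast le_top)) hps
  obtain ⟨u, hu, -, hf⟩ := hcd.contDiffOn (m := n) le_rfl (by simp)
  simp only [insert_eq_of_mem (extChartAt_mem_range p p)] at hu
  have hu2 : u ∩ (extChartAt I p).target ∈ 𝓝[range I] (extChartAt I p p) :=
    inter_mem hu (extChartAt_target_mem_nhdsWithin p)
  rw [hI] at hu2
  -- the chart expression of the field is extended across the boundary
  obtain ⟨f', hf', hev⟩ := exists_contDiff_extension_of_nhdsWithin (G := E) he n hu2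
    (hf.mono inter_subset_left)
  have hmem0 : extChartAt I p p ∈ {y | 0 ≤ ℓ y} := hI ▸ extChartAt_mem_range p p
  have hf'p : f' (extChartAt I p p) = (V p : E) := by
    have h2 := (hev.self_of_nhdsWithin hmem0).2
    rw [chartField_extChartAt V hps, chartD_self] at h2
    exact h2
  obtain ⟨ρ₁, hρ₁, hsub₁⟩ := Metric.mem_nhdsWithin_iff.1 hev
  -- the radius is chosen so that the flow remains in the interior, or crosses the levels of `ℓ`
  have hρ : ∃ ρ, 0 < ρ ∧ ρ ≤ ρ₁ ∧
      (p ∈ I.interior M → ∀ y ∈ Metric.ball (extChartAt I p p) ρ, 0 < ℓ y) ∧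
      (0 < ℓ (V p) → ∀ y ∈ Metric.ball (extChartAt I p p) ρ, 0 < ℓ (f' y)) := by
    have h1 : ∀ᶠ y in 𝓝 (extChartAt I p p), p ∈ I.interior M → 0 < ℓ y := by
      by_cases hp : p ∈ I.interior M
      · have := (mem_interior_iff_of_mem_source he hI hps).1 hp
        filter_upwards [ℓ.continuous.continuousAt.eventually (lt_mem_nhds this)] with y hy _ using hy
      · exact Eventually.of_forall fun y h => (hp h).elim
    have h2 : ∀ᶠ y in 𝓝 (extChartAt I p p), 0 < ℓ (V p) → 0 < ℓ (f' y) := by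
      by_cases hp : 0 < ℓ (V p)
      · have hc : ContinuousAt (fun y => ℓ (f' y)) (extChartAt I p p) :=
          (ℓ.continuous.comp hf'.continuous).continuousAt
        have := hc.eventually (lt_mem_nhds (show 0 < ℓ (f' (extChartAt I p p)) by rwa [hf'p]))
        filter_upwards [this] with y hy _ using hy
      · exact Eventually.of_forall fun y h => (hp h).elim
    obtain ⟨ρ₂, hρ₂, hsub₂⟩ := Metric.eventually_nhds_iff_ball.1 (h1.and h2)
    refine ⟨min ρ₁ ρ₂, lt_min hρ₁ hρ₂, min_le_left _ _, fun hp y hy => ?_, fun hp y hy => ?_⟩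
    · exact (hsub₂ y (Metric.ball_subset_ball (min_le_right _ _) hy)).1 hp
    · exact (hsub₂ y (Metric.ball_subset_ball (min_le_right _ _) hy)).2 hp
  obtain ⟨ρ, hρ, hρle, hint, hpos⟩ := hρ
  obtain ⟨φ, r, hr, hφ, hφ0, hφm, hφd⟩ := exists_contDiffOn_localFlow hn hf'
    (extChartAt I p p) hρ
  have hext : ∀ y ∈ Metric.ball (extChartAt I p p) ρ, y ∈ range I →
      y ∈ (extChartAt I p).target ∧ f' y = chartField I V p y := by
    intro y hy hyI
    have := hsub₁ ⟨Metric.ball_subset_ball hρle hy, hI ▸ hyI⟩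
    exact ⟨this.1.2, this.2⟩
  refine ⟨φ, r, hr, hφ, hφ0, fun y hy t ht hI' => (hext _ (hφm y hy t ht) hI').1, ?_, ?_,
    fun hp y hy t ht => hint hp _ (hφm y hy t ht), ?_⟩
  · have := hφd _ (Metric.mem_ball_self hr) 0 (by simpa)
    rwa [hφ0 _ (Metric.mem_ball_self hr), hf'p] at this
  · intro y hy
    refine isMIntegralCurveOn_extChartAt_symm
      (fun t ht => (hext _ (hφm y hy t ht.1) ht.2).1) fun t ht => ?_
    rw [← (hext _ (hφm y hy t ht.1) ht.2).2]
    exact (hφd y hy t ht.1).hasDerivWithinAt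
  · intro hp y hy
    have hder : ∀ t ∈ Ioo (-r) r, HasDerivAt (fun t => ℓ (φ (t, y))) (ℓ (f' (φ (t, y)))) t :=
      fun t ht => ℓ.hasFDerivAt.comp_hasDerivAt t (hφd y hy t (abs_lt.2 ht))
    refine strictMonoOn_of_deriv_pos (convex_Ioo _ _)
      (fun t ht => (hder t ht).continuousAt.continuousWithinAt) fun t ht => ?_
    rw [interior_Ioo] at ht
    rw [(hder t ht).deriv]
    exact hpos hp _ (hφm y hy t (abs_lt.2 ht))

/-- On a compact manifold, the integral curves of a vector field which points inwards along the
boundary exist for a uniform positive time. -/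
theorem exists_uniform_time [CompactSpace M] (he : ℓ e = 1) (hI : range I = {y | 0 ≤ ℓ y})
    {V : ∀ p : M, TangentSpace I p}
    (hV : ContMDiff I I.tangent ∞ (fun p => (⟨p, V p⟩ : TangentBundle I M)))
    (hin : ∀ p ∈ I.boundary M, 0 < ℓ (V p)) :
    ∃ ε > 0, ∀ p : M, ∃ γ : ℝ → M, γ 0 = p ∧ IsMIntegralCurveOn (I := I) γ V (Icc 0 ε) := by
  suffices h : ∃ ε > 0, ∀ p ∈ (univ : Set M), ∃ γ : ℝ → M, γ 0 = p ∧
      IsMIntegralCurveOn (I := I) γ V (Icc 0 ε) by simpa using h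
  refine isCompact_univ.induction_on (p := fun s => ∃ ε > 0, ∀ p ∈ s, ∃ γ : ℝ → M, γ 0 = p ∧
      IsMIntegralCurveOn (I := I) γ V (Icc 0 ε)) ⟨1, one_pos, by simp⟩ ?_ ?_ ?_
  · rintro s t hst ⟨ε, hε, h⟩
    exact ⟨ε, hε, fun p hp => h p (hst hp)⟩
  · rintro s t ⟨ε, hε, h⟩ ⟨ε', hε', h'⟩
    refine ⟨min ε ε', lt_min hε hε', fun p hp => ?_⟩
    rcases hp with hp | hp
    · obtain ⟨γ, h0, hγ⟩ := h p hp
      exact ⟨γ, h0, hγ.mono (Icc_subset_Icc_right (min_le_left _ _))⟩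
    · obtain ⟨γ, h0, hγ⟩ := h' p hp
      exact ⟨γ, h0, hγ.mono (Icc_subset_Icc_right (min_le_right _ _))⟩
  · intro p _
    obtain ⟨φ, r, hr, -, hφ0, -, -, hφc, hint, hbd⟩ := exists_localFlow he hI hV p le_rfl
    have hev : ∀ᶠ q in 𝓝 p, q ∈ (chartAt H p).source ∧
        extChartAt I p q ∈ Metric.ball (extChartAt I p p) r :=
      Filter.Eventually.and ((chartAt H p).open_source.mem_nhds (mem_chart_source H p))
        ((continuousAt_extChartAt p).eventually (Metric.ball_mem_nhds _ hr))
    refine ⟨_, mem_nhdsWithin_of_mem_nhds hev, r / 2, half_pos hr, fun q hq => ?_⟩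
    obtain ⟨hqs, hqb⟩ := hq
    refine ⟨fun t => (extChartAt I p).symm (φ (t, extChartAt I p q)), ?_,
      (hφc _ hqb).mono fun t ht => ?_⟩
    · change (extChartAt I p).symm (φ (0, extChartAt I p q)) = q
      rw [hφ0 _ hqb, (extChartAt I p).left_inv (by simpa using hqs)]
    · have htr : |t| < r := by rw [abs_of_nonneg ht.1]; linarith [ht.2]
      refine ⟨htr, ?_⟩
      rw [hI]
      change 0 ≤ ℓ (φ (t, extChartAt I p q))
      by_cases hp : p ∈ I.interior M
      · exact (hint hp _ hqb t htr).le
      · have hp' : 0 < ℓ (V p) := hin p (by rwa [← I.compl_interior])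
        have hq0 : extChartAt I p q ∈ {y | 0 ≤ ℓ y} := hI ▸ extChartAt_mem_range p q
        have := (hbd hp' _ hqb).monotoneOn (a := 0) (b := t) ⟨by linarith, hr⟩ (abs_lt.1 htr) ht.1
        simp only [hφ0 _ hqb] at this
        exact le_trans hq0 this

end HalfSpace

/-! ### The orbits through the boundary -/

section BoundaryOrbits

variable {E H : Type*} [NormedAddCommGroup E] [NormedSpace ℝ E]
  [TopologicalSpace H] {I : ModelWithCorners ℝ E H} {ℓ : E →L[ℝ] ℝ} {e : E}
  {M : Type*} [TopologicalSpace M] [ChartedSpace H M] [IsManifold I ∞ M]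
  {K : Type*}

/-- `Γ x` is the integral curve of `V` on `[0, ∞)` which starts at the boundary point `ι x`. -/
structure IsOrbitFamily (I : ModelWithCorners ℝ E H) (ι : K → M) (V : ∀ p : M, TangentSpace I p)
    (Γ : K → ℝ → M) : Prop where
  zero : ∀ x, Γ x 0 = ι x
  curve : ∀ x, IsMIntegralCurveOn (I := I) (Γ x) V (Ici 0)

variable {ι : K → M} {V : ∀ p : M, TangentSpace I p} {Γ : K → ℝ → M}

/-- An orbit of an inward pointing field cannot return to the boundary: its height would have a
local minimum there, with a positive derivative. -/
theorem IsOrbitFamily.mem_interior (hΓ : IsOrbitFamily I ι V Γ) (he : ℓ e = 1)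
    (hI : range I = {y | 0 ≤ ℓ y}) (hin : ∀ p ∈ I.boundary M, 0 < ℓ (V p)) {x : K} {t : ℝ}
    (ht : 0 < t) : Γ x t ∈ I.interior M := by
  rw [← I.compl_boundary, mem_compl_iff]
  intro hb
  have hs := mem_chart_source H (Γ x t)
  have hd := ((hΓ.curve x).hasDerivWithinAt_extChartAt (mem_Ici.2 ht.le) hs).hasDerivAt
    (Ici_mem_nhds ht)
  rw [chartField_extChartAt V hs, chartD_self] at hd
  have hd2 : HasDerivAt (fun r => ℓ (extChartAt I (Γ x t) (Γ x r))) (ℓ (V (Γ x t) : E)) t :=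
    ℓ.hasFDerivAt.comp_hasDerivAt t hd
  have hmin : IsLocalMin (fun r => ℓ (extChartAt I (Γ x t) (Γ x r))) t := by
    refine Eventually.of_forall fun r => ?_
    simp only [(mem_boundary_iff_of_mem_source he hI hs).1 hb]
    have : extChartAt I (Γ x t) (Γ x r) ∈ {y | 0 ≤ ℓ y} := hI ▸ extChartAt_mem_range _ _
    exact this
  have := hmin.hasDerivAt_eq_zero hd2
  have h2 := hin _ hb
  rw [this] at h2
  exact lt_irrefl _ h2

omit [IsManifold I ∞ M] in
theorem IsOrbitFamily.curve_add (hΓ : IsOrbitFamily I ι V Γ) (x : K) {a b : ℝ} (ha : 0 ≤ a) :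
    IsMIntegralCurveOn (I := I) (fun u => Γ x (u + a)) V (Icc 0 b) := by
  refine ((hΓ.curve x).comp_add a).mono fun u hu => ?_
  simp only [Set.mem_ofPred_eq, mem_Ici]
  linarith [hu.1]

variable [T2Space M]

theorem IsOrbitFamily.eq_of_curve (hΓ : IsOrbitFamily I ι V Γ)
    (hV : ContMDiff I I.tangent 1 (fun p => (⟨p, V p⟩ : TangentBundle I M))) {δ : ℝ → M} {s t : ℝ}
    (hs : 0 ≤ s) (ht : 0 ≤ t) {x : K} (hδ : IsMIntegralCurveOn (I := I) δ V (Icc 0 s))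
    (h0 : δ 0 = Γ x t) : δ s = Γ x (s + t) :=
  hδ.eq_of_eq hV ordConnected_Icc (hΓ.curve_add x ht) (a := 0) (b := s) ⟨le_rfl, hs⟩ ⟨hs, le_rfl⟩
    (by simpa using h0)

/-- A curve in the interior which ends on an orbit can be followed backwards along this orbit, since
it cannot reach the boundary point where the orbit starts. -/
theorem IsOrbitFamily.eq_of_curve_backward (hΓ : IsOrbitFamily I ι V Γ)
    (hV : ContMDiff I I.tangent 1 (fun p => (⟨p, V p⟩ : TangentBundle I M)))
    (hι : ∀ x, ι x ∈ I.boundary M) {δ : ℝ → M} {s t : ℝ}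
    (hs : 0 ≤ s) (ht : 0 ≤ t) {x : K} (hδ : IsMIntegralCurveOn (I := I) δ V (Icc 0 s))
    (hint : ∀ u ∈ Icc 0 s, δ u ∈ I.interior M)
    (h0 : δ s = Γ x t) : s ≤ t ∧ δ 0 = Γ x (t - s) := by
  rcases le_or_gt s t with hst | hst
  · refine ⟨hst, ?_⟩
    have := hδ.eq_of_eq hV ordConnected_Icc (hΓ.curve_add x (sub_nonneg.2 hst)) (a := s) (b := 0)
      ⟨hs, le_rfl⟩ ⟨le_rfl, hs⟩ (by simpa using h0)
    simpa using this
  · exfalso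
    have h1 : IsMIntegralCurveOn (I := I) (fun u => δ (u + (s - t))) V (Icc 0 t) := by
      refine (hδ.comp_add (s - t)).mono fun u hu => ?_
      simp only [Set.mem_ofPred_eq, mem_Icc]
      constructor <;> linarith [hu.1, hu.2]
    have := h1.eq_of_eq hV ordConnected_Icc (hΓ.curve_add x le_rfl) (a := t) (b := 0)
      ⟨ht, le_rfl⟩ ⟨le_rfl, ht⟩ (by simpa using h0)
    simp only [zero_add, hΓ.zero] at this
    have h2 := hint (s - t) ⟨by linarith, by linarith⟩
    rw [this, ← I.compl_boundary] at h2
    exact h2 (hι x)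

/-- Two orbits which meet coincide up to a shift of time, and the shift vanishes because positive
times belong to interior points. -/
theorem IsOrbitFamily.injective (hΓ : IsOrbitFamily I ι V Γ) (he : ℓ e = 1)
    (hI : range I = {y | 0 ≤ ℓ y}) (hin : ∀ p ∈ I.boundary M, 0 < ℓ (V p))
    (hV : ContMDiff I I.tangent 1 (fun p => (⟨p, V p⟩ : TangentBundle I M)))
    (hι : ∀ x, ι x ∈ I.boundary M) (hinj : Function.Injective ι) {x y : K} {s t : ℝ}
    (hs : 0 ≤ s) (ht : 0 ≤ t) (h : Γ x s = Γ y t) : x = y ∧ s = t := by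
  wlog hst : s ≤ t generalizing x y s t
  · obtain ⟨h1, h2⟩ := this ht hs h.symm (le_of_not_ge hst)
    exact ⟨h1.symm, h2.symm⟩
  have h1 := (hΓ.curve_add x le_rfl).eq_of_eq hV ordConnected_Icc
    (hΓ.curve_add y (sub_nonneg.2 hst)) (a := s) (b := 0) ⟨hs, le_rfl⟩ ⟨le_rfl, hs⟩
    (by simpa using h)
  simp only [zero_add, hΓ.zero] at h1
  have h2 : t - s = 0 := by
    by_contra hne
    have h3 := hΓ.mem_interior he hI hin (x := y) (t := t - s)
      (lt_of_le_of_ne (sub_nonneg.2 hst) (Ne.symm hne))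
    rw [← h1, ← I.compl_boundary] at h3
    exact h3 (hι x)
  rw [h2, hΓ.zero] at h1
  exact ⟨hinj h1, by linarith⟩

variable [FiniteDimensional ℝ E]

/-- Near the boundary, the orbits are given by a smooth local flow in a chart. -/
theorem IsOrbitFamily.exists_flowBox (hΓ : IsOrbitFamily I ι V Γ) (he : ℓ e = 1)
    (hI : range I = {y | 0 ≤ ℓ y}) (hin : ∀ p ∈ I.boundary M, 0 < ℓ (V p))
    (hV : ContMDiff I I.tangent ∞ (fun p => (⟨p, V p⟩ : TangentBundle I M)))
    (hι : ∀ x, ι x ∈ I.boundary M) (x₀ : K) {n : ℕ} (hn : 1 ≤ n) :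
    ∃ (φ : ℝ × E → E) (r : ℝ), 0 < r ∧
      (∀ z ∈ Metric.ball ((0 : ℝ), extChartAt I (ι x₀) (ι x₀)) r, ContDiffAt ℝ n φ z) ∧
      (∀ y ∈ Metric.ball (extChartAt I (ι x₀) (ι x₀)) r, φ (0, y) = y) ∧
      HasDerivAt (fun t => φ (t, extChartAt I (ι x₀) (ι x₀))) (V (ι x₀) : E) 0 ∧
      (∀ y ∈ Metric.ball (extChartAt I (ι x₀) (ι x₀)) r,
        StrictMonoOn (fun t => ℓ (φ (t, y))) (Ioo (-r) r)) ∧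
      ∀ x, ι x ∈ (chartAt H (ι x₀)).source →
        extChartAt I (ι x₀) (ι x) ∈ Metric.ball (extChartAt I (ι x₀) (ι x₀)) r →
        ∀ u ∈ Ico 0 r, φ (u, extChartAt I (ι x₀) (ι x)) ∈ (extChartAt I (ι x₀)).target ∧
          Γ x u = (extChartAt I (ι x₀)).symm (φ (u, extChartAt I (ι x₀) (ι x))) := by
  obtain ⟨φ, r, hr, hφ, hφ0, hφm, hφd, hφc, -, hbd⟩ := exists_localFlow he hI hV (ι x₀) hn
  have hbd' := hbd (hin _ (hι x₀))
  refine ⟨φ, r, hr, hφ, hφ0, hφd, hbd', fun x hxs hxb u hu => ?_⟩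
  have hmem : ∀ v ∈ Ico 0 r, |v| < r ∧ φ (v, extChartAt I (ι x₀) (ι x)) ∈ range I := by
    intro v hv
    have hvr : |v| < r := by rw [abs_of_nonneg hv.1]; exact hv.2
    refine ⟨hvr, ?_⟩
    rw [hI]
    have hq0 : extChartAt I (ι x₀) (ι x) ∈ {y | 0 ≤ ℓ y} := hI ▸ extChartAt_mem_range _ _
    have := (hbd' _ hxb).monotoneOn (a := 0) (b := v) ⟨by linarith, hr⟩ (abs_lt.1 hvr) hv.1
    simp only [hφ0 _ hxb] at this
    exact le_trans hq0 this
  refine ⟨hφm _ hxb u (hmem u hu).1 (hmem u hu).2, ?_⟩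
  have hc : IsMIntegralCurveOn (I := I)
      (fun t => (extChartAt I (ι x₀)).symm (φ (t, extChartAt I (ι x₀) (ι x)))) V (Icc 0 u) :=
    (hφc _ hxb).mono fun v hv => hmem v ⟨hv.1, hv.2.trans_lt hu.2⟩
  have := hΓ.eq_of_curve (hV.of_le (by simp)) hu.1 le_rfl (x := x) hc (by
    simp only [hφ0 _ hxb, hΓ.zero]
    exact (extChartAt I (ι x₀)).left_inv (by simpa using hxs))
  rw [add_zero] at this
  exact this.symm

variable {E' H' : Type*} [NormedAddCommGroup E'] [NormedSpace ℝ E'] [FiniteDimensional ℝ E']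
  [TopologicalSpace H'] {J : ModelWithCorners ℝ E' H'} [J.Boundaryless]
  [TopologicalSpace K] [ChartedSpace H' K] [IsManifold J ∞ K]

/-- For small times, `(x, t) ↦ Γ x t` is continuous. -/
theorem IsOrbitFamily.exists_tendsto (hΓ : IsOrbitFamily I ι V Γ) (he : ℓ e = 1)
    (hI : range I = {y | 0 ≤ ℓ y}) (hin : ∀ p ∈ I.boundary M, 0 < ℓ (V p))
    (hV : ContMDiff I I.tangent ∞ (fun p => (⟨p, V p⟩ : TangentBundle I M)))
    (hι : ∀ x, ι x ∈ I.boundary M) (hιc : Continuous ι) (x₀ : K) :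
    ∃ r > 0, ∀ t ∈ Ico 0 r,
      Tendsto (fun z : K × ℝ => Γ z.1 z.2) (𝓝 x₀ ×ˢ 𝓝[Ici 0] t) (𝓝 (Γ x₀ t)) := by
  obtain ⟨φ, r, hr, hφ, hφ0, hφd, hbd, hbox⟩ := hΓ.exists_flowBox he hI hin hV hι x₀ le_rfl
  refine ⟨r, hr, fun t ht => ?_⟩
  have h0 := hbox x₀ (mem_chart_source H _) (Metric.mem_ball_self hr)
  have hx : ∀ᶠ x in 𝓝 x₀, ι x ∈ (chartAt H (ι x₀)).source ∧
      extChartAt I (ι x₀) (ι x) ∈ Metric.ball (extChartAt I (ι x₀) (ι x₀)) r :=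
    hιc.continuousAt.eventually (Filter.Eventually.and
      ((chartAt H (ι x₀)).open_source.mem_nhds (mem_chart_source H (ι x₀)))
      ((continuousAt_extChartAt (ι x₀)).eventually (Metric.ball_mem_nhds _ hr)))
  have ht' : ∀ᶠ u in 𝓝[Ici 0] t, u ∈ Ico 0 r := by
    filter_upwards [self_mem_nhdsWithin, mem_nhdsWithin_of_mem_nhds (Iio_mem_nhds ht.2)] with u h h'
    exact ⟨h, h'⟩
  have hev := hx.prod_mk ht'
  have hφt : Tendsto (fun z : K × ℝ => φ (z.2, extChartAt I (ι x₀) (ι z.1)))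
      (𝓝 x₀ ×ˢ 𝓝[Ici 0] t) (𝓝 (φ (t, extChartAt I (ι x₀) (ι x₀)))) := by
    have hc : ContinuousAt φ (t, extChartAt I (ι x₀) (ι x₀)) :=
      (hφ _ (by
        rw [Metric.mem_ball, Prod.dist_eq, dist_self, max_eq_left dist_nonneg, Real.dist_eq,
          sub_zero, abs_of_nonneg ht.1]
        exact ht.2)).continuousAt
    refine hc.tendsto.comp (Tendsto.prodMk_nhds ?_ ?_)
    · exact tendsto_snd.mono_right nhdsWithin_le_nhds
    · exact ((continuousAt_extChartAt (ι x₀)).tendsto.comp hιc.continuousAt.tendsto).comp tendsto_fst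
  rw [(h0 t ht).2]
  have hs := ((continuousOn_extChartAt_symm (I := I) (ι x₀)) _ (h0 t ht).1).tendsto.comp
    (tendsto_nhdsWithin_iff.2 ⟨hφt, hev.mono fun z hz => (hbox z.1 hz.1.1 hz.1.2 z.2 hz.2).1⟩)
  refine hs.congr' (hev.mono fun z hz => ?_)
  exact (hbox z.1 hz.1.1 hz.1.2 z.2 hz.2).2.symm

/-- The orbits through the boundary sweep out a neighbourhood of the boundary, and the boundary
point through which the orbit of `q` passes depends smoothly on `q`. -/
theorem IsOrbitFamily.exists_collar (hΓ : IsOrbitFamily I ι V Γ) (he : ℓ e = 1)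
    (hI : range I = {y | 0 ≤ ℓ y}) (hin : ∀ p ∈ I.boundary M, 0 < ℓ (V p))
    (hV : ContMDiff I I.tangent ∞ (fun p => (⟨p, V p⟩ : TangentBundle I M)))
    (hι : ∀ x, ι x ∈ I.boundary M) (hιs : ContMDiff J I ∞ ι)
    (hιd : ∀ x, Function.Injective (mfderiv J I ι x))
    (hdim : Module.finrank ℝ E' + 1 = Module.finrank ℝ E) (x₀ : K) {n : ℕ} (hn : 1 ≤ n) :
    ∃ (X : M → K) (T : M → ℝ), ContMDiffAt I J n X (ι x₀) ∧ Tendsto T (𝓝 (ι x₀)) (𝓝 0) ∧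
      ∀ᶠ q in 𝓝 (ι x₀), 0 ≤ T q ∧ q = Γ (X q) (T q) := by
  obtain ⟨φ, r, hr, hφ, hφ0, hφd, hbd, hbox⟩ := hΓ.exists_flowBox he hI hin hV hι x₀ hn
  set p := ι x₀ with hp
  set y₀ := extChartAt I p p with hy₀
  set w₀ := extChartAt J x₀ x₀ with hw₀
  set j := chartMap J I ι x₀ p with hj
  have hn0 : (n : ℕ∞ω) ≠ 0 := by exact_mod_cast (by omega : n ≠ 0)
  have hrJ : range J = univ := J.range_eq_univ
  have hxs := mem_chart_source H' x₀
  have hps := mem_chart_source H p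
  have hjd : ContDiffAt ℝ n j w₀ := by
    have := contDiffWithinAt_chartMap (p := x₀) (p' := p) (n := n)
      ((hιs x₀).of_le (by exact_mod_cast le_top)) hxs hps
    rwa [hrJ, contDiffWithinAt_univ] at this
  have hjv : j w₀ = y₀ := by
    rw [hj, chartMap, extChartAt_to_inv]
  have hevw : ∀ᶠ w in 𝓝 w₀, w ∈ (extChartAt J x₀).target ∧
      ι ((extChartAt J x₀).symm w) ∈ (chartAt H p).source := by
    have := eventually_nhdsWithin_range_extChartAt (I := J) hxs
      (hιs.continuous.continuousAt.eventually ((chartAt H p).open_source.mem_nhds hps))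
    rw [hrJ, nhdsWithin_univ] at this
    exact this.mono fun w hw => ⟨hw.1, hw.2.2⟩
  have hjℓ : ∀ᶠ w in 𝓝 w₀, ℓ (j w) = 0 := hevw.mono fun w hw =>
    (mem_boundary_iff_of_mem_source he hI hw.2).1 (hι _)
  have hjball : ∀ᶠ w in 𝓝 w₀, j w ∈ Metric.ball y₀ r :=
    hjd.continuousAt.eventually (by rw [hjv]; exact Metric.ball_mem_nhds _ hr)
  have hjD : HasFDerivAt j (fderiv ℝ j w₀) w₀ := (hjd.differentiableAt hn0).hasFDerivAt
  have hDinj : Function.Injective (fderiv ℝ j w₀) := by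
    rw [injective_iff_map_eq_zero]
    intro v hv
    have h1 := fderivWithin_chartMap (I := J) (J := I) (p := x₀) (p' := p) (f := ι)
      ((hιs x₀).mdifferentiableAt (by simp)) hxs hps v
    rw [hrJ, fderivWithin_univ] at h1
    have h2 : chartD I p (ι x₀) (mfderiv J I ι x₀ (chartDInv J x₀ x₀ v)) = 0 := h1.symm.trans hv
    have h3 := congrArg (chartDInv I p (ι x₀)) h2
    rw [chartDInv_chartD hps, map_zero] at h3
    have h4 := hιd x₀ (h3.trans (map_zero _).symm)
    have h5 := congrArg (chartD J x₀ x₀) h4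
    rwa [chartD_chartDInv hxs, map_zero] at h5
  have hDℓ : ∀ v, ℓ (fderiv ℝ j w₀ v) = 0 := by
    intro v
    have h1 : HasFDerivAt (fun w => ℓ (j w)) (ℓ.comp (fderiv ℝ j w₀)) w₀ :=
      ℓ.hasFDerivAt.comp w₀ hjD
    have h2 : HasFDerivAt (fun w => ℓ (j w)) (0 : E' →L[ℝ] ℝ) w₀ :=
      (hasFDerivAt_const (0 : ℝ) w₀).congr_of_eventuallyEq hjℓ
    exact DFunLike.congr_fun (h1.unique h2) v
  -- the orbits in the chart; the differential at `(0, w₀)` is invertible because the field is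
  -- transverse to the boundary
  set Ψ : ℝ × E' → E := fun z => φ (z.1, j z.2) with hΨ
  have hΨd : ContDiffAt ℝ n Ψ (0, w₀) := by
    have h1 : ContDiffAt ℝ n φ ((fun z : ℝ × E' => (z.1, j z.2)) (0, w₀)) := by
      simp only [hjv]
      exact hφ _ (Metric.mem_ball_self hr)
    refine h1.comp (0, w₀) (contDiffAt_fst.prodMk ?_)
    exact ContDiffAt.comp (g := j) (f := Prod.snd) ((0 : ℝ), w₀) hjd contDiffAt_snd
  have hΨv : Ψ (0, w₀) = y₀ := by
    simp only [hΨ, hjv]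
    exact hφ0 _ (Metric.mem_ball_self hr)
  have hL : HasFDerivAt Ψ (fderiv ℝ Ψ (0, w₀)) (0, w₀) :=
    (hΨd.differentiableAt hn0).hasFDerivAt
  obtain ⟨v₀, hv₀, hL1⟩ : ∃ v₀ : E, 0 < ℓ v₀ ∧ fderiv ℝ Ψ (0, w₀) (1, 0) = v₀ := by
    refine ⟨(V p : E), hin _ (hι x₀), ?_⟩
    have h1 : HasDerivAt (fun t : ℝ => (t, w₀)) ((1 : ℝ), (0 : E')) 0 :=
      (hasDerivAt_id 0).prodMk (hasDerivAt_const 0 w₀)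
    have h2 : HasDerivAt (fun t : ℝ => Ψ (t, w₀)) (fderiv ℝ Ψ (0, w₀) (1, 0)) 0 :=
      HasFDerivAt.comp_hasDerivAt (x := (0 : ℝ)) (f := fun t : ℝ => (t, w₀)) hL h1
    refine h2.unique ?_
    simp only [hΨ, hjv]
    exact hφd
  have hL2 : ∀ v, fderiv ℝ Ψ (0, w₀) (0, v) = fderiv ℝ j w₀ v := by
    intro v
    have h1 : HasFDerivAt (fun w : E' => ((0 : ℝ), w))
        ((0 : E' →L[ℝ] ℝ).prod (ContinuousLinearMap.id ℝ E')) w₀ :=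
      (hasFDerivAt_const (0 : ℝ) w₀).prodMk (hasFDerivAt_id w₀)
    have h2 : HasFDerivAt (fun w => Ψ (0, w)) _ w₀ :=
      HasFDerivAt.comp (x := w₀) (f := fun w : E' => ((0 : ℝ), w)) hL h1
    have h3 : HasFDerivAt (fun w => Ψ (0, w)) (fderiv ℝ j w₀) w₀ :=
      hjD.congr_of_eventuallyEq (hjball.mono fun w hw => hφ0 _ hw)
    exact DFunLike.congr_fun (h2.unique h3) v
  have hLinj : Function.Injective (fderiv ℝ Ψ (0, w₀)) := by
    rw [injective_iff_map_eq_zero]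
    rintro ⟨a, v⟩ hav
    have h1 : ((a, v) : ℝ × E') = a • (1, 0) + (0, v) := by simp
    rw [h1, map_add, map_smul, hL1, hL2] at hav
    have h2 := congrArg ℓ hav
    rw [map_add, map_smul, hDℓ, add_zero, map_zero, smul_eq_mul] at h2
    have ha : a = 0 := (mul_eq_zero.1 h2).resolve_right hv₀.ne'
    rw [ha, zero_smul, zero_add] at hav
    rw [ha, hDinj (hav.trans (map_zero _).symm)]
    rfl
  have hfr : Module.finrank ℝ (ℝ × E') = Module.finrank ℝ E := by
    rw [Module.finrank_prod, Module.finrank_self, ← hdim, add_comm]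
  set L : (ℝ × E') ≃L[ℝ] E :=
    (LinearEquiv.ofInjectiveOfFinrankEq (fderiv ℝ Ψ (0, w₀) : ℝ × E' →ₗ[ℝ] E) hLinj
      hfr).toContinuousLinearEquiv with hLdef
  have hL' : HasFDerivAt Ψ (L : ℝ × E' →L[ℝ] E) (0, w₀) := by
    convert! hL using 1
  have hst := hΨd.hasStrictFDerivAt' hL' hn0
  set inv := hΨd.localInverse hL' hn0 with hinv
  have hinvd : ContDiffAt ℝ n inv y₀ := hΨv ▸ hΨd.to_localInverse hL' hn0
  have hinv0 : inv y₀ = (0, w₀) := hΨv ▸ hΨd.localInverse_apply_image hL' hn0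
  have hright : ∀ᶠ y in 𝓝 y₀, Ψ (inv y) = y := hΨv ▸ hst.eventually_right_inverse
  have hinvc : ContMDiffAt I 𝓘(ℝ, ℝ × E') n (fun q => inv (extChartAt I p q)) p :=
    (hinvd.contMDiffAt).comp p ((contMDiffAt_extChartAt (n := ∞)).of_le (by exact_mod_cast le_top))
  have hinvt : Tendsto (fun q => inv (extChartAt I p q)) (𝓝 p) (𝓝 (0, w₀)) := by
    have := hinvc.continuousAt.tendsto
    rwa [← hy₀, hinv0] at this
  refine ⟨fun q => (extChartAt J x₀).symm (inv (extChartAt I p q)).2,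
    fun q => (inv (extChartAt I p q)).1, ?_, ?_, ?_⟩
  · have h1 : ContMDiffAt 𝓘(ℝ, E') J n (extChartAt J x₀).symm w₀ :=
      ((contMDiffOn_extChartAt_symm (n := ∞) x₀).contMDiffAt
        (extChartAt_target_mem_nhds x₀)).of_le (by exact_mod_cast le_top)
    have h2 : ContMDiffAt I 𝓘(ℝ, E') n (fun q => (inv (extChartAt I p q)).2) p :=
      (contDiffAt_snd.contMDiffAt).comp p hinvc
    refine ContMDiffAt.comp_of_eq h1 h2 ?_
    rw [← hy₀, hinv0]
  · exact (continuous_fst.tendsto _).comp hinvt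
  · have e1 : ∀ᶠ q in 𝓝 p, Ψ (inv (extChartAt I p q)) = extChartAt I p q :=
      (continuousAt_extChartAt p).eventually hright
    have e2 : ∀ᶠ z in 𝓝 ((0 : ℝ), w₀), |z.1| < r ∧ z.2 ∈ (extChartAt J x₀).target ∧
        ι ((extChartAt J x₀).symm z.2) ∈ (chartAt H p).source ∧ ℓ (j z.2) = 0 ∧
        j z.2 ∈ Metric.ball y₀ r := by
      have h1 : ∀ᶠ t : ℝ in 𝓝 0, |t| < r :=
        (continuous_abs.tendsto' 0 0 abs_zero).eventually (gt_mem_nhds hr)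
      have := h1.prod_mk ((hevw.and hjℓ).and hjball)
      rw [← nhds_prod_eq] at this
      exact this.mono fun z hz => ⟨hz.1, hz.2.1.1.1, hz.2.1.1.2, hz.2.1.2, hz.2.2⟩
    filter_upwards [e1, hinvt.eventually e2, (chartAt H p).open_source.mem_nhds hps]
      with q hq1 hq2 hq3
    obtain ⟨ht, hw1, hw2, hw3, hw4⟩ := hq2
    set t := (inv (extChartAt I p q)).1
    set w := (inv (extChartAt I p q)).2
    have hΨq : φ (t, j w) = extChartAt I p q := hq1
    -- the height increases along the flow and vanishes at time `0`, so that the points of the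
    -- half-space are reached at times `t ≥ 0`
    have ht0 : 0 ≤ t := by
      by_contra hneg
      have := hbd _ hw4 (a := t) (b := 0) (abs_lt.1 ht) ⟨by linarith, hr⟩ (not_le.1 hneg)
      simp only [hφ0 _ hw4, hw3, hΨq] at this
      have h2 : extChartAt I p q ∈ {y | 0 ≤ ℓ y} := hI ▸ extChartAt_mem_range p q
      exact absurd this (not_lt.2 h2)
    refine ⟨ht0, ?_⟩
    have h1 := (hbox ((extChartAt J x₀).symm w) hw2 hw4 t ⟨ht0, (abs_lt.1 ht).2⟩).2
    rw [h1]
    change q = (extChartAt I p).symm (φ (t, j w))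
    rw [hΨq, (extChartAt I p).left_inv (by simpa using hq3)]

end BoundaryOrbits

section Projection

variable {E H : Type*} [NormedAddCommGroup E] [NormedSpace ℝ E] [FiniteDimensional ℝ E]
  [TopologicalSpace H] {I : ModelWithCorners ℝ E H} {ℓ : E →L[ℝ] ℝ} {e : E}
  {M : Type*} [TopologicalSpace M] [T2Space M] [ChartedSpace H M] [IsManifold I ∞ M]
  {E' H' : Type*} [NormedAddCommGroup E'] [NormedSpace ℝ E'] [FiniteDimensional ℝ E']
  [TopologicalSpace H'] {J : ModelWithCorners ℝ E' H'} [J.Boundaryless]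
  {K : Type*} [TopologicalSpace K] [ChartedSpace H' K] [IsManifold J ∞ K]
  {ι : K → M} {V : ∀ p : M, TangentSpace I p} {Γ : K → ℝ → M}

/-- The union of the orbits `Γ x`. -/
def orbitSet {K M : Type*} (Γ : K → ℝ → M) : Set M := {q | ∃ x t, 0 ≤ t ∧ Γ x t = q}

omit [FiniteDimensional ℝ E'] [J.Boundaryless] [IsManifold J ∞ K] in
/-- The local flow transports the smoothness of a map which is constant on the orbits. -/
theorem IsOrbitFamily.smooth_transfer (hΓ : IsOrbitFamily I ι V Γ) (he : ℓ e = 1)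
    (hI : range I = {y | 0 ≤ ℓ y})
    (hV : ContMDiff I I.tangent ∞ (fun p => (⟨p, V p⟩ : TangentBundle I M)))
    (hι : ∀ x, ι x ∈ I.boundary M) {n : ℕ} (hn : 1 ≤ n) {pr : M → K}
    (hpr : ∀ x t, 0 ≤ t → pr (Γ x t) = x) {p : M} (hp : p ∈ I.interior M) :
    ∃ r > 0, ∀ᶠ a in 𝓝 p, ∀ x t s, 0 ≤ t → 0 ≤ t + s → |s| < r → a = Γ x t →
      (orbitSet Γ ∈ 𝓝 (Γ x (t + s)) ∧ ContMDiffAt I J n pr (Γ x (t + s))) →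
      (orbitSet Γ ∈ 𝓝 (Γ x t) ∧ ContMDiffAt I J n pr (Γ x t)) := by
  obtain ⟨φ, r, hr, hφ, hφ0, hφm, -, hφc, hint, -⟩ := exists_localFlow he hI hV p hn
  have hint' := hint hp
  have hV1 : ContMDiff I I.tangent 1 (fun p => (⟨p, V p⟩ : TangentBundle I M)) :=
    hV.of_le (by simp)
  have hpos : ∀ y : E, 0 < ℓ y → y ∈ range I := fun y hy => by
    rw [hI]
    exact hy.le
  set c := extChartAt I p
  set Φ : ℝ → M → M := fun s q => c.symm (φ (s, c q)) with hΦ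
  have hev : ∀ᶠ a in 𝓝 p, a ∈ (chartAt H p).source ∧ c a ∈ Metric.ball (c p) r :=
    Filter.Eventually.and ((chartAt H p).open_source.mem_nhds (mem_chart_source H p))
      ((continuousAt_extChartAt p).eventually (Metric.ball_mem_nhds _ hr))
  have hcurve : ∀ q, c q ∈ Metric.ball (c p) r →
      IsMIntegralCurveOn (I := I) (fun s => Φ s q) V (Ioo (-r) r) := fun q hq =>
    (hφc _ hq).mono fun s hs => ⟨abs_lt.2 hs, hpos _ (hint' _ hq s (abs_lt.2 hs))⟩
  have hzero : ∀ q, q ∈ (chartAt H p).source → c q ∈ Metric.ball (c p) r → Φ 0 q = q := by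
    intro q hqs hq
    simp only [hΦ, hφ0 _ hq]
    exact (extChartAt I p).left_inv (by simpa using hqs)
  have hΦint : ∀ q s, c q ∈ Metric.ball (c p) r → |s| < r → Φ s q ∈ I.interior M := by
    intro q s hq hs
    have h1 := hint' _ hq s hs
    have h2 := hφm _ hq s hs (hpos _ h1)
    have h3 := (extChartAt I p).map_target h2
    rw [extChartAt_source] at h3
    rw [mem_interior_iff_of_mem_source he hI (p := p) h3, (extChartAt I p).right_inv h2]
    exact h1
  -- two points related by the local flow lie on the same orbit
  have hfwd : ∀ q s x t, q ∈ (chartAt H p).source → c q ∈ Metric.ball (c p) r → |s| < r →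
      0 ≤ t → q = Γ x t → 0 ≤ t + s → Φ s q = Γ x (t + s) := by
    intro q s x t hqs hq hs ht hqt hts
    have hs' := abs_lt.1 hs
    rcases le_total 0 s with h0 | h0
    · have := hΓ.eq_of_curve hV1 h0 ht (x := x) ((hcurve q hq).mono fun u hu =>
        ⟨by linarith [hu.1], by linarith [hu.2]⟩) (by rw [hzero q hqs hq, hqt])
      rw [this, add_comm]
    · have hc : IsMIntegralCurveOn (I := I) (fun u => Φ (u + s) q) V (Icc 0 (-s)) := by
        refine ((hcurve q hq).comp_add s).mono fun u hu => ?_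
        simp only [Set.mem_ofPred_eq, mem_Ioo]
        constructor <;> linarith [hu.1, hu.2]
      have := (hΓ.eq_of_curve_backward hV1 hι (by linarith) ht (x := x) hc
        (fun u hu => hΦint q _ hq (abs_lt.2 ⟨by linarith [hu.1], by linarith [hu.2]⟩))
        (by simp only [neg_add_cancel]; rw [hzero q hqs hq, hqt])).2
      simpa using this
  have hbwd : ∀ q s, q ∈ (chartAt H p).source → c q ∈ Metric.ball (c p) r → |s| < r →
      Φ s q ∈ orbitSet Γ → q ∈ orbitSet Γ ∧ pr q = pr (Φ s q) := by
    rintro q s hqs hq hs ⟨x, t, ht, hqt⟩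
    have hs' := abs_lt.1 hs
    rcases le_total 0 s with h0 | h0
    · have := hΓ.eq_of_curve_backward hV1 hι h0 ht (x := x) ((hcurve q hq).mono fun u hu =>
        ⟨by linarith [hu.1], by linarith [hu.2]⟩)
        (fun u hu => hΦint q u hq (abs_lt.2 ⟨by linarith [hu.1], by linarith [hu.2]⟩)) hqt.symm
      rw [hzero q hqs hq] at this
      rw [← hqt, hpr x t ht, this.2, hpr _ _ (sub_nonneg.2 this.1)]
      exact ⟨⟨x, _, sub_nonneg.2 this.1, rfl⟩, rfl⟩
    · have hc : IsMIntegralCurveOn (I := I) (fun u => Φ (u + s) q) V (Icc 0 (-s)) := by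
        refine ((hcurve q hq).comp_add s).mono fun u hu => ?_
        simp only [Set.mem_ofPred_eq, mem_Ioo]
        constructor <;> linarith [hu.1, hu.2]
      have := hΓ.eq_of_curve hV1 (by linarith) ht (x := x) hc (by simp [hqt])
      simp only [neg_add_cancel, hzero q hqs hq] at this
      have hnn : 0 ≤ -s + t := by linarith
      rw [← hqt, hpr x t ht, this, hpr _ _ hnn]
      exact ⟨⟨x, _, hnn, rfl⟩, rfl⟩
  refine ⟨r, hr, ?_⟩
  filter_upwards [hev] with a ha x t s ht hts hs hat hC
  obtain ⟨has, hab⟩ := ha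
  have hΦa : Φ s a = Γ x (t + s) := hfwd a s x t has hab hs ht hat hts
  have hΦd : ContMDiffAt I I n (Φ s) a := by
    have h1 : ContMDiffAt I 𝓘(ℝ, E) n c a :=
      (contMDiffAt_extChartAt' (n := ∞) has).of_le (by exact_mod_cast le_top)
    have h2 : ContDiffAt ℝ n φ (s, c a) := hφ _ (by
      rw [Metric.mem_ball, Prod.dist_eq, Real.dist_eq, sub_zero]
      exact max_lt hs hab)
    have h3 : ContMDiffAt I 𝓘(ℝ, E) n (fun q => φ (s, c q)) a :=
      ((h2.comp (c a) (contDiffAt_const.prodMk contDiffAt_id)).contMDiffAt).comp a h1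
    have h4 : ContMDiffWithinAt 𝓘(ℝ, E) I n c.symm (range I) (φ (s, c a)) :=
      (contMDiffWithinAt_extChartAt_symm_range (n := ∞) p
        (hφm _ hab s hs (hpos _ (hint' _ hab s hs)))).of_le (by exact_mod_cast le_top)
    have h5 : ∀ᶠ q in 𝓝 a, φ (s, c q) ∈ range I := by
      filter_upwards [(continuousAt_extChartAt' (I := I) (by simpa using has)).eventually
        (Metric.isOpen_ball.mem_nhds hab)] with q hq
      exact hpos _ (hint' _ hq s hs)
    exact (ContMDiffWithinAt.comp a h4 (h3.contMDiffWithinAt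
      (s := {q | φ (s, c q) ∈ range I})) fun q hq => hq).contMDiffAt h5
  rw [← hΦa] at hC
  rw [← hat]
  have hnear : ∀ᶠ q in 𝓝 a, q ∈ orbitSet Γ ∧ pr q = pr (Φ s q) := by
    filter_upwards [hΦd.continuousAt.eventually hC.1, (chartAt H p).open_source.mem_nhds has,
      (continuousAt_extChartAt' (I := I) (by simpa using has)).eventually
        (Metric.isOpen_ball.mem_nhds hab)] with q hq1 hq2 hq3
    exact hbwd q s hq2 hq3 hs hq1
  refine ⟨hnear.mono fun q hq => hq.1, ?_⟩
  exact (hC.2.comp a hΦd).congr_of_eventuallyEq (hnear.mono fun q hq => hq.2)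

/-- The union of the orbits through the boundary is open, and the projection to the boundary
along the orbits is smooth on it. -/
theorem IsOrbitFamily.exists_projection [Nonempty K] (hΓ : IsOrbitFamily I ι V Γ) (he : ℓ e = 1)
    (hI : range I = {y | 0 ≤ ℓ y}) (hin : ∀ p ∈ I.boundary M, 0 < ℓ (V p))
    (hV : ContMDiff I I.tangent ∞ (fun p => (⟨p, V p⟩ : TangentBundle I M)))
    (hι : ∀ x, ι x ∈ I.boundary M) (hιs : ContMDiff J I ∞ ι) (hinj : Function.Injective ι)
    (hιd : ∀ x, Function.Injective (mfderiv J I ι x))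
    (hdim : Module.finrank ℝ E' + 1 = Module.finrank ℝ E) :
    ∃ pr : M → K, ∀ x t, 0 ≤ t → pr (Γ x t) = x ∧ orbitSet Γ ∈ 𝓝 (Γ x t) ∧
      ContMDiffAt I J ∞ pr (Γ x t) := by
  classical
  have hV1 : ContMDiff I I.tangent 1 (fun p => (⟨p, V p⟩ : TangentBundle I M)) :=
    hV.of_le (by simp)
  let pr : M → K := fun q => if h : q ∈ orbitSet Γ then h.choose else Classical.arbitrary K
  have hpr : ∀ x t, 0 ≤ t → pr (Γ x t) = x := by
    intro x t ht
    have h : Γ x t ∈ orbitSet Γ := ⟨x, t, ht, rfl⟩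
    simp only [pr, dif_pos h]
    obtain ⟨t', ht', h'⟩ := h.choose_spec
    exact (hΓ.injective he hI hin hV1 hι hinj ht' ht h').1
  have key : ∀ n : ℕ, 1 ≤ n → ∀ x t, 0 ≤ t →
      orbitSet Γ ∈ 𝓝 (Γ x t) ∧ ContMDiffAt I J n pr (Γ x t) := by
    intro n hn x t ht
    have h0 : orbitSet Γ ∈ 𝓝 (ι x) ∧ ContMDiffAt I J n pr (ι x) := by
      obtain ⟨X, T, hX, -, hXT⟩ := hΓ.exists_collar he hI hin hV hι hιs hιd hdim x hn
      refine ⟨hXT.mono fun q hq => ⟨X q, T q, hq.1, hq.2.symm⟩, hX.congr_of_eventuallyEq ?_⟩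
      filter_upwards [hXT] with q hq
      calc pr q = pr (Γ (X q) (T q)) := by rw [← hq.2]
        _ = X q := hpr _ _ hq.1
    -- the property holds near the boundary, and its truth is locally constant along the orbit since
    -- it is transported by the local flow
    have hmain := (ordConnected_Ici (a := (0 : ℝ))).isPreconnected.induction₂
      (fun a b => (orbitSet Γ ∈ 𝓝 (Γ x a) ∧ ContMDiffAt I J n pr (Γ x a)) ↔
        (orbitSet Γ ∈ 𝓝 (Γ x b) ∧ ContMDiffAt I J n pr (Γ x b))) ?_
      (fun _ _ _ _ _ _ => Iff.trans) (fun _ _ _ _ => Iff.symm) (x := 0) (y := t) (mem_Ici.2 le_rfl) ht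
    · rw [hΓ.zero] at hmain
      exact hmain.1 h0
    intro t₀ ht₀
    have hcont := ((hΓ.curve x).continuousWithinAt ht₀).tendsto
    rcases (mem_Ici.1 ht₀).eq_or_lt with h00 | h00
    · subst h00
      rw [hΓ.zero] at hcont ⊢
      have h1 := (eventually_mem_nhds_iff.2 h0.1).and (ContMDiffAt.eventually_natCast h0.2)
      filter_upwards [hcont.eventually h1] with b hb
      exact iff_of_true h0 hb
    · obtain ⟨r, hr, hev⟩ := hΓ.smooth_transfer (J := J) he hI hV hι hn hpr
        (hΓ.mem_interior he hI hin (x := x) h00)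
      filter_upwards [hcont.eventually hev, self_mem_nhdsWithin,
        mem_nhdsWithin_of_mem_nhds (Metric.ball_mem_nhds t₀ hr)] with b hb hb0 hbr
      rw [Metric.mem_ball, Real.dist_eq] at hbr
      constructor
      · intro h
        refine hb x b (t₀ - b) hb0 (by simpa using h00.le) (by rwa [abs_sub_comm]) rfl ?_
        simpa using h
      · intro h
        refine hev.self_of_nhds x t₀ (b - t₀) h00.le (by simpa using hb0) hbr rfl ?_
        simpa using h
  refine ⟨pr, fun x t ht => ⟨hpr x t ht, (key 1 le_rfl x t ht).1, ?_⟩⟩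
  rw [contMDiffAt_infty]
  intro n
  rcases Nat.eq_zero_or_pos n with rfl | hn
  · exact (key 1 le_rfl x t ht).2.of_le (by simp)
  · exact (key n hn x t ht).2

end Projection

/-! ### Contact forms and the sign of the top power -/

section ContactAlgebra

variable {V : Type*} [AddCommGroup V] [Module ℝ V] [FiniteDimensional ℝ V]

theorem contact_ne_zero {a : V →ₗ[ℝ] ℝ} {B : V →ₗ[ℝ] V →ₗ[ℝ] ℝ} {m : ℕ}
    (hd : Module.finrank ℝ V = 2 * m + 1)
    (h : ∀ w : Fin (2 * m + 1) → V, LinearIndependent ℝ w →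
      wedgeOnePow a (fun x y => B x y) m w ≠ 0) : a ≠ 0 := by
  rintro rfl
  let b := Module.finBasisOfFinrankEq ℝ V hd
  refine h b b.linearIndependent ?_
  simp [wedgeOnePow]

/-- For a contact form `a` with `Ω = da`, the 2-form `Ω` is non-degenerate on `ker a`. -/
theorem contact_nondegenerate {a : V →ₗ[ℝ] ℝ} {B : V →ₗ[ℝ] V →ₗ[ℝ] ℝ} {m : ℕ}
    (hd : Module.finrank ℝ V = 2 * m + 1) (hB : ∀ x y, B x y = - B y x)
    (h : ∀ w : Fin (2 * m + 1) → V, LinearIndependent ℝ w →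
      wedgeOnePow a (fun x y => B x y) m w ≠ 0) {u : V} (hu : a u = 0)
    (huB : ∀ w, a w = 0 → B u w = 0) : u = 0 := by
  classical
  by_contra hne
  have ha := contact_ne_zero hd h
  obtain ⟨r, hr⟩ : ∃ r, a r ≠ 0 := by
    by_contra! hcon
    exact ha (LinearMap.ext hcon)
  have hker : Module.finrank ℝ (LinearMap.ker a) = 2 * m := by
    have h1 := LinearMap.finrank_range_add_finrank_ker a
    have h2 : LinearMap.range a = ⊤ := LinearMap.range_eq_top.2 (LinearMap.surjective ha)
    rw [h2, finrank_top, Module.finrank_self, hd] at h1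
    omega
  have hu' : (⟨u, hu⟩ : LinearMap.ker a) ≠ 0 := fun h0 => hne (congrArg Subtype.val h0)
  have hli : LinearIndepOn ℝ id ({⟨u, hu⟩} : Set (LinearMap.ker a)) :=
    LinearIndepOn.singleton hu'
  let b := Module.Basis.extend hli
  have : Fintype (hli.extend (subset_univ _)) := FiniteDimensional.fintypeBasisIndex b
  have hcard : Fintype.card (hli.extend (subset_univ _)) = 2 * m := by
    rw [← Module.finrank_eq_card_basis b, hker]
  let eq := Fintype.equivFinOfCardEq hcard
  let b' := b.reindex eq
  have hmem : (⟨u, hu⟩ : LinearMap.ker a) ∈ hli.extend (subset_univ _) :=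
    hli.subset_extend _ rfl
  let k := eq ⟨_, hmem⟩
  have hk : ((b' k : LinearMap.ker a) : V) = u := by
    simp [b', k, b, Module.Basis.reindex_apply]
  -- a basis of `V` made of a vector `r` with `a r ≠ 0` and of a basis of `ker a` containing `u`
  let w : Fin (2 * m + 1) → V := Fin.cons r fun j => (b' j : V)
  have hw : LinearIndependent ℝ w := by
    rw [linearIndependent_finCons]
    refine ⟨b'.linearIndependent.map' (LinearMap.ker a).subtype (by simp), fun hmem => hr ?_⟩
    have : Submodule.span ℝ (range fun j => (b' j : V)) ≤ LinearMap.ker a := by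
      rw [Submodule.span_le]
      rintro _ ⟨j, rfl⟩
      exact (b' j).2
    exact this hmem
  have hw0 : ∀ j, j ≠ 0 → a (w j) = 0 := by
    intro j hj
    obtain ⟨i, rfl⟩ := Fin.exists_succ_eq.2 hj
    exact (b' i).2
  refine h w hw (wedgeOnePow_eq_zero a B m hB w hw0 k.succ (Fin.succ_ne_zero _) fun j hj => ?_)
  have : w k.succ = u := hk
  rw [this]
  exact huB _ (hw0 j hj)

end ContactAlgebra

section ContactForms

variable {E H : Type*} [NormedAddCommGroup E] [NormedSpace ℝ E] [TopologicalSpace H]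
  {I : ModelWithCorners ℝ E H} {M : Type*} [TopologicalSpace M] [ChartedSpace H M]
  [IsManifold I ∞ M]

/-- The exterior derivative of a 1-form at a point, as a bilinear form. -/
def OneForm.dLin (I : ModelWithCorners ℝ E H) (θ : OneForm I M) (q : M) :
    TangentSpace I q →ₗ[ℝ] TangentSpace I q →ₗ[ℝ] ℝ :=
  LinearMap.mk₂ ℝ (fun u v => curl (OneForm.inChart I θ q) (range I) (extChartAt I q q)
      (chartD I q q u) (chartD I q q v))
    (fun _ _ _ => by simp only [map_add, add_apply]) (fun _ _ _ => by simp only [map_smul, smul_apply])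
    (fun _ _ _ => by simp only [map_add]) (fun _ _ _ => by simp only [map_smul])

theorem OneForm.dLin_apply (θ : OneForm I M) (q : M) (u v : TangentSpace I q) :
    OneForm.dLin I θ q u v = OneForm.d I θ q u v :=
  (OneForm.d_eq_curl_self θ q u v).symm

theorem OneForm.d_antisymm (θ : OneForm I M) (q : M) (u v : TangentSpace I q) :
    OneForm.d I θ q u v = - OneForm.d I θ q v u := by
  rw [OneForm.d_eq_curl_self, OneForm.d_eq_curl_self, curl_antisymm]

end ContactForms

section ContactBoundary

variable {m : ℕ} {K : Type*} [TopologicalSpace K]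
  [ChartedSpace (EuclideanSpace ℝ (Fin (2 * m + 1))) K] [IsManifold (𝓡 (2 * m + 1)) ∞ K]
  {α : OneForm (𝓡 (2 * m + 1)) K}

instance instFiniteDimensionalTangentSpace (x : K) :
    FiniteDimensional ℝ (TangentSpace (𝓡 (2 * m + 1)) x) :=
  inferInstanceAs (FiniteDimensional ℝ (EuclideanSpace ℝ (Fin (2 * m + 1))))

omit [IsManifold (𝓡 (2 * m + 1)) ∞ K] in
theorem finrank_tangentSpace_euclidean (x : K) :
    Module.finrank ℝ (TangentSpace (𝓡 (2 * m + 1)) x) = 2 * m + 1 :=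
  (finrank_euclideanSpace_fin : Module.finrank ℝ (EuclideanSpace ℝ (Fin (2 * m + 1))) = 2 * m + 1)

theorem IsContactForm.wedge_ne_zero (h : IsContactForm α) (x : K)
    (w : Fin (2 * m + 1) → TangentSpace (𝓡 (2 * m + 1)) x) (hw : LinearIndependent ℝ w) :
    wedgeOnePow (α x : TangentSpace (𝓡 (2 * m + 1)) x →ₗ[ℝ] ℝ)
      (fun u v => OneForm.dLin (𝓡 (2 * m + 1)) α x u v) m w ≠ 0 := by
  have := h x w hw
  simp only [OneForm.dLin_apply]
  exact this

theorem IsContactForm.ne_zero (h : IsContactForm α) (x : K) : α x ≠ 0 := by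
  intro h0
  refine contact_ne_zero (finrank_tangentSpace_euclidean x) (h.wedge_ne_zero x) ?_
  rw [h0]
  rfl

theorem IsContactForm.exists_apply_ne_zero (h : IsContactForm α) (x : K) : ∃ v, α x v ≠ 0 := by
  by_contra! hc
  exact h.ne_zero x (ContinuousLinearMap.ext hc)

theorem IsContactForm.eq_zero (h : IsContactForm α) {x : K} {u : TangentSpace (𝓡 (2 * m + 1)) x}
    (hu : α x u = 0) (hd : ∀ w, α x w = 0 → OneForm.d (𝓡 (2 * m + 1)) α x u w = 0) : u = 0 :=
  contact_nondegenerate (finrank_tangentSpace_euclidean x)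
    (fun u v => by rw [OneForm.dLin_apply, OneForm.dLin_apply]; exact OneForm.d_antisymm _ _ _ _)
    (h.wedge_ne_zero x) hu (fun w hw => by rw [OneForm.dLin_apply]; exact hd w hw)

end ContactBoundary

section TopPower

/-- A continuous bilinear form as a bilinear form. -/
def bilinOf {E : Type*} [NormedAddCommGroup E] [NormedSpace ℝ E] (A : E →L[ℝ] E →L[ℝ] ℝ) :
    E →ₗ[ℝ] E →ₗ[ℝ] ℝ :=
  LinearMap.mk₂ ℝ (fun u v => A u v) (by simp) (by simp) (by simp) (by simp)

theorem bilinOf_apply {E : Type*} [NormedAddCommGroup E] [NormedSpace ℝ E]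
    (A : E →L[ℝ] E →L[ℝ] ℝ) (u v : E) : bilinOf A u v = A u v := rfl

variable {m : ℕ}

/-- The value on the standard frame of the top power of a 2-form. -/
def frameDensity (m : ℕ) (A : EuclideanSpace ℝ (Fin (2 * m + 2)) →L[ℝ]
    EuclideanSpace ℝ (Fin (2 * m + 2)) →L[ℝ] ℝ) : ℝ :=
  wedgePow (fun u v => A u v) (m + 1) fun i =>
    (EuclideanSpace.single (i : Fin (2 * m + 2)) (1 : ℝ))

/-- The value of `a ∧ Ω^m` on the standard frame of the hyperplane `v₀ = 0`. -/
def boundaryDensity (m : ℕ) (a : EuclideanSpace ℝ (Fin (2 * m + 2)) →L[ℝ] ℝ)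
    (A : EuclideanSpace ℝ (Fin (2 * m + 2)) →L[ℝ] EuclideanSpace ℝ (Fin (2 * m + 2)) →L[ℝ] ℝ) : ℝ :=
  wedgeOnePow a (fun u v => A u v) m fun j =>
    (EuclideanSpace.single (j.succ : Fin (2 * m + 2)) (1 : ℝ))

/-- The top power on the frame obtained from the standard one by replacing the first vector by `N`
and scaling the others by `c`: only the first component of `N` matters. -/
theorem wedgePow_cons_smul_single (A : EuclideanSpace ℝ (Fin (2 * m + 2)) →L[ℝ]
    EuclideanSpace ℝ (Fin (2 * m + 2)) →L[ℝ] ℝ) (N : EuclideanSpace ℝ (Fin (2 * m + 2))) (c : ℝ) :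
    wedgePow (fun u v => A u v) (m + 1) (Fin.cons N fun j : Fin (2 * m + 1) =>
      c • (EuclideanSpace.single (j.succ : Fin (2 * m + 2)) (1 : ℝ) :
        EuclideanSpace ℝ (Fin (2 * m + 2))) : Fin (2 * m + 1 + 1) → _) =
      N 0 * c ^ (2 * m + 1) * frameDensity m A := by
  set f := wedgePowAlt (bilinOf A) (m + 1) with hf
  have hfa : ∀ v, wedgePow (fun u v => A u v) (m + 1) v = f v := fun v =>
    (wedgePowAlt_apply (bilinOf A) (m + 1) v).symm
  set b : Fin (2 * m + 2) → EuclideanSpace ℝ (Fin (2 * m + 2)) :=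
    fun i => EuclideanSpace.single i 1 with hb
  have hN : N = ∑ i, N i • b i := by
    ext j
    simp [hb, Pi.single_apply]
  rw [hfa, frameDensity, hfa]
  have hc : ∀ M : EuclideanSpace ℝ (Fin (2 * m + 2)),
      f (Fin.cons M fun j : Fin (2 * m + 1) => c • b j.succ : Fin (2 * m + 1 + 1) → _) =
      c ^ (2 * m + 1) * f (Fin.cons M fun j : Fin (2 * m + 1) => b j.succ :
        Fin (2 * m + 1 + 1) → _) := by
    intro M
    have := f.toMultilinearMap.map_smul_univ (Fin.cons 1 fun _ => c : Fin (2 * m + 1 + 1) → ℝ)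
      (Fin.cons M fun j : Fin (2 * m + 1) => b j.succ : Fin (2 * m + 1 + 1) → _)
    have hprod : ∏ i : Fin (2 * (m + 1)), (Fin.cons 1 fun _ => c : Fin (2 * m + 1 + 1) → ℝ) i =
        c ^ (2 * m + 1) := by
      change ∏ i : Fin (2 * m + 1 + 1), (Fin.cons 1 fun _ => c : Fin (2 * m + 1 + 1) → ℝ) i = _
      rw [Fin.prod_univ_succ]
      simp
    rw [hprod] at this
    have hcase : ∀ i : Fin (2 * m + 1 + 1),
        (Fin.cons M fun j => c • b j.succ : Fin (2 * m + 1 + 1) → _) i =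
          (Fin.cons 1 fun _ => c : Fin (2 * m + 1 + 1) → ℝ) i •
            (Fin.cons M fun j => b j.succ : Fin (2 * m + 1 + 1) → _) i :=
      Fin.cases (by simp) fun j => by simp
    exact Eq.trans (congrArg f (funext hcase)) this
  rw [hc]
  have hlin : f (Fin.cons N fun j : Fin (2 * m + 1) => b j.succ : Fin (2 * m + 1 + 1) → _) =
      N 0 * f b := by
    have hupd : ∀ M, (Fin.cons M fun j : Fin (2 * m + 1) => b j.succ : Fin (2 * m + 1 + 1) → _) =
        Function.update (b : Fin (2 * m + 1 + 1) → _) 0 M := by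
      intro M
      funext i
      refine Fin.cases ?_ (fun j => ?_) i <;> simp [Fin.succ_ne_zero]
    rw [hupd]
    conv_lhs => rw [hN]
    have h1 := f.map_update_sum Finset.univ (0 : Fin (2 * m + 1 + 1)) (fun i => N i • b i) b
    refine h1.trans ?_
    rw [Finset.sum_eq_single (0 : Fin (2 * m + 2))]
    · have h2 := f.map_update_smul b (0 : Fin (2 * m + 1 + 1)) (N 0) (b 0)
      refine h2.trans ?_
      rw [smul_eq_mul]
      congr 2
      exact Function.update_eq_self (0 : Fin (2 * m + 1 + 1)) b
    · intro i _ hi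
      have h2 := f.map_update_smul b (0 : Fin (2 * m + 1 + 1)) (N i) (b i)
      refine h2.trans ?_
      have h3 := f.map_update_self b (i := (0 : Fin (2 * m + 1 + 1))) (j := i) hi.symm
      rw [h3, smul_zero]
    · simp
  rw [hlin]
  change _ = N 0 * c ^ (2 * m + 1) * f b
  ring

/-- If `N ⌟ Ω = g a`, then the density of the top power of `Ω`, times the transverse component of
`N`, is a multiple of `g`. -/
theorem frameDensity_mul {A : EuclideanSpace ℝ (Fin (2 * m + 2)) →L[ℝ]
    EuclideanSpace ℝ (Fin (2 * m + 2)) →L[ℝ] ℝ} (hA : ∀ u v, A u v = - A v u)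
    {N : EuclideanSpace ℝ (Fin (2 * m + 2))} {a : EuclideanSpace ℝ (Fin (2 * m + 2)) →L[ℝ] ℝ}
    {g : ℝ} (h : ∀ w, A N w = g * a w) :
    N 0 * frameDensity m A = (m + 1) * (g * boundaryDensity m a A) := by
  have h1 := wedgePow_cons_smul_single A N 1
  simp only [one_smul, one_pow, mul_one] at h1
  rw [← h1]
  have h2 := wedgePow_cons (bilinOf A) hA m N fun j : Fin (2 * m + 1) =>
      (EuclideanSpace.single (j.succ : Fin (2 * m + 2)) (1 : ℝ) :
        EuclideanSpace ℝ (Fin (2 * m + 2)))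
  simp only [bilinOf_apply] at h2
  rw [h2]
  congr 1
  rw [boundaryDensity, wedgeOnePow, wedgeOnePow]
  simp only [bilinOf_apply, h, Finset.mul_sum]
  refine Finset.sum_congr rfl fun σ _ => ?_
  ring

end TopPower

/-! ### Vector fields and forms near the boundary -/

section LinearSystems

variable {W W' : Type*} [NormedAddCommGroup W] [NormedSpace ℝ W] [FiniteDimensional ℝ W]
  [NormedAddCommGroup W'] [NormedSpace ℝ W'] [FiniteDimensional ℝ W']

theorem ContinuousLinearMap.isInvertible_of_injective_of_finrank_eq {A : W →L[ℝ] W'}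
    (h : ∀ u, A u = 0 → u = 0) (hd : Module.finrank ℝ W = Module.finrank ℝ W') :
    A.IsInvertible := by
  have hinj : Function.Injective (A : W →ₗ[ℝ] W') :=
    (injective_iff_map_eq_zero (A : W →ₗ[ℝ] W')).2 h
  refine ⟨(LinearEquiv.ofInjectiveOfFinrankEq (A : W →ₗ[ℝ] W') hinj hd).toContinuousLinearEquiv, ?_⟩
  ext u
  rfl

theorem finrank_dual_clm : Module.finrank ℝ (W →L[ℝ] ℝ) = Module.finrank ℝ W := by
  rw [← (LinearMap.toContinuousLinearMap (𝕜 := ℝ) (E := W) (F' := ℝ)).finrank_eq]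
  exact Subspace.dual_finrank_eq

end LinearSystems

section Curl

variable {E : Type*} [NormedAddCommGroup E] [NormedSpace ℝ E]

theorem ContDiffWithinAt.curl {θ : E → E →L[ℝ] ℝ} {S : Set E} {y : E}
    (h : ContDiffWithinAt ℝ ∞ θ S y) (hS : UniqueDiffOn ℝ S) (hy : y ∈ S) :
    ContDiffWithinAt ℝ ∞ (curl θ S) S y := by
  have h1 : ContDiffWithinAt ℝ ∞ (fderivWithin ℝ θ S) S y :=
    h.fderivWithin_right hS (by simp) hy
  have hL : ContDiff ℝ ∞ fun A : E →L[ℝ] E →L[ℝ] ℝ => A.flip :=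
    IsBoundedLinearMap.contDiff
      { map_add := fun _ _ => rfl
        map_smul := fun _ _ => rfl
        bound := ⟨1, one_pos, fun A => by rw [one_mul, ContinuousLinearMap.opNorm_flip]⟩ }
  have h2 : ContDiffWithinAt ℝ ∞ (fun z => (fderivWithin ℝ θ S z).flip) S y :=
    hL.contDiffAt.comp_contDiffWithinAt y h1
  refine (h1.sub h2).congr (fun z _ => ?_) ?_ <;>
  · ext u v
    rw [curl_apply]
    rfl

end Curl

section BoundaryCharts

variable {E H : Type*} [NormedAddCommGroup E] [NormedSpace ℝ E] [TopologicalSpace H]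
  {I : ModelWithCorners ℝ E H} {ℓ : E →L[ℝ] ℝ} {e : E}
  {M : Type*} [TopologicalSpace M] [ChartedSpace H M] [IsManifold I ∞ M]
  {E' H' : Type*} [NormedAddCommGroup E'] [NormedSpace ℝ E'] [TopologicalSpace H']
  {J : ModelWithCorners ℝ E' H'} {K : Type*} [TopologicalSpace K] [ChartedSpace H' K]
  [IsManifold J ∞ K] {ι : K → M}

omit [IsManifold J ∞ K] in
/-- The vectors tangent to the boundary have no transverse component, in any chart. -/
theorem clm_chartD_mfderiv_boundary (he : ℓ e = 1) (hI : range I = {y | 0 ≤ ℓ y})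
    (hι : ∀ x, ι x ∈ I.boundary M) {x : K} (hιs : MDifferentiableAt J I ι x) {p : M}
    (hp : ι x ∈ (chartAt H p).source) (v : TangentSpace J x) :
    ℓ (chartD I p (ι x) (mfderiv J I ι x v)) = 0 := by
  have h0 : (fun z => ℓ (extChartAt I p (ι z))) =ᶠ[𝓝 x] fun _ => (0 : ℝ) := by
    filter_upwards [hιs.continuousAt.eventually ((chartAt H p).open_source.mem_nhds hp)] with z hz
    exact (mem_boundary_iff_of_mem_source he hI hz).1 (hι z)
  have h1 : MDifferentiableAt I 𝓘(ℝ, E) (extChartAt I p) (ι x) := mdifferentiableAt_extChartAt hp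
  have h2 : MDifferentiableAt 𝓘(ℝ, E) 𝓘(ℝ, ℝ) ℓ (extChartAt I p (ι x)) :=
    ℓ.differentiableAt.mdifferentiableAt
  have h3 : HasMFDerivAt J 𝓘(ℝ, ℝ) (fun z => ℓ (extChartAt I p (ι z))) x
      ((mfderiv 𝓘(ℝ, E) 𝓘(ℝ, ℝ) ℓ (extChartAt I p (ι x))).comp
        ((mfderiv I 𝓘(ℝ, E) (extChartAt I p) (ι x)).comp (mfderiv J I ι x))) :=
    h2.hasMFDerivAt.comp x (h1.hasMFDerivAt.comp x hιs.hasMFDerivAt)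
  have h4 : HasMFDerivAt J 𝓘(ℝ, ℝ) (fun _ : K => (0 : ℝ)) x
      ((mfderiv 𝓘(ℝ, E) 𝓘(ℝ, ℝ) ℓ (extChartAt I p (ι x))).comp
        ((mfderiv I 𝓘(ℝ, E) (extChartAt I p) (ι x)).comp (mfderiv J I ι x))) :=
    h3.congr_of_eventuallyEq h0.symm
  have h5 := hasMFDerivAt_unique h4 (hasMFDerivAt_const (I := J) (I' := 𝓘(ℝ, ℝ)) (0 : ℝ) x)
  have h6 := DFunLike.congr_fun h5 v
  have h7 : mfderiv 𝓘(ℝ, E) 𝓘(ℝ, ℝ) ℓ (extChartAt I p (ι x)) = ℓ := by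
    rw [mfderiv_eq_fderiv]
    exact ℓ.fderiv
  rw [h7] at h6
  exact h6

/-- Every point of a manifold with boundary is a limit of interior points. -/
theorem nhdsWithin_interior_neBot (he : ℓ e = 1) (hI : range I = {y | 0 ≤ ℓ y}) (p : M) :
    (𝓝[I.interior M] p).NeBot := by
  have hp : p ∈ (chartAt H p).source := mem_chart_source H p
  have h0 : Tendsto (fun t : ℝ => extChartAt I p p + t • e) (𝓝[>] 0)
      (𝓝[range I] (extChartAt I p p)) := by
    refine tendsto_nhdsWithin_iff.2 ⟨?_, ?_⟩
    · refine (Continuous.tendsto' (by fun_prop) 0 _ (by simp)).mono_left nhdsWithin_le_nhds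
    · filter_upwards [self_mem_nhdsWithin] with t (ht : 0 < t)
      have := extChartAt_mem_range (I := I) p p
      rw [hI] at this ⊢
      have h2 : 0 ≤ ℓ (extChartAt I p p) := this
      change 0 ≤ ℓ (extChartAt I p p + t • e)
      rw [map_add, map_smul, he]
      simp only [smul_eq_mul, mul_one]
      linarith
  have h1 : ∀ᶠ t : ℝ in 𝓝[>] 0, (extChartAt I p).symm (extChartAt I p p + t • e) ∈ I.interior M := by
    filter_upwards [h0.eventually (eventually_nhdsWithin_range_extChartAt hp
      (Eventually.of_forall fun _ => trivial)), self_mem_nhdsWithin] with t ht (ht0 : 0 < t)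
    rw [mem_interior_iff_of_mem_source he hI ht.2.1, (extChartAt I p).right_inv ht.1, map_add,
      map_smul, he]
    have := extChartAt_mem_range (I := I) p p
    rw [hI] at this
    have h2 : 0 ≤ ℓ (extChartAt I p p) := this
    simp only [smul_eq_mul, mul_one]
    linarith
  have h2 : Tendsto (fun t : ℝ => (extChartAt I p).symm (extChartAt I p p + t • e)) (𝓝[>] 0)
      (𝓝 p) := by
    rw [tendsto_def]
    intro s hs
    filter_upwards [h0.eventually (eventually_nhdsWithin_range_extChartAt hp hs)] with t ht
    exact ht.2.2
  exact (tendsto_nhdsWithin_iff.2 ⟨h2, h1⟩).neBot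

theorem contMDiffAt_section_of_chart {V : ∀ p : M, TangentSpace I p} {n : ℕ∞} {p q : M}
    (hq : q ∈ (chartAt H p).source)
    (hV : ContDiffWithinAt ℝ n (chartField I V p) (range I) (extChartAt I p q)) :
    ContMDiffAt I I.tangent n (fun p => (⟨p, V p⟩ : TangentBundle I M)) q := by
  refine ((trivializationAt E (TangentSpace I : M → Type _) p).contMDiffAt_section_iff
    (IB := I) (n := n) (s := V) (x₀ := q) (by simpa using hq)).2 ?_
  refine (contMDiffAt_iff_comp_symm hq).2 ?_
  have hmem : extChartAt I p q ∈ range I := by simp [extChartAt]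
  refine ContDiffWithinAt.congr_of_eventuallyEq_of_mem hV ?_ hmem
  filter_upwards [eventually_nhdsWithin_range_extChartAt hq
    (Eventually.of_forall (fun _ => trivial))] with y hy
  obtain ⟨hyt, hys, -⟩ := hy
  have h4 := TangentBundle.continuousLinearMapAt_trivializationAt (I := I) hys
  have h5 := DFunLike.congr_fun h4 (V ((extChartAt I p).symm y))
  rw [Trivialization.continuousLinearMapAt_apply, Trivialization.linearMapAt_apply,
    if_pos (by simpa using hys)] at h5
  exact h5

/-- A function given in a chart by a smooth expression is smooth. -/
theorem contMDiffAt_comp_extChartAt {G : Type*} [NormedAddCommGroup G] [NormedSpace ℝ G] {n : ℕ∞}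
    {f : E → G} {p q : M} (hq : q ∈ (chartAt H p).source)
    (hf : ContDiffWithinAt ℝ n f (range I) (extChartAt I p q)) :
    ContMDiffAt I 𝓘(ℝ, G) n (fun z => f (extChartAt I p z)) q := by
  refine (contMDiffAt_iff_comp_symm hq).2 ?_
  refine ContDiffWithinAt.congr_of_eventuallyEq_of_mem hf ?_ (extChartAt_mem_range p q)
  filter_upwards [eventually_nhdsWithin_range_extChartAt hq
    (Eventually.of_forall (fun _ => trivial))] with y hy
  rw [(extChartAt I p).right_inv hy.1]

omit [IsManifold I ∞ M] in
theorem tendsto_extChartAt_range {p q : M} (hq : q ∈ (chartAt H p).source) :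
    Tendsto (extChartAt I p) (𝓝 q) (𝓝[range I] (extChartAt I p q)) := by
  rw [tendsto_def]
  intro s hs
  filter_upwards [eventually_nhds_of_nhdsWithin_range hq hs] with z hz
  exact hz.2

variable {lam : OneForm I M}

theorem OneForm.IsSmooth.contDiffWithinAt_inChart (h : OneForm.IsSmooth I lam) {p q : M}
    (hq : q ∈ (chartAt H p).source) :
    ContDiffWithinAt ℝ ∞ (OneForm.inChart I lam p) (range I) (extChartAt I p q) :=
  (h.smoothAt q).contDiffWithinAt hq

theorem OneForm.IsSmooth.contDiffWithinAt_curl (h : OneForm.IsSmooth I lam) {p q : M}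
    (hq : q ∈ (chartAt H p).source) :
    ContDiffWithinAt ℝ ∞ (curl (OneForm.inChart I lam p) (range I)) (range I) (extChartAt I p q) :=
  (h.contDiffWithinAt_inChart hq).curl I.uniqueDiffOn (extChartAt_mem_range p q)

theorem OneForm.IsSmooth.d_eq_curl (h : OneForm.IsSmooth I lam) {p q : M}
    (hq : q ∈ (chartAt H p).source) (u v : TangentSpace I q) :
    OneForm.d I lam q u v = curl (OneForm.inChart I lam p) (range I) (extChartAt I p q)
      (chartD I p q u) (chartD I p q v) :=
  OneForm.d_eq_curl (ContDiffWithinAt.of_le (h.smoothAt q) (by exact_mod_cast le_top)) hq u v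

/-- Where the 1-form does not vanish, the factor `g` in `dλ (V, ·) = g λ` is smooth. -/
theorem contMDiffAt_factor (h : OneForm.IsSmooth I lam) {V : ∀ p : M, TangentSpace I p} {q : M}
    (hV : ContMDiffAt I I.tangent ∞ (fun p => (⟨p, V p⟩ : TangentBundle I M)) q)
    {g : M → ℝ} (hg : ∀ᶠ z in 𝓝 q, ∀ w, OneForm.d I lam z (V z) w = g z * lam z w)
    (hq : lam q ≠ 0) : ContMDiffAt I 𝓘(ℝ, ℝ) ∞ g q := by
  have hs : q ∈ (chartAt H q).source := mem_chart_source H q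
  obtain ⟨u, hu⟩ : ∃ u : E, OneForm.inChart I lam q (extChartAt I q q) u ≠ 0 := by
    by_contra! hc
    refine hq (ContinuousLinearMap.ext fun u => ?_)
    rw [OneForm.apply_eq_inChart lam hs, hc]
    rfl
  have h1 := h.contDiffWithinAt_inChart hs
  have h2 := h.contDiffWithinAt_curl hs
  have h3 := contDiffWithinAt_chartField hV hs
  have h4 : ContDiffWithinAt ℝ ∞ (fun y => OneForm.inChart I lam q y u) (range I)
      (extChartAt I q q) := h1.clm_apply contDiffWithinAt_const
  have h5 : ContDiffWithinAt ℝ ∞ (fun y => curl (OneForm.inChart I lam q) (range I) y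
      (chartField I V q y) u / OneForm.inChart I lam q y u) (range I)
      (extChartAt I q q) := ((h2.clm_apply h3).clm_apply contDiffWithinAt_const).div h4 hu
  refine (contMDiffAt_comp_extChartAt hs h5).congr_of_eventuallyEq ?_
  have h6 : ∀ᶠ z in 𝓝 q, OneForm.inChart I lam q (extChartAt I q z) u ≠ 0 :=
    (tendsto_extChartAt_range hs).eventually (h4.continuousWithinAt.eventually_ne hu)
  filter_upwards [hg, h6, (chartAt H q).open_source.mem_nhds hs] with z hz hz1 hz2
  have h7 := hz (chartDInv I q z u)
  rw [h.d_eq_curl hz2, OneForm.apply_eq_inChart lam hz2, chartD_chartDInv hz2,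
    ← chartField_extChartAt V hz2] at h7
  rw [h7]
  field_simp

/-- Near a point where `dλ` is non-degenerate, the equation `dλ (X, ·) = λ` has a smooth
solution. -/
theorem exists_local_liouville [FiniteDimensional ℝ E] (h : OneForm.IsSmooth I lam) {p : M}
    (hp : OneForm.DNondegenerateAt I lam p) :
    ∃ U ∈ 𝓝 p, ∃ X : ∀ p : M, TangentSpace I p,
      ContMDiffOn I I.tangent ∞ (fun p => (⟨p, X p⟩ : TangentBundle I M)) U ∧
      ∀ q ∈ U, ∀ w, OneForm.d I lam q (X q) w = lam q w := by
  have hs : p ∈ (chartAt H p).source := mem_chart_source H p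
  set B := curl (OneForm.inChart I lam p) (range I) with hB
  have hinv : (B (extChartAt I p p)).IsInvertible := by
    refine ContinuousLinearMap.isInvertible_of_injective_of_finrank_eq (fun u hu => ?_)
      finrank_dual_clm.symm
    have h1 : chartDInv I p p u = 0 := by
      refine hp _ fun v => ?_
      rw [h.d_eq_curl hs, chartD_chartDInv hs, ← hB, hu]
      rfl
    rw [← chartD_chartDInv (I := I) hs u, h1, map_zero]
  have hev : ∀ᶠ y in 𝓝[range I] (extChartAt I p p), (B y).IsInvertible := by
    obtain ⟨A, hA⟩ := hinv
    have := (h.contDiffWithinAt_curl hs).continuousWithinAt.tendsto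
    rw [← hB, ← hA] at this
    filter_upwards [this.eventually (ContinuousLinearEquiv.nhds A)] with y hy
    exact hy
  have hev' := eventually_nhds_of_nhdsWithin_range hs hev
  refine ⟨_, hev', fun q => chartDInv I p q ((B (extChartAt I p q)).inverse
    (OneForm.inChart I lam p (extChartAt I p q))), fun q hq => ?_, fun q hq w => ?_⟩
  · obtain ⟨hq1, hq2⟩ := hq
    refine ContMDiffAt.contMDiffWithinAt (contMDiffAt_section_of_chart (n := ⊤) hq1 ?_)
    have h1 : ContDiffWithinAt ℝ ∞ (fun y => (B y).inverse (OneForm.inChart I lam p y)) (range I)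
        (extChartAt I p q) :=
      (hq2.contDiffAt_map_inverse.comp_contDiffWithinAt _ (h.contDiffWithinAt_curl hq1)).clm_apply
        (h.contDiffWithinAt_inChart hq1)
    refine ContDiffWithinAt.congr_of_eventuallyEq_of_mem h1 ?_ (extChartAt_mem_range p q)
    filter_upwards [eventually_nhdsWithin_range_extChartAt hq1
      (Eventually.of_forall (fun _ => trivial))] with y hy
    rw [chartField, chartD_chartDInv hy.2.1, (extChartAt I p).right_inv hy.1]
  · obtain ⟨hq1, hq2⟩ := hq
    rw [h.d_eq_curl hq1, chartD_chartDInv hq1, ← hB, hq2.self_apply_inverse, ← OneForm.apply_eq_inChart lam hq1]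

end BoundaryCharts

/-! ### The boundary of the domain -/

theorem wedgePow_congr {V W : Type*} {Ω : V → V → ℝ} {Ω' : W → W → ℝ} {n : ℕ}
    {v : Fin (2 * n) → V} {w : Fin (2 * n) → W} (h : ∀ i j, Ω (v i) (v j) = Ω' (w i) (w j)) :
    wedgePow Ω n v = wedgePow Ω' n w := by
  simp only [wedgePow, h]

theorem wedgeOnePow_congr {V W : Type*} {a : V → ℝ} {a' : W → ℝ} {Ω : V → V → ℝ}
    {Ω' : W → W → ℝ} {m : ℕ} {v : Fin (2 * m + 1) → V} {w : Fin (2 * m + 1) → W}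
    (ha : ∀ i, a (v i) = a' (w i)) (h : ∀ i j, Ω (v i) (v j) = Ω' (w i) (w j)) :
    wedgeOnePow a Ω m v = wedgeOnePow a' Ω' m w := by
  simp only [wedgeOnePow, h, ha]

section Densities

variable {m : ℕ}

theorem ContDiffWithinAt.boundaryDensity {X : Type*} [NormedAddCommGroup X] [NormedSpace ℝ X]
    {a : X → EuclideanSpace ℝ (Fin (2 * m + 2)) →L[ℝ] ℝ}
    {A : X → EuclideanSpace ℝ (Fin (2 * m + 2)) →L[ℝ] EuclideanSpace ℝ (Fin (2 * m + 2)) →L[ℝ] ℝ}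
    {S : Set X} {y : X} (ha : ContDiffWithinAt ℝ ∞ a S y) (hA : ContDiffWithinAt ℝ ∞ A S y) :
    ContDiffWithinAt ℝ ∞ (fun z => boundaryDensity m (a z) (A z)) S y := by
  unfold _root_.boundaryDensity wedgeOnePow
  refine contDiffWithinAt_const.mul (ContDiffWithinAt.sum fun σ _ => contDiffWithinAt_const.mul ?_)
  refine (ha.clm_apply contDiffWithinAt_const).mul (contDiffWithinAt_prod fun i _ => ?_)
  exact (hA.clm_apply contDiffWithinAt_const).clm_apply contDiffWithinAt_const

/-- The coordinate transverse to the boundary of the half-space. -/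
def heightCLM (m : ℕ) : EuclideanSpace ℝ (Fin (2 * m + 2)) →L[ℝ] ℝ := EuclideanSpace.proj 0

theorem heightCLM_apply (v : EuclideanSpace ℝ (Fin (2 * m + 2))) : heightCLM m v = v 0 := rfl

theorem heightCLM_single : heightCLM m (EuclideanSpace.single 0 1) = 1 := by
  simp [heightCLM_apply]

theorem range_halfSpaceModel : range (𝓡∂ (2 * m + 2)) = {y | 0 ≤ heightCLM m y} :=
  range_modelWithCornersEuclideanHalfSpace (2 * m + 2)

end Densities

section Domain

variable {m : ℕ}
  {F : Type*} [TopologicalSpace F] [ChartedSpace (EuclideanHalfSpace (2 * m + 2)) F]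
  [IsManifold (𝓡∂ (2 * m + 2)) ∞ F]
  {K : Type*} [TopologicalSpace K] [ChartedSpace (EuclideanSpace ℝ (Fin (2 * m + 1))) K]
  [IsManifold (𝓡 (2 * m + 1)) ∞ K]
  {ι : K → F} {lam : OneForm (𝓡∂ (2 * m + 2)) F}

omit [IsManifold (𝓡∂ (2 * m + 2)) ∞ F] [IsManifold (𝓡 (2 * m + 1)) ∞ K] in
theorem IsBoundaryInclusion.mem_boundary (hι : IsBoundaryInclusion m ι) (x : K) :
    ι x ∈ (𝓡∂ (2 * m + 2)).boundary F := hι.range_eq ▸ mem_range_self x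

omit [IsManifold (𝓡∂ (2 * m + 2)) ∞ F] [IsManifold (𝓡 (2 * m + 1)) ∞ K] in
theorem IsBoundaryInclusion.contMDiff (hι : IsBoundaryInclusion m ι) :
    ContMDiff (𝓡 (2 * m + 1)) (𝓡∂ (2 * m + 2)) ∞ ι := hι.embedding.contMDiff

omit [IsManifold (𝓡∂ (2 * m + 2)) ∞ F] [IsManifold (𝓡 (2 * m + 1)) ∞ K] in
theorem IsBoundaryInclusion.injective (hι : IsBoundaryInclusion m ι) : Function.Injective ι :=
  hι.embedding.isEmbedding.injective

omit [IsManifold (𝓡∂ (2 * m + 2)) ∞ F] [IsManifold (𝓡 (2 * m + 1)) ∞ K] in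
theorem IsBoundaryInclusion.mdifferentiableAt (hι : IsBoundaryInclusion m ι) (x : K) :
    MDifferentiableAt (𝓡 (2 * m + 1)) (𝓡∂ (2 * m + 2)) ι x :=
  hι.contMDiff.mdifferentiable (by simp) x

omit [IsManifold (𝓡∂ (2 * m + 2)) ∞ F] [IsManifold (𝓡 (2 * m + 1)) ∞ K] in
theorem IsBoundaryInclusion.contMDiffAt_two (hι : IsBoundaryInclusion m ι) (x : K) :
    ContMDiffAt (𝓡 (2 * m + 1)) (𝓡∂ (2 * m + 2)) 2 ι x :=
  by
  exact_mod_cast (contMDiff_infty.1 hι.contMDiff 2) x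

theorem OneForm.IsSmooth.smoothAt_one (hlam : OneForm.IsSmooth (𝓡∂ (2 * m + 2)) lam) (q : F) :
    OneForm.SmoothAt (𝓡∂ (2 * m + 2)) lam 1 q :=
  ContDiffWithinAt.of_le (hlam.smoothAt q) (by exact_mod_cast le_top)

theorem IsBoundaryInclusion.d_boundaryForm (hι : IsBoundaryInclusion m ι)
    (hlam : OneForm.IsSmooth (𝓡∂ (2 * m + 2)) lam) (x : K)
    (u v : TangentSpace (𝓡 (2 * m + 1)) x) :
    OneForm.d (𝓡 (2 * m + 1)) (boundaryForm ι lam) x u v =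
      OneForm.d (𝓡∂ (2 * m + 2)) lam (ι x) (mfderiv (𝓡 (2 * m + 1)) (𝓡∂ (2 * m + 2)) ι x u)
        (mfderiv (𝓡 (2 * m + 1)) (𝓡∂ (2 * m + 2)) ι x v) :=
  OneForm.d_pullback (hι.contMDiffAt_two x) (Eventually.of_forall fun _ => rfl)
    (hlam.smoothAt_one _) u v

theorem IsBoundaryInclusion.smoothAt_boundaryForm (hι : IsBoundaryInclusion m ι)
    (hlam : OneForm.IsSmooth (𝓡∂ (2 * m + 2)) lam) (x : K) :
    OneForm.SmoothAt (𝓡 (2 * m + 1)) (boundaryForm ι lam) ⊤ x :=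
  OneForm.smoothAt_pullback hι.contMDiff.contMDiffAt (Eventually.of_forall fun _ => rfl)
    (hlam.smoothAt _)

/-- As the induced form is a contact form, the inclusion of the boundary is an immersion. -/
theorem IsBoundaryInclusion.mfderiv_injective (hι : IsBoundaryInclusion m ι)
    (hlam : OneForm.IsSmooth (𝓡∂ (2 * m + 2)) lam) (hc : IsContactForm (boundaryForm ι lam)) (x : K) :
    Function.Injective (mfderiv (𝓡 (2 * m + 1)) (𝓡∂ (2 * m + 2)) ι x) := by
  refine (injective_iff_map_eq_zero _).2 fun u hu => ?_
  refine hc.eq_zero ?_ fun w _ => ?_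
  · change lam (ι x) (mfderiv (𝓡 (2 * m + 1)) (𝓡∂ (2 * m + 2)) ι x u) = 0
    rw [hu, map_zero]
  · rw [hι.d_boundaryForm hlam, hu, ← OneForm.dLin_apply, map_zero]
    rfl

/-- In any chart, the tangent space of the boundary is the hyperplane of vectors without
transverse component. -/
theorem IsBoundaryInclusion.exists_chartD_mfderiv_eq (hι : IsBoundaryInclusion m ι)
    (hlam : OneForm.IsSmooth (𝓡∂ (2 * m + 2)) lam) (hc : IsContactForm (boundaryForm ι lam)) (x : K)
    {p : F} (hp : ι x ∈ (chartAt (EuclideanHalfSpace (2 * m + 2)) p).source)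
    {v : EuclideanSpace ℝ (Fin (2 * m + 2))} (hv : heightCLM m v = 0) :
    ∃ w, chartD (𝓡∂ (2 * m + 2)) p (ι x) (mfderiv (𝓡 (2 * m + 1)) (𝓡∂ (2 * m + 2)) ι x w) = v := by
  let D' : EuclideanSpace ℝ (Fin (2 * m + 1)) →L[ℝ] EuclideanSpace ℝ (Fin (2 * m + 2)) :=
    (chartD (𝓡∂ (2 * m + 2)) p (ι x)).comp (mfderiv (𝓡 (2 * m + 1)) (𝓡∂ (2 * m + 2)) ι x)
  let D : EuclideanSpace ℝ (Fin (2 * m + 1)) →ₗ[ℝ] EuclideanSpace ℝ (Fin (2 * m + 2)) := D'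
  have hinj : Function.Injective D := by
    intro u u' huu
    refine hι.mfderiv_injective hlam hc x ?_
    have := congrArg (chartDInv (𝓡∂ (2 * m + 2)) p (ι x)) huu
    exact (chartDInv_chartD hp _).symm.trans (this.trans (chartDInv_chartD hp _))
  have hle : LinearMap.range D ≤ LinearMap.ker (heightCLM m : EuclideanSpace ℝ (Fin (2 * m + 2)) →ₗ[ℝ] ℝ) := by
    rintro _ ⟨u, rfl⟩
    exact clm_chartD_mfderiv_boundary heightCLM_single range_halfSpaceModel hι.mem_boundary
      (hι.mdifferentiableAt x) hp u
  have h1 : Module.finrank ℝ (LinearMap.range D) = 2 * m + 1 := by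
    rw [LinearMap.finrank_range_of_inj hinj, finrank_euclideanSpace_fin]
  have h2 : Module.finrank ℝ (LinearMap.ker (heightCLM m : EuclideanSpace ℝ (Fin (2 * m + 2)) →ₗ[ℝ] ℝ)) = 2 * m + 1 := by
    have h3 := LinearMap.finrank_range_add_finrank_ker (heightCLM m : EuclideanSpace ℝ (Fin (2 * m + 2)) →ₗ[ℝ] ℝ)
    have h4 : LinearMap.range (heightCLM m : EuclideanSpace ℝ (Fin (2 * m + 2)) →ₗ[ℝ] ℝ) = ⊤ :=
      LinearMap.range_eq_top.2 fun c => ⟨c • EuclideanSpace.single 0 1, by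
        change heightCLM m (c • EuclideanSpace.single 0 1) = c
        rw [map_smul, heightCLM_single, smul_eq_mul, mul_one]⟩
    rw [h4, finrank_top, Module.finrank_self, finrank_euclideanSpace_fin] at h3
    omega
  have heq := Submodule.eq_of_le_of_finrank_eq hle (h1.trans h2.symm)
  have hmem : v ∈ LinearMap.range D := by
    rw [heq]
    exact hv
  exact hmem

theorem IsBoundaryInclusion.exists_mfderiv_eq (hι : IsBoundaryInclusion m ι)
    (hlam : OneForm.IsSmooth (𝓡∂ (2 * m + 2)) lam) (hc : IsContactForm (boundaryForm ι lam)) (x : K)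
    {v : EuclideanSpace ℝ (Fin (2 * m + 2))} (hv : heightCLM m v = 0) :
    ∃ w, (mfderiv (𝓡 (2 * m + 1)) (𝓡∂ (2 * m + 2)) ι x w : EuclideanSpace ℝ (Fin (2 * m + 2))) = v := by
  obtain ⟨w, hw⟩ := hι.exists_chartD_mfderiv_eq hlam hc x (mem_chart_source _ (ι x)) hv
  exact ⟨w, (chartD_self (I := 𝓡∂ (2 * m + 2)) (ι x) _).symm.trans hw⟩

omit [IsManifold (𝓡∂ (2 * m + 2)) ∞ F] in
theorem IsContactForm.apply_boundary_ne_zero (hc : IsContactForm (boundaryForm ι lam)) (x : K) :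
    lam (ι x) ≠ 0 := by
  intro h
  refine hc.ne_zero x ?_
  ext v
  change lam (ι x) _ = 0
  rw [h]
  rfl

/-- Near a boundary point, where `dλ (N, ·) = g λ`, the vector `N` points outwards if and only if
`g` is positive: this is the positivity of the contact form. -/
theorem IsBoundaryInclusion.eventually_sign (hι : IsBoundaryInclusion m ι)
    (hlam : OneForm.IsSmooth (𝓡∂ (2 * m + 2)) lam) (hc : IsContactForm (boundaryForm ι lam))
    (hpos : IsPositiveOnBoundary ι lam) (x : K) :
    boundaryDensity m (OneForm.inChart (𝓡∂ (2 * m + 2)) lam (ι x) (extChartAt (𝓡∂ (2 * m + 2)) (ι x) (ι x)))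
      (curl (OneForm.inChart (𝓡∂ (2 * m + 2)) lam (ι x)) (range (𝓡∂ (2 * m + 2)))
        (extChartAt (𝓡∂ (2 * m + 2)) (ι x) (ι x))) ≠ 0 ∧
    ∀ᶠ q in 𝓝 (ι x), q ∈ (𝓡∂ (2 * m + 2)).interior F →
      ∀ (N : TangentSpace (𝓡∂ (2 * m + 2)) q) (g : ℝ),
        (∀ w, OneForm.d (𝓡∂ (2 * m + 2)) lam q N w = g * lam q w) →
        (heightCLM m (chartD (𝓡∂ (2 * m + 2)) (ι x) q N) < 0 ↔ 0 < g) := by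
  set p := ι x with hp
  have hs : p ∈ (chartAt (EuclideanHalfSpace (2 * m + 2)) p).source := mem_chart_source _ p
  set θ := OneForm.inChart (𝓡∂ (2 * m + 2)) lam p with hθ
  set B := curl θ (range (𝓡∂ (2 * m + 2))) with hB
  have hw : ∀ j : Fin (2 * m + 1), ∃ w,
      chartD (𝓡∂ (2 * m + 2)) p p (mfderiv (𝓡 (2 * m + 1)) (𝓡∂ (2 * m + 2)) ι x w) =
        EuclideanSpace.single (j.succ : Fin (2 * m + 2)) 1 := fun j =>
    hι.exists_chartD_mfderiv_eq hlam hc x hs (by simp [heightCLM_apply])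
  choose w hw using hw
  have hli : LinearIndependent ℝ w := by
    have h1 : LinearIndependent ℝ fun j : Fin (2 * m + 1) =>
        (EuclideanSpace.single (j.succ : Fin (2 * m + 2)) 1 : EuclideanSpace ℝ (Fin (2 * m + 2))) := by
      have h2 := (EuclideanSpace.basisFun (Fin (2 * m + 2)) ℝ).toBasis.linearIndependent.comp
        (Fin.succ : Fin (2 * m + 1) → Fin (2 * m + 2)) (Fin.succ_injective _)
      simpa [Function.comp_def] using h2
    let D' : TangentSpace (𝓡 (2 * m + 1)) x →L[ℝ] EuclideanSpace ℝ (Fin (2 * m + 2)) :=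
      (chartD (𝓡∂ (2 * m + 2)) p p).comp (mfderiv (𝓡 (2 * m + 1)) (𝓡∂ (2 * m + 2)) ι x)
    have h2 : (D' : TangentSpace (𝓡 (2 * m + 1)) x →ₗ[ℝ] EuclideanSpace ℝ (Fin (2 * m + 2))) ∘ w =
        fun j => EuclideanSpace.single (j.succ : Fin (2 * m + 2)) 1 := funext hw
    refine LinearIndependent.of_comp
      (D' : TangentSpace (𝓡 (2 * m + 1)) x →ₗ[ℝ] EuclideanSpace ℝ (Fin (2 * m + 2))) ?_
    rw [h2]
    exact h1
  -- the value of `α ∧ (dα)^m` on `w` is the boundary density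
  have hbd : wedgeOnePow (boundaryForm ι lam x)
      (OneForm.d (𝓡 (2 * m + 1)) (boundaryForm ι lam) x) m w =
      boundaryDensity m (θ (extChartAt (𝓡∂ (2 * m + 2)) p p)) (B (extChartAt (𝓡∂ (2 * m + 2)) p p)) := by
    refine wedgeOnePow_congr (fun i => ?_) fun i j => ?_
    · change lam p (mfderiv (𝓡 (2 * m + 1)) (𝓡∂ (2 * m + 2)) ι x (w i)) = _
      rw [OneForm.apply_eq_inChart lam hs, hw]
    · rw [hι.d_boundaryForm hlam, hlam.d_eq_curl hs, hw, hw]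
  have hne := hc x w hli
  refine ⟨hbd ▸ hne, ?_⟩
  -- the frame `c • w`, with `c = 1` or `c = -1`, is positive
  obtain ⟨c, hc1, hcpos⟩ : ∃ c : ℝ, 0 < wedgeOnePow (boundaryForm ι lam x)
      (OneForm.d (𝓡 (2 * m + 1)) (boundaryForm ι lam) x) m (fun j => c • w j) ∧
      0 < c ^ (2 * m + 1) * boundaryDensity m (θ (extChartAt (𝓡∂ (2 * m + 2)) p p))
        (B (extChartAt (𝓡∂ (2 * m + 2)) p p)) := by
    rcases hne.lt_or_gt with h | h
    · refine ⟨-1, ?_, ?_⟩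
      · have h1 := wedgeOnePow_neg (boundaryForm ι lam x : TangentSpace (𝓡 (2 * m + 1)) x →ₗ[ℝ] ℝ)
          (OneForm.dLin (𝓡 (2 * m + 1)) (boundaryForm ι lam) x) m w
        simp only [OneForm.dLin_apply] at h1
        simp only [neg_smul, one_smul]
        refine lt_of_lt_of_eq (neg_pos.2 h) h1.symm
      · rw [← hbd, Odd.neg_one_pow (odd_two_mul_add_one m)]
        linarith
    · exact ⟨1, by simpa using h, by rw [← hbd]; simpa using h⟩
  have hposx := hpos x (fun j => c • w j)
    (-EuclideanSpace.single 0 1 : EuclideanSpace ℝ (Fin (2 * m + 2)))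
    (by
      change (-EuclideanSpace.single 0 1 : EuclideanSpace ℝ (Fin (2 * m + 2))) 0 < 0
      simp) hc1
  rw [eventually_nhdsWithin_iff] at hposx
  have hbcont : ∀ᶠ q in 𝓝 p, 0 < c ^ (2 * m + 1) *
      boundaryDensity m (θ (extChartAt (𝓡∂ (2 * m + 2)) p q)) (B (extChartAt (𝓡∂ (2 * m + 2)) p q)) := by
    have h1 := ((hlam.contDiffWithinAt_inChart hs).boundaryDensity
      (hlam.contDiffWithinAt_curl hs)).continuousWithinAt
    have h2 := h1.tendsto.const_mul (c ^ (2 * m + 1))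
    exact (tendsto_extChartAt_range hs).eventually (h2.eventually (lt_mem_nhds hcpos))
  filter_upwards [hposx, hbcont, (chartAt (EuclideanHalfSpace (2 * m + 2)) p).open_source.mem_nhds hs]
    with q hq1 hq2 hq3 hqi N g hN
  have h3 := hq1 hqi
  set W : Fin (2 * m + 1 + 1) → EuclideanSpace ℝ (Fin (2 * m + 2)) :=
    Fin.cons (-EuclideanSpace.single 0 1 : EuclideanSpace ℝ (Fin (2 * m + 2)))
      (fun j : Fin (2 * m + 1) => c • (EuclideanSpace.single (j.succ : Fin (2 * m + 2)) (1 : ℝ) :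
        EuclideanSpace ℝ (Fin (2 * m + 2)))) with hW
  have h4 : ∀ i : Fin (2 * m + 1 + 1),
      (Fin.cons (-EuclideanSpace.single 0 1 : EuclideanSpace ℝ (Fin (2 * m + 2)))
        (fun j => mfderiv (𝓡 (2 * m + 1)) (𝓡∂ (2 * m + 2)) ι x (c • w j)) :
        Fin (2 * m + 1 + 1) → TangentSpace (𝓡∂ (2 * m + 2)) (ι x)) i = W i := by
    refine Fin.cases rfl fun j => ?_
    have h6 := (chartD_self (I := 𝓡∂ (2 * m + 2)) (ι x) _).symm.trans (hw j)
    have h7 : mfderiv (𝓡 (2 * m + 1)) (𝓡∂ (2 * m + 2)) ι x (c • w j) =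
        c • mfderiv (𝓡 (2 * m + 1)) (𝓡∂ (2 * m + 2)) ι x (w j) := map_smul _ _ _
    exact h7.trans (congrArg (fun z : EuclideanSpace ℝ (Fin (2 * m + 2)) => c • z) h6)
  have h5 : 0 < wedgePow (fun u v => B (extChartAt (𝓡∂ (2 * m + 2)) p q) u v) (m + 1) W := by
    have h6 : 0 < wedgePow (OneForm.d (𝓡∂ (2 * m + 2)) lam q) (m + 1)
        (fun i => coordField (𝓡∂ (2 * m + 2)) p (W i) q) :=
      lt_of_lt_of_eq h3 (wedgePow_congr fun i j =>
        congrArg₂ (fun a b => OneForm.d (𝓡∂ (2 * m + 2)) lam q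
          (coordField (𝓡∂ (2 * m + 2)) p a q) (coordField (𝓡∂ (2 * m + 2)) p b q)) (h4 i) (h4 j))
    refine lt_of_lt_of_eq h6 (wedgePow_congr fun i j => ?_)
    rw [coordField_eq hq3, coordField_eq hq3, hlam.d_eq_curl hq3, chartD_chartDInv hq3,
      chartD_chartDInv hq3]
  rw [hW, wedgePow_cons_smul_single] at h5
  simp only [PiLp.neg_apply, PiLp.single_apply, if_true] at h5
  have h6 := frameDensity_mul (m := m) (A := B (extChartAt (𝓡∂ (2 * m + 2)) p q)) (curl_antisymm _ _ _)
    (N := chartD (𝓡∂ (2 * m + 2)) p q N) (a := θ (extChartAt (𝓡∂ (2 * m + 2)) p q)) (g := g) (by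
      intro u
      have h7 := hN (chartDInv (𝓡∂ (2 * m + 2)) p q u)
      rwa [hlam.d_eq_curl hq3, OneForm.apply_eq_inChart lam hq3, chartD_chartDInv hq3] at h7)
  rw [← heightCLM_apply] at h6
  set fd := frameDensity m (B (extChartAt (𝓡∂ (2 * m + 2)) p q))
  set bd := boundaryDensity m (θ (extChartAt (𝓡∂ (2 * m + 2)) p q)) (B (extChartAt (𝓡∂ (2 * m + 2)) p q))
  set N₀ := heightCLM m (chartD (𝓡∂ (2 * m + 2)) p q N)
  set C := c ^ (2 * m + 1)
  -- the positivity of the frame `(-e₀, c • w)` for `(dλ)^(m+1)`, and of `c • w` for `α ∧ (dα)^m`,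
  -- determines the signs of the two densities
  have hfd : C * fd < 0 := by linarith
  have h8 : N₀ * (C * fd) = (m + 1) * (g * (C * bd)) := by linear_combination C * h6
  have hm : (0 : ℝ) < m + 1 := by positivity
  constructor
  · intro h
    have h9 : 0 < N₀ * (C * fd) := mul_pos_of_neg_of_neg h hfd
    rw [h8] at h9
    exact pos_of_mul_pos_left (pos_of_mul_pos_right h9 hm.le) hq2.le
  · intro h
    have h9 : 0 < N₀ * (C * fd) := by rw [h8]; positivity
    by_contra! hcon
    exact absurd h9 (not_lt.2 (mul_nonpos_of_nonneg_of_nonpos hcon hfd.le))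

end Domain

/-! ### Extending the foliation of the Liouville field to the boundary -/

section Limits

theorem tendsto_clm_apply {X W W' : Type*} [NormedAddCommGroup W] [NormedSpace ℝ W]
    [NormedAddCommGroup W'] [NormedSpace ℝ W'] {f : Filter X} {A : X → W →L[ℝ] W'} {u : X → W}
    {A₀ : W →L[ℝ] W'} {u₀ : W} (hA : Tendsto A f (𝓝 A₀)) (hu : Tendsto u f (𝓝 u₀)) :
    Tendsto (fun x => A x (u x)) f (𝓝 (A₀ u₀)) :=
  (isBoundedBilinearMap_apply.continuous.tendsto (A₀, u₀)).comp (hA.prodMk_nhds hu)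

variable {E H : Type*} [NormedAddCommGroup E] [NormedSpace ℝ E] [TopologicalSpace H]
  {I : ModelWithCorners ℝ E H} {M : Type*} [TopologicalSpace M] [ChartedSpace H M]
  [IsManifold I ∞ M] {lam : OneForm I M} {V : ∀ p : M, TangentSpace I p} {p : M}

theorem tendsto_chartD_field
    (hV : ContMDiffAt I I.tangent ∞ (fun p => (⟨p, V p⟩ : TangentBundle I M)) p) :
    Tendsto (fun q => chartD I p q (V q)) (𝓝 p) (𝓝 (V p : E)) := by
  have hs : p ∈ (chartAt H p).source := mem_chart_source H p
  have h1 := (contDiffWithinAt_chartField hV hs).continuousWithinAt.tendsto.comp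
    (tendsto_extChartAt_range (I := I) hs)
  rw [chartField_extChartAt V hs, chartD_self] at h1
  refine h1.congr' ?_
  filter_upwards [(chartAt H p).open_source.mem_nhds hs] with q hq
  exact chartField_extChartAt V hq

theorem OneForm.IsSmooth.tendsto_apply (h : OneForm.IsSmooth I lam) {W : M → E}
    {w : TangentSpace I p} (hW : Tendsto W (𝓝 p) (𝓝 (w : E))) :
    Tendsto (fun q => lam q (chartDInv I p q (W q))) (𝓝 p) (𝓝 (lam p w)) := by
  have hs : p ∈ (chartAt H p).source := mem_chart_source H p
  have h1 := (h.contDiffWithinAt_inChart hs).continuousWithinAt.tendsto.comp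
    (tendsto_extChartAt_range (I := I) hs)
  have h2 := tendsto_clm_apply h1 hW
  rw [← chartD_self (I := I) p w, ← OneForm.apply_eq_inChart lam hs] at h2
  refine h2.congr' ?_
  filter_upwards [(chartAt H p).open_source.mem_nhds hs] with q hq
  rw [OneForm.apply_eq_inChart lam hq, chartD_chartDInv hq]
  rfl

theorem OneForm.IsSmooth.tendsto_d (h : OneForm.IsSmooth I lam) {U W : M → E}
    {u w : TangentSpace I p} (hU : Tendsto U (𝓝 p) (𝓝 (u : E)))
    (hW : Tendsto W (𝓝 p) (𝓝 (w : E))) :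
    Tendsto (fun q => OneForm.d I lam q (chartDInv I p q (U q)) (chartDInv I p q (W q))) (𝓝 p)
      (𝓝 (OneForm.d I lam p u w)) := by
  have hs : p ∈ (chartAt H p).source := mem_chart_source H p
  have h1 := (h.contDiffWithinAt_curl hs).continuousWithinAt.tendsto.comp
    (tendsto_extChartAt_range (I := I) hs)
  have h2 := tendsto_clm_apply (tendsto_clm_apply h1 hU) hW
  rw [← chartD_self (I := I) p w, ← chartD_self (I := I) p u, ← h.d_eq_curl hs] at h2
  refine h2.congr' ?_
  filter_upwards [(chartAt H p).open_source.mem_nhds hs] with q hq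
  rw [h.d_eq_curl hq, chartD_chartDInv hq, chartD_chartDInv hq]
  rfl

omit [IsManifold I ∞ M] in
theorem OneForm.liouvilleField_spec (h : ∃ X, ∀ w, OneForm.d I lam p X w = lam p w)
    (w : TangentSpace I p) : OneForm.d I lam p (OneForm.liouvilleField I lam p) w = lam p w := by
  unfold OneForm.liouvilleField
  rw [dif_pos h]
  exact h.choose_spec w

theorem OneForm.DNondegenerateAt.eq_of_d_eq (h : OneForm.DNondegenerateAt I lam p)
    {u v : TangentSpace I p} (huv : ∀ w, OneForm.d I lam p u w = OneForm.d I lam p v w) : u = v := by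
  refine sub_eq_zero.1 (h _ fun w => ?_)
  rw [← OneForm.dLin_apply, map_sub, LinearMap.sub_apply, OneForm.dLin_apply, OneForm.dLin_apply,
    huv, sub_self]

theorem OneForm.d_self (lam : OneForm I M) (p : M) (u : TangentSpace I p) :
    OneForm.d I lam p u u = 0 := by
  have := OneForm.d_antisymm lam p u u
  linarith

theorem OneForm.d_zero_left (lam : OneForm I M) (p : M) (w : TangentSpace I p) :
    OneForm.d I lam p 0 w = 0 := by
  rw [← OneForm.dLin_apply, map_zero, LinearMap.zero_apply]

theorem OneForm.d_smul_left (lam : OneForm I M) (p : M) (c : ℝ) (u w : TangentSpace I p) :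
    OneForm.d I lam p (c • u) w = c * OneForm.d I lam p u w := by
  rw [← OneForm.dLin_apply, map_smul, LinearMap.smul_apply, OneForm.dLin_apply, smul_eq_mul]

theorem OneForm.DNondegenerateAt.exists_liouville [FiniteDimensional ℝ E]
    (h : OneForm.DNondegenerateAt I lam p) : ∃ X, ∀ w, OneForm.d I lam p X w = lam p w := by
  have : FiniteDimensional ℝ (TangentSpace I p) := inferInstanceAs (FiniteDimensional ℝ E)
  have hinj : Function.Injective (OneForm.dLin I lam p) := by
    refine (injective_iff_map_eq_zero _).2 fun u hu => h u fun v => ?_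
    rw [← OneForm.dLin_apply, hu]
    rfl
  have hsurj : Function.Surjective (OneForm.dLin I lam p) :=
    (LinearMap.injective_iff_surjective_of_finrank_eq_finrank Subspace.dual_finrank_eq.symm).1 hinj
  obtain ⟨X, hX⟩ := hsurj (lam p : TangentSpace I p →ₗ[ℝ] ℝ)
  refine ⟨X, fun w => ?_⟩
  rw [← OneForm.dLin_apply, hX]
  rfl

/-- If `b` is antisymmetric and `z` is transverse to the hyperplane `ℓ = 0`, an equation
`b (z, ·) = g a` which holds on the hyperplane holds everywhere as soon as `a z = 0`. -/
theorem apply_eq_of_hyperplane {W : Type*} [AddCommGroup W] [Module ℝ W] [TopologicalSpace W]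
    {ℓ a : W →L[ℝ] ℝ} {b : W → W →L[ℝ] ℝ} (hb : ∀ u v, b u v = - b v u) {z : W} {g : ℝ}
    (hℓ : ℓ z = -1) (ha : a z = 0) (h : ∀ v, ℓ v = 0 → b z v = g * a v) (u : W) :
    b z u = g * a u := by
  have h1 := h (u + ℓ u • z) (by rw [map_add, map_smul, hℓ]; simp)
  have h2 : b z z = 0 := by
    have := hb z z
    linarith
  rw [map_add, map_smul, map_add, map_smul, h2, ha] at h1
  simpa using h1

end Limits

section Domain

variable {m : ℕ}
  {F : Type*} [TopologicalSpace F] [ChartedSpace (EuclideanHalfSpace (2 * m + 2)) F]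
  [IsManifold (𝓡∂ (2 * m + 2)) ∞ F]
  {K : Type*} [TopologicalSpace K] [ChartedSpace (EuclideanSpace ℝ (Fin (2 * m + 1))) K]
  [IsManifold (𝓡 (2 * m + 1)) ∞ K]
  {ι : K → F} {lam : OneForm (𝓡∂ (2 * m + 2)) F}

theorem isOpen_interior_halfSpace : IsOpen ((𝓡∂ (2 * m + 2)).interior F) := by
  refine isOpen_iff_mem_nhds.2 fun p hp => ?_
  have hs : p ∈ (chartAt (EuclideanHalfSpace (2 * m + 2)) p).source := mem_chart_source _ p
  rw [mem_interior_iff_of_mem_source heightCLM_single range_halfSpaceModel hs] at hp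
  have h1 : Tendsto (fun q => heightCLM m (extChartAt (𝓡∂ (2 * m + 2)) p q)) (𝓝 p)
      (𝓝 (heightCLM m (extChartAt (𝓡∂ (2 * m + 2)) p p))) :=
    ((heightCLM m).continuous.tendsto _).comp (continuousAt_extChartAt p)
  filter_upwards [h1.eventually (lt_mem_nhds hp),
    (chartAt (EuclideanHalfSpace (2 * m + 2)) p).open_source.mem_nhds hs] with q hq hqs
  exact (mem_interior_iff_of_mem_source (heightCLM_single (m := m)) range_halfSpaceModel hqs).2 hq

/-- A transverse field which is a positive multiple of the Liouville field at interior points is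
outward pointing. -/
theorem IsBoundaryInclusion.outward_of_eventually (hι : IsBoundaryInclusion m ι)
    (hlam : OneForm.IsSmooth (𝓡∂ (2 * m + 2)) lam) (hc : IsContactForm (boundaryForm ι lam))
    (hpos : IsPositiveOnBoundary ι lam) (x : K) {N : ∀ p : F, TangentSpace (𝓡∂ (2 * m + 2)) p}
    (hN : ContMDiffAt (𝓡∂ (2 * m + 2)) (𝓡∂ (2 * m + 2)).tangent ∞
      (fun p => (⟨p, N p⟩ : TangentBundle (𝓡∂ (2 * m + 2)) F)) (ι x))
    (hev : ∀ᶠ q in 𝓝 (ι x), q ∈ (𝓡∂ (2 * m + 2)).interior F →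
      ∃ g > 0, ∀ w, OneForm.d (𝓡∂ (2 * m + 2)) lam q (N q) w = g * lam q w)
    (hnot : ∀ w, mfderiv (𝓡 (2 * m + 1)) (𝓡∂ (2 * m + 2)) ι x w ≠ N (ι x)) :
    heightCLM m (N (ι x)) < 0 := by
  have h1 : Tendsto (fun q => heightCLM m (chartD (𝓡∂ (2 * m + 2)) (ι x) q (N q))) (𝓝 (ι x))
      (𝓝 (heightCLM m (N (ι x)))) :=
    ((heightCLM m).continuous.tendsto _).comp (tendsto_chartD_field hN)
  have := nhdsWithin_interior_neBot (heightCLM_single (m := m)) range_halfSpaceModel (ι x)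
  have h2 : heightCLM m (N (ι x)) ≤ 0 := by
    refine le_of_tendsto (h1.mono_left (nhdsWithin_le_nhds (s := (𝓡∂ (2 * m + 2)).interior F))) ?_
    filter_upwards [mem_nhdsWithin_of_mem_nhds hev,
      mem_nhdsWithin_of_mem_nhds (hι.eventually_sign hlam hc hpos x).2, self_mem_nhdsWithin]
      with q h3 h4 h5
    obtain ⟨g, hg, h6⟩ := h3 h5
    exact ((h4 h5 (N q) g h6).2 hg).le
  refine lt_of_le_of_ne h2 fun h3 => ?_
  obtain ⟨w, hw⟩ := hι.exists_mfderiv_eq hlam hc x h3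
  exact hnot w hw

/-- Near a boundary point there is a smooth field `N` with `dλ (N, ·) = g λ` which is transverse to
the boundary: the equations `N₀ = -1`, `λ (N) = 0` and `dλ (N, ·) = g λ` on a hyperplane are a
linear system for `(N, g)`, which is regular at the boundary because the induced form is a contact
form. -/
theorem IsBoundaryInclusion.exists_local_field (hι : IsBoundaryInclusion m ι)
    (hlam : OneForm.IsSmooth (𝓡∂ (2 * m + 2)) lam) (hc : IsContactForm (boundaryForm ι lam))
    (x : K) :
    ∃ U ∈ 𝓝 (ι x), ∃ N : ∀ p : F, TangentSpace (𝓡∂ (2 * m + 2)) p,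
      ContMDiffOn (𝓡∂ (2 * m + 2)) (𝓡∂ (2 * m + 2)).tangent ∞
        (fun p => (⟨p, N p⟩ : TangentBundle (𝓡∂ (2 * m + 2)) F)) U ∧
      ∀ q ∈ U, q ∈ (chartAt (EuclideanHalfSpace (2 * m + 2)) (ι x)).source ∧
        heightCLM m (chartD (𝓡∂ (2 * m + 2)) (ι x) q (N q)) = -1 ∧
        ∃ g : ℝ, ∀ w, OneForm.d (𝓡∂ (2 * m + 2)) lam q (N q) w = g * lam q w := by
  set p := ι x with hp
  have hs : p ∈ (chartAt (EuclideanHalfSpace (2 * m + 2)) p).source := mem_chart_source _ p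
  set θ := OneForm.inChart (𝓡∂ (2 * m + 2)) lam p with hθ
  set B := curl θ (range (𝓡∂ (2 * m + 2))) with hB
  let E := EuclideanSpace ℝ (Fin (2 * m + 2))
  let E₀ := EuclideanSpace ℝ (Fin (2 * m + 1))
  let j : E₀ →L[ℝ] E := (chartD (𝓡∂ (2 * m + 2)) p p).comp
    (mfderiv (𝓡 (2 * m + 1)) (𝓡∂ (2 * m + 2)) ι x)
  have hj : ∀ v : E, heightCLM m v = 0 → ∃ w, j w = v := fun v hv =>
    hι.exists_chartD_mfderiv_eq hlam hc x hs hv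
  let P : (E →L[ℝ] ℝ) →L[ℝ] (E₀ →L[ℝ] ℝ) := (ContinuousLinearMap.compL ℝ E₀ E ℝ).flip j
  -- the linear system, as a linear map which depends on the point
  let A : E → (E × ℝ →L[ℝ] ℝ × ℝ × (E₀ →L[ℝ] ℝ)) := fun y =>
    (ContinuousLinearMap.inl ℝ ℝ (ℝ × (E₀ →L[ℝ] ℝ))).comp
      ((heightCLM m).comp (ContinuousLinearMap.fst ℝ E ℝ)) +
    (ContinuousLinearMap.inr ℝ ℝ (ℝ × (E₀ →L[ℝ] ℝ))).comp
      ((ContinuousLinearMap.inl ℝ ℝ (E₀ →L[ℝ] ℝ)).comp ((θ y).comp (ContinuousLinearMap.fst ℝ E ℝ)) +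
       (ContinuousLinearMap.inr ℝ ℝ (E₀ →L[ℝ] ℝ)).comp (P.comp ((B y).comp (ContinuousLinearMap.fst ℝ E ℝ)
        - (ContinuousLinearMap.smulRightL ℝ (E × ℝ) (E →L[ℝ] ℝ) (ContinuousLinearMap.snd ℝ E ℝ)) (θ y))))
  have hA : ∀ y z, A y z = (heightCLM m z.1, θ y z.1, P (B y z.1 - z.2 • θ y)) := by
    intro y z
    refine Prod.ext ?_ (Prod.ext ?_ ?_) <;> simp [A]
  have hAsmooth : ∀ q ∈ (chartAt (EuclideanHalfSpace (2 * m + 2)) p).source,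
      ContDiffWithinAt ℝ ∞ A (range (𝓡∂ (2 * m + 2))) (extChartAt (𝓡∂ (2 * m + 2)) p q) := by
    intro q hq
    have h1 : ContDiffWithinAt ℝ ∞ θ _ _ := hlam.contDiffWithinAt_inChart hq
    have h2 : ContDiffWithinAt ℝ ∞ B _ _ := hlam.contDiffWithinAt_curl hq
    refine contDiffWithinAt_const.add (contDiffWithinAt_const.clm_comp
      ((contDiffWithinAt_const.clm_comp (h1.clm_comp contDiffWithinAt_const)).add
        (contDiffWithinAt_const.clm_comp (contDiffWithinAt_const.clm_comp
          ((h2.clm_comp contDiffWithinAt_const).sub ?_)))))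
    exact contDiffWithinAt_const.clm_apply h1
  have hinv : (A (extChartAt (𝓡∂ (2 * m + 2)) p p)).IsInvertible := by
    refine ContinuousLinearMap.isInvertible_of_injective_of_finrank_eq (fun z hz => ?_) ?_
    · rw [hA] at hz
      -- a solution of the homogeneous system is tangent to the boundary and lies in the kernel of the
      -- contact form `α`, and `dα (N, ·) = g α`
      obtain ⟨N, g⟩ := z
      simp only [Prod.mk_eq_zero] at hz
      obtain ⟨hz1, hz2, hz3⟩ := hz
      obtain ⟨n, rfl⟩ := hj N hz1
      have h3 : ∀ w : TangentSpace (𝓡 (2 * m + 1)) x,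
          OneForm.d (𝓡 (2 * m + 1)) (boundaryForm ι lam) x n w = g * boundaryForm ι lam x w := by
        intro w
        have h4 := DFunLike.congr_fun hz3 w
        have h5 : B (extChartAt (𝓡∂ (2 * m + 2)) p p) (j n) (j w) - g * θ (extChartAt (𝓡∂ (2 * m + 2)) p p) (j w) = 0 := h4
        refine (hι.d_boundaryForm hlam x n w).trans ((hlam.d_eq_curl hs _ _).trans
          ((sub_eq_zero.1 h5).trans ?_))
        exact congrArg (g * ·) (OneForm.apply_eq_inChart lam hs _).symm
      have h4 : boundaryForm ι lam x n = 0 :=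
        (OneForm.apply_eq_inChart lam hs _).trans hz2
      have hn : (n : TangentSpace (𝓡 (2 * m + 1)) x) = 0 :=
        hc.eq_zero h4 fun w hw => by rw [h3, hw, mul_zero]
      obtain ⟨v, hv⟩ := hc.exists_apply_ne_zero x
      have h5 := ((h3 v).symm.trans (congrArg (fun z : TangentSpace (𝓡 (2 * m + 1)) x =>
        OneForm.d (𝓡 (2 * m + 1)) (boundaryForm ι lam) x z v) hn)).trans
          (OneForm.d_zero_left _ _ _)
      have h6 : g = 0 := (mul_eq_zero.1 h5).resolve_right hv
      have h7 : j n = 0 := by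
        have : n = 0 := hn
        rw [this, map_zero]
      rw [h6, h7]
      rfl
    · simp only [Module.finrank_prod, finrank_dual_clm, Module.finrank_self, E, E₀,
        finrank_euclideanSpace_fin]
      ring
  have hev : ∀ᶠ y in 𝓝[range (𝓡∂ (2 * m + 2))] (extChartAt (𝓡∂ (2 * m + 2)) p p),
      (A y).IsInvertible := by
    obtain ⟨L, hL⟩ := hinv
    have := (hAsmooth p hs).continuousWithinAt.tendsto
    rw [← hL] at this
    filter_upwards [this.eventually (ContinuousLinearEquiv.nhds L)] with y hy
    exact hy
  have hev' := eventually_nhds_of_nhdsWithin_range hs hev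
  let Z : E → E × ℝ := fun y => (A y).inverse (-1, 0, 0)
  refine ⟨_, hev', fun q => chartDInv (𝓡∂ (2 * m + 2)) p q (Z (extChartAt (𝓡∂ (2 * m + 2)) p q)).1,
    fun q hq => ?_, fun q hq => ?_⟩
  · obtain ⟨hq1, hq2⟩ := hq
    refine ContMDiffAt.contMDiffWithinAt (contMDiffAt_section_of_chart (n := ⊤) hq1 ?_)
    have h1 : ContDiffWithinAt ℝ ∞ (fun y => (Z y).1) (range (𝓡∂ (2 * m + 2)))
        (extChartAt (𝓡∂ (2 * m + 2)) p q) :=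
      contDiff_fst.contDiffAt.comp_contDiffWithinAt _
        ((hq2.contDiffAt_map_inverse.comp_contDiffWithinAt _ (hAsmooth q hq1)).clm_apply
          contDiffWithinAt_const)
    refine ContDiffWithinAt.congr_of_eventuallyEq_of_mem h1 ?_ (extChartAt_mem_range p q)
    filter_upwards [eventually_nhdsWithin_range_extChartAt hq1
      (Eventually.of_forall (fun _ => trivial))] with y hy
    rw [chartField, chartD_chartDInv hy.2.1, (extChartAt (𝓡∂ (2 * m + 2)) p).right_inv hy.1]
  · obtain ⟨hq1, hq2⟩ := hq
    have h1 : A _ (Z (extChartAt (𝓡∂ (2 * m + 2)) p q)) = (-1, 0, 0) := hq2.self_apply_inverse _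
    rw [hA] at h1
    beta_reduce
    generalize Z (extChartAt (𝓡∂ (2 * m + 2)) p q) = z at h1 ⊢
    clear hinv hev hev' hAsmooth hA hq2 Z A
    set y := extChartAt (𝓡∂ (2 * m + 2)) p q
    obtain ⟨h2, h3⟩ := Prod.ext_iff.1 h1
    obtain ⟨h3, h4⟩ := Prod.ext_iff.1 h3
    simp only at h2 h3 h4
    refine ⟨hq1, by rw [chartD_chartDInv hq1]; exact h2, z.2, fun w => ?_⟩
    rw [hlam.d_eq_curl hq1, chartD_chartDInv hq1, OneForm.apply_eq_inChart lam hq1]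
    refine apply_eq_of_hyperplane (curl_antisymm _ _ _) h2 h3 (fun v hv => ?_) _
    obtain ⟨w', rfl⟩ := hj v hv
    have h5 : B y z.1 (j w') - z.2 * θ y (j w') = 0 := DFunLike.congr_fun h4 w'
    exact sub_eq_zero.1 h5

end Domain

section Domain

variable {m : ℕ}
  {F : Type*} [TopologicalSpace F] [ChartedSpace (EuclideanHalfSpace (2 * m + 2)) F]
  [IsManifold (𝓡∂ (2 * m + 2)) ∞ F]
  {K : Type*} [TopologicalSpace K] [ChartedSpace (EuclideanSpace ℝ (Fin (2 * m + 1))) K]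
  [IsManifold (𝓡 (2 * m + 1)) ∞ K]
  {ι : K → F} {lam : OneForm (𝓡∂ (2 * m + 2)) F}

/-- The vector field `ν` and the function `g` satisfy `dλ (ν, ·) = g λ` on the whole domain, where
`g` is positive on the interior; moreover `ν` is outward pointing along the boundary. At interior
points, `ν = g X` for the Liouville field `X`. -/
structure IsLiouvilleData (lam : OneForm (𝓡∂ (2 * m + 2)) F)
    (ν : ∀ p : F, TangentSpace (𝓡∂ (2 * m + 2)) p) (g : F → ℝ) : Prop where
  smooth : ContMDiff (𝓡∂ (2 * m + 2)) (𝓡∂ (2 * m + 2)).tangent ∞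
    (fun p => (⟨p, ν p⟩ : TangentBundle (𝓡∂ (2 * m + 2)) F))
  smooth_factor : ContMDiff (𝓡∂ (2 * m + 2)) 𝓘(ℝ, ℝ) ∞ g
  d_eq : ∀ p w, OneForm.d (𝓡∂ (2 * m + 2)) lam p (ν p) w = g p * lam p w
  apply_eq_zero : ∀ p, lam p (ν p) = 0
  pos : ∀ p ∈ (𝓡∂ (2 * m + 2)).interior F, 0 < g p
  outward : ∀ p ∈ (𝓡∂ (2 * m + 2)).boundary F, heightCLM m (ν p) < 0

omit [IsManifold (𝓡∂ (2 * m + 2)) ∞ F] in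
theorem mem_interior_or_boundary (p : F) :
    p ∈ (𝓡∂ (2 * m + 2)).interior F ∨ p ∈ (𝓡∂ (2 * m + 2)).boundary F := by
  by_cases h : p ∈ (𝓡∂ (2 * m + 2)).interior F
  · exact Or.inl h
  · rw [← ModelWithCorners.compl_interior]
    exact Or.inr h

omit [IsManifold (𝓡∂ (2 * m + 2)) ∞ F] in
theorem notMem_interior_of_mem_boundary {p : F} (h : p ∈ (𝓡∂ (2 * m + 2)).boundary F) :
    p ∉ (𝓡∂ (2 * m + 2)).interior F := by
  rw [← ModelWithCorners.compl_interior] at h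
  exact h

theorem DNondegenerateAt.d_smul_liouvilleField {q : F}
    (h : OneForm.DNondegenerateAt (𝓡∂ (2 * m + 2)) lam q) (c : ℝ)
    (w : TangentSpace (𝓡∂ (2 * m + 2)) q) :
    OneForm.d (𝓡∂ (2 * m + 2)) lam q (c • OneForm.liouvilleField (𝓡∂ (2 * m + 2)) lam q) w =
      c * lam q w := by
  rw [OneForm.d_smul_left, OneForm.liouvilleField_spec h.exists_liouville]

/-- A foliation which extends the foliation of the Liouville field and is transverse to the boundary
is spanned by a field `ν` with `dλ (ν, ·) = g λ` for a function `g` which is smooth up to the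
boundary. -/
theorem IsBoundaryInclusion.exists_isLiouvilleData (hι : IsBoundaryInclusion m ι)
    (hlam : OneForm.IsSmooth (𝓡∂ (2 * m + 2)) lam) (hc : IsContactForm (boundaryForm ι lam))
    (hpos : IsPositiveOnBoundary ι lam)
    (hsymp : ∀ p ∈ (𝓡∂ (2 * m + 2)).interior F,
      OneForm.DNondegenerateAt (𝓡∂ (2 * m + 2)) lam p)
    {ν : ∀ p : F, TangentSpace (𝓡∂ (2 * m + 2)) p} (hν : IsTransverseExtension ι lam ν) :
    ∃ g, IsLiouvilleData lam ν g := by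
  classical
  obtain ⟨v, hv, hvX⟩ := hν.extends_liouville
  have hd : ∀ p ∈ (𝓡∂ (2 * m + 2)).interior F, ∀ w,
      OneForm.d (𝓡∂ (2 * m + 2)) lam p (ν p) w = v p * lam p w := fun p hp w => by
    rw [(hvX p hp).2]
    exact DNondegenerateAt.d_smul_liouvilleField (hsymp p hp) _ _
  have h0int : ∀ p ∈ (𝓡∂ (2 * m + 2)).interior F, lam p (ν p) = 0 := fun p hp => by
    have h1 := hd p hp (ν p)
    rw [OneForm.d_self] at h1
    exact (mul_eq_zero.1 h1.symm).resolve_left (hvX p hp).1.ne'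
  -- both relations extend to the boundary by continuity
  have hne : ∀ p : F, (𝓝[(𝓡∂ (2 * m + 2)).interior F] p).NeBot := fun p =>
    nhdsWithin_interior_neBot (heightCLM_single (m := m)) range_halfSpaceModel p
  have hchart : ∀ p : F, ∀ᶠ q in 𝓝[(𝓡∂ (2 * m + 2)).interior F] p,
      q ∈ (chartAt (EuclideanHalfSpace (2 * m + 2)) p).source := fun p =>
    mem_nhdsWithin_of_mem_nhds
      ((chartAt (EuclideanHalfSpace (2 * m + 2)) p).open_source.mem_nhds (mem_chart_source _ p))
  have h0 : ∀ p, lam p (ν p) = 0 := by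
    intro p
    have := hne p
    have h1 := (hlam.tendsto_apply (tendsto_chartD_field (hν.smooth p))).mono_left
      (nhdsWithin_le_nhds (s := (𝓡∂ (2 * m + 2)).interior F))
    refine tendsto_nhds_unique h1 (Tendsto.congr' ?_ tendsto_const_nhds)
    filter_upwards [self_mem_nhdsWithin, hchart p] with q hq hqs
    rw [chartDInv_chartD hqs, h0int q hq]
  have hprop : ∀ p (u w : TangentSpace (𝓡∂ (2 * m + 2)) p),
      OneForm.d (𝓡∂ (2 * m + 2)) lam p (ν p) w * lam p u =
        OneForm.d (𝓡∂ (2 * m + 2)) lam p (ν p) u * lam p w := by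
    intro p u w
    have := hne p
    have hconst : ∀ z : TangentSpace (𝓡∂ (2 * m + 2)) p,
        Tendsto (fun _ : F => (z : EuclideanSpace ℝ (Fin (2 * m + 2)))) (𝓝 p)
          (𝓝 (z : EuclideanSpace ℝ (Fin (2 * m + 2)))) := fun z => tendsto_const_nhds
    have hfield := tendsto_chartD_field (hν.smooth p)
    have h1 := ((hlam.tendsto_d hfield (hconst w)).mul (hlam.tendsto_apply (hconst u))).mono_left
      (nhdsWithin_le_nhds (s := (𝓡∂ (2 * m + 2)).interior F))
    have h2 := ((hlam.tendsto_d hfield (hconst u)).mul (hlam.tendsto_apply (hconst w))).mono_left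
      (nhdsWithin_le_nhds (s := (𝓡∂ (2 * m + 2)).interior F))
    refine tendsto_nhds_unique h1 (h2.congr' ?_)
    filter_upwards [self_mem_nhdsWithin, hchart p] with q hq hqs
    rw [chartDInv_chartD hqs, hd q hq, hd q hq]
    ring
  -- the factor is `v` on the interior, and is determined by the field on the boundary
  have hex : ∀ p : F, ∃ c : ℝ, (∀ w, OneForm.d (𝓡∂ (2 * m + 2)) lam p (ν p) w = c * lam p w) ∧
      (p ∈ (𝓡∂ (2 * m + 2)).interior F → c = v p) := by
    intro p
    rcases mem_interior_or_boundary (m := m) p with hp | hp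
    · exact ⟨v p, hd p hp, fun _ => rfl⟩
    · rw [← hι.range_eq] at hp
      obtain ⟨x, rfl⟩ := hp
      obtain ⟨u, hu⟩ : ∃ u, lam (ι x) u ≠ 0 := by
        by_contra! hcon
        exact hc.apply_boundary_ne_zero x (ContinuousLinearMap.ext hcon)
      refine ⟨OneForm.d (𝓡∂ (2 * m + 2)) lam (ι x) (ν (ι x)) u / lam (ι x) u, fun w => ?_,
        fun h => absurd h (notMem_interior_of_mem_boundary (hι.mem_boundary x))⟩
      have := hprop (ι x) u w
      field_simp
      linarith
  choose g hg hgv using hex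
  refine ⟨g, hν.smooth, fun p => ?_, hg, h0, fun p hp => ?_, fun p hp => ?_⟩
  · rcases mem_interior_or_boundary (m := m) p with hp | hp
    · have hn := (isOpen_interior_halfSpace (m := m) (F := F)).mem_nhds hp
      exact (hv.contMDiffAt hn).congr_of_eventuallyEq
        (Filter.mem_of_superset hn fun q hq => hgv q hq)
    · rw [← hι.range_eq] at hp
      obtain ⟨x, rfl⟩ := hp
      exact contMDiffAt_factor hlam (hν.smooth _) (Eventually.of_forall hg)
        (hc.apply_boundary_ne_zero x)
  · rw [hgv p hp]
    exact (hvX p hp).1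
  · rw [← hι.range_eq] at hp
    obtain ⟨x, rfl⟩ := hp
    refine hι.outward_of_eventually hlam hc hpos x (hν.smooth _)
      (Eventually.of_forall fun q hq => ⟨v q, (hvX q hq).1, hd q hq⟩) fun w hw => ?_
    exact hν.transverse x ⟨w, hw⟩

/-- The foliation of the Liouville field extends to a foliation transverse to the boundary: the
local fields are glued by a partition of unity, the conditions on them being convex. Near the zeros
of `λ` the field is required to be the Liouville field itself, so that the factor of proportionality
is smooth there. -/
theorem IsBoundaryInclusion.exists_isTransverseExtension [T2Space F] [CompactSpace F]
    (hι : IsBoundaryInclusion m ι)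
    (hlam : OneForm.IsSmooth (𝓡∂ (2 * m + 2)) lam) (hc : IsContactForm (boundaryForm ι lam))
    (hpos : IsPositiveOnBoundary ι lam)
    (hsymp : ∀ p ∈ (𝓡∂ (2 * m + 2)).interior F,
      OneForm.DNondegenerateAt (𝓡∂ (2 * m + 2)) lam p) :
    ∃ ν : ∀ p : F, TangentSpace (𝓡∂ (2 * m + 2)) p, IsTransverseExtension ι lam ν := by
  classical
  set X := OneForm.liouvilleField (𝓡∂ (2 * m + 2)) lam with hX
  have hbclosed : IsClosed ((𝓡∂ (2 * m + 2)).boundary F) := by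
    rw [← ModelWithCorners.compl_interior]
    exact isOpen_interior_halfSpace.isClosed_compl
  have hzopen : IsOpen {p : F | lam p ≠ 0} := by
    refine isOpen_iff_mem_nhds.2 fun p hp => ?_
    obtain ⟨u, hu⟩ : ∃ u, lam p u ≠ 0 := by
      by_contra! hcon
      exact hp (ContinuousLinearMap.ext hcon)
    have h1 := hlam.tendsto_apply (w := u) (W := fun _ : F => (u : EuclideanSpace ℝ (Fin (2 * m + 2))))
      tendsto_const_nhds
    filter_upwards [h1.eventually_ne hu] with q hq h
    rw [h] at hq
    exact hq rfl
  have hsub : (𝓡∂ (2 * m + 2)).boundary F ⊆ {p : F | lam p ≠ 0} := by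
    rw [← hι.range_eq]
    rintro _ ⟨x, rfl⟩
    exact hc.apply_boundary_ne_zero x
  -- a neighbourhood of the boundary whose closure avoids the zeros of `λ`
  obtain ⟨O, hO, hbO, hOz⟩ := normal_exists_closure_subset hbclosed hzopen hsub
  -- the local conditions on the field
  let t : ∀ p : F, Set (TangentSpace (𝓡∂ (2 * m + 2)) p) := fun p =>
    {u | (p ∈ (𝓡∂ (2 * m + 2)).interior F → ∃ c > (0 : ℝ), u = c • X p) ∧
      (p ∈ (𝓡∂ (2 * m + 2)).boundary F → heightCLM m u < 0) ∧ (p ∉ O → u = X p)}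
  have hconv : ∀ p, Convex ℝ (t p) := by
    rintro p u ⟨hu1, hu2, hu3⟩ w ⟨hw1, hw2, hw3⟩ a b ha hb hab
    refine ⟨fun hp => ?_, fun hp => ?_, fun hp => ?_⟩
    · obtain ⟨c, hc, rfl⟩ := hu1 hp
      obtain ⟨c', hc', rfl⟩ := hw1 hp
      refine ⟨a * c + b * c', ?_, by rw [add_smul, mul_smul, mul_smul]⟩
      exact (convex_Ioi (0 : ℝ)) (mem_Ioi.2 hc) (mem_Ioi.2 hc') ha hb hab
    · have h1 := hu2 hp
      have h2 := hw2 hp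
      have h3 : heightCLM m (a • u + b • w) = a * heightCLM m u + b * heightCLM m w :=
        (map_add (heightCLM m) _ _).trans (congrArg₂ (· + ·) (map_smul (heightCLM m) a _)
          (map_smul (heightCLM m) b _))
      refine lt_of_eq_of_lt h3 ?_
      exact (convex_Iio (0 : ℝ)) h1 h2 ha hb hab
    · rw [hu3 hp, hw3 hp, ← add_smul, hab, one_smul]
  have hXd : ∀ q ∈ (𝓡∂ (2 * m + 2)).interior F, ∀ w,
      OneForm.d (𝓡∂ (2 * m + 2)) lam q (X q) w = lam q w := fun q hq w =>
    OneForm.liouvilleField_spec (hsymp q hq).exists_liouville w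
  obtain ⟨s, hs⟩ := exists_contMDiffSection_forall_mem_convex_of_local (𝓡∂ (2 * m + 2)) (n := ⊤)
    (F_fiber := EuclideanSpace ℝ (Fin (2 * m + 2))) (TangentSpace (𝓡∂ (2 * m + 2)) : F → Type) t hconv
    (fun p => by
      rcases mem_interior_or_boundary (m := m) p with hp | hp
      · obtain ⟨U, hU, Y, hY, hYd⟩ := exists_local_liouville hlam (hsymp p hp)
        refine ⟨U ∩ (𝓡∂ (2 * m + 2)).interior F,
          Filter.inter_mem hU (isOpen_interior_halfSpace.mem_nhds hp), Y,
          hY.mono inter_subset_left, fun q hq => ?_⟩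
        have h1 : Y q = X q := (hsymp q hq.2).eq_of_d_eq fun w => by
          rw [hYd q hq.1, hXd q hq.2]
        exact ⟨fun _ => ⟨1, one_pos, by rw [one_smul, h1]⟩,
          fun h => absurd hq.2 (notMem_interior_of_mem_boundary h), fun _ => h1⟩
      · have hpO := hbO hp
        rw [← hι.range_eq] at hp
        obtain ⟨x, rfl⟩ := hp
        obtain ⟨U, hU, N, hN, hNU⟩ := hι.exists_local_field hlam hc x
        obtain ⟨U', hU', hU'o, hxU'⟩ := mem_nhds_iff.1 (Filter.inter_mem hU
          (Filter.inter_mem (hι.eventually_sign hlam hc hpos x).2 (hO.mem_nhds hpO)))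
        have hsign : ∀ q ∈ U', q ∈ (𝓡∂ (2 * m + 2)).interior F →
            ∃ g > (0 : ℝ), ∀ w, OneForm.d (𝓡∂ (2 * m + 2)) lam q (N q) w = g * lam q w := by
          intro q hq hqi
          obtain ⟨-, h1, g, hg⟩ := hNU q (hU' hq).1
          refine ⟨g, ((hU' hq).2.1 hqi (N q) g hg).1 ?_, hg⟩
          rw [h1]
          norm_num
        refine ⟨U', hU'o.mem_nhds hxU', N, hN.mono fun q hq => (hU' hq).1, fun q hq => ⟨fun hqi => ?_,
          fun hqb => ?_, fun h => absurd (hU' hq).2.2 h⟩⟩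
        · obtain ⟨g, hg, hgd⟩ := hsign q hq hqi
          refine ⟨g, hg, (hsymp q hqi).eq_of_d_eq fun w => ?_⟩
          rw [hgd, OneForm.d_smul_left, hXd q hqi]
        · obtain ⟨h1, h2, -⟩ := hNU q (hU' hq).1
          rw [← hι.range_eq] at hqb
          obtain ⟨y, rfl⟩ := hqb
          refine hι.outward_of_eventually hlam hc hpos y
            (hN.contMDiffAt (Filter.mem_of_superset (hU'o.mem_nhds hq) fun q hq => (hU' hq).1))
            (Filter.mem_of_superset (hU'o.mem_nhds hq) hsign) fun w hw => ?_
          have h3 := clm_chartD_mfderiv_boundary heightCLM_single range_halfSpaceModel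
            hι.mem_boundary (hι.mdifferentiableAt y) h1 w
          rw [hw, h2] at h3
          norm_num at h3)
  have hsm : ContMDiff (𝓡∂ (2 * m + 2)) (𝓡∂ (2 * m + 2)).tangent ∞
    (fun p => (⟨p, s p⟩ : TangentBundle (𝓡∂ (2 * m + 2)) F)) := s.contMDiff
  have hex : ∀ p : F, ∃ c : ℝ, p ∈ (𝓡∂ (2 * m + 2)).interior F →
      0 < c ∧ s p = c • X p ∧ (lam p = 0 → c = 1) := by
    intro p
    by_cases hp : p ∈ (𝓡∂ (2 * m + 2)).interior F
    · by_cases hl : lam p = 0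
      · exact ⟨1, fun _ => ⟨one_pos, by rw [one_smul, (hs p).2.2 fun h => hOz (subset_closure h) hl],
          fun _ => rfl⟩⟩
      · obtain ⟨c, hc0, hcX⟩ := (hs p).1 hp
        exact ⟨c, fun _ => ⟨hc0, hcX, fun h => absurd h hl⟩⟩
    · exact ⟨1, fun h => absurd h hp⟩
  choose v hv using hex
  have hvd : ∀ p ∈ (𝓡∂ (2 * m + 2)).interior F, ∀ w,
      OneForm.d (𝓡∂ (2 * m + 2)) lam p (s p) w = v p * lam p w := fun p hp w => by
    rw [(hv p hp).2.1, OneForm.d_smul_left, hXd p hp]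
  refine ⟨fun p => s p, hsm, ⟨v, fun p hp => ?_, fun p hp => ⟨(hv p hp).1, (hv p hp).2.1⟩⟩,
    fun x hx => ?_⟩
  · have hn := (isOpen_interior_halfSpace (m := m) (F := F)).mem_nhds hp
    refine ContMDiffAt.contMDiffWithinAt ?_
    by_cases hl : lam p = 0
    · have hpO : p ∉ closure O := fun h => hOz h hl
      refine (contMDiffAt_const (c := (1 : ℝ))).congr_of_eventuallyEq ?_
      filter_upwards [hn, isClosed_closure.isOpen_compl.mem_nhds hpO] with q hq hqO
      by_cases hlq : lam q = 0
      · exact (hv q hq).2.2 hlq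
      · obtain ⟨u, hu⟩ : ∃ u, lam q u ≠ 0 := by
          by_contra! hcon
          exact hlq (ContinuousLinearMap.ext hcon)
        have h1 := hvd q hq u
        rw [(hs q).2.2 fun h => hqO (subset_closure h), hXd q hq] at h1
        exact (mul_right_cancel₀ hu ((one_mul _).trans h1)).symm
    · exact contMDiffAt_factor hlam (hsm p) (Filter.mem_of_superset hn fun q hq => hvd q hq) hl
  · obtain ⟨w, hw⟩ := hx
    have h1 := (hs (ι x)).2.1 (hι.mem_boundary x)
    have h2 := clm_chartD_mfderiv_boundary heightCLM_single range_halfSpaceModel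
      hι.mem_boundary (hι.mdifferentiableAt x) (mem_chart_source _ (ι x)) w
    rw [hw, chartD_self] at h2
    exact h1.ne h2

end Domain

/-! ### Degeneracy along the boundary -/

section

variable {E H : Type*} [NormedAddCommGroup E] [NormedSpace ℝ E] [TopologicalSpace H]
  {I : ModelWithCorners ℝ E H} {M : Type*} [TopologicalSpace M] [ChartedSpace H M]

theorem fnD_congr {G : Type*} [NormedAddCommGroup G] [NormedSpace ℝ G] {f f' : M → G} {p : M}
    (h : f =ᶠ[𝓝 p] f') : fnD I f p = fnD I f' p :=
  h.mfderiv_eq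

theorem fnD_mul {f f' : M → ℝ} {p : M} (hf : MDifferentiableAt I 𝓘(ℝ, ℝ) f p)
    (hf' : MDifferentiableAt I 𝓘(ℝ, ℝ) f' p) (u : TangentSpace I p) :
    fnD I (fun q => f q * f' q) p u = f p * fnD I f' p u + f' p * fnD I f p u := by
  have h := (hf.hasMFDerivAt.mul hf'.hasMFDerivAt).mfderiv
  exact DFunLike.congr_fun h u

theorem fnD_comp {E' H' : Type*} [NormedAddCommGroup E'] [NormedSpace ℝ E'] [TopologicalSpace H']
    {J : ModelWithCorners ℝ E' H'} {K : Type*} [TopologicalSpace K] [ChartedSpace H' K] {ι : K → M}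
    {f : M → ℝ} {x : K} (hf : MDifferentiableAt I 𝓘(ℝ, ℝ) f (ι x))
    (hι : MDifferentiableAt J I ι x) (u : TangentSpace J x) :
    fnD J (fun z => f (ι z)) x u = fnD I f (ι x) (mfderiv J I ι x u) :=
  DFunLike.congr_fun (mfderiv_comp x hf hι) u

/-- The differential of a function vanishes at a local minimum, on a manifold without boundary. -/
theorem fnD_eq_zero_of_isMinOn [I.Boundaryless] {f : M → ℝ} {p : M}
    (h : ∀ q, f p ≤ f q) (u : TangentSpace I p) : fnD I f p u = 0 := by
  by_cases hf : MDifferentiableAt I 𝓘(ℝ, ℝ) f p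
  · have hmin : IsLocalMin (writtenInExtChartAt I 𝓘(ℝ, ℝ) p f) (extChartAt I p p) := by
      refine Eventually.of_forall fun y => ?_
      simp only [writtenInExtChartAt, extChartAt_self_eq, Function.comp_apply, extChartAt_to_inv]
      exact h _
    have h1 := hmin.fderiv_eq_zero
    have h2 : fderivWithin ℝ (writtenInExtChartAt I 𝓘(ℝ, ℝ) p f) (range I) (extChartAt I p p) = 0 := by
      rw [I.range_eq_univ, fderivWithin_univ, h1]
    exact (DFunLike.congr_fun hf.mfderiv u).trans (DFunLike.congr_fun h2 u)
  · rw [fnD, mfderiv_zero_of_not_mdifferentiableAt hf]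
    rfl

end

section Domain

variable {m : ℕ}
  {F : Type*} [TopologicalSpace F] [ChartedSpace (EuclideanHalfSpace (2 * m + 2)) F]
  [IsManifold (𝓡∂ (2 * m + 2)) ∞ F]
  {K : Type*} [TopologicalSpace K] [ChartedSpace (EuclideanSpace ℝ (Fin (2 * m + 1))) K]
  [IsManifold (𝓡 (2 * m + 1)) ∞ K]
  {ι : K → F} {lam : OneForm (𝓡∂ (2 * m + 2)) F}
  {ν : ∀ p : F, TangentSpace (𝓡∂ (2 * m + 2)) p} {g : F → ℝ}

theorem IsLiouvilleData.nonneg (h : IsLiouvilleData lam ν g) (p : F) : 0 ≤ g p := by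
  have := nhdsWithin_interior_neBot (heightCLM_single (m := m)) range_halfSpaceModel p
  refine ge_of_tendsto (h.smooth_factor.continuous.continuousAt.mono_left
    (nhdsWithin_le_nhds (s := (𝓡∂ (2 * m + 2)).interior F))) ?_
  filter_upwards [self_mem_nhdsWithin] with q hq using (h.pos q hq).le

theorem IsLiouvilleData.mdifferentiable_factor (h : IsLiouvilleData lam ν g) (p : F) :
    MDifferentiableAt (𝓡∂ (2 * m + 2)) 𝓘(ℝ, ℝ) g p :=
  h.smooth_factor.mdifferentiable (by simp) p

/-- A tangent vector at a boundary point is the sum of a multiple of `ν` and of a vector tangent to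
the boundary. -/
theorem IsLiouvilleData.exists_decomposition (h : IsLiouvilleData lam ν g)
    (hι : IsBoundaryInclusion m ι) (hlam : OneForm.IsSmooth (𝓡∂ (2 * m + 2)) lam)
    (hc : IsContactForm (boundaryForm ι lam)) (x : K) (u : TangentSpace (𝓡∂ (2 * m + 2)) (ι x)) :
    ∃ (c : ℝ) (w : TangentSpace (𝓡 (2 * m + 1)) x),
      u = c • ν (ι x) + mfderiv (𝓡 (2 * m + 1)) (𝓡∂ (2 * m + 2)) ι x w := by
  have hν := (h.outward _ (hι.mem_boundary x)).ne
  obtain ⟨ν₀, hν₀⟩ : ∃ ν₀ : EuclideanSpace ℝ (Fin (2 * m + 2)), ν₀ = ν (ι x) := ⟨_, rfl⟩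
  obtain ⟨u₀, hu₀⟩ : ∃ u₀ : EuclideanSpace ℝ (Fin (2 * m + 2)), u₀ = u := ⟨_, rfl⟩
  have hne : heightCLM m ν₀ ≠ 0 := by
    rw [hν₀]
    exact hν
  obtain ⟨w, hw⟩ := hι.exists_mfderiv_eq hlam hc x
    (v := u₀ - (heightCLM m u₀ / heightCLM m ν₀) • ν₀) (by
      rw [map_sub, map_smul, smul_eq_mul, div_mul_cancel₀ _ hne, sub_self])
  refine ⟨heightCLM m u₀ / heightCLM m ν₀, w, ?_⟩
  have h1 : u₀ = (heightCLM m u₀ / heightCLM m ν₀) • ν₀ +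
      (u₀ - (heightCLM m u₀ / heightCLM m ν₀) • ν₀) := by abel
  refine hu₀.symm.trans (h1.trans ?_)
  exact congrArg₂ (· + ·) (congrArg (fun z : EuclideanSpace ℝ (Fin (2 * m + 2)) =>
    (heightCLM m u₀ / heightCLM m ν₀) • z) hν₀) hw.symm

/-- At a boundary point, `dλ` is degenerate if and only if `g` vanishes. -/
theorem IsLiouvilleData.dNondegenerateAt_iff (h : IsLiouvilleData lam ν g)
    (hι : IsBoundaryInclusion m ι) (hlam : OneForm.IsSmooth (𝓡∂ (2 * m + 2)) lam)
    (hc : IsContactForm (boundaryForm ι lam)) (x : K) :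
    OneForm.DNondegenerateAt (𝓡∂ (2 * m + 2)) lam (ι x) ↔ g (ι x) ≠ 0 := by
  constructor
  · intro hn hg
    have h1 : ν (ι x) = 0 := hn _ fun w => by rw [h.d_eq, hg, zero_mul]
    have h2 := h.outward _ (hι.mem_boundary x)
    rw [h1] at h2
    exact lt_irrefl _ (lt_of_eq_of_lt (map_zero (heightCLM m)).symm h2)
  · intro hg u hu
    -- a vector of the kernel of `dλ` is `c ν + w` with `w` tangent to the boundary; its tangential part
    -- `w` lies in `ker α` and is orthogonal to `ker α`
    obtain ⟨c, w, rfl⟩ := h.exists_decomposition hι hlam hc x u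
    have hd : ∀ v, OneForm.d (𝓡∂ (2 * m + 2)) lam (ι x)
        (mfderiv (𝓡 (2 * m + 1)) (𝓡∂ (2 * m + 2)) ι x w) v = - (c * (g (ι x) * lam (ι x) v)) := by
      intro v
      have h1 := hu v
      rw [← OneForm.dLin_apply, map_add, LinearMap.add_apply, OneForm.dLin_apply,
        OneForm.dLin_apply, OneForm.d_smul_left, h.d_eq] at h1
      linarith
    have hw : w = 0 := by
      refine hc.eq_zero ?_ fun w' hw' => ?_
      · have h1 := hd (ν (ι x))
        rw [OneForm.d_antisymm, h.d_eq, h.apply_eq_zero, mul_zero, mul_zero, neg_zero,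
          neg_eq_zero] at h1
        exact (mul_eq_zero.1 h1).resolve_left hg
      · rw [hι.d_boundaryForm hlam, hd]
        have : lam (ι x) (mfderiv (𝓡 (2 * m + 1)) (𝓡∂ (2 * m + 2)) ι x w') = 0 := hw'
        rw [this, mul_zero, mul_zero, neg_zero]
    obtain ⟨v, hv⟩ : ∃ v, lam (ι x) v ≠ 0 := by
      by_contra! hcon
      exact hc.apply_boundary_ne_zero x (ContinuousLinearMap.ext hcon)
    have h1 := hd v
    rw [hw, map_zero, OneForm.d_zero_left] at h1
    have hc0 : c = 0 := by
      have h2 : c * (g (ι x) * lam (ι x) v) = 0 := by linarith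
      exact (mul_eq_zero.1 h2).resolve_right (mul_ne_zero hg hv)
    rw [hw, hc0, map_zero, zero_smul, add_zero]

omit [IsManifold (𝓡 (2 * m + 1)) ∞ K] in
/-- At a boundary point where `g` vanishes, the differential of `g` vanishes on the tangent space of
the boundary, because `g` is nowhere negative. -/
theorem IsLiouvilleData.fnD_mfderiv_eq_zero (h : IsLiouvilleData lam ν g)
    (hι : IsBoundaryInclusion m ι) {x : K} (hg : g (ι x) = 0) (w : TangentSpace (𝓡 (2 * m + 1)) x) :
    fnD (𝓡∂ (2 * m + 2)) g (ι x) (mfderiv (𝓡 (2 * m + 1)) (𝓡∂ (2 * m + 2)) ι x w) = 0 := by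
  rw [← fnD_comp (h.mdifferentiable_factor _) (hι.mdifferentiableAt x)]
  refine fnD_eq_zero_of_isMinOn (fun z => ?_) w
  rw [hg]
  exact h.nonneg _

/-- The top power of `dλ` vanishes transversely at a boundary point if and only if `g` vanishes there
with a non-zero derivative along `ν`: the density of the top power is the product of `g` and of a
function without zeros. -/
theorem IsLiouvilleData.topPowerVanishesTransverselyAt_iff (h : IsLiouvilleData lam ν g)
    (hι : IsBoundaryInclusion m ι) (hlam : OneForm.IsSmooth (𝓡∂ (2 * m + 2)) lam)
    (hc : IsContactForm (boundaryForm ι lam)) (hpos : IsPositiveOnBoundary ι lam) (x : K) :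
    TopPowerVanishesTransverselyAt lam (ι x) ↔
      g (ι x) = 0 ∧ fnD (𝓡∂ (2 * m + 2)) g (ι x) (ν (ι x)) ≠ 0 := by
  have hbd := (hι.eventually_sign hlam hc hpos x).1
  have hν := h.outward _ (hι.mem_boundary x)
  have hdec := h.exists_decomposition hι hlam hc x
  have hmin := fun hg => h.fnD_mfderiv_eq_zero hι (x := x) hg
  generalize ι x = p at *
  have hs : p ∈ (chartAt (EuclideanHalfSpace (2 * m + 2)) p).source := mem_chart_source _ p
  set θ := OneForm.inChart (𝓡∂ (2 * m + 2)) lam p with hθ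
  set B := curl θ (range (𝓡∂ (2 * m + 2))) with hB
  set N := chartField (𝓡∂ (2 * m + 2)) ν p with hN
  have hθs : ContDiffWithinAt ℝ ∞ θ _ _ := hlam.contDiffWithinAt_inChart hs
  have hBs : ContDiffWithinAt ℝ ∞ B _ _ := hlam.contDiffWithinAt_curl hs
  have hNs : ContDiffWithinAt ℝ ∞ N _ _ := contDiffWithinAt_chartField (n := ⊤) (h.smooth p) hs
  have hN0 : heightCLM m (N (extChartAt (𝓡∂ (2 * m + 2)) p p)) ≠ 0 := by
    rw [hN, chartField_extChartAt ν hs, chartD_self]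
    exact hν.ne
  have hN0s : ContDiffWithinAt ℝ ∞ (fun y => heightCLM m (N y)) (range (𝓡∂ (2 * m + 2)))
      (extChartAt (𝓡∂ (2 * m + 2)) p p) := (heightCLM m).contDiff.contDiffAt.comp_contDiffWithinAt _ hNs
  -- the quotient of the density by `g`
  let μ : EuclideanSpace ℝ (Fin (2 * m + 2)) → ℝ := fun y =>
    (m + 1) * boundaryDensity m (θ y) (B y) / heightCLM m (N y)
  have hμs : ContDiffWithinAt ℝ ∞ μ (range (𝓡∂ (2 * m + 2))) (extChartAt (𝓡∂ (2 * m + 2)) p p) :=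
    (contDiffWithinAt_const.mul (hθs.boundaryDensity hBs)).div hN0s hN0
  have hμm : ContMDiffAt (𝓡∂ (2 * m + 2)) 𝓘(ℝ, ℝ) ∞ (fun q => μ (extChartAt (𝓡∂ (2 * m + 2)) p q)) p :=
    contMDiffAt_comp_extChartAt (n := ⊤) hs hμs
  have hμ0 : μ (extChartAt (𝓡∂ (2 * m + 2)) p p) ≠ 0 :=
    div_ne_zero (mul_ne_zero (by positivity) hbd) hN0
  set density : F → ℝ := fun q =>
    wedgePow (OneForm.d (𝓡∂ (2 * m + 2)) lam q) (m + 1)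
      (fun i => coordField (𝓡∂ (2 * m + 2)) p
        (EuclideanSpace.single i (1 : ℝ) : EuclideanSpace ℝ (Fin (2 * m + 2))) q) with hdens
  have heq : density =ᶠ[𝓝 p] fun q => g q * μ (extChartAt (𝓡∂ (2 * m + 2)) p q) := by
    have h1 : ∀ᶠ q in 𝓝 p, heightCLM m (N (extChartAt (𝓡∂ (2 * m + 2)) p q)) ≠ 0 :=
      (tendsto_extChartAt_range hs).eventually (hN0s.continuousWithinAt.eventually_ne hN0)
    filter_upwards [h1, (chartAt (EuclideanHalfSpace (2 * m + 2)) p).open_source.mem_nhds hs]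
      with q hq hqs
    have h2 : density q = frameDensity m (B (extChartAt (𝓡∂ (2 * m + 2)) p q)) := by
      refine wedgePow_congr fun i j => ?_
      rw [coordField_eq hqs, coordField_eq hqs, hlam.d_eq_curl hqs, chartD_chartDInv hqs,
        chartD_chartDInv hqs]
    have h3 := frameDensity_mul (m := m) (A := B (extChartAt (𝓡∂ (2 * m + 2)) p q)) (curl_antisymm _ _ _)
      (N := N (extChartAt (𝓡∂ (2 * m + 2)) p q)) (a := θ (extChartAt (𝓡∂ (2 * m + 2)) p q)) (g := g q) (by
        intro u
        have h7 := h.d_eq q (chartDInv (𝓡∂ (2 * m + 2)) p q u)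
        rwa [hlam.d_eq_curl hqs, OneForm.apply_eq_inChart lam hqs, chartD_chartDInv hqs,
          ← chartField_extChartAt ν hqs] at h7)
    rw [← h2, ← heightCLM_apply] at h3
    simp only [μ]
    field_simp
    linarith
  have hgm := h.mdifferentiable_factor p
  have hd : ∀ u, fnD (𝓡∂ (2 * m + 2)) density p u =
      g p * fnD (𝓡∂ (2 * m + 2)) (fun q => μ (extChartAt (𝓡∂ (2 * m + 2)) p q)) p u +
        μ (extChartAt (𝓡∂ (2 * m + 2)) p p) * fnD (𝓡∂ (2 * m + 2)) g p u := fun u => by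
    rw [fnD_congr heq, fnD_mul hgm (hμm.mdifferentiableAt (by simp))]
  change density p = 0 ∧ fnD (𝓡∂ (2 * m + 2)) density p ≠ 0 ↔ _
  rw [heq.self_of_nhds]
  simp only [mul_eq_zero, hμ0, or_false]
  refine and_congr_right fun hg => not_congr ⟨fun h0 => ?_, fun h0 => ?_⟩
  · have h1 := hd (ν p)
    rw [h0, hg, zero_mul, zero_add] at h1
    exact (mul_eq_zero.1 h1.symm).resolve_left hμ0
  · ext u
    rw [hd, hg, zero_mul, zero_add]
    obtain ⟨c, w, rfl⟩ := hdec u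
    rw [map_add, map_smul, h0, hmin hg]
    simp

end Domain

/-! ### The collar swept out by the orbits through the boundary -/

section Curves

variable {E H : Type*} [NormedAddCommGroup E] [NormedSpace ℝ E] [TopologicalSpace H]
  {I : ModelWithCorners ℝ E H} {M : Type*} [TopologicalSpace M] [ChartedSpace H M]
  {E' H' : Type*} [NormedAddCommGroup E'] [NormedSpace ℝ E'] [TopologicalSpace H']
  {J : ModelWithCorners ℝ E' H'} {K : Type*} [TopologicalSpace K] [ChartedSpace H' K]
  {γ : ℝ → M} {V : ∀ p : M, TangentSpace I p}

theorem IsMIntegralCurveOn.hasDerivWithinAt_comp {s : Set ℝ}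
    (hγ : IsMIntegralCurveOn (I := I) γ V s) {t : ℝ} (ht : t ∈ s) {f : M → ℝ}
    (hf : MDifferentiableAt I 𝓘(ℝ, ℝ) f (γ t)) :
    HasDerivWithinAt (fun t => f (γ t)) (fnD I f (γ t) (V (γ t))) s t := by
  have h0 := hf.hasMFDerivAt.comp_hasMFDerivWithinAt t (hγ t ht)
  let D : ℝ →L[ℝ] ℝ := (fnD I f (γ t)).comp ((1 : ℝ →L[ℝ] ℝ).smulRight (V (γ t)))
  have h1 : HasFDerivWithinAt (fun t => f (γ t)) D s t := h0.hasFDerivWithinAt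
  refine h1.hasDerivWithinAt.congr_deriv ?_
  change fnD I f (γ t) ((1 : ℝ) • V (γ t)) = _
  rw [one_smul]

theorem IsMIntegralCurveOn.mfderiv_eq_zero (hγ : IsMIntegralCurveOn (I := I) γ V (Ici 0)) {t : ℝ}
    (ht : 0 ≤ t) {f : M → K} (hf : MDifferentiableAt I J f (γ t)) {x : K}
    (hc : ∀ t, 0 ≤ t → f (γ t) = x) : mfderiv I J f (γ t) (V (γ t)) = 0 := by
  have h1 := hf.hasMFDerivAt.comp_hasMFDerivWithinAt t (hγ t ht)
  have h2 : HasMFDerivWithinAt 𝓘(ℝ, ℝ) J (f ∘ γ) (Ici 0) t (0 : ℝ →L[ℝ] TangentSpace J (f (γ t))) := by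
    have h3 := (hasMFDerivAt_const (I := 𝓘(ℝ, ℝ)) (I' := J) (f (γ t)) t).hasMFDerivWithinAt
      (s := Ici 0)
    exact h3.congr_of_eventuallyEq
      (eventually_nhdsWithin_of_forall fun r hr => (hc r hr).trans (hc t ht).symm) rfl
  have hu : UniqueMDiffWithinAt 𝓘(ℝ, ℝ) (Ici (0 : ℝ)) t :=
    (uniqueDiffOn_Ici 0 t ht).uniqueMDiffWithinAt
  have h4 := DFunLike.congr_fun (hu.eq h1 h2) (1 : ℝ)
  have h5 : mfderiv I J f (γ t) ((1 : ℝ) • V (γ t)) = 0 := h4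
  rwa [one_smul] at h5

variable [IsManifold I ∞ M]

theorem contMDiff_neg_field
    (hV : ContMDiff I I.tangent ∞ (fun p => (⟨p, V p⟩ : TangentBundle I M))) :
    ContMDiff I I.tangent ∞ (fun p => (⟨p, -V p⟩ : TangentBundle I M)) := by
  intro p
  have hs : p ∈ (chartAt H p).source := mem_chart_source H p
  refine contMDiffAt_section_of_chart (n := ⊤) (V := fun p => -V p) hs ?_
  have h1 : ContDiffWithinAt ℝ ∞ _ _ _ := (contDiffWithinAt_chartField (n := ⊤) (hV p) hs).neg
  refine h1.congr (fun y _ => ?_) ?_ <;> exact map_neg _ _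

/-- The ratio of two proportional smooth 1-forms is smooth. -/
theorem contMDiffAt_ratio {θ η : OneForm I M} {s : M → ℝ} {q : M}
    (hθ : OneForm.SmoothAt I θ ⊤ q) (hη : OneForm.SmoothAt I η ⊤ q)
    (h : ∀ᶠ z in 𝓝 q, θ z = s z • η z) (hq : η q ≠ 0) : ContMDiffAt I 𝓘(ℝ, ℝ) ∞ s q := by
  have hs : q ∈ (chartAt H q).source := mem_chart_source H q
  obtain ⟨u, hu⟩ : ∃ u : E, OneForm.inChart I η q (extChartAt I q q) u ≠ 0 := by
    by_contra! hc
    refine hq (ContinuousLinearMap.ext fun u => ?_)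
    rw [OneForm.apply_eq_inChart η hs, hc]
    rfl
  have h1 := hθ.contDiffWithinAt hs
  have h2 := hη.contDiffWithinAt hs
  have h4 : ContDiffWithinAt ℝ ∞ (fun y => OneForm.inChart I η q y u) (range I)
      (extChartAt I q q) := ContDiffWithinAt.clm_apply h2 contDiffWithinAt_const
  have h5 : ContDiffWithinAt ℝ ∞ (fun y => OneForm.inChart I θ q y u /
      OneForm.inChart I η q y u) (range I) (extChartAt I q q) :=
    (ContDiffWithinAt.clm_apply h1 contDiffWithinAt_const).div h4 hu
  -- evaluate both forms on the coordinate field `u`, on which `η` does not vanish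
  refine (contMDiffAt_comp_extChartAt hs h5).congr_of_eventuallyEq ?_
  have h6 : ∀ᶠ z in 𝓝 q, OneForm.inChart I η q (extChartAt I q z) u ≠ 0 :=
    (tendsto_extChartAt_range hs).eventually (h4.continuousWithinAt.eventually_ne hu)
  filter_upwards [h, h6, (chartAt H q).open_source.mem_nhds hs] with z hz hz1 hz2
  have h7 := DFunLike.congr_fun hz (chartDInv I q z u)
  rw [smul_apply, OneForm.apply_eq_inChart θ hz2,
    OneForm.apply_eq_inChart η hz2, chartD_chartDInv hz2] at h7
  rw [h7, smul_eq_mul]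
  field_simp

end Curves

section Domain

variable {m : ℕ}
  {F : Type*} [TopologicalSpace F] [ChartedSpace (EuclideanHalfSpace (2 * m + 2)) F]
  [IsManifold (𝓡∂ (2 * m + 2)) ∞ F]
  {K : Type*} [TopologicalSpace K] [ChartedSpace (EuclideanSpace ℝ (Fin (2 * m + 1))) K]
  [IsManifold (𝓡 (2 * m + 1)) ∞ K]
  {ι : K → F} {lam : OneForm (𝓡∂ (2 * m + 2)) F}
  {ν : ∀ p : F, TangentSpace (𝓡∂ (2 * m + 2)) p} {g : F → ℝ}

/-- The pullback of the 1-form `α` by the map `pr`. -/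
def pullForm (α : OneForm (𝓡 (2 * m + 1)) K) (pr : F → K) : OneForm (𝓡∂ (2 * m + 2)) F := fun q =>
  (α (pr q)).comp (mfderiv (𝓡∂ (2 * m + 2)) (𝓡 (2 * m + 1)) pr q)

/-- The structure of the collar of the orbits `Γ x` of `-ν` starting on the boundary: the projection
`pr` to the boundary along the orbits, and the function `s` with `λ = s pr^*α`. -/
structure IsLiouvilleCollar (ι : K → F) (lam : OneForm (𝓡∂ (2 * m + 2)) F)
    (ν : ∀ p : F, TangentSpace (𝓡∂ (2 * m + 2)) p) (g : F → ℝ) (Γ : K → ℝ → F) (pr : F → K)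
    (s : F → ℝ) : Prop where
  orbits : IsOrbitFamily (𝓡∂ (2 * m + 2)) ι (fun p => -ν p) Γ
  isOpen : IsOpen (orbitSet Γ)
  proj : ∀ x t, 0 ≤ t → pr (Γ x t) = x
  smooth_proj : ∀ p ∈ orbitSet Γ, ContMDiffAt (𝓡∂ (2 * m + 2)) (𝓡 (2 * m + 1)) ∞ pr p
  smooth_scale : ∀ p ∈ orbitSet Γ, ContMDiffAt (𝓡∂ (2 * m + 2)) 𝓘(ℝ, ℝ) ∞ s p
  scale_pos : ∀ p ∈ orbitSet Γ, 0 < s p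
  scale_boundary : ∀ x, s (ι x) = 1
  form_eq : ∀ p ∈ orbitSet Γ, lam p = s p • pullForm (boundaryForm ι lam) pr p
  form_ne_zero : ∀ p ∈ orbitSet Γ, lam p ≠ 0
  proj_field : ∀ p ∈ orbitSet Γ, mfderiv (𝓡∂ (2 * m + 2)) (𝓡 (2 * m + 1)) pr p (ν p) = 0
  scale_field : ∀ p ∈ orbitSet Γ, fnD (𝓡∂ (2 * m + 2)) s p (ν p) = g p * s p
  scale_tendsto : ∀ x, Tendsto (fun t => s (Γ x t)) atTop (𝓝 0)

theorem IsLiouvilleData.pos_neg (h : IsLiouvilleData lam ν g) :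
    ∀ p ∈ (𝓡∂ (2 * m + 2)).boundary F, 0 < heightCLM m (-ν p) := fun p hp => by
  have h1 := h.outward p hp
  have h2 : heightCLM m (-ν p) = - heightCLM m (ν p) := map_neg (heightCLM m) _
  linarith

omit [TopologicalSpace K] [ChartedSpace (EuclideanSpace ℝ (Fin (2 * m + 1))) K]
  [IsManifold (𝓡 (2 * m + 1)) ∞ K] in
theorem IsLiouvilleData.exists_orbits [T2Space F] [CompactSpace F]
    (h : IsLiouvilleData lam ν g) (ι : K → F) :
    ∃ Γ, IsOrbitFamily (𝓡∂ (2 * m + 2)) ι (fun p => -ν p) Γ := by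
  have hV := contMDiff_neg_field h.smooth
  obtain ⟨ε, hε, hex⟩ := exists_uniform_time heightCLM_single range_halfSpaceModel hV h.pos_neg
  choose Γ h0 hΓ using fun x : K => exists_isMIntegralCurveOn_Ici (hV.of_le (by simp)) hε hex (ι x)
  exact ⟨Γ, h0, hΓ⟩

omit [IsManifold (𝓡 (2 * m + 1)) ∞ K] in
/-- The orbits of `ν` which exit through the boundary are the orbits of `-ν` which start there. -/
theorem IsLiouvilleData.exitCollar_eq [T2Space F] (h : IsLiouvilleData lam ν g)
    (hι : IsBoundaryInclusion m ι) {Γ : K → ℝ → F}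
    (hΓ : IsOrbitFamily (𝓡∂ (2 * m + 2)) ι (fun p => -ν p) Γ) : exitCollar ν = orbitSet Γ := by
  have hV := (contMDiff_neg_field h.smooth).of_le (m := 1) (by simp)
  ext p
  constructor
  · rintro ⟨T, γ, hT, hγ, rfl, hb⟩
    rw [← hι.range_eq] at hb
    obtain ⟨x, hx⟩ := hb
    have h1 := hΓ.eq_of_curve hV hT le_rfl (x := x) hγ.reverse (by
      rw [sub_zero, ← hx, hΓ.zero])
    rw [sub_self, add_zero] at h1
    exact ⟨x, T, hT, h1.symm⟩
  · rintro ⟨x, t, ht, rfl⟩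
    have h1 : IsMIntegralCurveOn (I := 𝓡∂ (2 * m + 2)) (Γ x) (fun p => -ν p) (Icc 0 t) :=
      (hΓ.curve x).mono Icc_subset_Ici_self
    have h2 := h1.reverse
    simp only [neg_neg] at h2
    refine ⟨t, _, ht, h2, by rw [sub_zero], ?_⟩
    rw [sub_self, hΓ.zero]
    exact hι.mem_boundary x

/-- Along an orbit, the integral of `g` diverges: after a unit of time the orbit stays in a compact
subset of the interior. -/
theorem IsLiouvilleData.exists_le_factor [T2Space F] [CompactSpace F]
    (h : IsLiouvilleData lam ν g) (hι : IsBoundaryInclusion m ι)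
    (hlam : OneForm.IsSmooth (𝓡∂ (2 * m + 2)) lam) (hc : IsContactForm (boundaryForm ι lam))
    {Γ : K → ℝ → F} (hΓ : IsOrbitFamily (𝓡∂ (2 * m + 2)) ι (fun p => -ν p) Γ) (x : K) :
    ∃ c > 0, ∀ t, 1 ≤ t → c ≤ g (Γ x t) := by
  have hV := contMDiff_neg_field h.smooth
  -- the points reached before the time `1`
  set O : Set F := interior {q | ∃ x t, 0 ≤ t ∧ t < 1 ∧ q = Γ x t} with hO
  have hbO : ∀ y, ι y ∈ O := by
    intro y
    obtain ⟨X, T, -, hT, hev⟩ := hΓ.exists_collar heightCLM_single range_halfSpaceModel h.pos_neg hV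
      hι.mem_boundary hι.contMDiff (hι.mfderiv_injective hlam hc)
      (by rw [finrank_euclideanSpace_fin, finrank_euclideanSpace_fin]) y (n := 1) le_rfl
    rw [hO, mem_interior_iff_mem_nhds]
    filter_upwards [hev, hT.eventually (gt_mem_nhds one_pos)] with q hq hq1
    exact ⟨X q, T q, hq.1, hq1, hq.2⟩
  have hnot : ∀ t, 1 ≤ t → Γ x t ∈ Oᶜ := by
    intro t ht hmem
    obtain ⟨y, r, hr, hr1, heq⟩ := interior_subset hmem
    have := (hΓ.injective heightCLM_single range_halfSpaceModel h.pos_neg (hV.of_le (by simp))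
      hι.mem_boundary hι.injective (by linarith) hr heq).2
    linarith
  have hcompact : IsCompact Oᶜ := isOpen_interior.isClosed_compl.isCompact
  obtain ⟨q, hq, hmin⟩ := hcompact.exists_isMinOn ⟨Γ x 1, hnot 1 le_rfl⟩
    h.smooth_factor.continuous.continuousOn
  refine ⟨g q, h.pos q ?_, fun t ht => hmin (hnot t ht)⟩
  rcases mem_interior_or_boundary (m := m) q with hi | hb
  · exact hi
  · rw [← hι.range_eq] at hb
    obtain ⟨y, rfl⟩ := hb
    exact absurd (hbO y) hq

theorem smoothAt_pullForm {α : OneForm (𝓡 (2 * m + 1)) K} {pr : F → K} {p : F}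
    (hpr : ContMDiffAt (𝓡∂ (2 * m + 2)) (𝓡 (2 * m + 1)) ∞ pr p)
    (hα : OneForm.SmoothAt (𝓡 (2 * m + 1)) α ⊤ (pr p)) :
    OneForm.SmoothAt (𝓡∂ (2 * m + 2)) (pullForm α pr) ⊤ p :=
  OneForm.smoothAt_pullback hpr (Eventually.of_forall fun _ => rfl) hα

theorem d_pullForm {α : OneForm (𝓡 (2 * m + 1)) K} {pr : F → K} {p : F}
    (hpr : ContMDiffAt (𝓡∂ (2 * m + 2)) (𝓡 (2 * m + 1)) ∞ pr p)
    (hα : OneForm.SmoothAt (𝓡 (2 * m + 1)) α ⊤ (pr p)) (u v : TangentSpace (𝓡∂ (2 * m + 2)) p) :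
    OneForm.d (𝓡∂ (2 * m + 2)) (pullForm α pr) p u v = OneForm.d (𝓡 (2 * m + 1)) α (pr p)
      (mfderiv (𝓡∂ (2 * m + 2)) (𝓡 (2 * m + 1)) pr p u)
      (mfderiv (𝓡∂ (2 * m + 2)) (𝓡 (2 * m + 1)) pr p v) :=
  OneForm.d_pullback (hpr.of_le ENat.LEInfty.out)
    (Eventually.of_forall fun _ => rfl) (ContDiffWithinAt.of_le hα (by exact_mod_cast le_top)) u v

theorem OneForm.d_neg_left (θ : OneForm (𝓡∂ (2 * m + 2)) F) (p : F)
    (u w : TangentSpace (𝓡∂ (2 * m + 2)) p) :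
    OneForm.d (𝓡∂ (2 * m + 2)) θ p (-u) w = - OneForm.d (𝓡∂ (2 * m + 2)) θ p u w := by
  rw [← OneForm.dLin_apply, map_neg, LinearMap.neg_apply, OneForm.dLin_apply]

/-- Existence of the collar structure. The forms `λ` and `pr^*α` satisfy proportional linear
differential equations along the orbits and agree on the boundary, so that `λ = s pr^*α` where
`s = exp (-∫ g)` along each orbit. -/
theorem IsLiouvilleData.exists_isLiouvilleCollar [Nonempty K] [T2Space F] [CompactSpace F]
    (h : IsLiouvilleData lam ν g) (hι : IsBoundaryInclusion m ι)
    (hlam : OneForm.IsSmooth (𝓡∂ (2 * m + 2)) lam) (hc : IsContactForm (boundaryForm ι lam)) :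
    ∃ Γ pr s, IsLiouvilleCollar ι lam ν g Γ pr s := by
  classical
  obtain ⟨Γ, hΓ⟩ := h.exists_orbits ι
  have hV := contMDiff_neg_field h.smooth
  have hV1 := hV.of_le (m := 1) (by simp)
  obtain ⟨pr, hpr⟩ := hΓ.exists_projection heightCLM_single range_halfSpaceModel h.pos_neg hV
    hι.mem_boundary hι.contMDiff hι.injective (hι.mfderiv_injective hlam hc)
    (by rw [finrank_euclideanSpace_fin, finrank_euclideanSpace_fin])
  set α := boundaryForm ι lam with hα
  have hαs : ∀ x, OneForm.SmoothAt (𝓡 (2 * m + 1)) α ⊤ x := hι.smoothAt_boundaryForm hlam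
  set η := pullForm α pr with hη
  have hUopen : IsOpen (orbitSet Γ) := isOpen_iff_mem_nhds.2 fun p hp => by
    obtain ⟨x, t, ht, rfl⟩ := hp
    exact (hpr x t ht).2.1
  have hprs : ∀ p ∈ orbitSet Γ, ContMDiffAt (𝓡∂ (2 * m + 2)) (𝓡 (2 * m + 1)) ∞ pr p := by
    rintro _ ⟨x, t, ht, rfl⟩
    exact (hpr x t ht).2.2
  have hmem : ∀ x t, 0 ≤ t → Γ x t ∈ orbitSet Γ := fun x t ht => ⟨x, t, ht, rfl⟩
  have hιmem : ∀ x, ι x ∈ orbitSet Γ := fun x => ⟨x, 0, le_rfl, hΓ.zero x⟩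
  have hprι : ∀ x, pr (ι x) = x := fun x => by rw [← hΓ.zero x, (hpr x 0 le_rfl).1]
  have hprν : ∀ p ∈ orbitSet Γ, mfderiv (𝓡∂ (2 * m + 2)) (𝓡 (2 * m + 1)) pr p (ν p) = 0 := by
    rintro p ⟨x, t, ht, rfl⟩
    have h1 := (hΓ.curve x).mfderiv_eq_zero ht ((hprs _ (hmem x t ht)).mdifferentiableAt (by simp))
      (fun r hr => (hpr x r hr).1)
    rwa [map_neg, neg_eq_zero] at h1
  have hηs : ∀ p ∈ orbitSet Γ, OneForm.SmoothAt (𝓡∂ (2 * m + 2)) η ⊤ p := fun p hp =>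
    smoothAt_pullForm (hprs p hp) (hαs _)
  have hη0 : ∀ p ∈ orbitSet Γ, η p (-ν p) = 0 := by
    intro p hp
    change α (pr p) (mfderiv (𝓡∂ (2 * m + 2)) (𝓡 (2 * m + 1)) pr p (-ν p)) = 0
    rw [map_neg, hprν p hp, neg_zero, map_zero]
  have hdη : ∀ p ∈ orbitSet Γ, ∀ w, OneForm.d (𝓡∂ (2 * m + 2)) η p (-ν p) w = 0 := by
    intro p hp w
    rw [d_pullForm (hprs p hp) (hαs _), map_neg, hprν p hp, neg_zero, OneForm.d_zero_left]
  -- the scale function along the orbits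
  let G : K → ℝ → ℝ := fun x t => ∫ u in (0 : ℝ)..t, g (Γ x (max u 0))
  have hcont : ∀ x, Continuous fun u => g (Γ x (max u 0)) := fun x => by
    have h1 : ContinuousOn (Γ x) (Ici 0) := (hΓ.curve x).continuousOn
    exact h.smooth_factor.continuous.comp (h1.comp_continuous (by fun_prop) fun u => mem_Ici.2 (le_max_right _ _))
  have hG : ∀ x t, 0 ≤ t → HasDerivAt (G x) (g (Γ x t)) t := fun x t ht => by
    have h1 := intervalIntegral.integral_hasDerivAt_right ((hcont x).intervalIntegrable 0 t)
      ((hcont x).stronglyMeasurableAtFilter _ _) (hcont x).continuousAt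
    rwa [max_eq_left ht] at h1
  let S : K → ℝ → ℝ := fun x t => Real.exp (-G x t)
  have hS : ∀ x t, 0 ≤ t → HasDerivWithinAt (S x) (-g (Γ x t) * S x t) (Ici 0) t := fun x t ht => by
    have h1 := ((hG x t ht).neg.exp).hasDerivWithinAt (s := Ici 0)
    refine h1.congr_deriv ?_
    simp only [S, Pi.neg_apply]
    ring
  have hS0 : ∀ x, S x 0 = 1 := fun x => by simp [S, G]
  -- agreement on the boundary
  have hinit : ∀ x, lam (ι x) = η (ι x) := by
    intro x
    ext u
    obtain ⟨c, w, rfl⟩ := h.exists_decomposition hι hlam hc x u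
    have h1 : mfderiv (𝓡∂ (2 * m + 2)) (𝓡 (2 * m + 1)) pr (ι x)
        (mfderiv (𝓡 (2 * m + 1)) (𝓡∂ (2 * m + 2)) ι x w) = w := by
      have h2 := mfderiv_comp x ((hprs _ (hιmem x)).mdifferentiableAt (by simp))
        (hι.mdifferentiableAt x)
      have h3 : pr ∘ ι = id := funext hprι
      rw [h3, mfderiv_id] at h2
      exact (DFunLike.congr_fun h2 w).symm
    have h2 : η (ι x) (mfderiv (𝓡 (2 * m + 1)) (𝓡∂ (2 * m + 2)) ι x w) = α x w := by
      change α (pr (ι x)) (mfderiv (𝓡∂ (2 * m + 2)) (𝓡 (2 * m + 1)) pr (ι x)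
        (mfderiv (𝓡 (2 * m + 1)) (𝓡∂ (2 * m + 2)) ι x w)) = _
      rw [h1, hprι]
    have h3 : η (ι x) (ν (ι x)) = 0 := by
      have := hη0 _ (hιmem x)
      rwa [map_neg, neg_eq_zero] at this
    rw [map_add, map_add, map_smul, map_smul, h2, h3, h.apply_eq_zero]
    rfl
  have hs1 : ∀ p, OneForm.SmoothAt (𝓡∂ (2 * m + 2)) lam 1 p := hlam.smoothAt_one
  have hlam0 : ∀ p, lam p (-ν p) = 0 := fun p => by rw [map_neg, h.apply_eq_zero, neg_zero]
  have hdlam : ∀ p w, OneForm.d (𝓡∂ (2 * m + 2)) lam p (-ν p) w = -g p * lam p w := fun p w => by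
    rw [OneForm.d_neg_left, h.d_eq, neg_mul]
  have hη1 : ∀ p ∈ orbitSet Γ, OneForm.SmoothAt (𝓡∂ (2 * m + 2)) η 1 p := fun p hp =>
    ContDiffWithinAt.of_le (hηs p hp) (by exact_mod_cast le_top)
  have hform : ∀ x t, 0 ≤ t → lam (Γ x t) = S x t • η (Γ x t) := by
    intro x t ht
    refine eq_smul_along_integralCurve hV1 (f := fun p => -g p) (f' := fun _ => 0)
      h.smooth_factor.continuous.neg ordConnected_Ici (hΓ.curve x) (fun r _ => hs1 _)
      (fun r hr => hη1 _ (hmem x r hr)) (fun r _ => Eventually.of_forall hlam0)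
      (fun r hr => Filter.mem_of_superset (hUopen.mem_nhds (hmem x r hr)) hη0)
      (fun r _ w => hdlam _ w) (fun r hr w => by rw [hdη _ (hmem x r hr), zero_mul])
      (S := S x) (fun r hr => by simpa using hS x r hr) (a := 0) (b := t) self_mem_Ici ht ?_
    rw [hΓ.zero, hS0, one_smul, hinit]
  -- `λ` has no zeros on the collar: a zero would propagate to the boundary (this is the case `S = 0`
  -- of the propagation)
  have hlamne : ∀ p ∈ orbitSet Γ, lam p ≠ 0 := by
    rintro p ⟨x, t, ht, rfl⟩ h0
    have h1 := eq_smul_along_integralCurve hV1 (θ := lam) (η := η) (f := fun p => -g p)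
      (f' := fun _ => 0)
      h.smooth_factor.continuous.neg ordConnected_Ici (hΓ.curve x) (fun r _ => hs1 _)
      (fun r hr => hη1 _ (hmem x r hr)) (fun r _ => Eventually.of_forall hlam0)
      (fun r hr => Filter.mem_of_superset (hUopen.mem_nhds (hmem x r hr)) hη0)
      (fun r _ w => hdlam _ w) (fun r hr w => by rw [hdη _ (hmem x r hr), zero_mul])
      (S := fun _ => 0) (fun r hr => by simpa using hasDerivWithinAt_const r (Ici 0) (0 : ℝ))
      (a := t) (b := 0) ht self_mem_Ici (by rw [h0, zero_smul])
    rw [zero_smul, hΓ.zero] at h1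
    exact hc.apply_boundary_ne_zero x h1
  have hex : ∀ p : F, ∃ c : ℝ, ∀ x t, 0 ≤ t → Γ x t = p → c = S x t := by
    intro p
    by_cases hp : p ∈ orbitSet Γ
    · obtain ⟨x, t, ht, rfl⟩ := hp
      refine ⟨S x t, fun y r hr heq => ?_⟩
      obtain ⟨rfl, rfl⟩ := hΓ.injective heightCLM_single range_halfSpaceModel h.pos_neg hV1
        hι.mem_boundary hι.injective hr ht heq
      rfl
    · exact ⟨0, fun x t ht heq => absurd ⟨x, t, ht, heq⟩ hp⟩
  choose s hs using hex
  have hsS : ∀ x t, 0 ≤ t → s (Γ x t) = S x t := fun x t ht => hs _ x t ht rfl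
  have hformU : ∀ p ∈ orbitSet Γ, lam p = s p • η p := by
    rintro p ⟨x, t, ht, rfl⟩
    rw [hsS x t ht, hform x t ht]
  have hss : ∀ p ∈ orbitSet Γ, ContMDiffAt (𝓡∂ (2 * m + 2)) 𝓘(ℝ, ℝ) ∞ s p := by
    intro p hp
    refine contMDiffAt_ratio (hlam.smoothAt p) (hηs p hp)
      (Filter.mem_of_superset (hUopen.mem_nhds hp) hformU) fun h0 => hlamne p hp ?_
    rw [hformU p hp, h0, smul_zero]
  refine ⟨Γ, pr, s, hΓ, hUopen, fun x t ht => (hpr x t ht).1, hprs, hss, ?_, fun x => ?_, hformU,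
    hlamne, hprν, ?_, fun x => ?_⟩
  · rintro p ⟨x, t, ht, rfl⟩
    rw [hsS x t ht]
    exact Real.exp_pos _
  · rw [← hΓ.zero x, hsS x 0 le_rfl, hS0]
  · rintro p ⟨x, t, ht, rfl⟩
    have h1 := (hΓ.curve x).hasDerivWithinAt_comp ht ((hss _ (hmem x t ht)).mdifferentiableAt (by simp))
    have h2 := (hS x t ht).congr (fun r hr => hsS x r hr) (hsS x t ht)
    have h3 := (uniqueDiffOn_Ici 0 t ht).eq_deriv _ h1 h2
    rw [map_neg, ← hsS x t ht] at h3
    linarith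
  · obtain ⟨c, hc0, hcg⟩ := h.exists_le_factor hι hlam hc hΓ x
    have hGt : Tendsto (G x) atTop atTop := by
      have h1 : Tendsto (fun t : ℝ => G x 1 + (t - 1) * c) atTop atTop :=
        tendsto_atTop_add_const_left _ _
          ((tendsto_atTop_add_const_right _ (-1) tendsto_id).atTop_mul_const hc0)
      refine tendsto_atTop_mono' atTop ?_ h1
      filter_upwards [eventually_ge_atTop (1 : ℝ)] with t ht
      have h2 : G x t = G x 1 + ∫ u in (1 : ℝ)..t, g (Γ x (max u 0)) :=
        (intervalIntegral.integral_add_adjacent_intervals ((hcont x).intervalIntegrable 0 1)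
          ((hcont x).intervalIntegrable 1 t)).symm
      have h3 : ∫ _ in (1 : ℝ)..t, c ≤ ∫ u in (1 : ℝ)..t, g (Γ x (max u 0)) := by
        refine intervalIntegral.integral_mono_on ht intervalIntegrable_const
          ((hcont x).intervalIntegrable 1 t) fun u hu => ?_
        rw [max_eq_left (by linarith [hu.1])]
        exact hcg u hu.1
      rw [intervalIntegral.integral_const, smul_eq_mul] at h3
      rw [h2]
      gcongr
    have h1 : Tendsto (S x) atTop (𝓝 0) := Real.tendsto_exp_neg_atTop_nhds_zero.comp hGt
    refine h1.congr' ?_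
    filter_upwards [eventually_ge_atTop (0 : ℝ)] with t ht
    exact (hsS x t ht).symm

end Domain

/-! ### Coordinates on the cotangent bundle -/

section Cotangent

variable {E H : Type*} [NormedAddCommGroup E] [NormedSpace ℝ E] [TopologicalSpace H]
  {I : ModelWithCorners ℝ E H} {M : Type*} [TopologicalSpace M] [ChartedSpace H M]
  [IsManifold I ∞ M]
  {E' H' : Type*} [NormedAddCommGroup E'] [NormedSpace ℝ E'] [TopologicalSpace H']
  {J : ModelWithCorners ℝ E' H'} {N : Type*} [TopologicalSpace N] [ChartedSpace H' N]

/-- The fibre coordinate of a covector in the preferred chart at `p`. -/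
def cotCoord (I : ModelWithCorners ℝ E H) [IsManifold I ∞ M] (p : M) (β : Cotangent I M) :
    E →L[ℝ] ℝ :=
  (show TangentSpace I β.proj →L[ℝ] ℝ from β.2).comp (chartDInv I p β.proj)

theorem inCoordinates_cotangent (p : M) (β : Cotangent I M)
    (hβ : β.proj ∈ (chartAt H p).source) :
    ContinuousLinearMap.inCoordinates E (TangentSpace I : M → Type _) ℝ (Bundle.Trivial M ℝ)
      p β.proj p β.proj β.2 = cotCoord I p β := by
  ext v
  have h4 := TangentBundle.symmL_trivializationAt (I := I) hβ
  simp only [ContinuousLinearMap.inCoordinates, ContinuousLinearMap.comp_apply, h4]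
  simp [cotCoord, chartDInv]

theorem contMDiffAt_cotangent_iff {f : N → Cotangent I M} {q : N} {n : ℕ∞} :
    ContMDiffAt J (cotangentModel I) n f q ↔ ContMDiffAt J I n (fun z => (f z).proj) q ∧
      ContMDiffAt J 𝓘(ℝ, E →L[ℝ] ℝ) n (fun z => cotCoord I (f q).proj (f z)) q := by
  rw [contMDiffAt_hom_bundle]
  refine and_congr_right fun h => ?_
  have h1 : ∀ᶠ z in 𝓝 q, (f z).proj ∈ (chartAt H (f q).proj).source :=
    h.continuousAt.preimage_mem_nhds
      ((chartAt H (f q).proj).open_source.mem_nhds (mem_chart_source H _))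
  refine Filter.EventuallyEq.contMDiffAt_iff ?_
  filter_upwards [h1] with z hz
  exact inCoordinates_cotangent _ _ hz

theorem extChartAt_cotangent (β₀ β : Cotangent I M) (hβ : β.proj ∈ (chartAt H β₀.proj).source) :
    extChartAt (cotangentModel I) β₀ β = (extChartAt I β₀.proj β.proj, cotCoord I β₀.proj β) := by
  rw [FiberBundle.extChartAt]
  have h1 := inCoordinates_cotangent β₀.proj β hβ
  rw [← h1, PartialEquiv.trans_apply]
  have h2 : (trivializationAt (E →L[ℝ] ℝ)
      (fun p : M => TangentSpace I p →L[ℝ] Bundle.Trivial M ℝ p) β₀.proj) β = _ :=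
    hom_trivializationAt_apply (RingHom.id ℝ) β₀.proj β
  change (PartialEquiv.prod _ _) ((trivializationAt (E →L[ℝ] ℝ)
      (fun p : M => TangentSpace I p →L[ℝ] Bundle.Trivial M ℝ p) β₀.proj) β) = _
  rw [h2]
  rfl

theorem Cotangent.continuous_proj : Continuous fun β : Cotangent I M => β.proj :=
  FiberBundle.continuous_proj _ _

theorem contMDiff_cotangent_proj {n : ℕ∞} :
    ContMDiff (cotangentModel I) I n (fun β : Cotangent I M => β.proj) :=
  contMDiff_proj _

theorem contMDiffAt_cotCoord (β₀ : Cotangent I M) :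
    ContMDiffAt (cotangentModel I) 𝓘(ℝ, E →L[ℝ] ℝ) ∞ (cotCoord I β₀.proj) β₀ :=
  (contMDiffAt_cotangent_iff (n := ⊤) (f := id).1 contMDiffAt_id).2

/-- The map `p ↦ s(p) α_{pr(p)}` to the cotangent bundle. -/
def scaledSection (α : OneForm I M) (pr : N → M) (s : N → ℝ) (p : N) : Cotangent I M :=
  ⟨pr p, s p • α (pr p)⟩

variable {α : OneForm I M} {pr : N → M} {s : N → ℝ} {p : N}

omit [TopologicalSpace N] in
theorem cotCoord_scaledSection {x : M} {z : N} (hx : pr z ∈ (chartAt H x).source) :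
    cotCoord I x (scaledSection α pr s z) = s z • OneForm.inChart I α x (extChartAt I x (pr z)) := by
  rw [inChart_extChartAt α hx]
  rfl

theorem contMDiffAt_scaledSection (hpr : ContMDiffAt J I ∞ pr p)
    (hs : ContMDiffAt J 𝓘(ℝ, ℝ) ∞ s p) (hα : OneForm.SmoothAt I α ⊤ (pr p)) :
    ContMDiffAt J (cotangentModel I) ∞ (scaledSection α pr s) p := by
  refine (contMDiffAt_cotangent_iff (n := ⊤)).2 ⟨hpr, ?_⟩
  have h1 : ContMDiffAt I 𝓘(ℝ, E →L[ℝ] ℝ) ∞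
      (fun z => OneForm.inChart I α (pr p) (extChartAt I (pr p) z)) (pr p) :=
    contMDiffAt_comp_extChartAt (n := ⊤) (mem_chart_source H _) hα
  refine (hs.smul (h1.comp p hpr)).congr_of_eventuallyEq ?_
  filter_upwards [hpr.continuousAt.preimage_mem_nhds
      ((chartAt H (pr p)).open_source.mem_nhds (mem_chart_source H _))] with z hz
  exact cotCoord_scaledSection hz

/-- The canonical 1-form pulls back to `s pr^*α`. -/
theorem canonicalForm_comp_mfderiv {f : N → Cotangent I M}
    (hf : MDifferentiableAt J (cotangentModel I) f p) :
    (canonicalForm I (f p)).comp (mfderiv J (cotangentModel I) f p) =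
      (show TangentSpace I (f p).proj →L[ℝ] ℝ from (f p).2).comp
        (mfderiv J I (fun z => (f z).proj) p) := by
  have h1 := mfderiv_comp p ((contMDiff_cotangent_proj (I := I) (M := M) (n := 1)
    (f p)).mdifferentiableAt (by simp)) hf
  change _ = ContinuousLinearMap.comp _ (mfderiv J I ((fun β : Cotangent I M => β.proj) ∘ f) p)
  rw [h1]
  rfl

end Cotangent

section SectionInChart

theorem hasFDerivWithinAt_prod_smul {E E' : Type*} [NormedAddCommGroup E] [NormedSpace ℝ E]
    [NormedAddCommGroup E'] [NormedSpace ℝ E'] {G : Type*} [NormedAddCommGroup G]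
    [NormedSpace ℝ G] {S : Set E'} {T : Set E}
    {a : E' → E} {c : E' → ℝ} {A : E → G} {y : E'} {a' : E' →L[ℝ] E} {c' : E' →L[ℝ] ℝ}
    {A' : E →L[ℝ] G} (ha : HasFDerivWithinAt a a' S y) (hc : HasFDerivWithinAt c c' S y)
    (hA : HasFDerivWithinAt A A' T (a y)) (hST : MapsTo a S T) :
    HasFDerivWithinAt (fun y => (a y, c y • A (a y)))
      (a'.prod (c y • A'.comp a' + c'.smulRight (A (a y)))) S y :=
  ha.prodMk (hc.fun_smul (hA.comp y ha hST))

variable {E H : Type*} [NormedAddCommGroup E] [NormedSpace ℝ E] [TopologicalSpace H]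
  {I : ModelWithCorners ℝ E H} {M : Type*} [TopologicalSpace M] [ChartedSpace H M]
  [IsManifold I ∞ M]
  {E' H' : Type*} [NormedAddCommGroup E'] [NormedSpace ℝ E'] [TopologicalSpace H']
  {J : ModelWithCorners ℝ E' H'} {N : Type*} [TopologicalSpace N] [ChartedSpace H' N]
  [IsManifold J ∞ N] {α : OneForm I M} {pr : N → M} {s : N → ℝ} {p q : N}

/-- The map `p ↦ s(p) α_{pr(p)}` read in the preferred charts at `p` and `pr(p)`. -/
def sectionInChart (J : ModelWithCorners ℝ E' H') (α : OneForm I M) (pr : N → M) (s : N → ℝ)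
    (p : N) (y : E') : E × (E →L[ℝ] ℝ) :=
  (chartMap J I pr p (pr p) y,
    s ((extChartAt J p).symm y) • OneForm.inChart I α (pr p) (chartMap J I pr p (pr p) y))

omit [IsManifold J ∞ N] in
theorem writtenInExtChartAt_scaledSection (hpr : ContinuousAt pr p) :
    writtenInExtChartAt J (cotangentModel I) p (scaledSection α pr s)
      =ᶠ[𝓝[range J] (extChartAt J p p)] sectionInChart J α pr s p := by
  have h1 := hpr.preimage_mem_nhds
      ((chartAt H (pr p)).open_source.mem_nhds (mem_chart_source H _))
  filter_upwards [eventually_nhdsWithin_range_extChartAt (mem_chart_source H' p) h1] with y hy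
  have h2 : (scaledSection α pr s ((extChartAt J p).symm y)).proj ∈
    (chartAt H (scaledSection α pr s p).proj).source := hy.2.2
  refine (extChartAt_cotangent (scaledSection α pr s p) _ h2).trans ?_
  exact Prod.ext rfl (cotCoord_scaledSection hy.2.2)

theorem contDiffWithinAt_sectionInChart (hpr : ContMDiffAt J I ∞ pr p)
    (hs : ContMDiffAt J 𝓘(ℝ, ℝ) ∞ s p) (hα : OneForm.SmoothAt I α ⊤ (pr p)) :
    ContDiffWithinAt ℝ ∞ (sectionInChart J α pr s p) (range J) (extChartAt J p p) := by
  have h0 := mem_chart_source H' p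
  have h1 : ContDiffWithinAt ℝ ∞ _ _ _ :=
    contDiffWithinAt_chartMap (n := ⊤) hpr h0 (mem_chart_source H (pr p))
  have h2 := hs.contDiffWithinAt_comp_symm (n := ⊤) h0
  refine h1.prodMk (ContDiffWithinAt.smul h2 ?_)
  have h3 : chartMap J I pr p (pr p) (extChartAt J p p) = extChartAt I (pr p) (pr p) := by
    simp [chartMap]
  have h4 : ContDiffWithinAt ℝ ∞ (OneForm.inChart I α (pr p)) (range I)
      (chartMap J I pr p (pr p) (extChartAt J p p)) := by
    rw [h3]
    exact hα
  exact ContDiffWithinAt.comp _ h4 h1 fun y _ => extChartAt_mem_range _ _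

theorem fderivWithin_sectionInChart (hpr : ContMDiffAt J I ∞ pr q)
    (hs : ContMDiffAt J 𝓘(ℝ, ℝ) ∞ s q) (hα : OneForm.SmoothAt I α ⊤ (pr q))
    (hq : q ∈ (chartAt H' p).source) (hpq : pr q ∈ (chartAt H (pr p)).source) (u : E') :
    fderivWithin ℝ (sectionInChart J α pr s p) (range J) (extChartAt J p q) u =
      (chartD I (pr p) (pr q) (mfderiv J I pr q (chartDInv J p q u)),
        s q • fderivWithin ℝ (OneForm.inChart I α (pr p)) (range I) (extChartAt I (pr p) (pr q))
          (chartD I (pr p) (pr q) (mfderiv J I pr q (chartDInv J p q u))) +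
        fnD J s q (chartDInv J p q u) •
          OneForm.inChart I α (pr p) (extChartAt I (pr p) (pr q))) := by
  have hq' : q ∈ (extChartAt J p).source := by simpa using hq
  have hinv : (extChartAt J p).symm (extChartAt J p q) = q := (extChartAt J p).left_inv hq'
  have hu : UniqueDiffWithinAt ℝ (range J) (extChartAt J p q) :=
    J.uniqueDiffOn _ (extChartAt_mem_range p q)
  have h3 : chartMap J I pr p (pr p) (extChartAt J p q) = extChartAt I (pr p) (pr q) := by
    rw [chartMap, hinv]
  have ha := ((contDiffWithinAt_chartMap (n := ⊤) hpr hq hpq).differentiableWithinAt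
    (by simp)).hasFDerivWithinAt
  have hc := ((hs.contDiffWithinAt_comp_symm (n := ⊤) hq).differentiableWithinAt
    (by simp)).hasFDerivWithinAt
  have hA := ((hα.contDiffWithinAt hpq).differentiableWithinAt (by simp)).hasFDerivWithinAt
  have h4 := hasFDerivWithinAt_prod_smul ha hc (h3 ▸ hA) fun y _ => extChartAt_mem_range _ _
  have h5 := DFunLike.congr_fun (h4.fderivWithin hu) u
  refine h5.trans ?_
  rw [← fderivWithin_chartMap (hpr.mdifferentiableAt (by simp)) hq hpq,
    ← fderivWithin_comp_symm (hs.mdifferentiableAt (by simp)) hq]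
  simp only [ContinuousLinearMap.prod_apply, add_apply, smul_apply,
    ContinuousLinearMap.comp_apply, ContinuousLinearMap.smulRight_apply, hinv, h3]

omit [IsManifold J ∞ N] in
theorem mfderiv_scaledSection_apply (hpr : ContMDiffAt J I ∞ pr p)
    (hs : ContMDiffAt J 𝓘(ℝ, ℝ) ∞ s p) (hα : OneForm.SmoothAt I α ⊤ (pr p))
    (u : TangentSpace J p) :
    (mfderiv J (cotangentModel I) (scaledSection α pr s) p u : E × (E →L[ℝ] ℝ)) =
      fderivWithin ℝ (sectionInChart J α pr s p) (range J) (extChartAt J p p) (u : E') := by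
  have h1 := (contMDiffAt_scaledSection hpr hs hα).mdifferentiableAt (by simp)
  let D : E' →L[ℝ] E × (E →L[ℝ] ℝ) := mfderiv J (cotangentModel I) (scaledSection α pr s) p
  have h2 : HasFDerivWithinAt (writtenInExtChartAt J (cotangentModel I) p (scaledSection α pr s)) D
    (range J) (extChartAt J p p) := h1.hasMFDerivAt.2
  have h3 := writtenInExtChartAt_scaledSection (J := J) (α := α) (s := s) hpr.continuousAt
  have h4 := h2.congr_of_eventuallyEq h3.symm
    (h3.eq_of_nhdsWithin (extChartAt_mem_range p p)).symm
  exact (DFunLike.congr_fun (h4.fderivWithin (J.uniqueDiffOn _ (extChartAt_mem_range p p))) u).symm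

theorem fderivWithin_sectionInChart_self (hpr : ContMDiffAt J I ∞ pr p)
    (hs : ContMDiffAt J 𝓘(ℝ, ℝ) ∞ s p) (hα : OneForm.SmoothAt I α ⊤ (pr p))
    (u : TangentSpace J p) :
    fderivWithin ℝ (sectionInChart J α pr s p) (range J) (extChartAt J p p) (u : E') =
      ((mfderiv J I pr p u : E),
        s p • fderivWithin ℝ (OneForm.inChart I α (pr p)) (range I)
          (extChartAt I (pr p) (pr p)) (mfderiv J I pr p u : E) +
        fnD J s p u • OneForm.inChart I α (pr p) (extChartAt I (pr p) (pr p))) := by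
  have h2 := fderivWithin_sectionInChart hpr hs hα (mem_chart_source H' p)
    (mem_chart_source H (pr p)) (u : E')
  have h3 : chartDInv J p p (u : E') = u := chartDInv_self (E := E') (I := J) p u
  rw [h3] at h2
  have h5 : chartD I (pr p) (pr p) (mfderiv J I pr p u) = (mfderiv J I pr p u : E) :=
    chartD_self _ _
  rw [h5] at h2
  exact h2

/-- The tangent vectors which are mapped to multiples of the fibre direction `α`. -/
theorem eq_of_fderivWithin_sectionInChart_eq (hpr : ContMDiffAt J I ∞ pr p)
    (hs : ContMDiffAt J 𝓘(ℝ, ℝ) ∞ s p) (hα : OneForm.SmoothAt I α ⊤ (pr p)) (h0 : α (pr p) ≠ 0)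
    (u : TangentSpace J p) (t : ℝ)
    (h : fderivWithin ℝ (sectionInChart J α pr s p) (range J) (extChartAt J p p) (u : E') =
      t • ((0 : E), OneForm.inChart I α (pr p) (extChartAt I (pr p) (pr p)))) :
    mfderiv J I pr p u = 0 ∧ fnD J s p u = t := by
  have h6 : OneForm.inChart I α (pr p) (extChartAt I (pr p) (pr p)) ≠ 0 := fun h => by
    refine h0 (ContinuousLinearMap.ext fun v => ?_)
    rw [OneForm.apply_eq_inChart α (mem_chart_source H (pr p)), h]
    rfl
  have h7 := h.symm.trans (fderivWithin_sectionInChart_self hpr hs hα u)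
  have h8 := (Prod.ext_iff.1 h7).1.symm
  have h9 := (Prod.ext_iff.1 h7).2.symm
  simp only [Prod.smul_mk, smul_zero] at h8 h9
  rw [h8, map_zero, smul_zero, zero_add] at h9
  exact ⟨h8, smul_left_injective ℝ h6 h9⟩

/-- The kernel of the differential of `p ↦ s(p) α_{pr(p)}`. -/
theorem mfderiv_scaledSection_eq_zero_iff (hpr : ContMDiffAt J I ∞ pr p)
    (hs : ContMDiffAt J 𝓘(ℝ, ℝ) ∞ s p) (hα : OneForm.SmoothAt I α ⊤ (pr p)) (h0 : α (pr p) ≠ 0)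
    (u : TangentSpace J p) :
    mfderiv J (cotangentModel I) (scaledSection α pr s) p u = 0 ↔
      mfderiv J I pr p u = 0 ∧ fnD J s p u = 0 := by
  have h1 := mfderiv_scaledSection_apply hpr hs hα u
  constructor
  · intro hu
    refine eq_of_fderivWithin_sectionInChart_eq hpr hs hα h0 u 0 ?_
    rw [zero_smul]
    exact h1.symm.trans hu
  · rintro ⟨hu1, hu2⟩
    refine (h1.trans (fderivWithin_sectionInChart_self hpr hs hα u)).trans ?_
    rw [hu1, hu2, zero_smul, add_zero]
    exact Prod.ext rfl ((congrArg (fun z => s p • z) (map_zero _)).trans (smul_zero _))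

end SectionInChart

/-! ### The collar map is a bijection -/

section Domain

set_option linter.unusedSectionVars false

variable {m : ℕ}
  {F : Type*} [TopologicalSpace F] [ChartedSpace (EuclideanHalfSpace (2 * m + 2)) F]
  [IsManifold (𝓡∂ (2 * m + 2)) ∞ F]
  {K : Type*} [TopologicalSpace K] [ChartedSpace (EuclideanSpace ℝ (Fin (2 * m + 1))) K]
  [IsManifold (𝓡 (2 * m + 1)) ∞ K]
  {ι : K → F} {lam : OneForm (𝓡∂ (2 * m + 2)) F}
  {ν : ∀ p : F, TangentSpace (𝓡∂ (2 * m + 2)) p} {g : F → ℝ} {Γ : K → ℝ → F} {pr : F → K}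
  {s : F → ℝ}

namespace IsLiouvilleCollar

theorem mem_orbitSet (x : K) {t : ℝ} (ht : 0 ≤ t) : Γ x t ∈ orbitSet Γ := ⟨x, t, ht, rfl⟩

theorem boundary_mem (C : IsLiouvilleCollar ι lam ν g Γ pr s) (x : K) : ι x ∈ orbitSet Γ :=
  ⟨x, 0, le_rfl, C.orbits.zero x⟩

theorem proj_boundary (C : IsLiouvilleCollar ι lam ν g Γ pr s) (x : K) : pr (ι x) = x := by
  rw [← C.orbits.zero x, C.proj x 0 le_rfl]

theorem mem_interior (C : IsLiouvilleCollar ι lam ν g Γ pr s) (h : IsLiouvilleData lam ν g)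
    (x : K) {t : ℝ} (ht : 0 < t) :
    Γ x t ∈ (𝓡∂ (2 * m + 2)).interior F :=
  C.orbits.mem_interior heightCLM_single range_halfSpaceModel h.pos_neg ht

theorem hasDerivWithinAt_scale (C : IsLiouvilleCollar ι lam ν g Γ pr s) (x : K) {t : ℝ}
    (ht : 0 ≤ t) : HasDerivWithinAt (fun t => s (Γ x t)) (-(g (Γ x t) * s (Γ x t))) (Ici 0) t := by
  have h1 := (C.orbits.curve x).hasDerivWithinAt_comp ht
    ((C.smooth_scale _ (mem_orbitSet x ht)).mdifferentiableAt (by simp))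
  rwa [map_neg, C.scale_field _ (mem_orbitSet x ht)] at h1

theorem strictAntiOn_scale (C : IsLiouvilleCollar ι lam ν g Γ pr s) (h : IsLiouvilleData lam ν g)
    (x : K) : StrictAntiOn (fun t => s (Γ x t)) (Ici 0) := by
  refine strictAntiOn_of_deriv_neg (convex_Ici 0)
    (fun t ht => (C.hasDerivWithinAt_scale x ht).continuousWithinAt) fun t ht => ?_
  rw [interior_Ici, mem_Ioi] at ht
  rw [((C.hasDerivWithinAt_scale x ht.le).hasDerivAt (Ici_mem_nhds ht)).deriv]
  have h1 := h.pos _ (C.mem_interior h x ht)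
  have h2 := C.scale_pos _ (mem_orbitSet x ht.le)
  have := mul_pos h1 h2
  linarith

theorem scale_zero (C : IsLiouvilleCollar ι lam ν g Γ pr s) (x : K) : s (Γ x 0) = 1 := by
  rw [C.orbits.zero, C.scale_boundary]

theorem scale_lt_one (C : IsLiouvilleCollar ι lam ν g Γ pr s) (h : IsLiouvilleData lam ν g)
    (x : K) {t : ℝ} (ht : 0 < t) : s (Γ x t) < 1 := by
  rw [← C.scale_zero x]
  exact C.strictAntiOn_scale h x self_mem_Ici ht.le ht

theorem scale_le_one (C : IsLiouvilleCollar ι lam ν g Γ pr s) (h : IsLiouvilleData lam ν g)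
    {p : F} (hp : p ∈ orbitSet Γ) : s p ≤ 1 := by
  obtain ⟨x, t, ht, rfl⟩ := hp
  rcases ht.eq_or_lt with rfl | ht
  · exact (C.scale_zero x).le
  · exact (C.scale_lt_one h x ht).le

theorem scale_lt_one_iff (C : IsLiouvilleCollar ι lam ν g Γ pr s) (h : IsLiouvilleData lam ν g)
    {p : F} (hp : p ∈ orbitSet Γ) : s p < 1 ↔ p ∉ range ι := by
  constructor
  · rintro h1 ⟨x, rfl⟩
    exact h1.ne (C.scale_boundary x)
  · obtain ⟨x, t, ht, rfl⟩ := hp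
    intro h1
    refine C.scale_lt_one h x (ht.lt_of_ne ?_)
    rintro rfl
    exact h1 ⟨x, (C.orbits.zero x).symm⟩

theorem exists_scale_eq (C : IsLiouvilleCollar ι lam ν g Γ pr s) (x : K) {c : ℝ} (hc : 0 < c)
    (hc1 : c ≤ 1) : ∃ t, 0 ≤ t ∧ s (Γ x t) = c := by
  obtain ⟨T, hT, hT0⟩ := (((C.scale_tendsto x).eventually (gt_mem_nhds hc)).and
    (eventually_ge_atTop 0)).exists
  have h1 : ContinuousOn (fun t => s (Γ x t)) (Icc 0 T) := fun t ht =>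
    (C.hasDerivWithinAt_scale x ht.1).continuousWithinAt.mono Icc_subset_Ici_self
  obtain ⟨t, ht, rfl⟩ := intermediate_value_Icc' hT0 h1
    ⟨hT.le, hc1.trans (C.scale_zero x).ge⟩
  exact ⟨t, ht.1, rfl⟩

theorem eq_of_proj_eq (C : IsLiouvilleCollar ι lam ν g Γ pr s) (h : IsLiouvilleData lam ν g)
    {p q : F} (hp : p ∈ orbitSet Γ) (hq : q ∈ orbitSet Γ)
    (h1 : pr p = pr q) (h2 : s p = s q) : p = q := by
  obtain ⟨x, t, ht, rfl⟩ := hp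
  obtain ⟨y, r, hr, rfl⟩ := hq
  rw [C.proj x t ht, C.proj y r hr] at h1
  subst h1
  rw [(C.strictAntiOn_scale h x).injOn ht hr h2]

/-- The map `h` of the collar to the symplectization, `p ↦ s(p) α_{pr(p)}`. -/
abbrev toCotangent (ι : K → F) (lam : OneForm (𝓡∂ (2 * m + 2)) F) (pr : F → K) (s : F → ℝ) :
    F → Cotangent (𝓡 (2 * m + 1)) K :=
  scaledSection (boundaryForm ι lam) pr s

theorem toCotangent_mem_SLe (C : IsLiouvilleCollar ι lam ν g Γ pr s)
    (h : IsLiouvilleData lam ν g) :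
    MapsTo (toCotangent ι lam pr s) (orbitSet Γ) (SLe (𝓡 (2 * m + 1)) (boundaryForm ι lam)) :=
  fun p hp => ⟨s p, C.scale_pos p hp, C.scale_le_one h hp, rfl⟩

theorem toCotangent_mem_SLt (C : IsLiouvilleCollar ι lam ν g Γ pr s)
    (h : IsLiouvilleData lam ν g) :
    MapsTo (toCotangent ι lam pr s) (orbitSet Γ \ range ι)
      (SLt (𝓡 (2 * m + 1)) (boundaryForm ι lam)) :=
  fun p hp => ⟨s p, C.scale_pos p hp.1, (C.scale_lt_one_iff h hp.1).2 hp.2, rfl⟩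

theorem toCotangent_surjOn (C : IsLiouvilleCollar ι lam ν g Γ pr s) :
    SurjOn (toCotangent ι lam pr s) (orbitSet Γ) (SLe (𝓡 (2 * m + 1)) (boundaryForm ι lam)) := by
  rintro ⟨x, b⟩ ⟨c, hc, hc1, hβ⟩
  obtain ⟨t, ht, rfl⟩ := C.exists_scale_eq x hc hc1
  refine ⟨Γ x t, mem_orbitSet x ht, ?_⟩
  rw [hβ, toCotangent, scaledSection, C.proj x t ht]

theorem scaledSection_inj {A B : Type*} {α : OneForm (𝓡 (2 * m + 1)) K} {pr : A → K} {pr' : B → K}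
    {s : A → ℝ} {s' : B → ℝ} {p : A} {q : B}
    (h0 : α (pr p) ≠ 0) (h : scaledSection α pr s p = scaledSection α pr' s' q) :
    pr p = pr' q ∧ s p = s' q := by
  have h1 : pr p = pr' q := congrArg TotalSpace.proj h
  refine ⟨h1, ?_⟩
  unfold scaledSection at h
  rw [← h1] at h
  have h2 := eq_of_heq (TotalSpace.mk.inj h).2
  obtain ⟨v, hv⟩ : ∃ v, α (pr p) v ≠ 0 := by
    by_contra! hv
    exact h0 (ContinuousLinearMap.ext hv)
  exact mul_right_cancel₀ hv (DFunLike.congr_fun h2 v)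

theorem toCotangent_injOn (C : IsLiouvilleCollar ι lam ν g Γ pr s)
    (h : IsLiouvilleData lam ν g)
    (hc : IsContactForm (boundaryForm ι lam)) :
    InjOn (toCotangent ι lam pr s) (orbitSet Γ) := fun p hp q hq hpq => by
  have h1 := scaledSection_inj (hc.ne_zero (pr p)) hpq
  exact C.eq_of_proj_eq h hp hq h1.1 h1.2

theorem contMDiffAt_toCotangent (C : IsLiouvilleCollar ι lam ν g Γ pr s)
    (hι : IsBoundaryInclusion m ι) (hlam : OneForm.IsSmooth (𝓡∂ (2 * m + 2)) lam) {p : F}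
    (hp : p ∈ orbitSet Γ) :
    ContMDiffAt (𝓡∂ (2 * m + 2)) (cotangentModel (𝓡 (2 * m + 1))) ∞ (toCotangent ι lam pr s) p :=
  contMDiffAt_scaledSection (C.smooth_proj p hp) (C.smooth_scale p hp)
    (hι.smoothAt_boundaryForm hlam _)

theorem pullback (C : IsLiouvilleCollar ι lam ν g Γ pr s)
    (hι : IsBoundaryInclusion m ι) (hlam : OneForm.IsSmooth (𝓡∂ (2 * m + 2)) lam) {p : F}
    (hp : p ∈ orbitSet Γ) :
    lam p = (canonicalForm (𝓡 (2 * m + 1)) (toCotangent ι lam pr s p)).comp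
      (mfderiv (𝓡∂ (2 * m + 2)) (cotangentModel (𝓡 (2 * m + 1))) (toCotangent ι lam pr s) p) := by
  rw [canonicalForm_comp_mfderiv
    ((C.contMDiffAt_toCotangent hι hlam hp).mdifferentiableAt (by simp)), C.form_eq p hp]
  rfl

end IsLiouvilleCollar

end Domain

/-! ### The inverse of the collar map -/

section LocalInverse

theorem ContDiffAt.exists_local_rightInverse {E E' : Type*} [NormedAddCommGroup E]
    [NormedSpace ℝ E] [FiniteDimensional ℝ E] [NormedAddCommGroup E'] [NormedSpace ℝ E']
    [FiniteDimensional ℝ E'] {f : E → E'} {a : E} (hf : ContDiffAt ℝ ∞ f a)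
    (hinj : ∀ u, fderiv ℝ f a u = 0 → u = 0)
    (hd : Module.finrank ℝ E = Module.finrank ℝ E') :
    ∃ G : E' → E, ContDiffAt ℝ ∞ G (f a) ∧ G (f a) = a ∧ ∀ᶠ z in 𝓝 (f a), f (G z) = z := by
  have : CompleteSpace E := FiniteDimensional.complete ℝ E
  obtain ⟨A, hA⟩ := ContinuousLinearMap.isInvertible_of_injective_of_finrank_eq hinj hd
  have h1 : HasFDerivAt f (A : E →L[ℝ] E') a := by
    rw [hA]
    exact (hf.differentiableAt (by simp)).hasFDerivAt
  exact ⟨hf.localInverse h1 (by simp), hf.to_localInverse h1 (by simp),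
    hf.localInverse_apply_image h1 (by simp),
    (hf.hasStrictFDerivAt' h1 (by simp)).eventually_right_inverse⟩

variable {E H : Type*} [NormedAddCommGroup E] [NormedSpace ℝ E] [TopologicalSpace H]
  {I : ModelWithCorners ℝ E H} {M : Type*} [TopologicalSpace M] [ChartedSpace H M]
  [IsManifold I ∞ M]
  {E' H' : Type*} [NormedAddCommGroup E'] [NormedSpace ℝ E'] [TopologicalSpace H']
  {J : ModelWithCorners ℝ E' H'} {N : Type*} [TopologicalSpace N] [ChartedSpace H' N]
  [IsManifold J ∞ N] {α : OneForm I M}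

omit [IsManifold I ∞ M] in
theorem OneForm.exists_inChart_apply_ne_zero [IsManifold I 1 M] {x : M} (h0 : α x ≠ 0) :
    ∃ v, OneForm.inChart I α x (extChartAt I x x) v ≠ 0 := by
  by_contra! hv
  refine h0 (ContinuousLinearMap.ext fun u => ?_)
  rw [OneForm.apply_eq_inChart α (mem_chart_source H x), hv]
  rfl

/-- The factor `c` is a smooth function of the covector `c α_x`. -/
theorem exists_scaleCoord (β₀ : Cotangent I M) (hα : OneForm.SmoothAt I α ⊤ β₀.proj)
    (h0 : α β₀.proj ≠ 0) :
    ∃ σ : Cotangent I M → ℝ, ContMDiffAt (cotangentModel I) 𝓘(ℝ, ℝ) ∞ σ β₀ ∧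
      ∀ᶠ β in 𝓝 β₀, ∀ c : ℝ, β = ⟨β.proj, c • α β.proj⟩ → σ β = c := by
  obtain ⟨v, hv⟩ := OneForm.exists_inChart_apply_ne_zero h0
  set x := β₀.proj with hx
  have h1 : ContMDiffAt I 𝓘(ℝ, ℝ) ∞ (fun z => OneForm.inChart I α x (extChartAt I x z) v) x :=
    contMDiffAt_comp_extChartAt (n := ⊤) (mem_chart_source H _)
      (f := fun y => OneForm.inChart I α x y v) (ContDiffWithinAt.clm_apply hα contDiffWithinAt_const)
  have h2 : ContMDiffAt (cotangentModel I) 𝓘(ℝ, ℝ) ∞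
      (fun β : Cotangent I M => OneForm.inChart I α x (extChartAt I x β.proj) v) β₀ :=
    h1.comp β₀ (contMDiff_cotangent_proj (n := ⊤) β₀)
  have h3 : ContMDiffAt (cotangentModel I) 𝓘(ℝ, ℝ) ∞ (fun β => cotCoord I x β v) β₀ :=
    (contMDiffAt_cotCoord β₀).clm_apply contMDiffAt_const
  refine ⟨fun β => cotCoord I x β v / OneForm.inChart I α x (extChartAt I x β.proj) v,
    h3.div₀ h2 hv, ?_⟩
  have h4 : ∀ᶠ β : Cotangent I M in 𝓝 β₀, β.proj ∈ (chartAt H x).source :=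
    Cotangent.continuous_proj.continuousAt.preimage_mem_nhds
      ((chartAt H x).open_source.mem_nhds (mem_chart_source H _))
  filter_upwards [h2.continuousAt.eventually_ne hv, h4] with β hβ hβ' c hc
  have h5 : cotCoord I x β = c • OneForm.inChart I α x (extChartAt I x β.proj) := by
    have h6 : β = scaledSection α id (fun _ => c) β.proj := hc
    have h7 := cotCoord_scaledSection (α := α) (pr := id) (s := fun _ => c) (z := β.proj) hβ'
    rw [← h6] at h7
    exact h7
  rw [h5, smul_apply, smul_eq_mul, mul_div_cancel_right₀ _ hβ]

/-- At an interior point where its differential is injective, the map `p ↦ s(p) α_{pr(p)}` has a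
smooth local inverse on the set of all multiples of `α`. -/
theorem exists_localInverse_scaledSection [FiniteDimensional ℝ E] [FiniteDimensional ℝ E']
    {pr : N → M} {s : N → ℝ} {p : N} (hp : J.IsInteriorPoint p) (hpr : ContMDiffAt J I ∞ pr p)
    (hs : ContMDiffAt J 𝓘(ℝ, ℝ) ∞ s p) (hα : OneForm.SmoothAt I α ⊤ (pr p)) (h0 : α (pr p) ≠ 0)
    (hinj : ∀ u, mfderiv J I pr p u = 0 → fnD J s p u = 0 → u = 0)
    (hd : Module.finrank ℝ E' = Module.finrank ℝ E + 1) :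
    ∃ c : Cotangent I M → N, ContMDiffAt (cotangentModel I) J ∞ c (scaledSection α pr s p) ∧
      c (scaledSection α pr s p) = p ∧ ∀ᶠ β in 𝓝 (scaledSection α pr s p),
        ∀ a : ℝ, β = ⟨β.proj, a • α β.proj⟩ → scaledSection α pr s (c β) = β := by
  set β₀ := scaledSection α pr s p with hβ₀
  have hps := mem_chart_source H' p
  have hps' : p ∈ (extChartAt J p).source := mem_extChartAt_source p
  have hxs := mem_chart_source H (pr p)
  have hrange : range J ∈ 𝓝 (extChartAt J p p) := range_mem_nhds_isInteriorPoint hp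
  set y₀ := extChartAt J p p with hy₀
  have hinv0 : (extChartAt J p).symm y₀ = p := (extChartAt J p).left_inv hps'
  -- the coordinates `(pr, s)`, whose inverse `G` is composed below with the base point and the scale
  -- of a covector
  let Φ : E' → E × ℝ := fun y => (chartMap J I pr p (pr p) y, s ((extChartAt J p).symm y))
  have hc1 := (contDiffWithinAt_chartMap (n := ⊤) hpr hps hxs).contDiffAt hrange
  have hc2 := (hs.contDiffWithinAt_comp_symm (n := ⊤) hps).contDiffAt hrange
  have hΦ : ContDiffAt ℝ ∞ Φ y₀ := ContDiffAt.prodMk hc1 hc2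
  have hΦ0 : Φ y₀ = (extChartAt I (pr p) (pr p), s p) := by
    simp only [Φ, chartMap, hinv0]
  have hΦinj : ∀ u, fderiv ℝ Φ y₀ u = 0 → u = 0 := by
    intro u hu
    have h1 := (hc1.differentiableAt (by simp)).hasFDerivAt.prodMk
      (hc2.differentiableAt (by simp)).hasFDerivAt
    have h2 : fderiv ℝ Φ y₀ u = (fderiv ℝ (chartMap J I pr p (pr p)) y₀ u,
      fderiv ℝ (fun y => s ((extChartAt J p).symm y)) y₀ u) := DFunLike.congr_fun h1.fderiv u
    rw [h2, ← fderivWithin_of_mem_nhds hrange, ← fderivWithin_of_mem_nhds hrange] at hu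
    have h3 := (Prod.ext_iff.1 hu).1
    have h4 := (Prod.ext_iff.1 hu).2
    simp only [Prod.fst_zero, Prod.snd_zero] at h3 h4
    rw [hy₀, fderivWithin_chartMap (hpr.mdifferentiableAt (by simp)) hps hxs] at h3
    rw [hy₀, fderivWithin_comp_symm (hs.mdifferentiableAt (by simp)) hps] at h4
    have h5 : mfderiv J I pr p (chartDInv J p p u) = 0 := by
      rw [← chartDInv_chartD hxs (mfderiv J I pr p (chartDInv J p p u)), h3, map_zero]
    have h6 := hinj _ h5 h4
    rw [← chartD_chartDInv (I := J) hps u, h6, map_zero]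
  obtain ⟨G, hG, hG0, hGr⟩ := hΦ.exists_local_rightInverse hΦinj (by
    rw [hd, Module.finrank_prod, Module.finrank_self])
  obtain ⟨σ, hσ, hσe⟩ := exists_scaleCoord β₀ hα h0
  have hσ0 : σ β₀ = s p := hσe.self_of_nhds (s p) rfl
  let Ψ : Cotangent I M → E × ℝ := fun β => (extChartAt I (pr p) β.proj, σ β)
  have hΨ0 : Ψ β₀ = Φ y₀ := by
    rw [hΦ0, ← hσ0]
    rfl
  have hΨ : ContMDiffAt (cotangentModel I) 𝓘(ℝ, E × ℝ) ∞ Ψ β₀ := by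
    have h1 : ContMDiffAt (cotangentModel I) 𝓘(ℝ, E) ∞
        (fun β : Cotangent I M => extChartAt I (pr p) β.proj) β₀ :=
      ContMDiffAt.comp β₀ (contMDiffAt_extChartAt' hxs) (contMDiff_cotangent_proj (n := ⊤) β₀)
    exact h1.prodMk_space hσ
  have hGΨ : ContMDiffAt (cotangentModel I) 𝓘(ℝ, E') ∞ (fun β => G (Ψ β)) β₀ := by
    refine ContMDiffAt.comp β₀ (g := G) ?_ hΨ
    rw [hΨ0]
    exact hG.contMDiffAt
  have hGΨ0 : G (Ψ β₀) = y₀ := by rw [hΨ0, hG0]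
  have htarget : (extChartAt J p).target ∈ 𝓝 y₀ := by
    have h1 := extChartAt_target_mem_nhdsWithin (I := J) p
    rwa [nhdsWithin_eq_nhds.2 hrange] at h1
  have hsymm : ContMDiffAt 𝓘(ℝ, E') J ∞ (extChartAt J p).symm y₀ :=
    (contMDiffOn_extChartAt_symm p).contMDiffAt htarget
  have hc : ContMDiffAt (cotangentModel I) J ∞ (fun β => (extChartAt J p).symm (G (Ψ β))) β₀ :=
    ContMDiffAt.comp β₀ (g := (extChartAt J p).symm) (hGΨ0 ▸ hsymm) hGΨ
  have hc0 : (extChartAt J p).symm (G (Ψ β₀)) = p := by rw [hGΨ0, hinv0]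
  refine ⟨fun β => (extChartAt J p).symm (G (Ψ β)), hc, hc0, ?_⟩
  have e1 : ∀ᶠ β in 𝓝 β₀, Φ (G (Ψ β)) = Ψ β :=
    hΨ.continuousAt.eventually (by rw [hΨ0]; exact hGr)
  have e2 : ∀ᶠ β in 𝓝 β₀, pr ((extChartAt J p).symm (G (Ψ β))) ∈ (chartAt H (pr p)).source := by
    have h1 : ContinuousAt (fun β => pr ((extChartAt J p).symm (G (Ψ β)))) β₀ :=
      ContinuousAt.comp (g := pr) (by rw [hc0]; exact hpr.continuousAt) hc.continuousAt
    refine h1.preimage_mem_nhds ((chartAt H (pr p)).open_source.mem_nhds ?_)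
    rw [hc0]
    exact hxs
  have e3 : ∀ᶠ β : Cotangent I M in 𝓝 β₀, β.proj ∈ (chartAt H (pr p)).source :=
    Cotangent.continuous_proj.continuousAt.preimage_mem_nhds
      ((chartAt H (pr p)).open_source.mem_nhds hxs)
  filter_upwards [e1, e2, e3, hσe] with β h1 h2 h3 h4 a ha
  have h5 : chartMap J I pr p (pr p) (G (Ψ β)) = extChartAt I (pr p) β.proj :=
    (Prod.ext_iff.1 h1).1
  have h6 : s ((extChartAt J p).symm (G (Ψ β))) = a := (Prod.ext_iff.1 h1).2.trans (h4 a ha)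
  have h7 : pr ((extChartAt J p).symm (G (Ψ β))) = β.proj :=
    (extChartAt I (pr p)).injOn (by simpa using h2) (by simpa using h3) h5
  rw [scaledSection, h6, h7]
  exact ha.symm

end LocalInverse

section Domain

set_option linter.unusedSectionVars false

variable {m : ℕ}
  {F : Type*} [TopologicalSpace F] [ChartedSpace (EuclideanHalfSpace (2 * m + 2)) F]
  [IsManifold (𝓡∂ (2 * m + 2)) ∞ F]
  {K : Type*} [TopologicalSpace K] [ChartedSpace (EuclideanSpace ℝ (Fin (2 * m + 1))) K]
  [IsManifold (𝓡 (2 * m + 1)) ∞ K]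
  {ι : K → F} {lam : OneForm (𝓡∂ (2 * m + 2)) F}
  {ν : ∀ p : F, TangentSpace (𝓡∂ (2 * m + 2)) p} {g : F → ℝ} {Γ : K → ℝ → F} {pr : F → K}
  {s : F → ℝ}

/-- The exterior derivative of `s pr^*α`. -/
theorem d_eq_of_eq_smul_pullForm {α : OneForm (𝓡 (2 * m + 1)) K} {p : F}
    (hpr : ContMDiffAt (𝓡∂ (2 * m + 2)) (𝓡 (2 * m + 1)) ∞ pr p)
    (hs : ContMDiffAt (𝓡∂ (2 * m + 2)) 𝓘(ℝ, ℝ) ∞ s p)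
    (hα : OneForm.SmoothAt (𝓡 (2 * m + 1)) α ⊤ (pr p))
    (hform : ∀ᶠ z in 𝓝 p, lam z = s z • pullForm α pr z)
    (u v : TangentSpace (𝓡∂ (2 * m + 2)) p) :
    OneForm.d (𝓡∂ (2 * m + 2)) lam p u v =
      fnD (𝓡∂ (2 * m + 2)) s p u * α (pr p) (mfderiv (𝓡∂ (2 * m + 2)) (𝓡 (2 * m + 1)) pr p v) -
      fnD (𝓡∂ (2 * m + 2)) s p v * α (pr p) (mfderiv (𝓡∂ (2 * m + 2)) (𝓡 (2 * m + 1)) pr p u) +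
      s p * OneForm.d (𝓡 (2 * m + 1)) α (pr p)
        (mfderiv (𝓡∂ (2 * m + 2)) (𝓡 (2 * m + 1)) pr p u)
        (mfderiv (𝓡∂ (2 * m + 2)) (𝓡 (2 * m + 1)) pr p v) := by
  rw [OneForm.d_smul (hs.mdifferentiableAt (by simp))
    (ContDiffWithinAt.of_le (smoothAt_pullForm hpr hα) (by exact_mod_cast le_top)) hform,
    d_pullForm hpr hα]
  rfl

/-- The common kernel of `dpr` and `ds` is contained in the kernel of `d(s pr^*α)`. -/
theorem eq_zero_of_mfderiv_eq_zero {α : OneForm (𝓡 (2 * m + 1)) K} {p : F}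
    (hpr : ContMDiffAt (𝓡∂ (2 * m + 2)) (𝓡 (2 * m + 1)) ∞ pr p)
    (hs : ContMDiffAt (𝓡∂ (2 * m + 2)) 𝓘(ℝ, ℝ) ∞ s p)
    (hα : OneForm.SmoothAt (𝓡 (2 * m + 1)) α ⊤ (pr p))
    (hform : ∀ᶠ z in 𝓝 p, lam z = s z • pullForm α pr z)
    (hnd : OneForm.DNondegenerateAt (𝓡∂ (2 * m + 2)) lam p)
    (u : TangentSpace (𝓡∂ (2 * m + 2)) p)
    (hu : mfderiv (𝓡∂ (2 * m + 2)) (𝓡 (2 * m + 1)) pr p u = 0)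
    (hu' : fnD (𝓡∂ (2 * m + 2)) s p u = 0) : u = 0 := by
  refine hnd u fun v => ?_
  rw [d_eq_of_eq_smul_pullForm hpr hs hα hform, hu, hu', map_zero, OneForm.d_zero_left]
  ring

namespace IsLiouvilleCollar

theorem eventually_form_eq (C : IsLiouvilleCollar ι lam ν g Γ pr s) {p : F}
    (hp : p ∈ orbitSet Γ) : ∀ᶠ z in 𝓝 p, lam z = s z • pullForm (boundaryForm ι lam) pr z :=
  Filter.mem_of_superset (C.isOpen.mem_nhds hp) C.form_eq

/-- At interior points, the inverse of the collar map is locally given by a smooth map. -/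
theorem exists_localInverse (C : IsLiouvilleCollar ι lam ν g Γ pr s)
    (hι : IsBoundaryInclusion m ι) (hlam : OneForm.IsSmooth (𝓡∂ (2 * m + 2)) lam)
    (hc : IsContactForm (boundaryForm ι lam))
    (hsymp : ∀ p ∈ (𝓡∂ (2 * m + 2)).interior F,
      OneForm.DNondegenerateAt (𝓡∂ (2 * m + 2)) lam p) {p : F} (hp : p ∈ orbitSet Γ)
    (hpi : p ∈ (𝓡∂ (2 * m + 2)).interior F) :
    ∃ c : Cotangent (𝓡 (2 * m + 1)) K → F,
      ContMDiffAt (cotangentModel (𝓡 (2 * m + 1))) (𝓡∂ (2 * m + 2)) ∞ c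
        (toCotangent ι lam pr s p) ∧
      c (toCotangent ι lam pr s p) = p ∧ ∀ᶠ β in 𝓝 (toCotangent ι lam pr s p),
        β ∈ SLe (𝓡 (2 * m + 1)) (boundaryForm ι lam) →
          c β ∈ orbitSet Γ ∧ toCotangent ι lam pr s (c β) = β := by
  obtain ⟨c, hcs, hc0, hce⟩ := exists_localInverse_scaledSection hpi (C.smooth_proj p hp)
    (C.smooth_scale p hp) (hι.smoothAt_boundaryForm hlam _) (hc.ne_zero _)
    (eq_zero_of_mfderiv_eq_zero (C.smooth_proj p hp) (C.smooth_scale p hp)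
      (hι.smoothAt_boundaryForm hlam _) (C.eventually_form_eq hp) (hsymp p hpi))
    (by rw [finrank_euclideanSpace_fin, finrank_euclideanSpace_fin])
  refine ⟨c, hcs, hc0, ?_⟩
  have h1 : ∀ᶠ β in 𝓝 (toCotangent ι lam pr s p), c β ∈ orbitSet Γ :=
    hcs.continuousAt.preimage_mem_nhds (C.isOpen.mem_nhds (by rw [hc0]; exact hp))
  filter_upwards [hce, h1] with β h2 h3 hβ
  obtain ⟨a, -, -, ha⟩ := hβ
  exact ⟨h3, h2 a ha⟩

/-- Near the boundary, the inverse of the collar map is continuous: the orbit time at which the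
scale `s` takes a value close to `1` is small, locally uniformly. -/
theorem tendsto_inverse_boundary [T2Space F] (C : IsLiouvilleCollar ι lam ν g Γ pr s)
    (h : IsLiouvilleData lam ν g) (hι : IsBoundaryInclusion m ι)
    (hlam : OneForm.IsSmooth (𝓡∂ (2 * m + 2)) lam) (hc : IsContactForm (boundaryForm ι lam))
    {inv : Cotangent (𝓡 (2 * m + 1)) K → F}
    (hinv : ∀ β ∈ SLe (𝓡 (2 * m + 1)) (boundaryForm ι lam),
      inv β ∈ orbitSet Γ ∧ toCotangent ι lam pr s (inv β) = β) (x₀ : K) :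
    Tendsto inv (𝓝[SLe (𝓡 (2 * m + 1)) (boundaryForm ι lam)] (toCotangent ι lam pr s (ι x₀)))
      (𝓝 (ι x₀)) := by
  set β₀ := toCotangent ι lam pr s (ι x₀) with hβ₀
  have hβ₀p : β₀.proj = x₀ := C.proj_boundary x₀
  obtain ⟨r, hr, hflow⟩ := C.orbits.exists_tendsto heightCLM_single range_halfSpaceModel h.pos_neg
    (contMDiff_neg_field h.smooth) hι.mem_boundary hι.contMDiff.continuous x₀
  obtain ⟨σ, hσ, hσe⟩ := exists_scaleCoord (α := boundaryForm ι lam) β₀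
    (hι.smoothAt_boundaryForm hlam _) (hc.ne_zero _)
  have hσ0 : σ β₀ = 1 := (hσe.self_of_nhds (s (ι x₀)) rfl).trans (C.scale_boundary x₀)
  have hproj : Tendsto (fun β : Cotangent (𝓡 (2 * m + 1)) K => β.proj) (𝓝 β₀) (𝓝 x₀) := by
    have := (Cotangent.continuous_proj (I := 𝓡 (2 * m + 1)) (M := K)).continuousAt (x := β₀)
    rwa [ContinuousAt, hβ₀p] at this
  rw [tendsto_def]
  intro W hW
  have h0 := (hflow 0 ⟨le_rfl, hr⟩)
  rw [C.orbits.zero] at h0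
  obtain ⟨A, hA, B, hB, hAB⟩ := Filter.eventually_prod_iff.1 (h0.eventually hW)
  obtain ⟨δ, hδ, hδB⟩ := Metric.mem_nhdsWithin_iff.1 hB
  -- after the time `t₁` the scale is less than some `c < 1`, hence a covector with scale above `c`
  -- comes from a point reached before `t₁`
  set t₁ := min (δ / 2) (r / 2) with ht₁
  have ht₁0 : 0 < t₁ := lt_min (by linarith) (by linarith)
  have ht₁δ : t₁ < δ := (min_le_left _ _).trans_lt (by linarith)
  have ht₁r : t₁ < r := (min_le_right _ _).trans_lt (by linarith)
  have h1 : Tendsto (fun x => Γ x t₁) (𝓝 x₀) (𝓝 (Γ x₀ t₁)) :=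
    (hflow t₁ ⟨ht₁0.le, ht₁r⟩).comp (tendsto_id.prodMk
      (tendsto_nhdsWithin_iff.2 ⟨tendsto_const_nhds, Eventually.of_forall fun _ => ht₁0.le⟩))
  have h2 : Tendsto (fun x => s (Γ x t₁)) (𝓝 x₀) (𝓝 (s (Γ x₀ t₁))) :=
    (C.smooth_scale _ (mem_orbitSet x₀ ht₁0.le)).continuousAt.tendsto.comp h1
  obtain ⟨c, hc1, hc2⟩ := exists_between (C.scale_lt_one h x₀ ht₁0)
  have e1 := hproj.eventually (h2.eventually (gt_mem_nhds hc1))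
  have e2 := hproj.eventually hA
  have e3 := hσ.continuousAt.eventually (lt_mem_nhds (by rw [hσ0]; exact hc2))
  have e4 : ∀ᶠ β in 𝓝[SLe (𝓡 (2 * m + 1)) (boundaryForm ι lam)] β₀,
    β ∈ SLe (𝓡 (2 * m + 1)) (boundaryForm ι lam) := self_mem_nhdsWithin
  filter_upwards [nhdsWithin_le_nhds e1, nhdsWithin_le_nhds e2, nhdsWithin_le_nhds e3,
    nhdsWithin_le_nhds hσe, e4] with β h3 h4 h5 h6 h7
  obtain ⟨⟨x, t, ht, hxt⟩, h8⟩ := hinv β h7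
  rw [← hxt] at h8
  have h9 : x = β.proj := (C.proj x t ht).symm.trans (congrArg TotalSpace.proj h8)
  have h10 : σ β = s (Γ x t) := by
    refine h6 _ ?_
    conv_lhs => rw [← h8]
    rw [← h9]
    exact congrArg (fun y => (⟨y, s (Γ x t) • boundaryForm ι lam y⟩ :
      Cotangent (𝓡 (2 * m + 1)) K)) (C.proj x t ht)
  subst h9
  have h11 : t < t₁ := by
    by_contra! hle
    have := (C.strictAntiOn_scale h β.proj).antitoneOn ht₁0.le ht hle
    linarith
  change inv β ∈ W
  rw [← hxt]
  refine hAB h4 (hδB ⟨?_, ht⟩)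
  rw [Metric.mem_ball, Real.dist_eq, sub_zero, abs_of_nonneg ht]
  linarith

/-- The collar map `p ↦ s(p) α_{pr(p)}` has all the required properties. -/
theorem isLiouvilleCollarMap [T2Space F] [Nonempty F] (C : IsLiouvilleCollar ι lam ν g Γ pr s)
    (h : IsLiouvilleData lam ν g) (hι : IsBoundaryInclusion m ι)
    (hlam : OneForm.IsSmooth (𝓡∂ (2 * m + 2)) lam) (hc : IsContactForm (boundaryForm ι lam))
    (hsymp : ∀ p ∈ (𝓡∂ (2 * m + 2)).interior F,
      OneForm.DNondegenerateAt (𝓡∂ (2 * m + 2)) lam p) :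
    IsLiouvilleCollarMap ι lam (orbitSet Γ) (toCotangent ι lam pr s) := by
  have hinj := C.toCotangent_injOn h hc
  have hsurj := C.toCotangent_surjOn
  set inv := Function.invFunOn (toCotangent ι lam pr s) (orbitSet Γ) with hinvdef
  have hinv : ∀ β ∈ SLe (𝓡 (2 * m + 1)) (boundaryForm ι lam),
      inv β ∈ orbitSet Γ ∧ toCotangent ι lam pr s (inv β) = β := fun β hβ =>
    ⟨Function.invFunOn_mem (hsurj hβ), Function.invFunOn_eq (hsurj hβ)⟩
  have hle : SLt (𝓡 (2 * m + 1)) (boundaryForm ι lam) ⊆ SLe (𝓡 (2 * m + 1)) (boundaryForm ι lam) :=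
    fun β ⟨c, hc0, hc1, hβ⟩ => ⟨c, hc0, hc1.le, hβ⟩
  have hrange : ∀ β ∈ SLt (𝓡 (2 * m + 1)) (boundaryForm ι lam), inv β ∉ range ι := by
    rintro β ⟨c, hc0, hc1, hβ⟩
    obtain ⟨h1, h2⟩ := hinv β (hle ⟨c, hc0, hc1, hβ⟩)
    rw [← C.scale_lt_one_iff h h1]
    have h3 : toCotangent ι lam pr s (inv β) =
      scaledSection (boundaryForm ι lam) id (fun _ => c) β.proj := h2.trans hβ
    rw [(scaledSection_inj (s' := fun _ => c) (pr' := id) (hc.ne_zero _) h3).2]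
    exact hc1
  -- away from the boundary, the inverse coincides with the smooth local inverses
  have hloc : ∀ β ∈ SLe (𝓡 (2 * m + 1)) (boundaryForm ι lam), inv β ∉ range ι →
      ContMDiffWithinAt (cotangentModel (𝓡 (2 * m + 1))) (𝓡∂ (2 * m + 2)) ∞ inv
        (SLe (𝓡 (2 * m + 1)) (boundaryForm ι lam)) β := by
    intro β hβ hr
    obtain ⟨h1, h2⟩ := hinv β hβ
    rw [hι.range_eq] at hr
    obtain ⟨c, hcs, hc0, hce⟩ := C.exists_localInverse hι hlam hc hsymp h1
      ((mem_interior_or_boundary (m := m) _).resolve_right hr)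
    rw [h2] at hcs hc0 hce
    refine hcs.contMDiffWithinAt.congr_of_eventuallyEq ?_ hc0.symm
    filter_upwards [nhdsWithin_le_nhds hce, self_mem_nhdsWithin] with b hb hbS
    obtain ⟨h3, h4⟩ := hb hbS
    exact hinj (hinv b hbS).1 h3 ((hinv b hbS).2.trans h4.symm)
  refine ⟨fun p hp => (C.contMDiffAt_toCotangent hι hlam hp).contMDiffWithinAt,
    ⟨inv, C.toCotangent_mem_SLe h, fun β hβ => (hinv β hβ).1, ⟨fun p hp => ?_,
      fun β hβ => (hinv β hβ).2⟩, fun β hβ => ?_, C.toCotangent_mem_SLt h, fun β hβ => ?_,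
      fun β hβ => ?_⟩, fun x => ?_, fun p hp => C.pullback hι hlam hp⟩
  · have h1 := hinv _ (C.toCotangent_mem_SLe h hp)
    exact hinj h1.1 hp h1.2
  · by_cases hr : inv β ∈ range ι
    · obtain ⟨x, hx⟩ := hr
      have h1 := C.tendsto_inverse_boundary h hι hlam hc hinv x
      rw [hx, (hinv β hβ).2] at h1
      exact h1
    · exact (hloc β hβ hr).continuousWithinAt
  · exact ⟨(hinv β (hle hβ)).1, hrange β hβ⟩
  · exact (hloc β (hle hβ) (hrange β hβ)).mono hle
  · change (⟨pr (ι x), s (ι x) • boundaryForm ι lam (pr (ι x))⟩ : Cotangent (𝓡 (2 * m + 1)) K) = _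
    rw [C.proj_boundary, C.scale_boundary, one_smul]
    rfl

end IsLiouvilleCollar

end Domain

/-! ### Singular points and folds of the collar map -/

section SecondDerivative

/-- If the derivative of `f` along the vector field `V` is `a W`, where the function `a` vanishes
at `y₀`, then the second derivative of `f` along `V` at `y₀` is `da(V) W` modulo the range of the
derivative of `f`. -/
theorem iteratedFDerivWithin_two_along_field {E G : Type*} [NormedAddCommGroup E]
    [NormedSpace ℝ E] [NormedAddCommGroup G] [NormedSpace ℝ G] {f : E → G} {S : Set E} {y₀ : E}
    (hS : UniqueDiffOn ℝ S) (hy₀ : y₀ ∈ S) (hf : ContDiffWithinAt ℝ ∞ f S y₀) {V : E → E}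
    (hV : DifferentiableWithinAt ℝ V S y₀) {a : E → ℝ} {W : E → G}
    (ha : DifferentiableWithinAt ℝ a S y₀) (hW : DifferentiableWithinAt ℝ W S y₀)
    (ha0 : a y₀ = 0) (h : ∀ᶠ y in 𝓝[S] y₀, fderivWithin ℝ f S y (V y) = a y • W y) :
    iteratedFDerivWithin ℝ 2 f S y₀ (fun _ => V y₀) =
      fderivWithin ℝ a S y₀ (V y₀) • W y₀ -
        fderivWithin ℝ f S y₀ (fderivWithin ℝ V S y₀ (V y₀)) := by
  have hD : DifferentiableWithinAt ℝ (fderivWithin ℝ f S) S y₀ :=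
    (hf.fderivWithin_right (m := 1) hS
      (by rw [one_add_one_eq_two]; exact ENat.LEInfty.out) hy₀).differentiableWithinAt
      (by simp)
  have h1 := hD.hasFDerivWithinAt.clm_apply hV.hasFDerivWithinAt
  have h2 := ha.hasFDerivWithinAt.smul hW.hasFDerivWithinAt
  have h3 := h1.congr_of_eventuallyEq (h.mono fun y hy => hy.symm)
    (h.self_of_nhdsWithin hy₀).symm
  have h4 := DFunLike.congr_fun ((hS y₀ hy₀).eq h3 h2) (V y₀)
  rw [iteratedFDerivWithin_two_apply f hS hy₀]
  simp only [add_apply, ContinuousLinearMap.comp_apply, ContinuousLinearMap.flip_apply,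
    ContinuousLinearMap.smulRight_apply, ha0, zero_smul, zero_add] at h4
  rw [← h4]
  abel

theorem ContinuousLinearMap.not_injective_iff {V W : Type*} [AddCommGroup V] [Module ℝ V]
    [TopologicalSpace V] [AddCommGroup W] [Module ℝ W] [TopologicalSpace W] (f : V →L[ℝ] W) :
    ¬ Function.Injective f ↔ ∃ u, u ≠ 0 ∧ f u = 0 := by
  rw [injective_iff_map_eq_zero]
  push Not
  exact exists_congr fun u => and_comm

theorem ContinuousLinearMap.exists_ne_zero_of_finrank_ker_eq_one {V W : Type*} [AddCommGroup V]
    [Module ℝ V] [TopologicalSpace V] [AddCommGroup W] [Module ℝ W] [TopologicalSpace W]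
    {f : V →L[ℝ] W} (h : Module.finrank ℝ f.ker = 1) : ∃ u, u ≠ 0 ∧ f u = 0 := by
  obtain ⟨⟨u, hu⟩, hu0, -⟩ := finrank_eq_one_iff'.1 h
  exact ⟨u, fun h => hu0 (Subtype.ext h), hu⟩

theorem ContinuousLinearMap.finrank_ker_eq_one {V W : Type*} [AddCommGroup V]
    [Module ℝ V] [TopologicalSpace V] [AddCommGroup W] [Module ℝ W] [TopologicalSpace W]
    {f : V →L[ℝ] W} {v : V} (hv : v ≠ 0) (hfv : f v = 0) (h : ∀ u, f u = 0 → ∃ c : ℝ, u = c • v) :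
    Module.finrank ℝ f.ker = 1 := by
  refine finrank_eq_one_iff'.2 ⟨⟨v, hfv⟩, fun h0 => hv (congrArg Subtype.val h0), fun w => ?_⟩
  obtain ⟨c, hc⟩ := h w.1 w.2
  exact ⟨c, Subtype.ext hc.symm⟩

theorem ContinuousLinearMap.map_add_smul_eq {V W : Type*} [AddCommGroup V]
    [Module ℝ V] [TopologicalSpace V] [AddCommGroup W] [Module ℝ W] [TopologicalSpace W]
    {f : V →L[ℝ] W} {v v' : V} {w : W} {a b : ℝ} (h : f v = b • (a • w - f v')) :
    f (v + b • v') = (b * a) • w := by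
  rw [map_add, map_smul, h, smul_sub, smul_smul, sub_add_cancel]

end SecondDerivative

section Domain

set_option linter.unusedSectionVars false

variable {m : ℕ}
  {F : Type*} [TopologicalSpace F] [ChartedSpace (EuclideanHalfSpace (2 * m + 2)) F]
  [IsManifold (𝓡∂ (2 * m + 2)) ∞ F]
  {K : Type*} [TopologicalSpace K] [ChartedSpace (EuclideanSpace ℝ (Fin (2 * m + 1))) K]
  [IsManifold (𝓡 (2 * m + 1)) ∞ K]
  {ι : K → F} {lam : OneForm (𝓡∂ (2 * m + 2)) F}
  {ν : ∀ p : F, TangentSpace (𝓡∂ (2 * m + 2)) p} {g : F → ℝ} {Γ : K → ℝ → F} {pr : F → K}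
  {s : F → ℝ}

theorem IsLiouvilleData.ne_zero_boundary (h : IsLiouvilleData lam ν g)
    (hι : IsBoundaryInclusion m ι) (x : K) : ν (ι x) ≠ 0 := fun h1 => by
  have h2 := h.outward _ (hι.mem_boundary x)
  rw [h1] at h2
  exact lt_irrefl _ (h2.trans_eq (map_zero (heightCLM m)).symm)

namespace IsLiouvilleCollar

theorem mfderiv_eq_zero_iff (C : IsLiouvilleCollar ι lam ν g Γ pr s)
    (hι : IsBoundaryInclusion m ι) (hlam : OneForm.IsSmooth (𝓡∂ (2 * m + 2)) lam)
    (hc : IsContactForm (boundaryForm ι lam)) {p : F} (hp : p ∈ orbitSet Γ)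
    (u : TangentSpace (𝓡∂ (2 * m + 2)) p) :
    mfderiv (𝓡∂ (2 * m + 2)) (cotangentModel (𝓡 (2 * m + 1))) (toCotangent ι lam pr s) p u = 0 ↔
      mfderiv (𝓡∂ (2 * m + 2)) (𝓡 (2 * m + 1)) pr p u = 0 ∧ fnD (𝓡∂ (2 * m + 2)) s p u = 0 :=
  mfderiv_scaledSection_eq_zero_iff (C.smooth_proj p hp) (C.smooth_scale p hp)
    (hι.smoothAt_boundaryForm hlam _) (hc.ne_zero _) u

/-- At a boundary point, the kernel of `dpr` is spanned by `ν`. -/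
theorem exists_eq_smul_of_mfderiv_proj_eq_zero (C : IsLiouvilleCollar ι lam ν g Γ pr s)
    (h : IsLiouvilleData lam ν g) (hι : IsBoundaryInclusion m ι)
    (hlam : OneForm.IsSmooth (𝓡∂ (2 * m + 2)) lam) (hc : IsContactForm (boundaryForm ι lam))
    (x : K) (u : TangentSpace (𝓡∂ (2 * m + 2)) (ι x))
    (hu : mfderiv (𝓡∂ (2 * m + 2)) (𝓡 (2 * m + 1)) pr (ι x) u = 0) :
    ∃ c : ℝ, u = c • ν (ι x) := by
  obtain ⟨c, w, rfl⟩ := h.exists_decomposition hι hlam hc x u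
  have h1 : mfderiv (𝓡∂ (2 * m + 2)) (𝓡 (2 * m + 1)) pr (ι x)
      (mfderiv (𝓡 (2 * m + 1)) (𝓡∂ (2 * m + 2)) ι x w) = w := by
    have h2 := mfderiv_comp x ((C.smooth_proj _ (C.boundary_mem x)).mdifferentiableAt (by simp))
      (hι.mdifferentiableAt x)
    have h3 : pr ∘ ι = id := funext C.proj_boundary
    rw [h3, mfderiv_id] at h2
    exact (DFunLike.congr_fun h2 w).symm
  rw [map_add, map_smul, C.proj_field _ (C.boundary_mem x), smul_zero, zero_add, h1] at hu
  refine ⟨c, ?_⟩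
  have h4 : w = 0 := hu
  rw [h4, map_zero, add_zero]

/-- The singular points of the collar map are the points where `dpr` and `ds` have a common kernel. -/
theorem isSingularPoint_iff_exists (C : IsLiouvilleCollar ι lam ν g Γ pr s)
    (hι : IsBoundaryInclusion m ι) (hlam : OneForm.IsSmooth (𝓡∂ (2 * m + 2)) lam)
    (hc : IsContactForm (boundaryForm ι lam)) {p : F} (hp : p ∈ orbitSet Γ) :
    IsSingularPoint (𝓡∂ (2 * m + 2)) (cotangentModel (𝓡 (2 * m + 1)))
        (toCotangent ι lam pr s) p ↔
      ∃ u, u ≠ 0 ∧ mfderiv (𝓡∂ (2 * m + 2)) (𝓡 (2 * m + 1)) pr p u = 0 ∧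
        fnD (𝓡∂ (2 * m + 2)) s p u = 0 := by
  refine (ContinuousLinearMap.not_injective_iff _).trans (exists_congr fun u => ?_)
  rw [C.mfderiv_eq_zero_iff hι hlam hc hp]

/-- The common kernel of `dpr` and `ds` is contained in the kernel of `dλ`, and it contains `ν` at the
boundary points where `g` vanishes. -/
theorem isSingularPoint_iff (C : IsLiouvilleCollar ι lam ν g Γ pr s)
    (h : IsLiouvilleData lam ν g) (hι : IsBoundaryInclusion m ι)
    (hlam : OneForm.IsSmooth (𝓡∂ (2 * m + 2)) lam) (hc : IsContactForm (boundaryForm ι lam))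
    (hsymp : ∀ p ∈ (𝓡∂ (2 * m + 2)).interior F,
      OneForm.DNondegenerateAt (𝓡∂ (2 * m + 2)) lam p) {p : F} (hp : p ∈ orbitSet Γ) :
    IsSingularPoint (𝓡∂ (2 * m + 2)) (cotangentModel (𝓡 (2 * m + 1)))
        (toCotangent ι lam pr s) p ↔
      p ∈ range ι ∧ ¬ OneForm.DNondegenerateAt (𝓡∂ (2 * m + 2)) lam p := by
  rw [C.isSingularPoint_iff_exists hι hlam hc hp]
  constructor
  · rintro ⟨u, hu0, hu1, hu2⟩
    have hnd : ¬ OneForm.DNondegenerateAt (𝓡∂ (2 * m + 2)) lam p := fun hn =>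
      hu0 (eq_zero_of_mfderiv_eq_zero (C.smooth_proj p hp) (C.smooth_scale p hp)
        (hι.smoothAt_boundaryForm hlam _) (C.eventually_form_eq hp) hn u hu1 hu2)
    refine ⟨?_, hnd⟩
    rw [hι.range_eq]
    exact (mem_interior_or_boundary (m := m) p).resolve_left fun hi => hnd (hsymp p hi)
  · rintro ⟨⟨x, rfl⟩, hnd⟩
    rw [h.dNondegenerateAt_iff hι hlam hc, not_not] at hnd
    refine ⟨ν (ι x), h.ne_zero_boundary hι x, C.proj_field _ hp, ?_⟩
    rw [C.scale_field _ hp, hnd, zero_mul]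

/-- The derivative along `ν` of the collar map is `g s` times the fibre direction `α`. Hence, where
`g` vanishes, its second derivative along `ν` is `dg(ν) s` times this direction, modulo the range of
the differential. -/
theorem exists_iteratedFDerivWithin_two_eq (C : IsLiouvilleCollar ι lam ν g Γ pr s)
    (h : IsLiouvilleData lam ν g) (hι : IsBoundaryInclusion m ι)
    (hlam : OneForm.IsSmooth (𝓡∂ (2 * m + 2)) lam) {p : F} (hp : p ∈ orbitSet Γ) (hg : g p = 0) :
    ∃ w : EuclideanSpace ℝ (Fin (2 * m + 2)), iteratedFDerivWithin ℝ 2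
      (writtenInExtChartAt (𝓡∂ (2 * m + 2)) (cotangentModel (𝓡 (2 * m + 1))) p
        (toCotangent ι lam pr s)) (range (𝓡∂ (2 * m + 2))) (extChartAt (𝓡∂ (2 * m + 2)) p p)
        (fun _ => (ν p : EuclideanSpace ℝ (Fin (2 * m + 2)))) =
      (fnD (𝓡∂ (2 * m + 2)) g p (ν p) * s p) •
        ((0 : EuclideanSpace ℝ (Fin (2 * m + 1))), OneForm.inChart (𝓡 (2 * m + 1))
          (boundaryForm ι lam) (pr p) (extChartAt (𝓡 (2 * m + 1)) (pr p) (pr p))) -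
      fderivWithin ℝ (sectionInChart (𝓡∂ (2 * m + 2)) (boundaryForm ι lam) pr s p)
        (range (𝓡∂ (2 * m + 2))) (extChartAt (𝓡∂ (2 * m + 2)) p p) w := by
  set α := boundaryForm ι lam with hα
  have hαs : ∀ x, OneForm.SmoothAt (𝓡 (2 * m + 1)) α ⊤ x := hι.smoothAt_boundaryForm hlam
  have hps := mem_chart_source (EuclideanHalfSpace (2 * m + 2)) p
  have hxs := mem_chart_source (EuclideanSpace ℝ (Fin (2 * m + 1))) (pr p)
  have hmem := extChartAt_mem_range (I := 𝓡∂ (2 * m + 2)) p p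
  have hinv0 : (extChartAt (𝓡∂ (2 * m + 2)) p).symm (extChartAt (𝓡∂ (2 * m + 2)) p p) = p :=
    extChartAt_to_inv p
  have hpr := C.smooth_proj p hp
  have hs := C.smooth_scale p hp
  have hgs : ContMDiffAt (𝓡∂ (2 * m + 2)) 𝓘(ℝ, ℝ) ∞ (fun q => g q * s q) p :=
    (h.smooth_factor p).mul hs
  let a : EuclideanSpace ℝ (Fin (2 * m + 2)) → ℝ := fun y =>
    (fun q => g q * s q) ((extChartAt (𝓡∂ (2 * m + 2)) p).symm y)
  let W : EuclideanSpace ℝ (Fin (2 * m + 2)) →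
      EuclideanSpace ℝ (Fin (2 * m + 1)) × (EuclideanSpace ℝ (Fin (2 * m + 1)) →L[ℝ] ℝ) := fun y =>
    (0, OneForm.inChart (𝓡 (2 * m + 1)) α (pr p)
      (chartMap (𝓡∂ (2 * m + 2)) (𝓡 (2 * m + 1)) pr p (pr p) y))
  have hV : ContDiffWithinAt ℝ ∞ _ _ _ := contDiffWithinAt_chartField (n := ⊤) (h.smooth p) hps
  have hV0 : chartField (𝓡∂ (2 * m + 2)) ν p (extChartAt (𝓡∂ (2 * m + 2)) p p) = ν p :=
    (chartField_extChartAt ν hps).trans (chartD_self p (ν p))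
  have ha : ContDiffWithinAt ℝ ∞ a (range (𝓡∂ (2 * m + 2))) (extChartAt (𝓡∂ (2 * m + 2)) p p) :=
    hgs.contDiffWithinAt_comp_symm (n := ⊤) hps
  have h1 : ContDiffWithinAt ℝ ∞ _ _ _ := contDiffWithinAt_chartMap (n := ⊤) hpr hps hxs
  have h3 : chartMap (𝓡∂ (2 * m + 2)) (𝓡 (2 * m + 1)) pr p (pr p)
      (extChartAt (𝓡∂ (2 * m + 2)) p p) = extChartAt (𝓡 (2 * m + 1)) (pr p) (pr p) := by
    rw [chartMap, hinv0]
  have hW : ContDiffWithinAt ℝ ∞ W (range (𝓡∂ (2 * m + 2)))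
      (extChartAt (𝓡∂ (2 * m + 2)) p p) := by
    have h4 : ContDiffWithinAt ℝ ∞ (OneForm.inChart (𝓡 (2 * m + 1)) α (pr p))
        (range (𝓡 (2 * m + 1))) (chartMap (𝓡∂ (2 * m + 2)) (𝓡 (2 * m + 1)) pr p (pr p)
          (extChartAt (𝓡∂ (2 * m + 2)) p p)) := by
      rw [h3]
      exact hαs _
    exact contDiffWithinAt_const.prodMk
      (ContDiffWithinAt.comp _ h4 h1 fun y _ => extChartAt_mem_range _ _)
  -- near `p`, the derivative of `h` along `ν` is `g s` times the fibre direction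
  have hev : ∀ᶠ y in 𝓝[range (𝓡∂ (2 * m + 2))] (extChartAt (𝓡∂ (2 * m + 2)) p p),
      fderivWithin ℝ (sectionInChart (𝓡∂ (2 * m + 2)) α pr s p) (range (𝓡∂ (2 * m + 2))) y
        (chartField (𝓡∂ (2 * m + 2)) ν p y) = a y • W y := by
    have e0 : ∀ᶠ q in 𝓝 p, q ∈ orbitSet Γ := C.isOpen.mem_nhds hp
    have e1 : ∀ᶠ q in 𝓝 p, q ∈ orbitSet Γ ∧
        pr q ∈ (chartAt (EuclideanSpace ℝ (Fin (2 * m + 1))) (pr p)).source :=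
      e0.and (hpr.continuousAt.preimage_mem_nhds
        ((chartAt (EuclideanSpace ℝ (Fin (2 * m + 1))) (pr p)).open_source.mem_nhds hxs))
    filter_upwards [eventually_nhdsWithin_range_extChartAt hps e1] with y hy
    obtain ⟨hyt, hys, hyU, hyp⟩ := hy
    obtain ⟨q, rfl⟩ : ∃ q, q = (extChartAt (𝓡∂ (2 * m + 2)) p).symm y := ⟨_, rfl⟩
    have hyq : extChartAt (𝓡∂ (2 * m + 2)) p ((extChartAt (𝓡∂ (2 * m + 2)) p).symm y) = y :=
      (extChartAt (𝓡∂ (2 * m + 2)) p).right_inv hyt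
    have h5 := fderivWithin_sectionInChart (C.smooth_proj _ hyU) (C.smooth_scale _ hyU) (hαs _)
      hys hyp (chartField (𝓡∂ (2 * m + 2)) ν p y)
    have h6 : chartDInv (𝓡∂ (2 * m + 2)) p ((extChartAt (𝓡∂ (2 * m + 2)) p).symm y)
        (chartField (𝓡∂ (2 * m + 2)) ν p y) = ν ((extChartAt (𝓡∂ (2 * m + 2)) p).symm y) :=
      chartDInv_chartD hys _
    rw [hyq, h6, C.proj_field _ hyU, C.scale_field _ hyU, map_zero, map_zero, smul_zero,
      zero_add] at h5
    refine h5.trans ?_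
    simp only [a, W, Prod.smul_mk, smul_zero, chartMap]
  have ha0 : a (extChartAt (𝓡∂ (2 * m + 2)) p p) = 0 := by
    simp only [a, hinv0, hg, zero_mul]
  have key := iteratedFDerivWithin_two_along_field (𝓡∂ (2 * m + 2)).uniqueDiffOn hmem
    (contDiffWithinAt_sectionInChart hpr hs (hαs _)) (hV.differentiableWithinAt (by simp))
    (ha.differentiableWithinAt (by simp)) (hW.differentiableWithinAt (by simp)) ha0 hev
  have hcongr := writtenInExtChartAt_scaledSection (J := 𝓡∂ (2 * m + 2)) (α := α) (s := s)
    hpr.continuousAt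
  rw [hcongr.iteratedFDerivWithin_eq (hcongr.eq_of_nhdsWithin hmem)]
  rw [hV0] at key
  refine ⟨fderivWithin ℝ (chartField (𝓡∂ (2 * m + 2)) ν p) (range (𝓡∂ (2 * m + 2)))
    (extChartAt (𝓡∂ (2 * m + 2)) p p) (ν p), key.trans ?_⟩
  have h7 : fderivWithin ℝ a (range (𝓡∂ (2 * m + 2))) (extChartAt (𝓡∂ (2 * m + 2)) p p) (ν p) =
      fnD (𝓡∂ (2 * m + 2)) g p (ν p) * s p := by
    have h8 := fderivWithin_comp_symm (hgs.mdifferentiableAt (by simp)) hps (ν p)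
    refine h8.trans ?_
    have h9 : chartDInv (𝓡∂ (2 * m + 2)) p p (ν p) = ν p :=
      chartDInv_self (E := EuclideanSpace ℝ (Fin (2 * m + 2))) (I := 𝓡∂ (2 * m + 2)) p (ν p)
    rw [h9, fnD_mul (h.mdifferentiable_factor p) (hs.mdifferentiableAt (by simp)), hg, zero_mul,
      zero_add, mul_comm]
  rw [h7]
  simp only [W, h3]

/-- At a singular point the kernel of `dh` is spanned by `ν`, and the second derivative of `h` along
`ν` is `dg(ν) s` times the fibre direction, which does not lie in the range of `dh`. Hence the folds
are the points where `g` vanishes with `dg(ν) ≠ 0`. -/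
theorem isFoldPoint_iff (C : IsLiouvilleCollar ι lam ν g Γ pr s)
    (h : IsLiouvilleData lam ν g) (hι : IsBoundaryInclusion m ι)
    (hlam : OneForm.IsSmooth (𝓡∂ (2 * m + 2)) lam) (hc : IsContactForm (boundaryForm ι lam))
    (hpos : IsPositiveOnBoundary ι lam)
    (hsymp : ∀ p ∈ (𝓡∂ (2 * m + 2)).interior F,
      OneForm.DNondegenerateAt (𝓡∂ (2 * m + 2)) lam p) {p : F} (hp : p ∈ orbitSet Γ) :
    IsFoldPoint (𝓡∂ (2 * m + 2)) (cotangentModel (𝓡 (2 * m + 1))) (toCotangent ι lam pr s) p ↔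
      p ∈ range ι ∧ TopPowerVanishesTransverselyAt lam p := by
  have hpr := C.smooth_proj p hp
  have hs := C.smooth_scale p hp
  have hα := hι.smoothAt_boundaryForm hlam (pr p)
  have hH := mfderiv_scaledSection_apply hpr hs hα
  have hsp := C.scale_pos p hp
  constructor
  · rintro ⟨h1, h2⟩
    have hsing := (ContinuousLinearMap.not_injective_iff _).2
      (ContinuousLinearMap.exists_ne_zero_of_finrank_ker_eq_one h1)
    obtain ⟨⟨x, rfl⟩, hnd⟩ := (C.isSingularPoint_iff h hι hlam hc hsymp hp).1 hsing
    rw [h.dNondegenerateAt_iff hι hlam hc, not_not] at hnd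
    refine ⟨⟨x, rfl⟩, (h.topPowerVanishesTransverselyAt_iff hι hlam hc hpos x).2
      ⟨hnd, fun hdg => ?_⟩⟩
    obtain ⟨w, hw⟩ := C.exists_iteratedFDerivWithin_two_eq h hι hlam hp hnd
    refine h2 (ν (ι x)) ?_ (h.ne_zero_boundary hι x) ⟨-w, (hH _).trans (Eq.trans ?_ hw.symm)⟩
    · rw [C.mfderiv_eq_zero_iff hι hlam hc hp, C.scale_field _ hp, hnd, zero_mul]
      exact ⟨C.proj_field _ hp, rfl⟩
    · rw [hdg, zero_mul, zero_smul, zero_sub]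
      exact map_neg _ _
  · rintro ⟨⟨x, rfl⟩, htr⟩
    obtain ⟨hg, hdg⟩ := (h.topPowerVanishesTransverselyAt_iff hι hlam hc hpos x).1 htr
    obtain ⟨w', hw'⟩ := C.exists_iteratedFDerivWithin_two_eq h hι hlam hp hg
    have hsν : fnD (𝓡∂ (2 * m + 2)) s (ι x) (ν (ι x)) = 0 := by
      rw [C.scale_field _ hp, hg, zero_mul]
    have hker : ∀ u, mfderiv (𝓡∂ (2 * m + 2)) (cotangentModel (𝓡 (2 * m + 1)))
        (toCotangent ι lam pr s) (ι x) u = 0 → ∃ c : ℝ, u = c • ν (ι x) := fun u hu =>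
      C.exists_eq_smul_of_mfderiv_proj_eq_zero h hι hlam hc x u
        ((C.mfderiv_eq_zero_iff hι hlam hc hp u).1 hu).1
    refine ⟨ContinuousLinearMap.finrank_ker_eq_one (h.ne_zero_boundary hι x)
      ((C.mfderiv_eq_zero_iff hι hlam hc hp _).2 ⟨C.proj_field _ hp, hsν⟩) hker, ?_⟩
    rintro k hk hk0 ⟨w, hw⟩
    obtain ⟨c, rfl⟩ := hker k hk
    have hc0 : c ≠ 0 := fun h0 => hk0 (by rw [h0, zero_smul])
    have h1 := (hH w).symm.trans hw
    have h2 := ContinuousMultilinearMap.map_smul_univ (iteratedFDerivWithin ℝ 2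
      (writtenInExtChartAt (𝓡∂ (2 * m + 2)) (cotangentModel (𝓡 (2 * m + 1))) (ι x)
        (toCotangent ι lam pr s)) (range (𝓡∂ (2 * m + 2)))
        (extChartAt (𝓡∂ (2 * m + 2)) (ι x) (ι x))) (fun _ => c)
        (fun _ => (ν (ι x) : EuclideanSpace ℝ (Fin (2 * m + 2))))
    rw [hw', Fin.prod_univ_two] at h2
    have h3 := ContinuousLinearMap.map_add_smul_eq (h1.trans h2)
    -- a tangent vector mapped to a multiple of the fibre direction is a multiple of `ν`
    obtain ⟨h4, h5⟩ := eq_of_fderivWithin_sectionInChart_eq hpr hs hα (hc.ne_zero _) _ _ h3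
    obtain ⟨b, hb⟩ := C.exists_eq_smul_of_mfderiv_proj_eq_zero h hι hlam hc x _ h4
    rw [hb, map_smul, hsν, smul_zero] at h5
    exact mul_ne_zero (mul_ne_zero hc0 hc0) (mul_ne_zero hdg hsp.ne') h5.symm

end IsLiouvilleCollar

end Domain

/-! ### Uniqueness of the collar map -/

section Domain

set_option linter.unusedSectionVars false

variable {m : ℕ}
  {F : Type*} [TopologicalSpace F] [ChartedSpace (EuclideanHalfSpace (2 * m + 2)) F]
  [IsManifold (𝓡∂ (2 * m + 2)) ∞ F]
  {K : Type*} [TopologicalSpace K] [ChartedSpace (EuclideanSpace ℝ (Fin (2 * m + 1))) K]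
  [IsManifold (𝓡 (2 * m + 1)) ∞ K]
  {ι : K → F} {lam : OneForm (𝓡∂ (2 * m + 2)) F}
  {ν : ∀ p : F, TangentSpace (𝓡∂ (2 * m + 2)) p} {g : F → ℝ} {Γ : K → ℝ → F} {pr : F → K}
  {s : F → ℝ}

/-- If `(f, ℓ)` is an injective map between spaces of the same dimension, then `f` is surjective. -/
theorem ContinuousLinearMap.surjective_of_injective_prod {V W : Type*} [NormedAddCommGroup V]
    [NormedSpace ℝ V] [FiniteDimensional ℝ V] [NormedAddCommGroup W] [NormedSpace ℝ W]
    [FiniteDimensional ℝ W] {f : V →L[ℝ] W} {ℓ : V →L[ℝ] ℝ}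
    (hinj : ∀ u, f u = 0 → ℓ u = 0 → u = 0)
    (hd : Module.finrank ℝ V = Module.finrank ℝ W + 1) : Function.Surjective f := by
  have h1 : Function.Injective (f.prod ℓ : V →ₗ[ℝ] W × ℝ) :=
    (injective_iff_map_eq_zero (f.prod ℓ : V →ₗ[ℝ] W × ℝ)).2 fun u hu =>
      hinj u (Prod.ext_iff.1 hu).1 (Prod.ext_iff.1 hu).2
  have h2 := (LinearMap.injective_iff_surjective_of_finrank_eq_finrank (by
    rw [hd, Module.finrank_prod, Module.finrank_self])).1 h1
  intro w
  obtain ⟨v, hv⟩ := h2 (w, 0)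
  exact ⟨v, (Prod.ext_iff.1 hv).1⟩

/-- Any smooth map `pr` with `λ = s pr^*α`, `s ≠ 0`, which is a submersion at `p` contracts the
Liouville direction: `dpr(ν)` lies in `ker α` and is `dα`-orthogonal to it. -/
theorem IsLiouvilleData.mfderiv_field_eq_zero (h : IsLiouvilleData lam ν g)
    (hι : IsBoundaryInclusion m ι) (hlam : OneForm.IsSmooth (𝓡∂ (2 * m + 2)) lam)
    (hc : IsContactForm (boundaryForm ι lam)) {p : F}
    (hpr : ContMDiffAt (𝓡∂ (2 * m + 2)) (𝓡 (2 * m + 1)) ∞ pr p)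
    (hs : ContMDiffAt (𝓡∂ (2 * m + 2)) 𝓘(ℝ, ℝ) ∞ s p) (hsp : s p ≠ 0)
    (hform : ∀ᶠ z in 𝓝 p, lam z = s z • pullForm (boundaryForm ι lam) pr z)
    (hsurj : Function.Surjective (mfderiv (𝓡∂ (2 * m + 2)) (𝓡 (2 * m + 1)) pr p)) :
    mfderiv (𝓡∂ (2 * m + 2)) (𝓡 (2 * m + 1)) pr p (ν p) = 0 := by
  have h0 : ∀ w, lam p w = s p * boundaryForm ι lam (pr p)
      (mfderiv (𝓡∂ (2 * m + 2)) (𝓡 (2 * m + 1)) pr p w) := fun w =>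
    DFunLike.congr_fun hform.self_of_nhds w
  have h1 : boundaryForm ι lam (pr p)
      (mfderiv (𝓡∂ (2 * m + 2)) (𝓡 (2 * m + 1)) pr p (ν p)) = 0 := by
    have h2 := h0 (ν p)
    rw [h.apply_eq_zero] at h2
    exact (mul_eq_zero.1 h2.symm).resolve_left hsp
  refine hc.eq_zero h1 fun v hv => ?_
  obtain ⟨w, rfl⟩ := hsurj v
  have h3 := d_eq_of_eq_smul_pullForm hpr hs (hι.smoothAt_boundaryForm hlam _) hform (ν p) w
  rw [h.d_eq, h0, hv, h1] at h3
  simp only [mul_zero, sub_zero, zero_add] at h3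
  exact (mul_eq_zero.1 h3.symm).resolve_left hsp

theorem Cotangent.snd_eq_of_eq_mk {β : Cotangent (𝓡 (2 * m + 1)) K}
    {b : TangentSpace (𝓡 (2 * m + 1)) β.proj →L[ℝ] ℝ} (h : β = ⟨β.proj, b⟩) : β.2 = b := by
  obtain ⟨x, c⟩ := β
  exact eq_of_heq (TotalSpace.mk.inj h).2

theorem pullForm_congr {α : OneForm (𝓡 (2 * m + 1)) K} {pr pr' : F → K} {p : F}
    (h : pr' =ᶠ[𝓝 p] pr) : pullForm α pr' p = pullForm α pr p := by
  let A : K → EuclideanSpace ℝ (Fin (2 * m + 1)) →L[ℝ] ℝ := α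
  have h1 : A (pr' p) = A (pr p) := by rw [h.self_of_nhds]
  have h2 := h.mfderiv_eq (I := 𝓡∂ (2 * m + 2)) (I' := 𝓡 (2 * m + 1))
  exact congrArg₂ (fun (a : EuclideanSpace ℝ (Fin (2 * m + 1)) →L[ℝ] ℝ)
    (d : EuclideanSpace ℝ (Fin (2 * m + 2)) →L[ℝ] EuclideanSpace ℝ (Fin (2 * m + 1))) => a.comp d)
    h1 h2

theorem IsBoundaryInclusion.t2Space [T2Space F] (hι : IsBoundaryInclusion m ι) : T2Space K :=
  hι.embedding.isEmbedding.t2Space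

/-- A map which contracts the velocity of the orbit `Γ x` is constant along this orbit. -/
theorem IsOrbitFamily.eq_of_mfderiv_eq_zero [T2Space K] {V : ∀ p : F, TangentSpace (𝓡∂ (2 * m + 2)) p}
    (hΓ : IsOrbitFamily (𝓡∂ (2 * m + 2)) ι V Γ)
    (hpr : ∀ p ∈ orbitSet Γ, ContMDiffAt (𝓡∂ (2 * m + 2)) (𝓡 (2 * m + 1)) ∞ pr p)
    (h0 : ∀ p ∈ orbitSet Γ, mfderiv (𝓡∂ (2 * m + 2)) (𝓡 (2 * m + 1)) pr p (V p) = 0) (x : K)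
    {t : ℝ} (ht : 0 ≤ t) : pr (Γ x t) = pr (ι x) := by
  have h1 : IsMIntegralCurveOn (I := 𝓡 (2 * m + 1)) (fun t => pr (Γ x t)) (fun _ => 0) (Ici 0) := by
    intro r hr
    have hmem : Γ x r ∈ orbitSet Γ := ⟨x, r, hr, rfl⟩
    have h2 := ((hpr _ hmem).mdifferentiableAt (by simp)).hasMFDerivAt.comp_hasMFDerivWithinAt r
      (hΓ.curve x r hr)
    refine h2.congr_mfderiv ?_
    refine ContinuousLinearMap.ext fun (c : ℝ) => ?_
    change mfderiv (𝓡∂ (2 * m + 2)) (𝓡 (2 * m + 1)) pr (Γ x r) (c • V (Γ x r)) =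
      c • (0 : TangentSpace (𝓡 (2 * m + 1)) (pr (Γ x r)))
    rw [map_smul, h0 _ hmem]
  have h2 : IsMIntegralCurveOn (I := 𝓡 (2 * m + 1)) (fun _ => pr (ι x)) (fun _ => 0) (Ici 0) := by
    intro r hr
    refine (hasMFDerivAt_const (I := 𝓘(ℝ, ℝ)) (I' := 𝓡 (2 * m + 1)) (pr (ι x))
      r).hasMFDerivWithinAt.congr_mfderiv ?_
    refine ContinuousLinearMap.ext fun (c : ℝ) => ?_
    exact (smul_zero c : c • (0 : TangentSpace (𝓡 (2 * m + 1)) (pr (ι x))) = 0).symm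
  have hV : ContMDiff (𝓡 (2 * m + 1)) (𝓡 (2 * m + 1)).tangent 1
      (fun p => (⟨p, 0⟩ : TangentBundle (𝓡 (2 * m + 1)) K)) :=
    contMDiff_zeroSection ℝ (TangentSpace (𝓡 (2 * m + 1)) : K → Type _)
  exact h1.eq_of_eq hV ordConnected_Ici h2 (a := 0) (b := t) self_mem_Ici ht (by rw [hΓ.zero])

namespace IsLiouvilleCollar

/-- The collar map is determined by its properties: the projection `pr` to `K` of any such map
satisfies `λ = s pr^*α`, hence is constant along the orbits, and `s` is determined by `pr`. -/
theorem eqOn_toCotangent [T2Space F] (C : IsLiouvilleCollar ι lam ν g Γ pr s)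
    (h : IsLiouvilleData lam ν g) (hι : IsBoundaryInclusion m ι)
    (hlam : OneForm.IsSmooth (𝓡∂ (2 * m + 2)) lam) (hc : IsContactForm (boundaryForm ι lam))
    (hsymp : ∀ p ∈ (𝓡∂ (2 * m + 2)).interior F,
      OneForm.DNondegenerateAt (𝓡∂ (2 * m + 2)) lam p)
    {f : F → Cotangent (𝓡 (2 * m + 1)) K}
    (hf : IsLiouvilleCollarMap ι lam (orbitSet Γ) f) :
    EqOn f (toCotangent ι lam pr s) (orbitSet Γ) := by
  have := hι.t2Space
  obtain ⟨-, hmaps, -⟩ := hf.homeo_and_diffeo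
  have hex : ∀ p, ∃ c : ℝ, p ∈ orbitSet Γ → 0 < c ∧
      f p = ⟨(f p).proj, c • boundaryForm ι lam (f p).proj⟩ := fun p => by
    by_cases hp : p ∈ orbitSet Γ
    · obtain ⟨c, hc0, -, hc⟩ := hmaps hp
      exact ⟨c, fun _ => ⟨hc0, hc⟩⟩
    · exact ⟨0, fun h => absurd h hp⟩
  choose s' hs' using hex
  set pr' : F → K := fun p => (f p).proj with hpr'
  have hfs : ∀ p ∈ orbitSet Γ,
      ContMDiffAt (𝓡∂ (2 * m + 2)) (cotangentModel (𝓡 (2 * m + 1))) ∞ f p := fun p hp =>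
    (hf.smooth p hp).contMDiffAt (C.isOpen.mem_nhds hp)
  have hpr's : ∀ p ∈ orbitSet Γ, ContMDiffAt (𝓡∂ (2 * m + 2)) (𝓡 (2 * m + 1)) ∞ pr' p :=
    fun p hp => (contMDiff_cotangent_proj (n := ⊤) (f p)).comp p (hfs p hp)
  have hform : ∀ p ∈ orbitSet Γ, lam p = s' p • pullForm (boundaryForm ι lam) pr' p := by
    intro p hp
    rw [hf.pullback p hp, canonicalForm_comp_mfderiv ((hfs p hp).mdifferentiableAt (by simp))]
    have h1 : (show TangentSpace (𝓡 (2 * m + 1)) (f p).proj →L[ℝ] ℝ from (f p).2) =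
        s' p • boundaryForm ι lam (f p).proj := Cotangent.snd_eq_of_eq_mk (hs' p hp).2
    rw [h1]
    rfl
  have hform' : ∀ p ∈ orbitSet Γ, ∀ᶠ z in 𝓝 p, lam z = s' z • pullForm (boundaryForm ι lam) pr' z :=
    fun p hp => Filter.mem_of_superset (C.isOpen.mem_nhds hp) hform
  have hs's : ∀ p ∈ orbitSet Γ, ContMDiffAt (𝓡∂ (2 * m + 2)) 𝓘(ℝ, ℝ) ∞ s' p := fun p hp => by
    refine contMDiffAt_ratio (hlam.smoothAt p)
      (smoothAt_pullForm (hpr's p hp) (hι.smoothAt_boundaryForm hlam _)) (hform' p hp) fun h0 => ?_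
    refine C.form_ne_zero p hp ?_
    rw [hform p hp, h0, smul_zero]
  have hprι : ∀ x, pr' (ι x) = x := fun x => congrArg TotalSpace.proj (hf.boundary x)
  -- `pr'` is a submersion: in the interior by the non-degeneracy of `dλ`, and at the boundary because
  -- it restricts to the identity there
  have hsurj : ∀ p ∈ orbitSet Γ,
      Function.Surjective (mfderiv (𝓡∂ (2 * m + 2)) (𝓡 (2 * m + 1)) pr' p) := by
    intro p hp
    rcases mem_interior_or_boundary (m := m) p with hi | hb
    · exact ContinuousLinearMap.surjective_of_injective_prod
        (V := EuclideanSpace ℝ (Fin (2 * m + 2))) (W := EuclideanSpace ℝ (Fin (2 * m + 1)))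
        (eq_zero_of_mfderiv_eq_zero (hpr's p hp) (hs's p hp) (hι.smoothAt_boundaryForm hlam _)
          (hform' p hp) (hsymp p hi))
        (by rw [finrank_euclideanSpace_fin, finrank_euclideanSpace_fin])
    · rw [← hι.range_eq] at hb
      obtain ⟨x, rfl⟩ := hb
      intro w
      have h2 := mfderiv_comp x ((hpr's _ hp).mdifferentiableAt (by simp))
        (hι.mdifferentiableAt x)
      have h3 : pr' ∘ ι = id := funext hprι
      rw [h3, mfderiv_id] at h2
      exact ⟨_, (DFunLike.congr_fun h2 w).symm⟩
  have hpreq : ∀ p ∈ orbitSet Γ, pr' p = pr p := by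
    rintro p ⟨x, t, ht, rfl⟩
    rw [C.orbits.eq_of_mfderiv_eq_zero hpr's (fun p hp => ?_) x ht, hprι, C.proj x t ht]
    rw [map_neg, h.mfderiv_field_eq_zero hι hlam hc (hpr's p hp) (hs's p hp) (hs' p hp).1.ne'
      (hform' p hp) (hsurj p hp), neg_zero]
  intro p hp
  have hev : pr' =ᶠ[𝓝 p] pr := Filter.mem_of_superset (C.isOpen.mem_nhds hp) hpreq
  have hpull : pullForm (boundaryForm ι lam) pr' p = pullForm (boundaryForm ι lam) pr p :=
    pullForm_congr hev
  -- both scales are the ratio of `λ` and of the same form without zeros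
  have hss : s' p = s p := by
    have h1 := (hform p hp).symm.trans (C.form_eq p hp)
    have h2 : pullForm (boundaryForm ι lam) pr p ≠ 0 := fun h0 => C.form_ne_zero p hp (by
      rw [C.form_eq p hp, h0, smul_zero])
    obtain ⟨v, hv⟩ : ∃ v, pullForm (boundaryForm ι lam) pr p v ≠ 0 := by
      by_contra! hv
      exact h2 (ContinuousLinearMap.ext hv)
    rw [hpull] at h1
    exact mul_right_cancel₀ hv (DFunLike.congr_fun h1 v)
  rw [(hs' p hp).2, hss]
  exact congrArg (fun y => (⟨y, s p • boundaryForm ι lam y⟩ :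
      Cotangent (𝓡 (2 * m + 1)) K)) (hpreq p hp)

end IsLiouvilleCollar

end Domain

end

theorem mainTheorem11 (m : ℕ)
    {F : Type*} [TopologicalSpace F] [T2Space F] [CompactSpace F]
    [ChartedSpace (EuclideanHalfSpace (2 * m + 2)) F] [IsManifold (𝓡∂ (2 * m + 2)) ∞ F]
    {K : Type*} [TopologicalSpace K] [Nonempty K]
    [ChartedSpace (EuclideanSpace ℝ (Fin (2 * m + 1))) K] [IsManifold (𝓡 (2 * m + 1)) ∞ K]
    (ι : K → F) (hι : IsBoundaryInclusion m ι)
    (lam : OneForm (𝓡∂ (2 * m + 2)) F) (hlam : OneForm.IsSmooth (𝓡∂ (2 * m + 2)) lam)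
    (hcontact : IsContactForm (boundaryForm ι lam))
    (hpos : IsPositiveOnBoundary ι lam)
    (hsymp : ∀ p ∈ (𝓡∂ (2 * m + 2)).interior F,
      OneForm.DNondegenerateAt (𝓡∂ (2 * m + 2)) lam p) :
    (∃ ν : ∀ p : F, TangentSpace (𝓡∂ (2 * m + 2)) p, IsTransverseExtension ι lam ν) ∧
    ∀ ν : ∀ p : F, TangentSpace (𝓡∂ (2 * m + 2)) p, IsTransverseExtension ι lam ν →
      IsOpen (exitCollar ν) ∧
      ∃ h : F → Cotangent (𝓡 (2 * m + 1)) K,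
        IsLiouvilleCollarMap ι lam (exitCollar ν) h ∧
        (∀ h' : F → Cotangent (𝓡 (2 * m + 1)) K,
          IsLiouvilleCollarMap ι lam (exitCollar ν) h' → EqOn h' h (exitCollar ν)) ∧
        (∀ p ∈ exitCollar ν,
          IsSingularPoint (𝓡∂ (2 * m + 2))
              (cotangentModel (𝓡 (2 * m + 1))) h p ↔
            p ∈ range ι ∧ ¬ OneForm.DNondegenerateAt (𝓡∂ (2 * m + 2)) lam p) ∧
        (∀ p ∈ exitCollar ν,
          IsFoldPoint (𝓡∂ (2 * m + 2))
              (cotangentModel (𝓡 (2 * m + 1))) h p ↔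
            p ∈ range ι ∧ TopPowerVanishesTransverselyAt lam p) := by
  refine ⟨hι.exists_isTransverseExtension hlam hcontact hpos hsymp, fun ν hν => ?_⟩
  obtain ⟨g, h⟩ := hι.exists_isLiouvilleData hlam hcontact hpos hsymp hν
  obtain ⟨Γ, pr, s, C⟩ := h.exists_isLiouvilleCollar hι hlam hcontact
  have : Nonempty F := ⟨ι (Classical.arbitrary K)⟩
  rw [h.exitCollar_eq hι C.orbits]
  exact ⟨C.isOpen, IsLiouvilleCollar.toCotangent ι lam pr s,
    C.isLiouvilleCollarMap h hι hlam hcontact hsymp,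
    fun f hf => C.eqOn_toCotangent h hι hlam hcontact hsymp hf,
    fun p hp => C.isSingularPoint_iff h hι hlam hcontact hsymp hp,
    fun p hp => C.isFoldPoint_iff h hι hlam hcontact hpos hsymp hp⟩
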